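/- **Squares and the restrictions $F_{A,B}$.** Let $A,B$ be two symbols. For $n\in\omega$, an $n$-square on $\{A,B\}$ is an $(n+2)\times(n+2)$ block consisting of an $n\times n$ block of $B$'s surrounded by a border of $A$'s. Degenerate ($\infty$-)squares are also allowed: blocks $I\times J$, with $I,J\subseteq\mathbb Z$ infinite intervals (quarter-planes, half-planes, the plane), with $A$'s on the border and $B$'s inside. A configuration $x\in\{A,B\}^{\mathbb Z^2}$ satisfies $F_{A,B}$ if there is a set $S$ of (finite or degenerate) squares occurring in $x$ such that: every $2\times2$ block of $B$'s lies inside a square of $S$; every $A$ lies on the border of exactly one square of $S$; every $n$-square pattern with $1\le n<\infty$ that occurs in $x$ belongs to $S$; and the sizes of any two squares of $S$ differ by at most $1$ (so finite and degenerate squares do not coexist). "Contained" squares are squares of $S$. The type of $x$ is $n$ if $x$ contains only $n$-squares, $(n,n+1)$ if it contains both $n$-squares and $(n+1)$-squares and no others, and $\infty$ if it contains only degenerate squares. **The shifts $X_T$.** Let $\Omega=\{(n,n+1):n\in\omega\}$ and $2\Omega=\{(2n,2n+1):n\in\omega\}$. Put $A_\lambda=0$, $B_\lambda=1$ for the empty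 string $\lambda$; for $\sigma\in\Omega^{<\omega}$, $B_{\sigma^\smallfrown(n,n+1)}$ is the $(n+1)$-square on the alphabet $\{A_\sigma,B_\sigma\}$, and $A_{\sigma^\smallfrown(n,n+1)}$ is the $n$-square on that alphabet with a row of $B_\sigma$'s added along the top and along the right side. Thus $A_\sigma,B_\sigma\in 2^{[0,j_\sigma)^2}$ for some $j_\sigma$. A configuration $x\in2^{\mathbb Z^2}$ is $\sigma$-regular if for some $g\in[0,j_\sigma)^2$ every block $x\upharpoonright([0,j_\sigma)^2+h+g)$, $h\in(j_\sigma\mathbb Z)^2$, is $A_\sigma$ or $B_\sigma$; then $x$ is read as a configuration on $\{A_\sigma,B_\sigma\}$. For a tree $T\subseteq(2\Omega)^{<\omega}$ (closed under initial segments, with $\lambda\in T$) let $X_T$ be the subshift of all $x\in2^{\mathbb Z^2}$ such that for every $\sigma\in T$: - ($F_\sigma$) if $x$ is $\sigma$-regular, then $x$, read as a configuration on $\{A_\sigma,B_\sigma\}$, satisfies $F_{A_\sigma,B_\sigma}$; - ($R_\sigma$) if $\sigma=\rho^\smallfrown(n,n+1)$, $x$ is $\rho$-regular, and $x$ contains both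 an $n$-square and an $(n+1)$-square on the alphabet $\{A_\rho,B_\rho\}$, then $x$ is $\sigma$-regular and both $A_\sigma$ and $B_\sigma$ appear in it. **Types.** For $x\in X_T$ let $\rho\in T\cup[T]$ ($[T]$ being the set of infinite paths) be longest such that $x$ is $\rho$-regular (for $\rho \in [T]$: $\tau$-regular for all finite initial segments $\tau$ of $\rho$). Put $\operatorname{type}_T(x)=\rho$ if $\rho\in[T]$, and $\operatorname{type}_T(x)=\rho^\smallfrown t$ if $\rho\in T$, where $t$ is the type of $x$ read on $\{A_\rho,B_\rho\}$. Let $L_T=\{\operatorname{type}_T(x):x\in X_T\}$ with the lexicographic order induced by $0<(0,1)<1<(1,2)<2<\dots<\infty$. **Ranks.** A subshift $X$ has TCPE if every factor of it (a compact metrizable $\mathbb Z^2$-system which is the image of $X$ under a continuous equivariant map) with more than one point has positive topological entropy. A pair $x\neq y$ in $X$ is an entropy pair if $h(X,\{K_x^c,K_y^c\})>0$ for all disjoint closed neighbourhoods $K_x,K_y$ of $x,y$. Let $E_1$ be the set of pairs $(x,y) \in X^2$ that are equal or entropy pairs; $E_{\alpha+1}$ is the topological closure of $E_\alpha$ if $E_\alpha$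 is not closed, and otherwise the symmetric, transitive closure of $E_\alpha$; $E_\lambda=\bigcup_{1\le\alpha<\lambda}E_\alpha$ for limit $\lambda$. The TCPE rank of $X$ is the least $\alpha\ge1$ with $E_\alpha=X^2$. On a linear order $L$ let $H_0$ be equality, let $a\mathrel{H_{\beta+1}}b$ if there are only finitely many $H_\beta$-classes between those of $a$ and $b$, and take unions at limits; the Hausdorff rank of $L$ is the least $\beta$ with $H_\beta=L^2$. $L$ is scattered if $\mathbb Q$ does not order-embed into $L$. **Theorem.** Let $T\subseteq(2\Omega)^{<\omega}$ be a tree. Then $X_T$ has TCPE if and only if $L_T$ is scattered. In this case $X_T$ has a TCPE rank and $L_T$ has a Hausdorff rank. Furthermore, if $X_T$ has TCPE rank $\alpha$ and $L_T$ has Hausdorff rank $\beta$, then $\alpha\in\{2\beta-1,2\beta\}$, that is, $\alpha+1=2\beta$ or $\alpha=2\beta$; here $2\beta$ is the ordinal product with $2(\beta+1)=2\beta+2$ and $2\lambda=\lambda$ for limit $\lambda$. -/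

import Mathlib

noncomputable section

namespace TCPE

open Set Filter Topology

/-! ### Configurations and entropy of `ℤ²`-systems -/

/-- Configurations in `2^{ℤ²}`; `false` is the symbol `0` and `true` is the symbol `1`.
A position is `(column, row)`; columns grow to the east and rows grow to the north. -/
def Config : Type := ℤ × ℤ → Bool

instance : TopologicalSpace Config := inferInstanceAs (TopologicalSpace (ℤ × ℤ → Bool))

/-- The shift action `(g x)(h) = x(h - g)`. -/
instance : AddAction (ℤ × ℤ) Config where
  vadd g x := fun h => x (h - g)
  zero_vadd x := by funext h; exact congrArg x (sub_zero h)
  add_vadd g g' x := by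
    funext h
    exact congrArg x (by abel : h - (g + g') = h - g - g')

section Entropy

variable {Y : Type} [AddAction (ℤ × ℤ) Y]

/-- The box `[0,n)²`. -/
def box (n : ℕ) : Set (ℤ × ℤ) := Ico 0 (n : ℤ) ×ˢ Ico 0 (n : ℤ)

/-- The common refinement `⋁_{g ∈ [0,n)²} g⁻¹ 𝒰`. -/
def refinement (𝒰 : Set (Set Y)) (n : ℕ) : Set (Set Y) :=
  {V | ∃ c : ℤ × ℤ → Set Y, (∀ g ∈ box n, c g ∈ 𝒰) ∧
    V = ⋂ g ∈ box n, (fun x : Y => g +ᵥ x) ⁻¹' (c g)}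

/-- The least cardinality of a finite subfamily of `𝒱` that covers `X`. -/
def coverNumber (X : Set Y) (𝒱 : Set (Set Y)) : ℕ :=
  sInf {k | ∃ 𝒲 : Finset (Set Y), (↑𝒲 : Set (Set Y)) ⊆ 𝒱 ∧ X ⊆ ⋃₀ (↑𝒲 : Set (Set Y)) ∧
    𝒲.card = k}

/-- The entropy `h(X, 𝒰) = lim_n log N(𝒰_n) / n²` of the invariant set `X` relative to a cover `𝒰`
of `X`. (For an open cover of a compact invariant set the sequence is bounded and converges, so the
upper limit is the limit.) -/
def coverEntropy (X : Set Y) (𝒰 : Set (Set Y)) : ℝ :=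
  limsup (fun n : ℕ => Real.log (coverNumber X (refinement 𝒰 n)) / (n : ℝ) ^ 2) atTop

/-- The topological entropy of a compact `ℤ²`-system: the supremum over all open covers. -/
def topEntropy (Y : Type) [TopologicalSpace Y] [AddAction (ℤ × ℤ) Y] : ENNReal :=
  ⨆ (𝒰 : Set (Set Y)) (_ : (∀ U ∈ 𝒰, IsOpen U) ∧ ⋃₀ 𝒰 = univ),
    ENNReal.ofReal (coverEntropy univ 𝒰)

end Entropy

/-- A subshift `X` has topological completely positive entropy: every factor of `X`
(a compact metrizable `ℤ²`-system `Y` with a continuous equivariant surjection `f : X → Y`)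
with more than one point has positive topological entropy. -/
def HasTCPE (X : Set Config) : Prop :=
  ∀ (Y : Type) [TopologicalSpace Y] [CompactSpace Y] [TopologicalSpace.MetrizableSpace Y]
    [AddAction (ℤ × ℤ) Y] [ContinuousConstVAdd (ℤ × ℤ) Y] (f : X → Y),
    Continuous f → Function.Surjective f →
    (∀ (g : ℤ × ℤ) (x x' : X), (x' : Config) = g +ᵥ (x : Config) → f x' = g +ᵥ f x) →
    Nontrivial Y → 0 < topEntropy Y

/-- `(x, y)` is an entropy pair of the subshift `X`: the points are distinct, and
`h(X, {Kₓᶜ, K_yᶜ}) > 0` for all disjoint closed neighbourhoods `Kₓ`, `K_y` in `X` of `x`, `y`. -/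
def IsEntropyPair (X : Set Config) (x y : X) : Prop :=
  x ≠ y ∧ ∀ K K' : Set Config, K ⊆ X → K' ⊆ X → IsClosed K → IsClosed K' →
    K ∈ 𝓝[X] (x : Config) → K' ∈ 𝓝[X] (y : Config) → Disjoint K K' →
    0 < coverEntropy X {Kᶜ, K'ᶜ}

/-- The relation `E₁` of entropy-or-equal pairs. -/
def entropyOrEqual (X : Set Config) : Set (X × X) :=
  {p | p.1 = p.2 ∨ IsEntropyPair X p.1 p.2}

/-- The least equivalence relation containing `E`; for the reflexive relations below this is the
transitive, symmetric closure. -/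
def equivClosure {X : Type} (E : Set (X × X)) : Set (X × X) :=
  {p | Relation.EqvGen (fun a b => (a, b) ∈ E) p.1 p.2}

open Classical in
/-- One step of the hierarchy: topological closure if `E` is not closed, otherwise the generated
equivalence relation (which is `E` itself if `E` is a closed equivalence relation). -/
def stepRel {X : Type} [TopologicalSpace X] (E : Set (X × X)) : Set (X × X) :=
  if IsClosed E then equivClosure E else closure E

open Classical in
/-- The hierarchy `E_α`, `α ≥ 1`, of relations on `X`: it starts with the entropy-or-equal pairs
`E₁`, and unions are taken at limits. (The auxiliary value at `0` is the diagonal.) -/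
def tcpeRel (X : Set Config) (α : Ordinal.{0}) : Set (X × X) :=
  Ordinal.limitRecOn α (diagonal X)
    (fun γ E => if γ = 0 then entropyOrEqual X else stepRel E)
    (fun γ _ E => ⋃ (δ : Ordinal.{0}) (h : δ < γ), E δ h)

/-- `α` is the TCPE rank of `X`: the least `α ≥ 1` with `E_α = X²`. -/
def IsTCPERank (X : Set Config) (α : Ordinal.{0}) : Prop :=
  IsLeast {γ | 1 ≤ γ ∧ tcpeRel X γ = univ} α

/-! ### Scattered orders and the Hausdorff rank -/

/-- A linear order is scattered if `ℚ` does not embed into it. -/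
def IsScattered (L : Type) [LinearOrder L] : Prop := IsEmpty (ℚ ↪o L)

/-- The equivalence relation on `L` whose classes are the elements of the `α`-th Hausdorff
derivative: at a successor step two elements are identified if only finitely many of the previous
classes lie between them, and unions are taken at limits. -/
def hausdorffRel (L : Type) [LinearOrder L] (α : Ordinal.{0}) : L → L → Prop :=
  Ordinal.limitRecOn α (fun a b => a = b)
    (fun _ H a b => ((fun c => {d | H c d}) '' uIcc a b).Finite)
    (fun γ _ H a b => ∃ (δ : Ordinal.{0}) (h : δ < γ), H δ h a b)

/-- `β` is the Hausdorff rank of `L`: the least `β` at which all elements are identified. -/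
def IsHausdorffRank (L : Type) [LinearOrder L] (β : Ordinal.{0}) : Prop :=
  IsLeast {γ | ∀ a b : L, hausdorffRel L γ a b} β

/-! ### Squares, and the shift with restrictions `F_{0,1}` -/

/-- The position of an `n`-square, that is, of a block with sides of length `n + 2` (the inner
`n × n` block and its border). For `n = ⊤` these are the degenerate, infinite squares: both sides
are infinite intervals, so the block is a quarter-plane, a half-plane or the whole plane. -/
structure Square where
  cols : Set ℤ
  rows : Set ℤ
  size : ℕ∞
  cols_ordConnected : cols.OrdConnected
  rows_ordConnected : rows.OrdConnected
  cols_encard : cols.encard = size + 2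
  rows_encard : rows.encard = size + 2

namespace Square

def interior (Q : Square) : Set (ℤ × ℤ) :=
  {p | p.1 - 1 ∈ Q.cols ∧ p.1 + 1 ∈ Q.cols ∧ p.2 - 1 ∈ Q.rows ∧ p.2 + 1 ∈ Q.rows}

def border (Q : Square) : Set (ℤ × ℤ) := (Q.cols ×ˢ Q.rows) \ Q.interior

/-- In `x` there is a square at the position `Q`: `0` on the border and `1` inside. -/
def Occurs (Q : Square) (x : Config) : Prop :=
  (∀ p ∈ Q.border, x p = false) ∧ (∀ p ∈ Q.interior, x p = true)

end Square

/-- `S` is a decomposition of `x` into squares that witnesses the restrictions `F_{0,1}`. -/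
structure IsParsing (x : Config) (S : Set Square) : Prop where
  occurs : ∀ Q ∈ S, Q.Occurs x
  /-- every `2 × 2` block of `1`s is inside a square -/
  block : ∀ p : ℤ × ℤ, (∀ q ∈ Icc p (p + (1, 1)), x q = true) →
    ∃ Q ∈ S, Icc p (p + (1, 1)) ⊆ Q.interior
  /-- every `0` is on the border of exactly one square of the decomposition -/
  border : ∀ p, x p = false → ∃! Q, Q ∈ S ∧ p ∈ Q.border
  /-- an `n`-square that is visible in `x`, `1 ≤ n < ∞`, is a square of the decomposition, so no
  `0` is on the borders of two of them. (Without a condition for `n = 0`: a `2 × 2` block of `0`s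
  may be formed by the borders of adjacent squares.) -/
  visible : ∀ Q : Square, 1 ≤ Q.size → Q.size ≠ ⊤ → Q.Occurs x → Q ∈ S
  /-- the sizes of two squares differ by at most one -/
  size_le : ∀ Q ∈ S, ∀ Q' ∈ S, Q.size ≤ Q'.size + 1

/-- The shift given by the restrictions `F_{0,1}`. -/
def baseShift : Set Config := {x | ∃ S, IsParsing x S}

/-- `x` contains an `n`-square. -/
def ContainsSquare (x : Config) (n : ℕ) : Prop := ∃ S, IsParsing x S ∧ ∃ Q ∈ S, Q.size = n

/-- The linearly ordered set `0 < (0,1) < 1 < (1,2) < 2 < ⋯ < ∞` of symbols is represented by `ℕ∞`: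
`n` is `2n`, the pair `(n,n+1)` is `2n+1`, and `∞` is `⊤`. -/
abbrev Sym : Type := ℕ∞

def Sym.num (n : ℕ) : Sym := ((2 * n : ℕ) : ℕ∞)

def Sym.pair (n : ℕ) : Sym := ((2 * n + 1 : ℕ) : ℕ∞)

/-- `t` is the type of the configuration `x` of `baseShift`, read off the sizes of its squares. -/
inductive HasBaseType (x : Config) : Sym → Prop
  | num (S : Set Square) (n : ℕ) : IsParsing x S → Square.size '' S = {(n : ℕ∞)} →
      HasBaseType x (Sym.num n)
  | pair (S : Set Square) (n : ℕ) : IsParsing x S →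
      Square.size '' S = {(n : ℕ∞), (n : ℕ∞) + 1} → HasBaseType x (Sym.pair n)
  | infty (S : Set Square) : IsParsing x S → Square.size '' S = {⊤} → HasBaseType x ⊤

/-! ### The patterns `A_σ`, `B_σ` and the shifts `X_T`

The pair `(n, n+1) ∈ Ω` is represented by `n`, so that strings over `Ω` are lists of natural
numbers, and strings over `2Ω` are lists of even numbers. -/

/-- The patterns `A_{(n,n+1)}` (for `false`) and `B_{(n,n+1)}` (for `true`) in `2^{[0,n+3)²}`:
an `n`-square with a row of `1`s added along the top and along the right side, and an
`(n+1)`-square. -/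
def unitTile (n : ℕ) (b : Bool) (p : ℤ × ℤ) : Bool :=
  if b then
    decide ((1 ≤ p.1 ∧ p.1 ≤ n + 1) ∧ (1 ≤ p.2 ∧ p.2 ≤ n + 1))
  else
    decide (p.1 = n + 2 ∨ p.2 = n + 2 ∨ ((1 ≤ p.1 ∧ p.1 ≤ n) ∧ (1 ≤ p.2 ∧ p.2 ≤ n)))

/-- The side length `j_σ` of `A_σ` and `B_σ`. -/
def tileSize (σ : List ℕ) : ℕ := (σ.map (· + 3)).prod

/-- `A_σ` and `B_σ`, by recursion on the reversal of `σ`. -/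
def tileRev : List ℕ → Bool → ℤ × ℤ → Bool
  | [], b, _ => b
  | n :: ρ, b, p =>
    tileRev ρ (unitTile n b (p.1 / tileSize ρ, p.2 / tileSize ρ))
      (p.1 % tileSize ρ, p.2 % tileSize ρ)

/-- The pattern `A_σ` (for `false`) or `B_σ` (for `true`) on `[0, j_σ)²`. -/
def tile (σ : List ℕ) : Bool → ℤ × ℤ → Bool := tileRev σ.reverse

theorem tile_nil (b : Bool) (p : ℤ × ℤ) : tile [] b p = b := rfl

/-- `A_{σ⌢(n,n+1)}` and `B_{σ⌢(n,n+1)}` are `A_{(n,n+1)}` and `B_{(n,n+1)}` on the alphabet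
`{A_σ, B_σ}`. -/
theorem tile_append (σ : List ℕ) (n : ℕ) (b : Bool) (p : ℤ × ℤ) :
    tile (σ ++ [n]) b p =
      tile σ (unitTile n b (p.1 / tileSize σ, p.2 / tileSize σ))
        (p.1 % tileSize σ, p.2 % tileSize σ) := by
  have h : tileSize σ.reverse = tileSize σ := by
    simp [tileSize, List.map_reverse, List.prod_reverse]
  simp [tile, tileRev, h]

/-- `x` is `σ`-regular with some `σ`-alignment `g`, and `y` is `x` considered as a configuration on
the alphabet `{A_σ, B_σ}`. -/
def IsReading (σ : List ℕ) (x y : Config) : Prop :=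
  ∃ g ∈ box (tileSize σ), ∀ q : ℤ × ℤ, ∀ p ∈ box (tileSize σ),
    x (g + tileSize σ • q + p) = tile σ (y q) p

def IsRegular (σ : List ℕ) (x : Config) : Prop := ∃ y, IsReading σ x y

/-- The restrictions `F_σ`: as a configuration on `{A_σ, B_σ}`, `x` satisfies `F_{0,1}`. -/
def RestrF (σ : List ℕ) (x : Config) : Prop := ∀ y, IsReading σ x y → y ∈ baseShift

/-- The restrictions `R_{ρ⌢(n,n+1)}`: if `x` contains both an `n`-square and an `(n+1)`-square on
the alphabet `{A_ρ, B_ρ}`, then `x` is a configuration on `{A_σ, B_σ}`, `σ = ρ⌢(n,n+1)`, in which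
both `A_σ` and `B_σ` appear. -/
def RestrR (ρ : List ℕ) (n : ℕ) (x : Config) : Prop :=
  ∀ y, IsReading ρ x y → ContainsSquare y n → ContainsSquare y (n + 1) →
    ∃ z, IsReading (ρ ++ [n]) x z ∧ (∃ q, z q = false) ∧ (∃ q, z q = true)

/-- The subshift `X_T`. -/
def shiftOf (T : Set (List ℕ)) : Set Config :=
  {x | (∀ σ ∈ T, RestrF σ x) ∧ ∀ ρ n, ρ ++ [n] ∈ T → RestrR ρ n x}

/-- A tree: a set of strings closed under initial segments, with the empty string as its root. -/
structure IsTree (T : Set (List ℕ)) : Prop where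
  root : [] ∈ T
  prefix_mem : ∀ σ τ : List ℕ, σ <+: τ → τ ∈ T → σ ∈ T

/-! ### Types and the linear order `L_T` -/

/-- Finite and infinite strings of symbols, with the lexicographic order; a finite string is
continued by `⊥`. (No type is a proper initial segment of another one.) -/
abbrev TypeString : Type := Lex (ℕ → WithBot Sym)

def finString (s : List Sym) : TypeString :=
  toLex fun i => (s[i]?).elim ⊥ (fun a => (a : WithBot Sym))

def infString (f : ℕ → Sym) : TypeString := toLex fun i => (f i : WithBot Sym)

/-- `s` is `type_T(x)`: for the longest `ρ ∈ T ∪ [T]` such that `x` is `ρ`-regular, it is `ρ` if `ρ`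
is infinite, and `ρ⌢t` if `ρ` is finite and `x` has type `t` on the alphabet `{A_ρ, B_ρ}`. -/
inductive HasType (T : Set (List ℕ)) (x : Config) : TypeString → Prop
  | fin (ρ : List ℕ) (y : Config) (t : Sym) : ρ ∈ T → IsReading ρ x y →
      (∀ ρ' ∈ T, IsRegular ρ' x → ρ'.length ≤ ρ.length) → HasBaseType y t →
      HasType T x (finString (ρ.map Sym.pair ++ [t]))
  | path (f : ℕ → ℕ) :
      (∀ k, (List.range k).map f ∈ T ∧ IsRegular ((List.range k).map f) x) →
      HasType T x (infString fun i => Sym.pair (f i))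

/-- The linear order `L_T` of the types of the elements of `X_T`. -/
abbrev typeOrder (T : Set (List ℕ)) : Type := {s : TypeString // ∃ x ∈ shiftOf T, HasType T x s}

end TCPE

end

namespace TCPE

open Set Filter Topology

/-! ### The Hausdorff derivatives of a linear order -/

section Hausdorff

variable {L : Type} [LinearOrder L]

/-! The type is a shift-invariant map `typeOf` from X_T onto the linear order L_T, and the theorem
compares the hierarchy E_α with the Hausdorff derivatives H_γ along this map. Two points are allied
(`Allied`) if they have a common alignment for every string of T for which both are regular. The
core is `TypeMap` together with `tcpeRel_even`: for γ ≥ 1, E_{2γ} is an equivalence relation,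
related points have H_γ-equivalent types, and allied points with H_γ-equivalent types are related.

The induction step has two halves. First, the type is continuous up to an error of at most three
types (`HasType.eventually_near`): a restriction R_σ is triggered by a finite window, so regularity
propagates to nearby points, except where a reading is constant. Hence taking the closure links only
points with finitely many classes between their types (`TypeMap.finite_of_mem_closure`). Secondly,
every type is realised by a point allied with two given allied points. Letting the type run
cofinally through a class without a largest element and taking a cluster point, one lands in the
next class (`TypeMap.exists_mem_closure_of_noMax`), so closure followed by the generated equivalence
performs one derivative.

For the start, large patterns of both points of an entropy pair occur in one point, so the pair is a
limit of pairs of equal type. Conversely, allied points of the same type are equal or form an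
entropy pair (`mem_entropyOrEqual_of_typeOf_eq`), and consecutive types are linked through the
configurations made of one tile only (`mem_equivClosure_of_covBy`).

The entropy pairs rest on a geometric fact: large patterns made of n- and (n+1)-squares can be
placed independently on a lattice (`exists_independent`). Such configurations are packings by square
blocks. A chain of neighbouring blocks crosses the region, and everything above it can be replaced
by straight stacks (`RegionPacking.surgery`); with gaps of one row these end at any prescribed large
height (`exists_isStack_aligned`). Cutting on four sides gives a packing of a box with the pattern
in its middle (`exists_box`), and equal boxes fit together. Degenerate squares are limits of large
ones (`eventually_exists_agree`). For an infinite path, a window meets at most two rows and two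
columns of deep tiles, and every such pattern occurs among 2-squares.

Since the strings are even, the sets {n, n+1} of sizes that different tiles of one level allow are
disjoint, so the strings for which a point is regular form a chain and types are well defined.

A constant configuration is allied with every point, so E_{2γ} is full exactly if H_γ is; this gives
the relation of the ranks. If L_T is scattered the derivatives become full, and a full E_α yields
TCPE, because the kernel of a factor without entropy is a closed equivalence relation containing all
entropy pairs. If ℚ embeds into L_T, it yields a nonconstant continuous real function of the type,
whose range is a factor with trivial action. -/

theorem hausdorffRel_zero (a b : L) : hausdorffRel L 0 a b ↔ a = b := by
  simp [hausdorffRel]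

theorem hausdorffRel_succ (γ : Ordinal.{0}) (a b : L) :
    hausdorffRel L (γ + 1) a b ↔
      ((fun c => {d | hausdorffRel L γ c d}) '' uIcc a b).Finite := by
  simp only [hausdorffRel, Ordinal.limitRecOn_add_one]

theorem hausdorffRel_limit {γ : Ordinal.{0}} (h : Order.IsSuccLimit γ) (a b : L) :
    hausdorffRel L γ a b ↔ ∃ δ < γ, hausdorffRel L δ a b := by
  simp only [hausdorffRel]
  rw [Ordinal.limitRecOn_limit _ _ _ _ h]
  simp

/-- An equivalence relation whose classes are convex. -/
structure ConvexEquiv {L : Type*} [LinearOrder L] (H : L → L → Prop) : Prop where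
  refl : ∀ a, H a a
  symm : ∀ {a b}, H a b → H b a
  trans : ∀ {a b c}, H a b → H b c → H a c
  convex : ∀ {a b c}, a ≤ b → b ≤ c → H a c → H a b

namespace ConvexEquiv

variable {L : Type*} [LinearOrder L] {H : L → L → Prop}

theorem convex_right (h : ConvexEquiv H) {a b c : L} (h1 : a ≤ b) (h2 : b ≤ c) (h3 : H a c) :
    H b c :=
  h.trans (h.symm (h.convex h1 h2 h3)) h3

theorem of_mem_uIcc (h : ConvexEquiv H) {a b c : L} (hc : c ∈ uIcc a b) (hab : H a b) :
    H a c := by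
  rcases le_total a b with hl | hl
  · rw [uIcc_of_le hl] at hc
    exact h.convex hc.1 hc.2 hab
  · rw [uIcc_of_ge hl] at hc
    exact h.symm (h.convex_right hc.1 hc.2 (h.symm hab))

theorem class_eq_iff (h : ConvexEquiv H) {a b : L} : {d | H a d} = {d | H b d} ↔ H a b := by
  constructor
  · intro e
    have : b ∈ {d | H b d} := h.refl b
    rw [← e] at this
    exact this
  · intro hab
    ext d
    exact ⟨fun hd => h.trans (h.symm hab) hd, fun hd => h.trans hab hd⟩

theorem toDual (h : ConvexEquiv H) :
    ConvexEquiv (L := Lᵒᵈ) fun a b => H (OrderDual.ofDual a) (OrderDual.ofDual b) where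
  refl _ := h.refl _
  symm := h.symm
  trans := h.trans
  convex := fun h1 h2 h3 => h.symm (h.convex_right h2 h1 (h.symm h3))

end ConvexEquiv

theorem hausdorffRel_mono_succ {γ : Ordinal.{0}} (h : ConvexEquiv (hausdorffRel L γ)) {a b : L}
    (hab : hausdorffRel L γ a b) : hausdorffRel L (γ + 1) a b := by
  rw [hausdorffRel_succ]
  refine (Set.finite_singleton {d | hausdorffRel L γ a d}).subset ?_
  rintro _ ⟨c, hc, rfl⟩
  exact (h.class_eq_iff.2 (h.symm (h.of_mem_uIcc hc hab)))

theorem convexEquiv_hausdorffRel_succ {γ : Ordinal.{0}} :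
    ConvexEquiv (hausdorffRel L (γ + 1)) := by
  constructor
  · intro a
    rw [hausdorffRel_succ]
    simp
  · intro a b hab
    rw [hausdorffRel_succ] at hab ⊢
    rwa [uIcc_comm]
  · intro a b c hab hbc
    rw [hausdorffRel_succ] at hab hbc ⊢
    refine (hab.union hbc).subset ?_
    rw [← image_union]
    exact image_mono uIcc_subset_uIcc_union_uIcc
  · intro a b c h1 h2 hac
    rw [hausdorffRel_succ] at hac ⊢
    refine hac.subset (image_mono ?_)
    rw [uIcc_of_le h1, uIcc_of_le (h1.trans h2)]
    exact Icc_subset_Icc_right h2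

/-- Convexity and monotonicity are proved together: at a limit, transitivity compares two earlier
indices at their maximum, which uses both statements. -/
theorem hausdorffRel_aux (γ : Ordinal.{0}) :
    ConvexEquiv (hausdorffRel L γ) ∧
      ∀ δ ≤ γ, ∀ a b : L, hausdorffRel L δ a b → hausdorffRel L γ a b := by
  induction γ using Ordinal.limitRecOn with
  | zero =>
    refine ⟨⟨?_, ?_, ?_, ?_⟩, ?_⟩ <;> simp only [hausdorffRel_zero]
    · exact fun _ => trivial
    · exact fun h => h.symm
    · exact fun h h' => h.trans h'
    · rintro a b c h1 h2 rfl
      exact le_antisymm h1 h2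
    · intro δ hδ a b h
      have : δ = 0 := le_antisymm hδ (zero_le)
      subst this
      exact (hausdorffRel_zero _ _).1 h
  | add_one γ ih =>
    refine ⟨convexEquiv_hausdorffRel_succ, fun δ hδ a b h => ?_⟩
    rcases hδ.lt_or_eq with hlt | rfl
    · exact hausdorffRel_mono_succ ih.1 (ih.2 δ (Order.lt_add_one_iff.1 hlt) a b h)
    · exact h
  | limit γ hγ ih =>
    refine ⟨⟨?_, ?_, ?_, ?_⟩, ?_⟩
    · intro a
      rw [hausdorffRel_limit hγ]
      exact ⟨0, hγ.bot_lt, (ih 0 hγ.bot_lt).1.refl a⟩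
    · intro a b
      rw [hausdorffRel_limit hγ, hausdorffRel_limit hγ]
      rintro ⟨δ, hδ, h⟩
      exact ⟨δ, hδ, (ih δ hδ).1.symm h⟩
    · intro a b c
      rw [hausdorffRel_limit hγ, hausdorffRel_limit hγ, hausdorffRel_limit hγ]
      rintro ⟨δ, hδ, h⟩ ⟨δ', hδ', h'⟩
      have hm : max δ δ' < γ := max_lt hδ hδ'
      exact ⟨_, hm, (ih _ hm).1.trans ((ih _ hm).2 _ (le_max_left _ _) _ _ h)
        ((ih _ hm).2 _ (le_max_right _ _) _ _ h')⟩
    · intro a b c h1 h2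
      rw [hausdorffRel_limit hγ, hausdorffRel_limit hγ]
      rintro ⟨δ, hδ, h⟩
      exact ⟨δ, hδ, (ih δ hδ).1.convex h1 h2 h⟩
    · intro δ hδ a b h
      rcases hδ.lt_or_eq with hlt | rfl
      · rw [hausdorffRel_limit hγ]
        exact ⟨δ, hlt, h⟩
      · exact h

theorem convexEquiv_hausdorffRel (γ : Ordinal.{0}) : ConvexEquiv (hausdorffRel L γ) :=
  (hausdorffRel_aux γ).1

theorem hausdorffRel_mono {δ γ : Ordinal.{0}} (h : δ ≤ γ) {a b : L}
    (hab : hausdorffRel L δ a b) : hausdorffRel L γ a b :=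
  (hausdorffRel_aux γ).2 δ h a b hab

/-- This makes the bounded error in the continuity of types invisible from the first derivative on.
-/
theorem hausdorffRel_of_finite {γ : Ordinal.{0}} (hγ : 1 ≤ γ) {a b : L}
    (h : (uIcc a b).Finite) : hausdorffRel L γ a b := by
  refine hausdorffRel_mono hγ ?_
  rw [← zero_add (1 : Ordinal), hausdorffRel_succ]
  exact h.image _

theorem finite_of_hausdorffRel_one {a b : L} (h : hausdorffRel L 1 a b) : (uIcc a b).Finite := by
  rw [← zero_add (1 : Ordinal), hausdorffRel_succ] at h
  refine Set.Finite.of_finite_image h ?_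
  intro c _ d _ (e : {x | hausdorffRel L 0 c x} = {x | hausdorffRel L 0 d x})
  have : d ∈ {x | hausdorffRel L 0 d x} := (hausdorffRel_zero _ _).2 rfl
  rw [← e] at this
  exact (hausdorffRel_zero _ _).1 this

/-- The Hausdorff derivatives of a scattered order reach the full relation. -/
theorem exists_hausdorffRel_of_isScattered (hL : IsScattered L) :
    ∃ γ : Ordinal.{0}, ∀ a b : L, hausdorffRel L γ a b := by
  classical
  -- The derivatives increase; if they never stabilised, they would inject the ordinals into the
  -- subsets of `L × L`.
  obtain ⟨γ, hγ⟩ : ∃ γ : Ordinal.{0},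
      ∀ a b : L, hausdorffRel L (γ + 1) a b → hausdorffRel L γ a b := by
    by_contra! hne
    refine not_injective_of_ordinal
      (fun γ : Ordinal.{0} => {p : L × L | hausdorffRel L γ p.1 p.2}) ?_
    have key : ∀ γ δ : Ordinal.{0}, γ < δ →
        {p : L × L | hausdorffRel L γ p.1 p.2} ≠ {p : L × L | hausdorffRel L δ p.1 p.2} := by
      intro γ δ hlt heq
      obtain ⟨a, b, h1, h2⟩ := hne γ
      have : (a, b) ∈ {p : L × L | hausdorffRel L δ p.1 p.2} :=
        hausdorffRel_mono (Order.add_one_le_of_lt hlt) h1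
      rw [← heq] at this
      exact h2 this
    intro γ δ h
    rcases lt_trichotomy γ δ with hl | hl | hl
    · exact absurd h (key _ _ hl)
    · exact hl
    · exact absurd h.symm (key _ _ hl)
  refine ⟨γ, ?_⟩
  by_contra! hne
  obtain ⟨a₀, b₀, hab₀⟩ := hne
  have hH := convexEquiv_hausdorffRel (L := L) γ
  let s : Setoid L := ⟨hausdorffRel L γ, hH.refl, hH.symm, hH.trans⟩
  -- One representative of each class of the stable relation. Two classes with none between them
  -- would be merged by one more derivative, so the representatives are densely ordered and contain
  -- a copy of ℚ.
  let r : L → L := fun a => (Quotient.mk s a).out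
  have hr : ∀ a, hausdorffRel L γ (r a) a := fun a => Quotient.mk_out (s := s) a
  have hrr : ∀ a b, hausdorffRel L γ a b → r a = r b := by
    intro a b h
    have : Quotient.mk s a = Quotient.mk s b := Quotient.sound h
    simp only [r, this]
  have hd : DenselyOrdered (range r) := by
    constructor
    rintro ⟨_, a, rfl⟩ ⟨_, b, rfl⟩ hlt
    have hlt' : r a < r b := hlt
    have hnot : ¬ hausdorffRel L γ (r a) (r b) := by
      intro h
      have := hrr a b (hH.trans (hH.symm (hr a)) (hH.trans h (hr b)))
      exact hlt'.ne this
    have hinf : ¬ ((fun c => {d | hausdorffRel L γ c d}) '' uIcc (r a) (r b)).Finite := by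
      rw [← hausdorffRel_succ]
      exact fun h => hnot (hγ _ _ h)
    obtain ⟨_, ⟨c, hc, rfl⟩, hc'⟩ : ∃ C ∈ (fun c => {d | hausdorffRel L γ c d}) '' uIcc (r a) (r b),
        C ∉ ({{d | hausdorffRel L γ (r a) d}, {d | hausdorffRel L γ (r b) d}} : Set (Set L)) := by
      by_contra! hcon
      exact hinf ((Set.toFinite _).subset hcon)
    simp only [mem_insert_iff, mem_singleton_iff, not_or, hH.class_eq_iff] at hc'
    rw [uIcc_of_le hlt'.le] at hc
    refine ⟨⟨r c, c, rfl⟩, ?_, ?_⟩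
    · change r a < r c
      by_contra! hcon
      exact hc'.1 (hH.symm (hH.convex_right hcon hc.1 (hr c)))
    · change r c < r b
      by_contra! hcon
      exact hc'.2 (hH.convex hc.2 hcon (hH.symm (hr c)))
  have hn : Nontrivial (range r) := by
    refine ⟨⟨r a₀, a₀, rfl⟩, ⟨r b₀, b₀, rfl⟩, fun h => hab₀ ?_⟩
    have h' : r a₀ = r b₀ := congrArg Subtype.val h
    exact hH.trans (hH.symm (hr a₀)) (h' ▸ hr b₀)
  obtain ⟨e⟩ := Order.embedding_from_countable_to_dense ℚ (range r)
  exact hL.false (e.trans (OrderEmbedding.subtype _))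

end Hausdorff

end TCPE

namespace TCPE

open Set Filter Topology

/-! ### Maps to a linear order which are continuous up to a bounded number of steps -/

/-- At most three elements lie in the closed interval spanned by `c` and `t`. -/
def Near {L : Type*} [LinearOrder L] (c t : L) : Prop := (uIcc c t).encard ≤ 3

theorem Near.finite {L : Type*} [LinearOrder L] {c t : L} (h : Near c t) : (uIcc c t).Finite :=
  Set.finite_of_encard_le_coe (k := 3) h

theorem not_near_of_chain {L : Type*} [LinearOrder L] {c t c₁ c₂ c₃ c₄ : L}
    (h1 : c₁ ∈ uIcc c t) (h4 : c₄ ∈ uIcc c t) (h12 : c₁ < c₂) (h23 : c₂ < c₃) (h34 : c₃ < c₄) :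
    ¬ Near c t := by
  intro h
  have hsub : ({c₁, c₂, c₃, c₄} : Set L) ⊆ uIcc c t := by
    have hI : Icc c₁ c₄ ⊆ uIcc c t := ordConnected_uIcc.out h1 h4
    rintro d (rfl | rfl | rfl | rfl)
    · exact h1
    · exact hI ⟨h12.le, (h23.trans h34).le⟩
    · exact hI ⟨(h12.trans h23).le, h34.le⟩
    · exact h4
  have h5 : (({c₁, c₂, c₃, c₄} : Set L)).encard = 4 := by
    have e1 : c₁ ∉ ({c₂, c₃, c₄} : Set L) := by
      simp [h12.ne, (h12.trans h23).ne, (h12.trans (h23.trans h34)).ne]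
    have e2 : c₂ ∉ ({c₃, c₄} : Set L) := by simp [h23.ne, (h23.trans h34).ne]
    rw [encard_insert_of_notMem e1, encard_insert_of_notMem e2, encard_pair h34.ne]
    norm_num
  have := (encard_le_encard hsub).trans h
  rw [h5] at this
  exact absurd this (by decide)

/-- A map `ty` to a linear order that is continuous up to a bounded number of steps, together with
a compatible relation `Al` between points of its domain. -/
structure TypeMap {X L : Type*} [TopologicalSpace X] [LinearOrder L] (ty : X → L)
    (Al : X → X → Prop) : Prop where
  symm : ∀ {x y}, Al x y → Al y x
  eventually_gt : ∀ x a, a < ty x → ∀ᶠ z in 𝓝 x, a < ty z ∨ Near (ty z) (ty x)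
  eventually_lt : ∀ x a, ty x < a → ∀ᶠ z in 𝓝 x, ty z < a ∨ Near (ty z) (ty x)
  interpolate : ∀ {x y}, Al x y → ∀ c, ∃ z, ty z = c ∧ Al x z ∧ Al z y
  of_frequently : ∀ {x y}, (∃ᶠ z in 𝓝 x, Al z y ∧ ¬ Near (ty z) (ty x)) → Al x y

theorem near_toDual {L : Type*} [LinearOrder L] {c t : L} :
    Near (OrderDual.toDual c) (OrderDual.toDual t) ↔ Near c t := by
  unfold Near
  rw [uIcc_toDual]
  rfl

namespace TypeMap

variable {X L : Type*} [TopologicalSpace X] [LinearOrder L] {ty : X → L} {Al : X → X → Prop}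

theorem toDual (h : TypeMap ty Al) : TypeMap (fun x => OrderDual.toDual (ty x)) Al where
  symm := h.symm
  eventually_gt x a ha := (h.eventually_lt x (OrderDual.ofDual a) ha).mono
    fun _ hz => hz.imp id near_toDual.2
  eventually_lt x a ha := (h.eventually_gt x (OrderDual.ofDual a) ha).mono
    fun _ hz => hz.imp id near_toDual.2
  interpolate := fun ha c => h.interpolate ha (OrderDual.ofDual c)
  of_frequently := fun hf => h.of_frequently (hf.mono fun _ hz => ⟨hz.1, fun h' => hz.2
    (near_toDual.2 h')⟩)

/-- Two adjacent classes, the lower one without a largest element, are linked in the closure. -/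
theorem exists_mem_closure_of_noMax [CompactSpace X] (h : TypeMap ty Al) {H : L → L → Prop}
    (hH : ConvexEquiv H) (hfin : ∀ a b, (uIcc a b).Finite → H a b) {E : Set (X × X)}
    (hE : ∀ x y, H (ty x) (ty y) → Al x y → (x, y) ∈ E) {x y : X} (hAl : Al x y)
    (hlt : ty x < ty y) (hn : ¬ H (ty x) (ty y))
    (hcl : ∀ c ∈ Icc (ty x) (ty y), H (ty x) c ∨ H (ty y) c)
    (hmax : ∀ c ∈ Icc (ty x) (ty y), H (ty x) c → ∃ d ∈ Icc (ty x) (ty y), H (ty x) d ∧ c < d) :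
    ∃ z, (x, z) ∈ closure E ∧ (z, y) ∈ E := by
  -- A point of each type, allied with both ends.
  choose w hwty hwx hwy using fun c => h.interpolate hAl c
  let C : Set L := {c | c ∈ Icc (ty x) (ty y) ∧ H (ty x) c}
  have hCx : ty x ∈ C := ⟨⟨le_rfl, hlt.le⟩, hH.refl _⟩
  have : Nonempty C := ⟨⟨_, hCx⟩⟩
  have : (atTop : Filter C).NeBot := atTop_neBot
  have hup : ∀ c ∈ C, ∃ d ∈ C, c < d := fun c hc => by
    obtain ⟨d, hd, hd', hcd⟩ := hmax c hc.1 hc.2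
    exact ⟨d, ⟨hd, hd'⟩, hcd⟩
  -- `C` is the part of the lower class in the interval, directed upwards without a largest element;
  -- `z` is a cluster point of points whose types run cofinally through it.
  obtain ⟨z, hz⟩ := exists_clusterPt_of_compactSpace (map (fun c : C => w c) atTop)
  have hz' : MapClusterPt z atTop (fun c : C => w c) := hz
  have hfreq : ∀ {p : X → Prop}, (∀ᶠ u in 𝓝 z, p u) → ∀ c₀ ∈ C, ∃ c ∈ C, c₀ ≤ c ∧ p (w c) := by
    intro p hp c₀ hc₀
    have := (hz'.frequently hp).and_eventually (eventually_ge_atTop (⟨c₀, hc₀⟩ : C))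
    obtain ⟨c, hc, hc'⟩ := this.exists
    exact ⟨c, c.2, hc', hc⟩
  have hnear : ∀ c ∈ C, ¬ H c (ty y) := fun c hc hcy => hn (hH.trans hc.2 hcy)
  -- If the type of `z` were below some element of `C`, then three further steps up in `C` would put
  -- four elements between the type of `z` and those of nearby `w c`, more than `Near` permits.
  have hgt : ∀ c ∈ C, c < ty z := by
    intro c₀ hc₀
    by_contra! hle
    obtain ⟨c₁, hc₁, h01⟩ := hup c₀ hc₀
    obtain ⟨c₂, hc₂, h12⟩ := hup c₁ hc₁
    obtain ⟨c₃, hc₃, h23⟩ := hup c₂ hc₂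
    have hzc : ty z < c₃ := lt_of_le_of_lt hle (h01.trans (h12.trans h23))
    obtain ⟨c, hc, hle', hcp⟩ := hfreq (h.eventually_lt z c₃ hzc) c₃ hc₃
    rw [hwty] at hcp
    rcases hcp with hcp | hcp
    · exact absurd hcp (not_lt.2 hle')
    · have hc₀z : ty z ≤ c := hzc.le.trans hle'
      refine not_near_of_chain (c := c) (t := ty z) ?_ ?_ h01 h12 h23 hcp
      · rw [uIcc_of_ge hc₀z]
        exact ⟨hle, (h01.trans (h12.trans h23)).le.trans hle'⟩
      · rw [uIcc_of_ge hc₀z]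
        exact ⟨hzc.le, hle'⟩
  -- Above all of `C` but not above `ty y`, only the upper class is left. Beyond `ty y` the type of
  -- `z` would be near that of some `w c`, so that `c` and `ty y` would be equivalent.
  have hzy : H (ty z) (ty y) := by
    rcases le_or_gt (ty z) (ty y) with hle | hlt'
    · rcases hcl (ty z) ⟨(hgt _ hCx).le, hle⟩ with h1 | h1
      · exact absurd (hgt (ty z) ⟨⟨(hgt _ hCx).le, hle⟩, h1⟩) (lt_irrefl _)
      · exact hH.symm h1
    · obtain ⟨c, hc, -, hcp⟩ := hfreq (h.eventually_gt z _ hlt') _ hCx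
      rw [hwty] at hcp
      rcases hcp with hcp | hcp
      · exact absurd hcp (not_lt.2 hc.1.2)
      · exact absurd (hH.convex hc.1.2 hlt'.le (hfin _ _ hcp.finite)) (hnear c hc)
  refine ⟨z, ?_, hE _ _ hzy ?_⟩
  · have hcl' : MapClusterPt (x, z) atTop (fun c : C => (x, w c)) :=
      hz'.continuousAt_comp (f := fun u => (x, u)) (by fun_prop)
    refine mem_closure_iff_nhds.2 fun U hU => ?_
    obtain ⟨c, hc⟩ := (hcl'.frequently hU).exists
    exact ⟨_, hc, hE _ _ (by rw [hwty]; exact c.2.2) (hwx c)⟩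
  · refine h.of_frequently ?_
    intro hev
    obtain ⟨c, hc, -, hcp⟩ := hfreq hev _ hCx
    refine hcp ⟨hwy c, fun hnr => ?_⟩
    rw [hwty] at hnr
    exact hnear c hc (hH.trans (hfin _ _ hnr.finite) hzy)

/-- Points of adjacent classes are linked in the closure. -/
theorem eqvGen_of_adjacent [CompactSpace X] (h : TypeMap ty Al) {H : L → L → Prop}
    (hH : ConvexEquiv H) (hfin : ∀ a b, (uIcc a b).Finite → H a b) {E : Set (X × X)}
    (hE : ∀ x y, H (ty x) (ty y) → Al x y → (x, y) ∈ E) {x y : X} (hAl : Al x y)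
    (hle : ty x ≤ ty y) (hcl : ∀ c ∈ Icc (ty x) (ty y), H (ty x) c ∨ H (ty y) c) :
    Relation.EqvGen (fun a b => (a, b) ∈ closure E) x y := by
  by_cases hxy : H (ty x) (ty y)
  · exact .rel _ _ (subset_closure (hE _ _ hxy hAl))
  have hlt : ty x < ty y := lt_of_le_of_ne hle fun e => hxy (e ▸ hH.refl _)
  by_cases hmax : ∀ c ∈ Icc (ty x) (ty y), H (ty x) c →
      ∃ d ∈ Icc (ty x) (ty y), H (ty x) d ∧ c < d
  · obtain ⟨z, h1, h2⟩ := h.exists_mem_closure_of_noMax hH hfin hE hAl hlt hxy hcl hmax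
    exact .trans _ z _ (.rel _ _ h1) (.rel _ _ (subset_closure h2))
  · push Not at hmax
    obtain ⟨c, hc, hxc, hcmax⟩ := hmax
    -- A largest element of the lower class and a smallest one of the upper class would be
    -- neighbours, hence equivalent. So the upper class has no smallest element and the order dual
    -- of the previous case applies.
    have hmin : ∀ d ∈ Icc (ty x) (ty y), H (ty y) d →
        ∃ e ∈ Icc (ty x) (ty y), H (ty y) e ∧ e < d := by
      intro d hd hyd
      by_contra! hcon
      have hcd : c < d := by
        by_contra! hdc
        exact hxy (hH.trans (hH.convex hd.1 hdc hxc) (hH.symm hyd))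
      have : uIcc c d ⊆ {c, d} := by
        intro e he
        rw [uIcc_of_le hcd.le] at he
        have heI : e ∈ Icc (ty x) (ty y) := ⟨hc.1.trans he.1, he.2.trans hd.2⟩
        rcases hcl e heI with h1 | h1
        · exact Or.inl (le_antisymm (hcmax e heI h1) he.1)
        · exact Or.inr (le_antisymm he.2 (hcon e heI h1))
      exact hxy (hH.trans hxc (hH.trans (hfin _ _ ((Set.toFinite _).subset this)) (hH.symm hyd)))
    obtain ⟨z, h1, h2⟩ := h.toDual.exists_mem_closure_of_noMax hH.toDual
      (fun a b hab => hfin (OrderDual.ofDual a) (OrderDual.ofDual b)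
        (by rw [uIcc_ofDual]; exact hab)) (E := E)
      (fun x y => hE x y) (h.symm hAl) hlt (fun h' => hxy (hH.symm h'))
      (fun d hd => (hcl (OrderDual.ofDual d) ⟨hd.2, hd.1⟩).symm)
      (fun d hd hyd => by
        obtain ⟨e, he, he1, he2⟩ := hmin (OrderDual.ofDual d) ⟨hd.2, hd.1⟩ hyd
        exact ⟨OrderDual.toDual e, ⟨he.2, he.1⟩, he1, he2⟩)
    exact .symm _ _ (.trans _ z _ (.rel _ _ h1) (.rel _ _ (subset_closure h2)))

/-- Points with finitely many classes between them are linked in the closure. -/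
theorem eqvGen_of_finite [CompactSpace X] (h : TypeMap ty Al) {H : L → L → Prop}
    (hH : ConvexEquiv H) (hfin : ∀ a b, (uIcc a b).Finite → H a b) {E : Set (X × X)}
    (hE : ∀ x y, H (ty x) (ty y) → Al x y → (x, y) ∈ E) {x y : X} (hAl : Al x y)
    (hf : ((fun c => {d | H c d}) '' uIcc (ty x) (ty y)).Finite) :
    Relation.EqvGen (fun a b => (a, b) ∈ closure E) x y := by
  have key : ∀ (n : ℕ) (x y : X), Al x y → ty x ≤ ty y →
      ((fun c => {d | H c d}) '' Icc (ty x) (ty y)).Finite →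
      ((fun c => {d | H c d}) '' Icc (ty x) (ty y)).ncard ≤ n →
      Relation.EqvGen (fun a b => (a, b) ∈ closure E) x y := by
    intro n
    induction n with
    | zero =>
      intro x y _ hle hf hc
      rw [Nat.le_zero, ncard_eq_zero hf, image_eq_empty] at hc
      exact absurd hc (nonempty_Icc.2 hle).ne_empty
    | succ n ih =>
      intro x y hAl hle hf hc
      -- A type outside both end classes splits the interval into two with fewer classes: the left
      -- one misses the class of `ty y`, the right one that of `ty x`.
      by_cases hcl : ∀ c ∈ Icc (ty x) (ty y), H (ty x) c ∨ H (ty y) c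
      · exact h.eqvGen_of_adjacent hH hfin hE hAl hle hcl
      push Not at hcl
      obtain ⟨c, hc1, hcx, hcy⟩ := hcl
      obtain ⟨z, rfl, hxz, hzy⟩ := h.interpolate hAl c
      refine .trans _ z _ (ih x z hxz hc1.1 (hf.subset (image_mono (Icc_subset_Icc_right hc1.2)))
        ?_) (ih z y hzy hc1.2 (hf.subset (image_mono (Icc_subset_Icc_left hc1.1))) ?_)
      · refine Nat.le_of_lt_succ (lt_of_lt_of_le (ncard_lt_ncard ?_ hf) hc)
        refine ⟨image_mono (Icc_subset_Icc_right hc1.2), fun hsub => ?_⟩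
        obtain ⟨d, hd, hd'⟩ := hsub ⟨ty y, ⟨hle, le_rfl⟩, rfl⟩
        exact hcy (hH.symm (hH.convex_right hd.2 hc1.2 (hH.class_eq_iff.1 hd')))
      · refine Nat.le_of_lt_succ (lt_of_lt_of_le (ncard_lt_ncard ?_ hf) hc)
        refine ⟨image_mono (Icc_subset_Icc_left hc1.1), fun hsub => ?_⟩
        obtain ⟨d, hd, hd'⟩ := hsub ⟨ty x, ⟨le_rfl, hle⟩, rfl⟩
        exact hcx (hH.convex hc1.1 hd.1 (hH.symm (hH.class_eq_iff.1 hd')))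
  rcases le_total (ty x) (ty y) with hle | hle
  · rw [uIcc_of_le hle] at hf
    exact key _ x y hAl hle hf le_rfl
  · rw [uIcc_of_ge hle] at hf
    exact .symm _ _ (key _ y x (h.symm hAl) hle hf le_rfl)

/-- A near type cannot jump over four elements, so a chain of four turns the approximate bound into
a strict one. -/
theorem eventually_lt_of_chain (h : TypeMap ty Al) {x : X} {c₁ c₂ c₃ c₄ : L} (h1 : ty x ≤ c₁)
    (h12 : c₁ < c₂) (h23 : c₂ < c₃) (h34 : c₃ < c₄) : ∀ᶠ z in 𝓝 x, ty z < c₄ := by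
  filter_upwards [h.eventually_lt x c₄ (h1.trans_lt (h12.trans (h23.trans h34)))] with z hz
  rcases hz with hz | hz
  · exact hz
  · by_contra! hle
    have h14 := (h12.trans (h23.trans h34)).le
    refine not_near_of_chain (c := ty z) (t := ty x) ?_ ?_ h12 h23 h34 hz
    · rw [uIcc_of_ge (h1.trans (h14.trans hle))]
      exact ⟨h1, h14.trans hle⟩
    · rw [uIcc_of_ge (h1.trans (h14.trans hle))]
      exact ⟨h1.trans h14, hle⟩

theorem eventually_gt_of_chain (h : TypeMap ty Al) {x : X} {c₁ c₂ c₃ c₄ : L} (h4 : c₄ ≤ ty x)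
    (h12 : c₁ < c₂) (h23 : c₂ < c₃) (h34 : c₃ < c₄) : ∀ᶠ z in 𝓝 x, c₁ < ty z :=
  h.toDual.eventually_lt_of_chain (x := x) (c₁ := OrderDual.toDual c₄)
    (c₂ := OrderDual.toDual c₃) (c₃ := OrderDual.toDual c₂) (c₄ := OrderDual.toDual c₁)
    h4 h34 h23 h12

/-- In the closure of an equivalence relation with convex classes, only finitely many classes lie
between related points. -/
theorem finite_of_mem_closure (h : TypeMap ty Al) {H : L → L → Prop}
    (hH : ConvexEquiv H) {E : Set (X × X)} (hE : ∀ x y, (x, y) ∈ E → H (ty x) (ty y)) {x y : X}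
    (hxy : (x, y) ∈ closure E) : ((fun c => {d | H c d}) '' uIcc (ty x) (ty y)).Finite := by
  have key : ∀ (E : Set (X × X)) (x y : X), (∀ x y, (x, y) ∈ E → H (ty x) (ty y)) →
      (x, y) ∈ closure E → ty x ≤ ty y →
      ((fun c => {d | H c d}) '' Icc (ty x) (ty y)).Finite := by
    intro E x y hE hxy hle
    by_contra hinf
    -- Eight inequivalent types: the lower four absorb the error at `x`, the upper four the error at
    -- `y`. Related points near `x` and `y` then have types on the two sides of the inequivalent `e
    -- 3` and `e 4`.
    obtain ⟨s, hs, hcard⟩ := Set.Infinite.exists_subset_card_eq hinf 8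
    have : Nonempty L := ⟨ty x⟩
    choose! r hr hr' using fun C (hC : C ∈ (fun c => {d | H c d}) '' Icc (ty x) (ty y)) => hC
    have hinj : Set.InjOn r (s : Set (Set L)) := by
      intro C hC D hD e
      rw [← hr' C (hs hC), ← hr' D (hs hD), e]
    classical
    have hcard' : (s.image r).card = 8 := by rw [Finset.card_image_of_injOn hinj, hcard]
    let e := (s.image r).orderEmbOfFin hcard'
    have hemem : ∀ i, e i ∈ Icc (ty x) (ty y) := by
      intro i
      have := Finset.orderEmbOfFin_mem (s.image r) hcard' i
      obtain ⟨C, hC, hCe⟩ := Finset.mem_image.1 this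
      change (s.image r).orderEmbOfFin hcard' i ∈ _
      rw [← hCe]
      exact hr C (hs hC)
    have hne : ¬ H (e 3) (e 4) := by
      intro hcon
      obtain ⟨C, hC, hCe⟩ := Finset.mem_image.1 (Finset.orderEmbOfFin_mem (s.image r) hcard' 3)
      obtain ⟨D, hD, hDe⟩ := Finset.mem_image.1 (Finset.orderEmbOfFin_mem (s.image r) hcard' 4)
      have hlt : e 3 < e 4 := e.strictMono (by decide)
      have : C = D := by
        rw [← hr' C (hs hC), ← hr' D (hs hD)]
        refine hH.class_eq_iff.2 ?_
        rw [hCe, hDe]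
        exact hcon
      refine hlt.ne ?_
      change (s.image r).orderEmbOfFin hcard' 3 = (s.image r).orderEmbOfFin hcard' 4
      rw [← hCe, ← hDe, this]
    have hlt : ∀ i j : Fin 8, i < j → e i < e j := fun i j hij => e.strictMono hij
    have h1 := h.eventually_lt_of_chain (x := x) (hemem 0).1 (hlt 0 1 (by decide))
      (hlt 1 2 (by decide)) (hlt 2 3 (by decide))
    have h2 := h.eventually_gt_of_chain (x := y) (hemem 7).2 (hlt 4 5 (by decide))
      (hlt 5 6 (by decide)) (hlt 6 7 (by decide))
    have h3 := h1.prodMk_nhds h2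
    obtain ⟨⟨z, w⟩, ⟨hz, hw⟩, hzw⟩ := mem_closure_iff_nhds.1 hxy _ h3
    exact hne (hH.convex_right hz.le (hlt 3 4 (by decide)).le
      (hH.convex (hz.trans (hlt 3 4 (by decide))).le hw.le (hE _ _ hzw)))
  rcases le_total (ty x) (ty y) with hle | hle
  · rw [uIcc_of_le hle]
    exact key E x y hE hxy hle
  · rw [uIcc_of_ge hle]
    refine key (Prod.swap ⁻¹' E) y x (fun x y hxy => hH.symm (hE _ _ hxy)) ?_ hle
    exact closure_mono (by rw [image_swap_eq_preimage_swap])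
      (image_closure_subset_closure_image continuous_swap ⟨(x, y), hxy, rfl⟩)

/-- A monotone function on a linear order into which `ℚ` embeds which is a strictly increasing
function of the embedded `ℚ`, and which is continuous along `ty`. -/
theorem exists_continuous_of_not_isScattered {X L : Type} [TopologicalSpace X] [LinearOrder L]
    {ty : X → L} {Al : X → X → Prop} (h : TypeMap ty Al) (hL : ¬ IsScattered L) :
    ∃ φ : L → ℝ, Continuous (fun x => φ (ty x)) ∧ ∃ a b, φ a ≠ φ b := by
  rw [IsScattered, not_isEmpty_iff] at hL
  obtain ⟨e⟩ := hL
  -- The value at `a` is the supremum of the rationals in [0,1] whose images lie below `a`; 0 is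
  -- adjoined to keep the set nonempty.
  let s : L → Set ℝ := fun a => insert 0 {r : ℝ | ∃ q : ℚ, (q : ℝ) = r ∧ r ∈ Icc (0 : ℝ) 1 ∧ e q ≤ a}
  let φ : L → ℝ := fun a => sSup (s a)
  have hbdd : ∀ a, BddAbove (s a) := fun a => ⟨1, by
    rintro r (rfl | ⟨q, -, hr, -⟩)
    · exact zero_le_one
    · exact hr.2⟩
  have hne : ∀ a, (s a).Nonempty := fun a => ⟨0, mem_insert _ _⟩
  have hlow : ∀ (q : ℚ) a, (q : ℝ) ∈ Icc (0 : ℝ) 1 → e q ≤ a → (q : ℝ) ≤ φ a := fun q a hq hqa =>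
    le_csSup (hbdd a) (Or.inr ⟨q, rfl, hq, hqa⟩)
  have h0 : ∀ a, 0 ≤ φ a := fun a => le_csSup (hbdd a) (mem_insert _ _)
  have h1 : ∀ a, φ a ≤ 1 := fun a => csSup_le (hne a) (by
    rintro r (rfl | ⟨q, -, hr, -⟩)
    · exact zero_le_one
    · exact hr.2)
  have hup : ∀ (q : ℚ) a, (0 : ℝ) ≤ q → a < e q → φ a ≤ q := by
    intro q a hq hqa
    refine csSup_le (hne a) ?_
    rintro r (rfl | ⟨q', rfl, -, hr⟩)
    · exact hq
    · exact_mod_cast (e.lt_iff_lt.1 (hr.trans_lt hqa)).le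
  refine ⟨φ, ?_, e 0, e 1, ?_⟩
  · rw [continuous_iff_continuousAt]
    intro x
    refine tendsto_order.2 ⟨fun a ha => ?_, fun a ha => ?_⟩
    · rcases lt_or_ge a 0 with ha0 | ha0
      · exact Eventually.of_forall fun z => ha0.trans_le (h0 _)
      -- Four rationals between `a` and the value at `x` provide the chain of four types that
      -- absorbs the error of `ty`.
      obtain ⟨q₁, hq1, hq1'⟩ := exists_rat_btwn ha
      obtain ⟨q₂, hq2, hq2'⟩ := exists_rat_btwn hq1'
      obtain ⟨q₃, hq3, hq3'⟩ := exists_rat_btwn hq2'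
      obtain ⟨q₄, hq4, hq4'⟩ := exists_rat_btwn hq3'
      have hx : e q₄ ≤ ty x := by
        by_contra! hcon
        have : (0 : ℝ) ≤ q₄ := by linarith
        exact absurd (hup q₄ _ this hcon) (not_le.2 hq4')
      have hlt : ∀ {q q' : ℚ}, (q : ℝ) < q' → e q < e q' := fun hqq =>
        e.lt_iff_lt.2 (by exact_mod_cast hqq)
      filter_upwards [h.eventually_gt_of_chain hx (hlt hq2) (hlt hq3) (hlt hq4)] with z hz
      exact hq1.trans_le (hlow q₁ _ ⟨by linarith, (hq1'.trans_le (h1 _)).le⟩ hz.le)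
    · rcases lt_or_ge 1 a with ha1 | ha1
      · exact Eventually.of_forall fun z => (h1 _).trans_lt ha1
      obtain ⟨q₁, hq1, hq1'⟩ := exists_rat_btwn ha
      obtain ⟨q₂, hq2, hq2'⟩ := exists_rat_btwn hq1
      obtain ⟨q₃, hq3, hq3'⟩ := exists_rat_btwn hq2
      obtain ⟨q₄, hq4, hq4'⟩ := exists_rat_btwn hq3
      have hq40 : (0 : ℝ) ≤ q₄ := (h0 _).trans hq4.le
      have hx : ty x ≤ e q₄ := by
        by_contra! hcon
        exact absurd (hlow q₄ _ ⟨hq40, by linarith⟩ hcon.le) (not_le.2 hq4)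
      have hlt : ∀ {q q' : ℚ}, (q : ℝ) < q' → e q < e q' := fun hqq =>
        e.lt_iff_lt.2 (by exact_mod_cast hqq)
      filter_upwards [h.eventually_lt_of_chain hx (hlt hq4') (hlt hq3') (hlt hq2')] with z hz
      exact (hup q₁ _ (by linarith) hz).trans_lt hq1'
  · have e1 : φ (e 0) ≤ ((1 / 2 : ℚ) : ℝ) := hup _ _ (by norm_num) (e.lt_iff_lt.2 (by norm_num))
    have e2 : ((1 : ℚ) : ℝ) ≤ φ (e 1) := hlow 1 _ (by norm_num) le_rfl
    intro e3
    rw [e3] at e1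
    have := e2.trans e1
    norm_num at this

end TypeMap

end TCPE

namespace TCPE

open Set Filter Topology

/-! ### The hierarchy of relations on a subshift -/

instance : T2Space Config := inferInstanceAs (T2Space (ℤ × ℤ → Bool))
instance : CompactSpace Config := inferInstanceAs (CompactSpace (ℤ × ℤ → Bool))

/-- Neighbourhoods of the two points of a limit pair are also neighbourhoods of the points of a
close pair in the relation, whose members are distinct because the neighbourhoods are disjoint. -/
theorem isClosed_entropyOrEqual (X : Set Config) : IsClosed (entropyOrEqual X) := by
  rw [← closure_subset_iff_isClosed]
  rintro ⟨x, y⟩ hxy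
  by_cases hne : x = y
  · exact Or.inl hne
  refine Or.inr ⟨hne, fun K K' hKX hK'X hK hK' hx hy hd => ?_⟩
  have hx' : ∀ᶠ u : X in 𝓝 x, K ∈ 𝓝[X] (u : Config) := by
    have := eventually_eventually_nhdsWithin (a := (x : Config)) (s := X)
      (p := fun u => u ∈ K) |>.2 hx
    rw [nhdsWithin_eq_map_subtype_coe x.2] at this
    exact this
  have hy' : ∀ᶠ u : X in 𝓝 y, K' ∈ 𝓝[X] (u : Config) := by
    have := eventually_eventually_nhdsWithin (a := (y : Config)) (s := X)
      (p := fun u => u ∈ K') |>.2 hy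
    rw [nhdsWithin_eq_map_subtype_coe y.2] at this
    exact this
  obtain ⟨⟨u, v⟩, ⟨hu, hv⟩, huv⟩ := mem_closure_iff_nhds.1 hxy _ (hx'.prodMk_nhds hy')
  rcases huv with huv | huv
  · have huv' : u = v := huv
    exact absurd (mem_of_mem_nhdsWithin v.2 hv)
      (disjoint_left.1 hd (huv' ▸ mem_of_mem_nhdsWithin u.2 hu))
  · exact huv.2 K K' hKX hK'X hK hK' hu hv hd

theorem tcpeRel_zero (X : Set Config) : tcpeRel X 0 = diagonal X := by
  simp [tcpeRel]

theorem tcpeRel_one (X : Set Config) : tcpeRel X 1 = entropyOrEqual X := by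
  rw [← zero_add (1 : Ordinal)]
  simp [tcpeRel, -zero_add, Ordinal.limitRecOn_add_one]

theorem tcpeRel_succ (X : Set Config) {γ : Ordinal.{0}} (hγ : γ ≠ 0) :
    tcpeRel X (γ + 1) = stepRel (tcpeRel X γ) := by
  simp [tcpeRel, Ordinal.limitRecOn_add_one, hγ]

theorem tcpeRel_limit (X : Set Config) {γ : Ordinal.{0}} (hγ : Order.IsSuccLimit γ) :
    tcpeRel X γ = ⋃ (δ : Ordinal.{0}) (_ : δ < γ), tcpeRel X δ := by
  simp only [tcpeRel]
  rw [Ordinal.limitRecOn_limit _ _ _ _ hγ]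

theorem subset_equivClosure {X : Type} (E : Set (X × X)) : E ⊆ equivClosure E :=
  fun _ hp => Relation.EqvGen.rel _ _ hp

theorem subset_stepRel {X : Type} [TopologicalSpace X] (E : Set (X × X)) : E ⊆ stepRel E := by
  unfold stepRel
  split_ifs
  · exact subset_equivClosure E
  · exact subset_closure

theorem tcpeRel_mono (X : Set Config) {γ δ : Ordinal.{0}} (h : γ ≤ δ) :
    tcpeRel X γ ⊆ tcpeRel X δ := by
  induction δ using Ordinal.limitRecOn with
  | zero => rw [le_antisymm h zero_le]
  | add_one δ ih =>
    rcases h.lt_or_eq with hlt | rfl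
    · refine (ih (Order.lt_add_one_iff.1 hlt)).trans ?_
      by_cases h0 : δ = 0
      · subst h0
        rw [zero_add, tcpeRel_one, tcpeRel_zero]
        rintro ⟨x, y⟩ hxy
        exact Or.inl hxy
      · rw [tcpeRel_succ X h0]
        exact subset_stepRel _
    · exact subset_rfl
  | limit δ hδ ih =>
    rcases h.lt_or_eq with hlt | rfl
    · rw [tcpeRel_limit X hδ]
      exact fun p hp => mem_iUnion₂.2 ⟨γ, hlt, hp⟩
    · exact subset_rfl

theorem equivClosure_equivClosure {X : Type} (E : Set (X × X)) :
    equivClosure (equivClosure E) = equivClosure E := by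
  refine Subset.antisymm ?_ (subset_equivClosure _)
  rintro ⟨x, y⟩ h
  exact (Relation.EqvGen.is_equivalence _).eqvGen_iff.1 h

/-- The relations of even index and those with index one more. -/
theorem tcpeRel_even_succ (X : Set Config) {γ : Ordinal.{0}} (hγ : 1 ≤ γ)
    (h : equivClosure (tcpeRel X (2 * γ)) = tcpeRel X (2 * γ)) :
    tcpeRel X (2 * γ + 1) = closure (tcpeRel X (2 * γ)) ∧
    tcpeRel X (2 * (γ + 1)) = equivClosure (closure (tcpeRel X (2 * γ))) := by
  have h0 : 2 * γ ≠ 0 := mul_ne_zero two_ne_zero (Order.one_le_iff_ne_zero.1 hγ)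
  have e1 : tcpeRel X (2 * γ + 1) = closure (tcpeRel X (2 * γ)) := by
    rw [tcpeRel_succ X h0, stepRel]
    -- In the closed case the generated equivalence relation is the relation itself, which is then
    -- its own closure; so both cases give the closure.
    split_ifs with hc
    · rw [h, hc.closure_eq]
    · rfl
  refine ⟨e1, ?_⟩
  have e2 : 2 * (γ + 1) = 2 * γ + 1 + 1 := by
    rw [mul_add, mul_one, add_assoc, one_add_one_eq_two]
  rw [e2, tcpeRel_succ X (by simp), e1, stepRel, if_pos isClosed_closure]

variable {L : Type} [LinearOrder L]

/-- The hierarchy of relations is controlled by the Hausdorff derivatives of the order of types. -/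
theorem tcpeRel_even {X : Set Config} [CompactSpace X] {ty : X → L} {Al : X → X → Prop}
    (h : TypeMap ty Al)
    (hE : ∀ x y, IsEntropyPair X x y → (x, y) ∈ closure {p : X × X | ty p.1 = ty p.2})
    (hG : ∀ x y, hausdorffRel L 1 (ty x) (ty y) → Al x y →
      (x, y) ∈ equivClosure (entropyOrEqual X)) {γ : Ordinal.{0}} (hγ : 1 ≤ γ) :
    equivClosure (tcpeRel X (2 * γ)) = tcpeRel X (2 * γ) ∧
    (∀ x y, (x, y) ∈ tcpeRel X (2 * γ) → hausdorffRel L γ (ty x) (ty y)) ∧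
    (∀ x y, hausdorffRel L γ (ty x) (ty y) → Al x y → (x, y) ∈ tcpeRel X (2 * γ)) := by
  induction γ using Ordinal.limitRecOn with
  | zero => exact absurd hγ (by simp)
  | add_one γ ih =>
    by_cases h0 : γ = 0
    · subst h0
      have e : tcpeRel X (2 * (0 + 1)) = equivClosure (entropyOrEqual X) := by
        rw [zero_add, mul_one, ← one_add_one_eq_two, tcpeRel_succ X one_ne_zero, tcpeRel_one,
          stepRel, if_pos (isClosed_entropyOrEqual X)]
      rw [e]
      refine ⟨equivClosure_equivClosure _, fun x y hxy => ?_, fun x y hxy => hG x y ?_⟩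
      · have hH := convexEquiv_hausdorffRel (L := L) (0 + 1)
        have heq : Equivalence fun x y : X => hausdorffRel L (0 + 1) (ty x) (ty y) :=
          ⟨fun x => hH.refl (ty x), hH.symm, hH.trans⟩
        refine heq.eqvGen_iff.1 (Relation.EqvGen.mono ?_ x y hxy)
        rintro u v (huv | huv)
        · have : u = v := huv
          exact this ▸ hH.refl _
        -- An entropy pair is a limit of pairs of equal type, that is, of `H_0`-equivalent types, so
        -- the bound for closures applies with `H_0`.
        · rw [hausdorffRel_succ]
          exact h.finite_of_mem_closure (convexEquiv_hausdorffRel 0)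
            (fun x y hxy => (hausdorffRel_zero _ _).2 hxy) (hE u v huv)
      · rwa [zero_add] at hxy
    · have hγ' : 1 ≤ γ := Order.one_le_iff_ne_zero.2 h0
      obtain ⟨h1, h2, h3⟩ := ih hγ'
      rw [(tcpeRel_even_succ X hγ' h1).2]
      refine ⟨equivClosure_equivClosure _, fun x y hxy => ?_, fun x y hxy hAl => ?_⟩
      · have hH := convexEquiv_hausdorffRel (L := L) (γ + 1)
        have heq : Equivalence fun x y : X => hausdorffRel L (γ + 1) (ty x) (ty y) :=
          ⟨fun x => hH.refl (ty x), hH.symm, hH.trans⟩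
        refine heq.eqvGen_iff.1 (Relation.EqvGen.mono ?_ x y hxy)
        intro u v huv
        rw [hausdorffRel_succ]
        exact h.finite_of_mem_closure (convexEquiv_hausdorffRel γ) h2 huv
      · rw [hausdorffRel_succ] at hxy
        exact h.eqvGen_of_finite (convexEquiv_hausdorffRel γ)
          (fun a b => hausdorffRel_of_finite hγ') h3 hAl hxy
  | limit γ hlim ih =>
    -- The ordinals `2 * δ` with `1 ≤ δ < γ` are cofinal in the limit ordinal `2 * γ`.
    have hmem : ∀ p : X × X, p ∈ tcpeRel X (2 * γ) ↔
        ∃ δ < γ, 1 ≤ δ ∧ p ∈ tcpeRel X (2 * δ) := by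
      intro p
      constructor
      · intro hp
        rw [tcpeRel_limit X (Ordinal.isSuccLimit_mul_right two_pos hlim)] at hp
        obtain ⟨δ, hδ, hp⟩ := mem_iUnion₂.1 hp
        obtain ⟨ε, hε, hδε⟩ := (Ordinal.lt_mul_iff_of_isSuccLimit hlim).1 hδ
        refine ⟨ε + 1, hlim.add_one_lt hε, le_add_self, tcpeRel_mono X ?_ hp⟩
        exact hδε.le.trans (mul_le_mul_right (le_self_add) 2)
      · rintro ⟨δ, hδ, -, hp⟩
        exact tcpeRel_mono X (mul_le_mul_right hδ.le 2) hp
    refine ⟨?_, ?_, ?_⟩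
    · refine Subset.antisymm ?_ (subset_equivClosure _)
      have heq : Equivalence fun x y : X => (x, y) ∈ tcpeRel X (2 * γ) := by
        have heqδ : ∀ δ, equivClosure (tcpeRel X δ) = tcpeRel X δ →
            Equivalence fun x y : X => (x, y) ∈ tcpeRel X δ := by
          intro δ hδ
          rw [← hδ]
          exact Relation.EqvGen.is_equivalence _
        have h1γ : (1 : Ordinal) < γ := (Ordinal.one_lt_of_isSuccLimit hlim)
        refine ⟨fun x => ?_, fun {x y} hxy => ?_, fun {x y z} hxy hyz => ?_⟩
        · exact (hmem _).2 ⟨1, h1γ, le_rfl, (heqδ _ (ih 1 h1γ le_rfl).1).refl x⟩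
        · obtain ⟨δ, hδ, h1δ, hp⟩ := (hmem _).1 hxy
          exact (hmem _).2 ⟨δ, hδ, h1δ, (heqδ _ (ih δ hδ h1δ).1).symm hp⟩
        · obtain ⟨δ, hδ, h1δ, hp⟩ := (hmem _).1 hxy
          obtain ⟨δ', hδ', h1δ', hp'⟩ := (hmem _).1 hyz
          have hm : max δ δ' < γ := max_lt hδ hδ'
          have h1m : 1 ≤ max δ δ' := h1δ.trans (le_max_left _ _)
          exact (hmem _).2 ⟨_, hm, h1m, (heqδ _ (ih _ hm h1m).1).trans
            (tcpeRel_mono X (mul_le_mul_right (le_max_left _ _) 2) hp)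
            (tcpeRel_mono X (mul_le_mul_right (le_max_right _ _) 2) hp')⟩
      rintro ⟨x, y⟩ hxy
      exact heq.eqvGen_iff.1 hxy
    · intro x y hxy
      obtain ⟨δ, hδ, h1δ, hp⟩ := (hmem _).1 hxy
      exact hausdorffRel_mono hδ.le ((ih δ hδ h1δ).2.1 x y hp)
    · intro x y hxy hAl
      obtain ⟨δ, hδ, hp⟩ := (hausdorffRel_limit hlim _ _).1 hxy
      have hm : max δ 1 < γ := max_lt hδ (Ordinal.one_lt_of_isSuccLimit hlim)
      exact (hmem _).2 ⟨_, hm, le_max_right _ _, (ih _ hm (le_max_right _ _)).2.2 x y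
        (hausdorffRel_mono (le_max_left _ _) hp) hAl⟩

/-- The relation of index `2 β` is full if and only if the `β`-th derivative is. -/
theorem tcpeRel_even_eq_univ_iff {X : Set Config} [CompactSpace X] {ty : X → L}
    {Al : X → X → Prop} (h : TypeMap ty Al) (hsurj : Function.Surjective ty)
    (hE : ∀ x y, IsEntropyPair X x y → (x, y) ∈ closure {p : X × X | ty p.1 = ty p.2})
    (hG : ∀ x y, hausdorffRel L 1 (ty x) (ty y) → Al x y →
      (x, y) ∈ equivClosure (entropyOrEqual X)) (hfree : ∃ z, ∀ x, Al x z)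
    {γ : Ordinal.{0}} (hγ : 1 ≤ γ) :
    tcpeRel X (2 * γ) = univ ↔ ∀ a b : L, hausdorffRel L γ a b := by
  obtain ⟨h1, h2, h3⟩ := tcpeRel_even h hE hG hγ
  constructor
  · intro hu a b
    obtain ⟨x, rfl⟩ := hsurj a
    obtain ⟨y, rfl⟩ := hsurj b
    exact h2 x y (hu ▸ mem_univ _)
  · intro hu
    -- Two arbitrary points need not be allied; both are linked to a point that is allied with all.
    obtain ⟨z, hz⟩ := hfree
    refine eq_univ_of_forall ?_
    rintro ⟨x, y⟩
    rw [← h1]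
    exact .trans _ z _ (.rel _ _ (h3 x z (hu _ _) (hz x)))
      (.symm _ _ (.rel _ _ (h3 y z (hu _ _) (hz y))))

/-- Fullness of `E_{2γ}` is fullness of `H_γ`, so `α ≤ 2β` while `2γ < α` for all `γ < β`. For `β =
γ + 1` this leaves `2γ + 1` and `2γ + 2`; for limit `β` it forces `α = 2β`. -/
theorem rank_relation {X : Set Config} [CompactSpace X] {ty : X → L} {Al : X → X → Prop}
    (h : TypeMap ty Al) (hsurj : Function.Surjective ty)
    (hE : ∀ x y, IsEntropyPair X x y → (x, y) ∈ closure {p : X × X | ty p.1 = ty p.2})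
    (hG : ∀ x y, hausdorffRel L 1 (ty x) (ty y) → Al x y →
      (x, y) ∈ equivClosure (entropyOrEqual X)) (hfree : ∃ z, ∀ x, Al x z)
    (hL : ∃ a b : L, a ≠ b) {α β : Ordinal.{0}} (hα : IsTCPERank X α)
    (hβ : IsHausdorffRank L β) : α + 1 = 2 * β ∨ α = 2 * β := by
  have iff_ := fun (γ : Ordinal.{0}) (hγ : 1 ≤ γ) =>
    tcpeRel_even_eq_univ_iff h hsurj hE hG hfree hγ
  have hβ0 : 1 ≤ β := by
    rw [Order.one_le_iff_ne_zero]
    rintro rfl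
    obtain ⟨a, b, hab⟩ := hL
    exact hab ((hausdorffRel_zero _ _).1 (hβ.1 a b))
  have h2β : (1 : Ordinal) ≤ 2 * β :=
    Order.one_le_iff_ne_zero.2 (mul_ne_zero two_ne_zero (Order.one_le_iff_ne_zero.1 hβ0))
  have hle : α ≤ 2 * β := hα.2 ⟨h2β, (iff_ β hβ0).2 hβ.1⟩
  have hgt : ∀ γ < β, 2 * γ < α := by
    intro γ hγ
    by_contra! hcon
    rcases eq_or_ne γ 0 with rfl | h0
    · rw [mul_zero] at hcon
      exact absurd (hα.1.1.trans hcon) (by simp)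
    have : tcpeRel X (2 * γ) = univ :=
      eq_univ_of_univ_subset (hα.1.2 ▸ tcpeRel_mono X hcon)
    exact absurd (hβ.2 ((iff_ γ (Order.one_le_iff_ne_zero.2 h0)).1 this)) (not_le.2 hγ)
  rcases Ordinal.zero_or_succ_or_isSuccLimit β with rfl | ⟨γ, rfl⟩ | hlim
  · simp at hβ0
  · have e2 : 2 * Order.succ γ = 2 * γ + 1 + 1 := by
      rw [Order.succ_eq_add_one, mul_add, mul_one, add_assoc, one_add_one_eq_two]
    have h1 : 2 * γ + 1 ≤ α := Order.add_one_le_of_lt (hgt γ (Order.lt_succ γ))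
    rw [e2] at hle ⊢
    rcases h1.lt_or_eq with h1 | h1
    · exact Or.inr (le_antisymm hle (Order.add_one_le_of_lt h1))
    · exact Or.inl (by rw [h1])
  · refine Or.inr (le_antisymm hle ?_)
    by_contra! hcon
    obtain ⟨γ, hγ, hlt⟩ := (Ordinal.lt_mul_iff_of_isSuccLimit hlim).1 hcon
    exact absurd (hgt γ hγ) (not_lt.2 hlt.le)

end TCPE

namespace TCPE

open Set Filter Topology

/-! ### Neighbourhoods in the space of configurations -/

/-- The position `p` is in the window `[-N,N]²`. -/
def InWindow (N : ℕ) (p : ℤ × ℤ) : Prop :=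
  (-(N : ℤ) ≤ p.1 ∧ p.1 ≤ N) ∧ (-(N : ℤ) ≤ p.2 ∧ p.2 ≤ N)

/-- `z` and `x` agree on the window `[-N,N]²`. -/
def Agree (N : ℕ) (x z : Config) : Prop := ∀ p : ℤ × ℤ, InWindow N p → z p = x p

theorem InWindow.mono {N M : ℕ} (h : M ≤ N) {p : ℤ × ℤ} (hp : InWindow M p) : InWindow N p := by
  unfold InWindow at *
  omega

theorem Agree.mono {N M : ℕ} (h : M ≤ N) {x z : Config} (hz : Agree N x z) : Agree M x z :=
  fun p hp => hz p (hp.mono h)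

theorem exists_inWindow (I : Set (ℤ × ℤ)) (hI : I.Finite) : ∃ N : ℕ, ∀ p ∈ I, InWindow N p := by
  refine ⟨hI.toFinset.sup fun p => max p.1.natAbs p.2.natAbs, fun p hp => ?_⟩
  have := Finset.le_sup (f := fun p : ℤ × ℤ => max p.1.natAbs p.2.natAbs) (hI.mem_toFinset.2 hp)
  simp only [max_le_iff] at this
  unfold InWindow
  omega

theorem mem_nhds_config_iff {x : Config} {U : Set Config} :
    U ∈ 𝓝 x ↔ ∃ N : ℕ, ∀ z, Agree N x z → z ∈ U := by
  have hx : ∀ (y : ℤ × ℤ → Bool) (V : Set (ℤ × ℤ → Bool)),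
      V ∈ 𝓝 y ↔ ∃ N : ℕ, ∀ z : ℤ × ℤ → Bool, (∀ p, InWindow N p → z p = y p) → z ∈ V := by
    intro y V
    rw [nhds_pi, Filter.mem_pi]
    constructor
    · rintro ⟨I, hI, t, ht, hsub⟩
      obtain ⟨N, hN⟩ := exists_inWindow I hI
      refine ⟨N, fun z hz => hsub fun p hp => ?_⟩
      rw [hz p (hN p hp)]
      exact mem_of_mem_nhds (ht p)
    · rintro ⟨N, hN⟩
      refine ⟨Icc (-(N : ℤ)) N ×ˢ Icc (-(N : ℤ)) N, (finite_Icc _ _).prod (finite_Icc _ _),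
        fun p => {y p}, fun p => by simp, fun z hz => hN z fun p hp => ?_⟩
      exact hz p hp
  exact hx x U

theorem isClosed_eval (p : ℤ × ℤ) (b : Bool) : IsClosed {z : Config | z p = b} := by
  have : IsClosed {z : ℤ × ℤ → Bool | z p = b} :=
    isClosed_eq (continuous_apply p) continuous_const
  exact this

theorem isClosed_agree (N : ℕ) (x : Config) : IsClosed {z | Agree N x z} := by
  have h : {z : Config | Agree N x z} = ⋂ (p : ℤ × ℤ) (_ : InWindow N p),
      {z : Config | z p = x p} := by
    ext z
    rw [mem_iInter₂]
    rfl
  rw [h]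
  exact isClosed_iInter fun p => isClosed_iInter fun _ => isClosed_eval p _

theorem agree_mem_nhds (N : ℕ) (x : Config) : {z | Agree N x z} ∈ 𝓝 x :=
  mem_nhds_config_iff.2 ⟨N, fun _ h => h⟩

theorem exists_not_agree {x y : Config} (h : x ≠ y) : ∃ N, ∀ z, Agree N x z → ¬ Agree N y z := by
  obtain ⟨p, hp⟩ := Function.ne_iff.1 h
  obtain ⟨N, hN⟩ := exists_inWindow {p} (finite_singleton p)
  refine ⟨N, fun z h1 h2 => hp ?_⟩
  rw [← h1 p (hN p rfl), h2 p (hN p rfl)]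

theorem vadd_config_apply (g : ℤ × ℤ) (x : Config) (h : ℤ × ℤ) : (g +ᵥ x) h = x (h - g) := rfl

/-! ### Cover numbers -/

section Cover

variable {Y : Type} [AddAction (ℤ × ℤ) Y]

/-- The box `[0,n)²` as a finite set. -/
noncomputable def boxFinset (n : ℕ) : Finset (ℤ × ℤ) := Finset.Ico 0 (n : ℤ) ×ˢ Finset.Ico 0 (n : ℤ)

theorem mem_boxFinset {n : ℕ} {g : ℤ × ℤ} : g ∈ boxFinset n ↔ g ∈ box n := by
  simp [boxFinset, box]

theorem exists_cover_pair {A B : Set Y} (h : A ∪ B = univ) (X : Set Y) (n : ℕ) :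
    ∃ 𝒲 : Finset (Set Y), (↑𝒲 : Set (Set Y)) ⊆ refinement {A, B} n ∧
      X ⊆ ⋃₀ (↑𝒲 : Set (Set Y)) ∧ 𝒲.card ≤ 2 ^ (n * n) := by
  classical
  let f : Finset (ℤ × ℤ) → Set Y := fun s =>
    ⋂ g ∈ box n, (fun x : Y => g +ᵥ x) ⁻¹' (if g ∈ s then A else B)
  refine ⟨(boxFinset n).powerset.image f, ?_, fun x _ => ?_, ?_⟩
  · intro V hV
    obtain ⟨s, -, rfl⟩ := Finset.mem_image.1 (Finset.mem_coe.1 hV)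
    refine ⟨fun g => if g ∈ s then A else B, fun g _ => ?_, rfl⟩
    dsimp only
    split_ifs
    · exact Or.inl rfl
    · exact Or.inr rfl
  · refine ⟨f ((boxFinset n).filter fun g => g +ᵥ x ∈ A), ?_, ?_⟩
    · exact Finset.mem_coe.2 (Finset.mem_image_of_mem _ (Finset.mem_powerset.2
        (Finset.filter_subset _ _)))
    · refine mem_iInter₂.2 fun g hg => ?_
      have hAB : g +ᵥ x ∈ A ∪ B := h ▸ mem_univ _
      change g +ᵥ x ∈ if g ∈ _ then A else B
      split_ifs with hs
      · exact (Finset.mem_filter.1 hs).2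
      · rcases hAB with hA | hB
        · exact absurd (Finset.mem_filter.2 ⟨mem_boxFinset.2 hg, hA⟩) hs
        · exact hB
  · refine Finset.card_image_le.trans ?_
    rw [Finset.card_powerset]
    simp [boxFinset]

theorem coverNumber_pair_le {A B : Set Y} (h : A ∪ B = univ) (X : Set Y) (n : ℕ) :
    coverNumber X (refinement {A, B} n) ≤ 2 ^ (n * n) := by
  obtain ⟨𝒲, h1, h2, h3⟩ := exists_cover_pair h X n
  have : coverNumber X (refinement {A, B} n) ≤ 𝒲.card := Nat.sInf_le ⟨𝒲, h1, h2, rfl⟩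
  exact this.trans h3

theorem log_div_nonneg (X : Set Y) (𝒰 : Set (Set Y)) (n : ℕ) :
    0 ≤ Real.log (coverNumber X (refinement 𝒰 n)) / (n : ℝ) ^ 2 :=
  div_nonneg (Real.log_natCast_nonneg _) (by positivity)

theorem log_div_le_of_pair {A B : Set Y} (h : A ∪ B = univ) (X : Set Y) (n : ℕ) :
    Real.log (coverNumber X (refinement {A, B} n)) / (n : ℝ) ^ 2 ≤ Real.log 2 := by
  rcases Nat.eq_zero_or_pos n with rfl | hn
  · simpa using Real.log_nonneg one_le_two
  have hn' : (0 : ℝ) < (n : ℝ) ^ 2 := by positivity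
  rw [div_le_iff₀ hn']
  rcases Nat.eq_zero_or_pos (coverNumber X (refinement {A, B} n)) with h0 | h0
  · rw [h0]
    simp only [Nat.cast_zero, Real.log_zero]
    have := Real.log_nonneg one_le_two
    positivity
  · calc Real.log (coverNumber X (refinement {A, B} n))
        ≤ Real.log ((2 : ℝ) ^ (n * n)) := by
          refine Real.log_le_log (by exact_mod_cast h0) ?_
          exact_mod_cast coverNumber_pair_le h X n
      _ = Real.log 2 * (n : ℝ) ^ 2 := by
          rw [Real.log_pow]
          push_cast
          ring

/-- An upper limit of reals can be compared only for bounded sequences; this is the bound from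
above. -/
theorem isBoundedUnder_pair {A B : Set Y} (h : A ∪ B = univ) (X : Set Y) :
    IsBoundedUnder (· ≤ ·) atTop (fun n : ℕ =>
      Real.log (coverNumber X (refinement {A, B} n)) / (n : ℝ) ^ 2) :=
  isBoundedUnder_of ⟨Real.log 2, log_div_le_of_pair h X⟩

theorem isCobounded_log_div (X : Set Y) (𝒰 : Set (Set Y)) :
    IsCoboundedUnder (· ≤ ·) atTop (fun n : ℕ =>
      Real.log (coverNumber X (refinement 𝒰 n)) / (n : ℝ) ^ 2) :=
  (isBoundedUnder_of ⟨0, log_div_nonneg X 𝒰⟩ : IsBoundedUnder (· ≥ ·) atTop _).isCoboundedUnder_flip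

/-- A cover whose refinements have subcovers of bounded size has no entropy. -/
theorem coverEntropy_le_zero {X : Set Y} {𝒰 : Set (Set Y)} {k : ℕ}
    (h : ∀ n : ℕ, 0 < n → coverNumber X (refinement 𝒰 n) ≤ k) : coverEntropy X 𝒰 ≤ 0 := by
  have hlim : Tendsto (fun n : ℕ => Real.log (k + 1 : ℕ) / (n : ℝ) ^ 2) atTop (𝓝 0) := by
    refine Tendsto.div_atTop tendsto_const_nhds ?_
    exact (tendsto_pow_atTop two_ne_zero).comp tendsto_natCast_atTop_atTop
  rw [← hlim.limsup_eq]
  refine limsup_le_limsup ?_ (isCobounded_log_div X 𝒰) hlim.isBoundedUnder_le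
  filter_upwards [eventually_gt_atTop 0] with n hn
  have hn' : (0 : ℝ) < (n : ℝ) ^ 2 := by positivity
  refine div_le_div_of_nonneg_right ?_ hn'.le
  rcases Nat.eq_zero_or_pos (coverNumber X (refinement 𝒰 n)) with h0 | h0
  · rw [h0]
    simpa using Real.log_natCast_nonneg (k + 1)
  · refine Real.log_le_log (by exact_mod_cast h0) ?_
    exact_mod_cast (h n hn).trans (Nat.le_succ k)

end Cover

/-! ### Entropy pairs -/

/-- If the patterns of `x` and `y` can be prescribed independently along a lattice, then `(x, y)`
is an entropy pair. -/
theorem isEntropyPair_of_independent {X : Set Config} {x y : X} (hxy : x ≠ y)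
    (hX : ∀ (g : ℤ × ℤ), ∀ z ∈ X, g +ᵥ z ∈ X)
    (h : ∀ N : ℕ, ∃ K : ℕ, 0 < K ∧ ∀ θ : ℤ × ℤ → Bool, ∃ z ∈ X, ∀ q p : ℤ × ℤ,
      InWindow N p → z (K * q.1 + p.1, K * q.2 + p.2) = if θ q then (x : Config) p else (y : Config) p) :
    IsEntropyPair X x y := by
  classical
  refine ⟨hxy, fun A B hAX hBX hA hB hx hy hd => ?_⟩
  obtain ⟨U, hU, hUA⟩ := mem_nhdsWithin_iff_exists_mem_nhds_inter.1 hx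
  obtain ⟨V, hV, hVB⟩ := mem_nhdsWithin_iff_exists_mem_nhds_inter.1 hy
  obtain ⟨N₁, hN₁⟩ := mem_nhds_config_iff.1 hU
  obtain ⟨N₂, hN₂⟩ := mem_nhds_config_iff.1 hV
  obtain ⟨K, hK, hθ⟩ := h (max N₁ N₂)
  have hAB : Aᶜ ∪ Bᶜ = univ := by
    rw [← compl_inter, hd.inter_eq, compl_empty]
  have hne : Aᶜ ≠ Bᶜ := by
    intro e
    have hxA : (x : Config) ∈ A := mem_of_mem_nhdsWithin x.2 hx
    exact disjoint_left.1 hd hxA (compl_inj_iff.1 e ▸ hxA)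
  have hlow : ∀ m : ℕ, 2 ^ (m * m) ≤ coverNumber X (refinement {Aᶜ, Bᶜ} (K * m)) := by
    intro m
    obtain ⟨𝒲₀, h1, h2, -⟩ := exists_cover_pair hAB X (K * m)
    refine le_csInf ⟨_, 𝒲₀, h1, h2, rfl⟩ ?_
    rintro _ ⟨𝒲, hsub, hcov, rfl⟩
    choose! c hc hcV using fun W (hW : W ∈ refinement {Aᶜ, Bᶜ} (K * m)) => hW
    -- Each member of a refinement records which of the two complements was chosen at each lattice
    -- point of the box. A point coded by `θ` lies only in members that record `θ`, so a subcover
    -- needs one member for each of the `2 ^ (m * m)` codes.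
    let D : Set Config → (Fin m × Fin m → Bool) := fun W ij =>
      decide (c W ((K * (ij.1 : ℕ) : ℤ), (K * (ij.2 : ℕ) : ℤ)) = Bᶜ)
    have hsurj : (Finset.univ : Finset (Fin m × Fin m → Bool)) ⊆ 𝒲.image D := by
      intro θ _
      -- Translation by `g` reads the point at `p - g`, so the code of the lattice point `(i, j)`
      -- has to be placed at `(-i, -j)`.
      let θ' : ℤ × ℤ → Bool := fun q =>
        if hq : (-q.1).toNat < m ∧ (-q.2).toNat < m then θ (⟨_, hq.1⟩, ⟨_, hq.2⟩) else false
      obtain ⟨z, hz, hzθ⟩ := hθ θ'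
      obtain ⟨W, hW, hzW⟩ := hcov hz
      refine Finset.mem_image.2 ⟨W, hW, ?_⟩
      have hWr := hsub hW
      funext ⟨i, j⟩
      have hbox : ((K * (i : ℕ) : ℤ), (K * (j : ℕ) : ℤ)) ∈ box (K * m) := by
        have hi : (i : ℕ) < m := i.2
        have hj : (j : ℕ) < m := j.2
        refine ⟨⟨by positivity, ?_⟩, ⟨by positivity, ?_⟩⟩ <;> dsimp only
        · exact_mod_cast Nat.mul_lt_mul_of_pos_left hi hK
        · exact_mod_cast Nat.mul_lt_mul_of_pos_left hj hK
      set g : ℤ × ℤ := ((K * (i : ℕ) : ℤ), (K * (j : ℕ) : ℤ)) with hg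
      have hgz : g +ᵥ z ∈ c W g := by
        have := hzW
        rw [hcV W hWr] at this
        exact mem_iInter₂.1 this g hbox
      have hθ'v : θ' (-((i : ℕ) : ℤ), -((j : ℕ) : ℤ)) = θ (i, j) := by
        simp only [θ']
        rw [dif_pos ⟨by simp, by simp⟩]
        congr 1
        ext <;> simp
      have hval : ∀ p : ℤ × ℤ, InWindow (max N₁ N₂) p →
          (g +ᵥ z) p = if θ (i, j) then (x : Config) p else (y : Config) p := by
        intro p hp
        rw [← hθ'v, ← hzθ _ p hp, vadd_config_apply]
        congr 1
        ext <;> simp [hg] <;> ring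
      have hgX : g +ᵥ z ∈ X := hX g z hz
      change decide (c W g = Bᶜ) = θ (i, j)
      rcases hc W hWr g hbox with e | e
      · have : ¬ θ (i, j) = true := by
          intro ht
          refine absurd (hUA ⟨hN₁ _ fun p hp => ?_, hgX⟩) (e ▸ hgz : g +ᵥ z ∈ Aᶜ)
          rw [hval p (hp.mono (le_max_left _ _)), if_pos ht]
        rw [e, decide_eq_false hne, Bool.eq_false_iff.2 this]
      · have e' : c W g = Bᶜ := e
        have : θ (i, j) = true := by
          by_contra ht
          refine absurd (hVB ⟨hN₂ _ fun p hp => ?_, hgX⟩) (e' ▸ hgz : g +ᵥ z ∈ Bᶜ)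
          rw [hval p (hp.mono (le_max_right _ _)), if_neg ht]
        rw [this, decide_eq_true e']
    have := (Finset.card_le_card hsurj).trans Finset.card_image_le
    simpa using this
  have hpos : 0 < Real.log 2 / (K : ℝ) ^ 2 := by
    have := Real.log_pos one_lt_two
    positivity
  refine hpos.trans_le (le_limsup_of_frequently_le ?_ (isBoundedUnder_pair hAB X))
  rw [frequently_atTop]
  intro a
  -- The lower bound is needed only along the multiples of `K`, since the upper limit is taken.
  refine ⟨K * (a + 1), by nlinarith, ?_⟩
  have hKR : (0 : ℝ) < K := by exact_mod_cast hK
  have h2 : Real.log ((2 : ℝ) ^ ((a + 1) * (a + 1))) ≤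
      Real.log (coverNumber X (refinement {Aᶜ, Bᶜ} (K * (a + 1)))) :=
    Real.log_le_log (by positivity) (by exact_mod_cast hlow (a + 1))
  rw [Real.log_pow] at h2
  rw [div_le_div_iff₀ (by positivity) (by positivity)]
  push_cast at h2 ⊢
  calc Real.log 2 * ((K : ℝ) * (a + 1)) ^ 2 = ((a + 1) * (a + 1) * Real.log 2) * (K : ℝ) ^ 2 := by
        ring
    _ ≤ _ := mul_le_mul_of_nonneg_right h2 (by positivity)

/-- Arbitrarily large central patterns of both points of an entropy pair occur in one point. -/
theorem exists_agree_of_isEntropyPair {X : Set Config} (hc : IsClosed X) {x y : X}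
    (h : IsEntropyPair X x y) (N : ℕ) :
    ∃ z ∈ X, ∃ g g' : ℤ × ℤ, Agree N x (g +ᵥ z) ∧ Agree N y (g' +ᵥ z) := by
  obtain ⟨hne, hent⟩ := h
  obtain ⟨N₀, hN₀⟩ := exists_not_agree (fun e => hne (Subtype.ext e) : (x : Config) ≠ y)
  by_contra! hcon
  set M := max N N₀ with hM
  let A : Set Config := {z | Agree M x z} ∩ X
  let B : Set Config := {z | Agree M y z} ∩ X
  have hnhds : ∀ u : X, {z | Agree M u z} ∩ X ∈ 𝓝[X] (u : Config) := fun u =>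
    mem_nhdsWithin_iff_exists_mem_nhds_inter.2 ⟨_, agree_mem_nhds M u, subset_rfl⟩
  have hpos := hent A B inter_subset_right inter_subset_right ((isClosed_agree M x).inter hc)
    ((isClosed_agree M y).inter hc) (hnhds x) (hnhds y)
    (disjoint_left.2 fun z hz hz' => hN₀ z (hz.1.mono (le_max_right _ _))
      (hz'.1.mono (le_max_right _ _)))
  refine absurd hpos (not_lt.2 (coverEntropy_le_zero (k := 2) fun n _ => ?_))
  classical
  -- If no point shows both patterns, each point avoids one of them at all translates in the box, so
  -- two members of every refinement suffice and there is no entropy.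
  let W : Set Config → Set Config := fun C => ⋂ g ∈ box n, (fun x : Config => g +ᵥ x) ⁻¹' C
  suffices coverNumber X (refinement {Aᶜ, Bᶜ} n) ≤ ({W Aᶜ, W Bᶜ} : Finset (Set Config)).card from
    this.trans Finset.card_le_two
  refine Nat.sInf_le ⟨{W Aᶜ, W Bᶜ}, ?_, fun z hz => ?_, rfl⟩
  · intro V hV
    simp only [Finset.coe_insert, Finset.coe_singleton, mem_insert_iff, mem_singleton_iff] at hV
    rcases hV with rfl | rfl
    · exact ⟨fun _ => Aᶜ, fun _ _ => Or.inl rfl, rfl⟩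
    · exact ⟨fun _ => Bᶜ, fun _ _ => Or.inr rfl, rfl⟩
  · by_cases hzA : z ∈ W Aᶜ
    · exact ⟨W Aᶜ, by simp, hzA⟩
    · refine ⟨W Bᶜ, by simp, mem_iInter₂.2 fun g' _ hg' => hzA (mem_iInter₂.2 fun g _ hg => ?_)⟩
      exact hcon z hz g g' (hg.1.mono (le_max_left _ _)) (hg'.1.mono (le_max_left _ _))

/-- Both patterns occur in one point `z`, and the translates of `z` that show them at the origin
have the type of `z`. -/
theorem mem_closure_of_isEntropyPair {L : Type*} {X : Set Config} (hc : IsClosed X)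
    (hX : ∀ (g : ℤ × ℤ), ∀ z ∈ X, g +ᵥ z ∈ X) {ty : X → L}
    (hty : ∀ (g : ℤ × ℤ) (x x' : X), (x' : Config) = g +ᵥ (x : Config) → ty x' = ty x) {x y : X}
    (h : IsEntropyPair X x y) : (x, y) ∈ closure {p : X × X | ty p.1 = ty p.2} := by
  refine mem_closure_iff_nhds.2 fun U hU => ?_
  rw [nhds_prod_eq, mem_prod_iff] at hU
  obtain ⟨U₁, hU₁, U₂, hU₂, hsub⟩ := hU
  rw [nhds_subtype_eq_comap] at hU₁ hU₂
  obtain ⟨V₁, hV₁, hVU₁⟩ := hU₁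
  obtain ⟨V₂, hV₂, hVU₂⟩ := hU₂
  obtain ⟨N₁, hN₁⟩ := mem_nhds_config_iff.1 hV₁
  obtain ⟨N₂, hN₂⟩ := mem_nhds_config_iff.1 hV₂
  obtain ⟨z, hz, g, g', h1, h2⟩ := exists_agree_of_isEntropyPair hc h (max N₁ N₂)
  refine ⟨(⟨g +ᵥ z, hX g z hz⟩, ⟨g' +ᵥ z, hX g' z hz⟩), hsub ⟨hVU₁ ?_, hVU₂ ?_⟩, ?_⟩
  · exact hN₁ _ (h1.mono (le_max_left _ _))
  · exact hN₂ _ (h2.mono (le_max_right _ _))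
  · exact (hty g ⟨z, hz⟩ _ rfl).trans (hty g' ⟨z, hz⟩ _ rfl).symm

/-! ### Factors -/

/-- The full relation is reached only if every nontrivial factor has positive entropy. -/
theorem hasTCPE_of_tcpeRel {X : Set Config} (hc : IsClosed X) {α : Ordinal.{0}}
    (h : tcpeRel X α = univ) : HasTCPE X := by
  classical
  intro Y _ _ _ _ _ f hf hsurj hequiv hY
  by_contra hzero
  -- Disjoint closed neighbourhoods of the images pull back to disjoint closed neighbourhoods of the
  -- points, and the pulled back cover has no more entropy than the cover of the factor.
  have hpair : ∀ x y : X, IsEntropyPair X x y → f x = f y := by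
    intro x y hxy
    by_contra hne
    obtain ⟨U, hxU, hU, V, hyV, hV, hUV⟩ := exists_open_nhds_disjoint_closure hne
    let lift : Set Y → Set Config := fun C => Subtype.val '' (f ⁻¹' C)
    have hcl : ∀ C, IsClosed C → IsClosed (lift C) := fun C hC =>
      hc.isClosedEmbedding_subtypeVal.isClosedMap _ (hC.preimage hf)
    have hnh : ∀ (C : Set Y) (u : X), C ∈ 𝓝 (f u) → lift C ∈ 𝓝[X] (u : Config) := by
      intro C u hC
      rw [nhdsWithin_eq_map_subtype_coe u.2]
      exact image_mem_map (hf.continuousAt hC)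
    have hmem : ∀ (C : Set Y) (u : X), (u : Config) ∈ lift C ↔ f u ∈ C := by
      intro C u
      exact ⟨fun ⟨v, hv, e⟩ => Subtype.ext e ▸ hv, fun hu => ⟨u, hu, rfl⟩⟩
    have hdis : Disjoint (lift (closure U)) (lift (closure V)) := by
      rw [disjoint_left]
      rintro _ ⟨u, hu, rfl⟩ hu'
      exact disjoint_left.1 hUV hu ((hmem _ u).1 hu')
    have hpos := hxy.2 (lift (closure U)) (lift (closure V))
      (by rintro _ ⟨u, -, rfl⟩; exact u.2) (by rintro _ ⟨u, -, rfl⟩; exact u.2)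
      (hcl _ isClosed_closure) (hcl _ isClosed_closure)
      (hnh _ _ (mem_of_superset (hU.mem_nhds hxU) subset_closure))
      (hnh _ _ (mem_of_superset (hV.mem_nhds hyV) subset_closure)) hdis
    have hcov : (closure U)ᶜ ∪ (closure V)ᶜ = univ := by
      rw [← compl_inter, hUV.inter_eq, compl_empty]
    have hle : coverEntropy X {(lift (closure U))ᶜ, (lift (closure V))ᶜ} ≤
        coverEntropy (univ : Set Y) {(closure U)ᶜ, (closure V)ᶜ} := by
      refine limsup_le_limsup (Eventually.of_forall fun n => ?_) (isCobounded_log_div X _)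
        (isBoundedUnder_pair hcov univ)
      refine div_le_div_of_nonneg_right ?_ (by positivity)
      rcases Nat.eq_zero_or_pos (coverNumber X
        (refinement {(lift (closure U))ᶜ, (lift (closure V))ᶜ} n)) with h0 | h0
      · rw [h0]
        simpa using Real.log_natCast_nonneg _
      refine Real.log_le_log (by exact_mod_cast h0) (Nat.cast_le.2 ?_)
      obtain ⟨𝒲₀, h1, h2, -⟩ := exists_cover_pair hcov univ n
      refine le_csInf ⟨_, 𝒲₀, h1, h2, rfl⟩ ?_
      rintro _ ⟨𝒲, hsub, hcov', rfl⟩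
      choose! c hcU hcV using fun W
        (hW : W ∈ refinement {(closure U)ᶜ, (closure V)ᶜ} n) => hW
      let c' : Set Y → ℤ × ℤ → Set Config := fun W g =>
        if c W g = (closure U)ᶜ then (lift (closure U))ᶜ else (lift (closure V))ᶜ
      let F : Set Y → Set Config := fun W => ⋂ g ∈ box n, (fun x : Config => g +ᵥ x) ⁻¹' (c' W g)
      refine le_trans ?_ (Finset.card_image_le (s := 𝒲) (f := F))
      refine Nat.sInf_le ⟨𝒲.image F, ?_, fun z hz => ?_, rfl⟩
      · intro W' hW'
        obtain ⟨W, -, rfl⟩ := Finset.mem_image.1 (Finset.mem_coe.1 hW')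
        refine ⟨c' W, fun g _ => ?_, rfl⟩
        simp only [c']
        split_ifs
        · exact Or.inl rfl
        · exact Or.inr rfl
      · obtain ⟨W, hW, hzW⟩ := hcov' (mem_univ (f ⟨z, hz⟩))
        refine ⟨F W, Finset.mem_coe.2 (Finset.mem_image_of_mem _ hW), mem_iInter₂.2 fun g hg => ?_⟩
        rw [hcV W (hsub hW)] at hzW
        have hzg : g +ᵥ f ⟨z, hz⟩ ∈ c W g := mem_iInter₂.1 hzW g hg
        change g +ᵥ z ∈ c' W g
        have key : ∀ C : Set Y, g +ᵥ f ⟨z, hz⟩ ∈ Cᶜ → g +ᵥ z ∈ (lift C)ᶜ := by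
          rintro C hC ⟨u, hu, e⟩
          have := hequiv g ⟨z, hz⟩ u e
          exact hC (this ▸ hu)
        simp only [c']
        split_ifs with hif
        · exact key _ (hif ▸ hzg)
        · rcases hcU W (hsub hW) g hg with e | e
          · exact absurd e hif
          · exact key _ ((e : c W g = _) ▸ hzg)
    refine hzero ((ENNReal.ofReal_pos.2 (hpos.trans_le hle)).trans_le ?_)
    refine le_iSup₂_of_le {(closure U)ᶜ, (closure V)ᶜ} ⟨?_, ?_⟩ le_rfl
    · rintro W (rfl | rfl) <;> exact isClosed_closure.isOpen_compl
    · rw [sUnion_pair, hcov]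
  have hker : IsClosed {p : X × X | f p.1 = f p.2} :=
    isClosed_eq (hf.comp continuous_fst) (hf.comp continuous_snd)
  -- The kernel of `f` is a closed equivalence relation, hence it absorbs every step of the
  -- hierarchy.
  have hall : ∀ δ : Ordinal.{0}, tcpeRel X δ ⊆ {p : X × X | f p.1 = f p.2} := by
    intro δ
    induction δ using Ordinal.limitRecOn with
    | zero =>
      rw [tcpeRel_zero]
      rintro ⟨x, y⟩ hxy
      exact congrArg f hxy
    | add_one δ ih =>
      by_cases h0 : δ = 0
      · subst h0
        rw [zero_add, tcpeRel_one]
        rintro ⟨x, y⟩ (hxy | hxy)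
        · exact congrArg f hxy
        · exact hpair x y hxy
      · rw [tcpeRel_succ X h0, stepRel]
        split_ifs
        · rintro ⟨x, y⟩ hxy
          have heq : Equivalence fun x y : X => f x = f y :=
            ⟨fun _ => rfl, fun h => h.symm, fun h h' => h.trans h'⟩
          exact heq.eqvGen_iff.1 (Relation.EqvGen.mono (fun u v huv => ih huv) x y hxy)
        · exact closure_minimal ih hker
    | limit δ hδ ih =>
      rw [tcpeRel_limit X hδ]
      exact iUnion₂_subset ih
  obtain ⟨a, b, hab⟩ := hY
  obtain ⟨x, rfl⟩ := hsurj a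
  obtain ⟨y, rfl⟩ := hsurj b
  exact hab (hall α (h ▸ mem_univ (x, y)))

/-- A subshift with a nonconstant continuous invariant real function does not have TCPE. -/
theorem not_hasTCPE_of_invariant {X : Set Config} (hc : IsClosed X) {φ : X → ℝ}
    (hφ : Continuous φ)
    (hinv : ∀ (g : ℤ × ℤ) (x x' : X), (x' : Config) = g +ᵥ (x : Config) → φ x' = φ x)
    {x y : X} (hxy : φ x ≠ φ y) : ¬ HasTCPE X := by
  intro h
  have : CompactSpace X := isCompact_iff_compactSpace.1 hc.isCompact
  have : CompactSpace (range φ) := isCompact_iff_compactSpace.1 (isCompact_range hφ)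
  -- The range of an invariant function is a factor with the trivial action.
  let act : AddAction (ℤ × ℤ) (range φ) :=
    { vadd := fun _ y => y
      zero_vadd := fun _ => rfl
      add_vadd := fun _ _ _ => rfl }
  have : ContinuousConstVAdd (ℤ × ℤ) (range φ) := ⟨fun _ => continuous_id⟩
  have hpos := h (range φ) (rangeFactorization φ) (hφ.rangeFactorization)
    rangeFactorization_surjective
    (fun g x x' e => Subtype.ext (hinv g x x' e))
    ⟨⟨φ x, mem_range_self x⟩, ⟨φ y, mem_range_self y⟩, fun e => hxy (congrArg Subtype.val e)⟩
  refine absurd hpos (not_lt.2 (iSup₂_le fun 𝒰 h𝒰 => ?_))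
  rw [nonpos_iff_eq_zero, ENNReal.ofReal_eq_zero]
  -- Under the trivial action every finite subcover of the cover reappears in all its refinements,
  -- so cover numbers stay bounded.
  obtain ⟨t, ht⟩ := isCompact_univ.elim_finite_subcover (fun U : 𝒰 => (U : Set (range φ)))
    (fun U => h𝒰.1 U U.2) (by rw [← sUnion_eq_iUnion, h𝒰.2])
  classical
  refine coverEntropy_le_zero (k := t.card) fun n hn => ?_
  have h0 : ((0, 0) : ℤ × ℤ) ∈ box n := by
    refine ⟨⟨le_rfl, ?_⟩, ⟨le_rfl, ?_⟩⟩ <;> dsimp only <;> exact_mod_cast hn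
  refine le_trans ?_ (Finset.card_image_le (s := t) (f := fun U : 𝒰 => (U : Set (range φ))))
  refine Nat.sInf_le ⟨t.image fun U : 𝒰 => (U : Set (range φ)), fun V hV => ?_, fun v _ => ?_, rfl⟩
  · obtain ⟨U, -, rfl⟩ := Finset.mem_image.1 (Finset.mem_coe.1 hV)
    refine ⟨fun _ => U, fun _ _ => U.2, ?_⟩
    ext v
    exact ⟨fun hv => mem_iInter₂.2 fun _ _ => hv, fun hv => mem_iInter₂.1 hv _ h0⟩
  · obtain ⟨U, hU, hv⟩ := mem_iUnion₂.1 (ht (mem_univ v))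
    exact ⟨U, Finset.mem_coe.2 (Finset.mem_image_of_mem _ hU), hv⟩

end TCPE

namespace TCPE

open Set Filter Topology

/-! ### Packings of rectangular regions by squares -/

/-- A square block with lower left corner `(l, d)` and side `s`. -/
@[ext]
structure Blk where
  l : ℤ
  d : ℤ
  s : ℤ

namespace Blk

/-- The column `c` meets the block. -/
def Col (Q : Blk) (c : ℤ) : Prop := Q.l ≤ c ∧ c < Q.l + Q.s

/-- The row `r` meets the block. -/
def Row (Q : Blk) (r : ℤ) : Prop := Q.d ≤ r ∧ r < Q.d + Q.s

/-- The cell `(c, r)` is in the block. -/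
def Mem (Q : Blk) (c r : ℤ) : Prop := Q.Col c ∧ Q.Row r

end Blk

/-- The cell `(c, r)` is covered by a block of `P`. -/
def Covered (P : Set Blk) (c r : ℤ) : Prop := ∃ Q ∈ P, Q.Mem c r

/-- A packing of the region `U × V` by disjoint blocks with sides in `A`, such that the uncovered
cells contain no `2 × 2` block, even across the boundary of the region, and no isolated cell. -/
structure RegionPacking (A U V : Set ℤ) (P : Set Blk) : Prop where
  size : ∀ Q ∈ P, Q.s ∈ A
  sub : ∀ Q ∈ P, ∀ c r, Q.Mem c r → c ∈ U ∧ r ∈ V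
  disj : ∀ Q ∈ P, ∀ Q' ∈ P, ∀ c r, Q.Mem c r → Q'.Mem c r → Q = Q'
  blk : ∀ c r c' r', c' ∈ U → r' ∈ V → c ≤ c' → c' ≤ c + 1 → r ≤ r' → r' ≤ r + 1 →
    ∃ a b, c ≤ a ∧ a ≤ c + 1 ∧ r ≤ b ∧ b ≤ r + 1 ∧ Covered P a b
  iso : ∀ c ∈ U, ∀ r ∈ V, ¬ Covered P c r → ∃ c' ∈ U, ∃ r' ∈ V, ¬ Covered P c' r' ∧
    ¬ (c' = c ∧ r' = r) ∧ c - 1 ≤ c' ∧ c' ≤ c + 1 ∧ r - 1 ≤ r' ∧ r' ≤ r + 1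

/-- A horizontal chain of blocks of `P`, from one side of the region to the other. -/
structure Chain (U : Set ℤ) (P C : Set Blk) : Prop where
  sub : C ⊆ P
  cover : ∀ c ∈ U, (∃ Q ∈ C, Q.Col c) ∨ (∃ Q ∈ C, Q.l + Q.s = c) ∧ ∃ Q ∈ C, Q.l = c + 1
  col : ∀ Q ∈ C, ∀ Q' ∈ C, ∀ c, Q.Col c → Q'.Col c → Q = Q'
  overlap : ∀ Q ∈ C, ∀ Q' ∈ C, (Q'.l = Q.l + Q.s ∨ Q'.l = Q.l + Q.s + 1) →
    Q.d < Q'.d + Q'.s ∧ Q'.d < Q.d + Q.s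

/-- The bottoms `B` of a stack of blocks of side `s` that fills the rows of `V` from row `t` on,
with gaps of height at most one and flush with the upper boundary of `V`. -/
structure IsStack (V : Set ℤ) (t s : ℤ) (B : Set ℤ) : Prop where
  le : ∀ b ∈ B, t ≤ b
  sub : ∀ b ∈ B, ∀ r, b ≤ r → r < b + s → r ∈ V
  disj : ∀ b ∈ B, ∀ b' ∈ B, ∀ r, b ≤ r → r < b + s → b' ≤ r → r < b' + s → b = b'
  cover : ∀ r, t ≤ r → (r ∈ V ∨ r + 1 ∈ V) →
    ∃ b ∈ B, (b ≤ r ∧ r < b + s) ∨ (b ≤ r + 1 ∧ r + 1 < b + s)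

/-- The blocks of `P` in or below the chain `C`. -/
def keep (P C : Set Blk) : Set Blk :=
  {Q | Q ∈ P ∧ ∃ Q' ∈ C, ∃ c r, Q.Mem c r ∧ Q'.Col c ∧ r < Q'.d + Q'.s}

/-- The blocks stacked above the chain `C`. -/
def stacked (C : Set Blk) (st : Blk → Set ℤ) : Set Blk :=
  {Q | ∃ Q' ∈ C, Q.l = Q'.l ∧ Q.s = Q'.s ∧ Q.d ∈ st Q'}

section Surgery

variable {A U V V' : Set ℤ} {P C : Set Blk} {st : Blk → Set ℤ}

/-- A kept block starts below the top of the chain in some column, and this spreads column by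
column: if its bottom were above the next chain block, then, consecutive chain blocks sharing rows,
it would be a row of the previous chain block. The two blocks would share a cell and coincide,
although the chain block does not reach the next column. -/
theorem keep_lt (hP : RegionPacking A U V P) (hA : ∀ s ∈ A, 2 ≤ s) (hC : Chain U P C) {Q : Blk}
    (hQ : Q ∈ keep P C) {a : ℤ} (ha : Q.Col a) {Q' : Blk} (hQ' : Q' ∈ C) (hQ'a : Q'.Col a) :
    Q.d < Q'.d + Q'.s := by
  obtain ⟨hQP, Q₀, hQ₀, c₀, r₀, ⟨hc₀, hr₀⟩, hQ₀c, hr⟩ := hQ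
  have h2 : ∀ R ∈ C, 2 ≤ R.s := fun R hR => hA _ (hP.size R (hC.sub hR))
  have hcell : ∀ R ∈ C, ∀ b, Q.Col b → R.Col b → Q.d < R.d + R.s → R.d ≤ Q.d → Q = R := by
    intro R hR b hb hRb h1 h3
    refine hP.disj Q hQP R (hC.sub hR) b Q.d ⟨hb, le_rfl, ?_⟩ ⟨hRb, h3, h1⟩
    have := hA _ (hP.size Q hQP)
    omega
  have hU : ∀ b, Q.Col b → b ∈ U := fun b hb => (hP.sub Q hQP b r₀ ⟨hb, hr₀⟩).1
  have hstart : ∀ R ∈ C, R.Col c₀ → Q.d < R.d + R.s := by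
    intro R hR hRc
    rw [hC.col R hR Q₀ hQ₀ c₀ hRc hQ₀c]
    exact lt_of_le_of_lt hr₀.1 hr
  have right : ∀ n : ℕ, Q.Col (c₀ + n) → ∀ R ∈ C, R.Col (c₀ + n) → Q.d < R.d + R.s := by
    intro n
    induction n using Nat.strong_induction_on with
    | _ n ih =>
      intro hn R hR hRn
      rcases Nat.eq_zero_or_pos n with rfl | hpos
      · simp only [Nat.cast_zero, add_zero] at hRn
        exact hstart R hR hRn
      obtain ⟨m, rfl⟩ : ∃ m, n = m + 1 := ⟨n - 1, by omega⟩
      push_cast at hn hRn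
      unfold Blk.Col at hn hRn hc₀
      have hm : Q.Col (c₀ + m) := by unfold Blk.Col; omega
      by_cases hin : R.Col (c₀ + m)
      · exact ih m (by omega) hm R hR hin
      unfold Blk.Col at hin
      by_cases hex : ∃ S ∈ C, S.Col (c₀ + m)
      · obtain ⟨S, hS, hSm⟩ := hex
        have hSd := ih m (by omega) hm S hS hSm
        have hne : ¬ S.Col (c₀ + m + 1) := by
          intro hS'
          have := hC.col S hS R hR (c₀ + m + 1) hS' (by unfold Blk.Col; omega)
          rw [this] at hSm
          exact hin hSm
        have ho := hC.overlap S hS R hR (by unfold Blk.Col at hSm hne; omega)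
        by_contra hcon
        have := hcell S hS _ hm hSm hSd (by omega)
        rw [← this] at hne
        exact hne (by unfold Blk.Col; omega)
      -- Here column `c₀ + m` is a gap of the chain, of width one, so the comparison is with the
      -- chain block ending two columns before `R`.
      · rcases hC.cover _ (hU _ hm) with h' | ⟨⟨S, hS, hSe⟩, -⟩
        · exact absurd h' hex
        have hm0 : m ≠ 0 := by
          rintro rfl
          exact hex ⟨Q₀, hQ₀, by simpa using hQ₀c⟩
        have hS2 := h2 S hS
        have hSm : S.Col (c₀ + (m - 1 : ℕ)) := by unfold Blk.Col; omega
        have hQm : Q.Col (c₀ + (m - 1 : ℕ)) := by unfold Blk.Col; omega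
        have hSd := ih (m - 1) (by omega) hQm S hS hSm
        have ho := hC.overlap S hS R hR (by omega)
        by_contra hcon
        have := hcell S hS _ hQm hSm hSd (by omega)
        rw [this] at hn
        omega
  have left : ∀ n : ℕ, Q.Col (c₀ - n) → ∀ R ∈ C, R.Col (c₀ - n) → Q.d < R.d + R.s := by
    intro n
    induction n using Nat.strong_induction_on with
    | _ n ih =>
      intro hn R hR hRn
      rcases Nat.eq_zero_or_pos n with rfl | hpos
      · simp only [Nat.cast_zero, sub_zero] at hRn
        exact hstart R hR hRn
      obtain ⟨m, rfl⟩ : ∃ m, n = m + 1 := ⟨n - 1, by omega⟩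
      push_cast at hn hRn
      unfold Blk.Col at hn hRn hc₀
      have hm : Q.Col (c₀ - m) := by unfold Blk.Col; omega
      by_cases hin : R.Col (c₀ - m)
      · exact ih m (by omega) hm R hR hin
      unfold Blk.Col at hin
      by_cases hex : ∃ S ∈ C, S.Col (c₀ - m)
      · obtain ⟨S, hS, hSm⟩ := hex
        have hSd := ih m (by omega) hm S hS hSm
        have hne : ¬ S.Col (c₀ - m - 1) := by
          intro hS'
          have := hC.col S hS R hR (c₀ - m - 1) hS' (by unfold Blk.Col; omega)
          rw [this] at hSm
          exact hin hSm
        have ho := hC.overlap R hR S hS (by unfold Blk.Col at hSm hne; omega)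
        by_contra hcon
        have := hcell S hS _ hm hSm hSd (by omega)
        rw [← this] at hne
        exact hne (by unfold Blk.Col; omega)
      · rcases hC.cover _ (hU _ hm) with h' | ⟨-, S, hS, hSe⟩
        · exact absurd h' hex
        have hm0 : m ≠ 0 := by
          rintro rfl
          exact hex ⟨Q₀, hQ₀, by simpa using hQ₀c⟩
        have hS2 := h2 S hS
        have hSm : S.Col (c₀ - (m - 1 : ℕ)) := by unfold Blk.Col; omega
        have hQm : Q.Col (c₀ - (m - 1 : ℕ)) := by unfold Blk.Col; omega
        have hSd := ih (m - 1) (by omega) hQm S hS hSm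
        have ho := hC.overlap R hR S hS (by omega)
        by_contra hcon
        have := hcell S hS _ hQm hSm hSd (by omega)
        rw [this] at hn
        omega
  rcases le_total c₀ a with h | h
  · have e : a = c₀ + (a - c₀).toNat := by omega
    rw [e] at ha hQ'a
    exact right _ ha Q' hQ' hQ'a
  · have e : a = c₀ - (c₀ - a).toNat := by omega
    rw [e] at ha hQ'a
    exact left _ ha Q' hQ' hQ'a

/-- A kept block that starts below the top of a chain block and reaches beyond it would contain its
topmost cell in that column. -/
theorem keep_row_lt (hP : RegionPacking A U V P) (hA : ∀ s ∈ A, 2 ≤ s) (hC : Chain U P C) {Q : Blk}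
    (hQ : Q ∈ keep P C) {c r : ℤ} (hm : Q.Mem c r) {Q' : Blk} (hQ' : Q' ∈ C) (hc : Q'.Col c) :
    r < Q'.d + Q'.s := by
  by_contra hcon
  have h1 := keep_lt hP hA hC hQ hm.1 hQ' hc
  have h2 := hA _ (hP.size Q' (hC.sub hQ'))
  obtain ⟨hmc, hmr⟩ := hm
  unfold Blk.Row at hmr
  have := hP.disj Q hQ.1 Q' (hC.sub hQ') c (Q'.d + Q'.s - 1)
    ⟨hmc, by unfold Blk.Row; omega⟩ ⟨hc, by unfold Blk.Row; omega⟩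
  rw [this] at hmr
  omega

/-- Replacing everything above a chain by straight columns of blocks gives a packing. -/
theorem RegionPacking.surgery (hP : RegionPacking A U V P) (hA : ∀ s ∈ A, 2 ≤ s)
    (hC : Chain U P C) (hV' : V' ⊆ V) (hlow : ∀ r ∈ V, ∀ r' ∈ V', r ≤ r' → r ∈ V')
    (hord : V'.OrdConnected) (hCV : ∀ Q ∈ C, ∀ r, Q.Row r → r ∈ V')
    (hst : ∀ Q ∈ C, IsStack V' (Q.d + Q.s) Q.s (st Q)) :
    RegionPacking A U V' (keep P C ∪ stacked C st) := by
  have h2 : ∀ R ∈ C, 2 ≤ R.s := fun R hR => hA _ (hP.size R (hC.sub hR))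
  have hkeepV : ∀ Q ∈ keep P C, ∀ r, Q.Row r → r ∈ V' := by
    rintro Q hQ r hr
    obtain ⟨hQP, Q', hQ', c, r', ⟨hc, hr'⟩, hQ'c, hlt⟩ := hQ
    have hrV : r ∈ V := (hP.sub Q hQP c r ⟨hc, hr⟩).2
    have := keep_row_lt hP hA hC ⟨hQP, Q', hQ', c, r', ⟨hc, hr'⟩, hQ'c, hlt⟩ ⟨hc, hr⟩ hQ' hQ'c
    have hs := h2 Q' hQ'
    exact hlow r hrV (Q'.d + Q'.s - 1) (hCV Q' hQ' _ (by unfold Blk.Row; omega)) (by omega)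
  have hsz : ∀ Q ∈ keep P C ∪ stacked C st, Q.s ∈ A := by
    rintro Q (hQ | ⟨Q', hQ', -, hs, -⟩)
    · exact hP.size Q hQ.1
    · rw [hs]
      exact hP.size Q' (hC.sub hQ')
  -- coverage in a column of the chain
  have hcolLow : ∀ Q' ∈ C, ∀ c r, Q'.Col c → r < Q'.d + Q'.s →
      (Covered (keep P C ∪ stacked C st) c r ↔ Covered P c r) := by
    intro Q' hQ' c r hc hr
    constructor
    · rintro ⟨Q, hQ | ⟨R, hR, h1, h3, h4⟩, hm⟩
      · exact ⟨Q, hQ.1, hm⟩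
      · have hRc : R.Col c := by
          have := hm.1
          unfold Blk.Col at this ⊢
          omega
        have := hC.col R hR Q' hQ' c hRc hc
        subst this
        have h5 := (hst R hR).le _ h4
        have h6 := hm.2
        unfold Blk.Row at h6
        omega
    · rintro ⟨Q, hQ, hm⟩
      exact ⟨Q, Or.inl ⟨hQ, Q', hQ', c, r, hm, hc, hr⟩, hm⟩
  have hcolUp : ∀ Q' ∈ C, ∀ c r, Q'.Col c → Q'.d + Q'.s ≤ r →
      (Covered (keep P C ∪ stacked C st) c r ↔ ∃ b ∈ st Q', b ≤ r ∧ r < b + Q'.s) := by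
    intro Q' hQ' c r hc hr
    constructor
    · rintro ⟨Q, hQ | ⟨R, hR, h1, h3, h4⟩, hm⟩
      · have := keep_row_lt hP hA hC hQ hm hQ' hc
        omega
      · have hRc : R.Col c := by
          have := hm.1
          unfold Blk.Col at this ⊢
          omega
        have := hC.col R hR Q' hQ' c hRc hc
        subst this
        have h6 := hm.2
        unfold Blk.Row at h6
        exact ⟨Q.d, h4, by omega⟩
    · rintro ⟨b, hb, hbr⟩
      refine ⟨⟨Q'.l, b, Q'.s⟩, Or.inr ⟨Q', hQ', rfl, rfl, hb⟩, ⟨hc, ?_⟩⟩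
      exact hbr
  -- coverage in a gap column
  have hgapUp : ∀ Q₁ ∈ C, ∀ Q₂ ∈ C, ∀ c r, Q₁.l + Q₁.s = c → Q₂.l = c + 1 → Q₁.d ≤ r → Q₂.d ≤ r →
      ¬ Covered (keep P C ∪ stacked C st) c r := by
    rintro Q₁ hQ₁ Q₂ hQ₂ c r e1 e2 hr1 hr2 ⟨Q, hQ | ⟨R, hR, h1, h3, h4⟩, hm⟩
    · have hs := hsz Q (Or.inl hQ)
      have hs2 := hA _ hs
      have hs1' := h2 Q₁ hQ₁
      have hs2' := h2 Q₂ hQ₂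
      have hmc := hm.1
      unfold Blk.Col at hmc
      have key : ∀ Q' ∈ C, ∀ a, Q.Col a → Q'.Col a → Q'.d ≤ r → ¬ Q'.Col c → False := by
        intro Q' hQ' a ha hQ'a hr' hn
        have := keep_row_lt hP hA hC hQ ⟨ha, hm.2⟩ hQ' hQ'a
        have e := hP.disj Q hQ.1 Q' (hC.sub hQ') a r ⟨ha, hm.2⟩ ⟨hQ'a, hr', this⟩
        rw [← e] at hn
        exact hn hm.1
      by_cases hl : Q.l ≤ c - 1
      · exact key Q₁ hQ₁ (c - 1) (by unfold Blk.Col; omega) (by unfold Blk.Col; omega) hr1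
          (by unfold Blk.Col; omega)
      · exact key Q₂ hQ₂ (c + 1) (by unfold Blk.Col; omega) (by unfold Blk.Col; omega) hr2
          (by unfold Blk.Col; omega)
    · have hRc := hm.1
      have hs1' := h2 Q₁ hQ₁
      have hs2' := h2 Q₂ hQ₂
      have hs3' := h2 R hR
      unfold Blk.Col at hRc
      by_cases hl : R.l ≤ c - 1
      · have := hC.col R hR Q₁ hQ₁ (c - 1) (by unfold Blk.Col; omega) (by unfold Blk.Col; omega)
        subst this
        omega
      · have := hC.col R hR Q₂ hQ₂ (c + 1) (by unfold Blk.Col; omega) (by unfold Blk.Col; omega)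
        subst this
        omega
  -- Neighbouring chain blocks share rows, so `r` is below the tops of both. A block covering the
  -- gap column has width at least two, hence enters the column of a chain block below its top and
  -- is kept.
  have hgapLow : ∀ Q₁ ∈ C, ∀ Q₂ ∈ C, ∀ c r, Q₁.l + Q₁.s = c → Q₂.l = c + 1 →
      (r < Q₁.d ∨ r < Q₂.d) → ∀ Q ∈ P, Q.Mem c r → Q ∈ keep P C := by
    rintro Q₁ hQ₁ Q₂ hQ₂ c r e1 e2 hr Q hQ hm
    have hs2 := hA _ (hP.size Q hQ)
    have hs1' := h2 Q₁ hQ₁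
    have hs2' := h2 Q₂ hQ₂
    have ho := hC.overlap Q₁ hQ₁ Q₂ hQ₂ (by omega)
    have hmc := hm.1
    unfold Blk.Col at hmc
    by_cases hl : Q.l ≤ c - 1
    · exact ⟨hQ, Q₁, hQ₁, c - 1, r, ⟨by unfold Blk.Col; omega, hm.2⟩, by unfold Blk.Col; omega,
        by omega⟩
    · exact ⟨hQ, Q₂, hQ₂, c + 1, r, ⟨by unfold Blk.Col; omega, hm.2⟩, by unfold Blk.Col; omega,
        by omega⟩
  refine ⟨hsz, ?_, ?_, ?_, ?_⟩
  · rintro Q (hQ | ⟨Q', hQ', h1, h3, h4⟩) c r hm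
    · exact ⟨(hP.sub Q hQ.1 c r hm).1, hkeepV Q hQ r hm.2⟩
    · obtain ⟨hc, hr⟩ := hm
      unfold Blk.Col at hc
      unfold Blk.Row at hr
      have := h2 Q' hQ'
      refine ⟨(hP.sub Q' (hC.sub hQ') c Q'.d ⟨by unfold Blk.Col; omega, by unfold Blk.Row; omega⟩).1,
        (hst Q' hQ').sub Q.d h4 r (by omega) (by omega)⟩
  · have cross : ∀ Q ∈ keep P C, ∀ R ∈ stacked C st, ∀ c r, Q.Mem c r → R.Mem c r → False := by
      rintro Q hQ R ⟨Q', hQ', h1, h3, h4⟩ c r hm hm'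
      have hc := hm'.1
      have hr := hm'.2
      unfold Blk.Col at hc
      unfold Blk.Row at hr
      have := keep_row_lt hP hA hC hQ hm hQ' (by unfold Blk.Col; omega)
      have := (hst Q' hQ').le _ h4
      omega
    rintro Q (hQ | hQ) R (hR | hR) c r hm hm'
    · exact hP.disj Q hQ.1 R hR.1 c r hm hm'
    · exact (cross Q hQ R hR c r hm hm').elim
    · exact (cross R hR Q hQ c r hm' hm).elim
    · obtain ⟨Q₁, hQ₁, h1, h3, h4⟩ := hQ
      obtain ⟨Q₂, hQ₂, h1', h3', h4'⟩ := hR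
      obtain ⟨hc, hr⟩ := hm
      obtain ⟨hc', hr'⟩ := hm'
      unfold Blk.Col at hc hc'
      unfold Blk.Row at hr hr'
      have := hC.col Q₁ hQ₁ Q₂ hQ₂ c (by unfold Blk.Col; omega) (by unfold Blk.Col; omega)
      subst this
      have := (hst Q₁ hQ₁).disj _ h4 _ h4' r (by omega) (by omega) (by omega) (by omega)
      ext <;> omega
  · intro c r c' r' hc' hr' h1 h3 h4 h5
    -- one of the two columns belongs to the chain
    obtain ⟨Q', hQ', a, ha1, ha2, hQ'a⟩ : ∃ Q' ∈ C, ∃ a, c ≤ a ∧ a ≤ c + 1 ∧ Q'.Col a := by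
      rcases hC.cover c' hc' with ⟨Q', hQ', h⟩ | ⟨⟨Q₁, hQ₁, e1⟩, Q₂, hQ₂, e2⟩
      · exact ⟨Q', hQ', c', h1, h3, h⟩
      · have := h2 Q₁ hQ₁
        have := h2 Q₂ hQ₂
        by_cases hcc : c' = c
        · exact ⟨Q₂, hQ₂, c + 1, by omega, by omega, by unfold Blk.Col; omega⟩
        · exact ⟨Q₁, hQ₁, c, by omega, by omega, by unfold Blk.Col; omega⟩
    by_cases hup : Q'.d + Q'.s ≤ r
    · have hrV : r ∈ V' ∨ r + 1 ∈ V' := by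
        rcases (by omega : r' = r ∨ r' = r + 1) with rfl | rfl
        · exact Or.inl hr'
        · exact Or.inr hr'
      obtain ⟨b, hb, hb' | hb'⟩ := (hst Q' hQ').cover r hup hrV
      · exact ⟨a, r, ha1, ha2, le_rfl, by omega,
          (hcolUp Q' hQ' a r hQ'a hup).2 ⟨b, hb, hb'⟩⟩
      · exact ⟨a, r + 1, ha1, ha2, by omega, le_rfl,
          (hcolUp Q' hQ' a (r + 1) hQ'a (by omega)).2 ⟨b, hb, hb'⟩⟩
    by_cases hmid : Q'.d ≤ r + 1
    · have hs := h2 Q' hQ'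
      have hself : ∀ b, Q'.Row b → Covered (keep P C ∪ stacked C st) a b := fun b hb =>
        (hcolLow Q' hQ' a b hQ'a hb.2).2 ⟨Q', hC.sub hQ', hQ'a, hb⟩
      by_cases hr1 : Q'.d ≤ r
      · exact ⟨a, r, ha1, ha2, le_rfl, by omega, hself r ⟨hr1, by omega⟩⟩
      · exact ⟨a, r + 1, ha1, ha2, by omega, le_rfl, hself (r + 1) ⟨hmid, by omega⟩⟩
    · obtain ⟨a', b', hb1, hb2, hb3, hb4, Q, hQ, hm⟩ := hP.blk c r c' r' hc' (hV' hr') h1 h3 h4 h5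
      refine ⟨a', b', hb1, hb2, hb3, hb4, ?_⟩
      have hs := h2 Q' hQ'
      have hQU : a' ∈ U := (hP.sub Q hQ a' b' hm).1
      by_cases hex : ∃ R ∈ C, R.Col a'
      · obtain ⟨R, hR, hRa⟩ := hex
        refine (hcolLow R hR a' b' hRa ?_).2 ⟨Q, hQ, hm⟩
        by_cases hRQ : R = Q'
        · subst hRQ
          omega
        · have hne : ¬ R.Col a := fun h => hRQ (hC.col R hR Q' hQ' a h hQ'a)
          have hne' : ¬ Q'.Col a' := fun h => hRQ (hC.col R hR Q' hQ' a' hRa h)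
          unfold Blk.Col at hne hne' hRa hQ'a
          rcases lt_or_ge a a' with hlt | hge
          · have := hC.overlap Q' hQ' R hR (by omega)
            omega
          · have := hC.overlap R hR Q' hQ' (by omega)
            omega
      · rcases hC.cover a' hQU with h' | ⟨⟨Q₁, hQ₁, e1⟩, Q₂, hQ₂, e2⟩
        · exact absurd h' hex
        have hs1 := h2 Q₁ hQ₁
        have hs2 := h2 Q₂ hQ₂
        have hne : a' ≠ a := by
          rintro rfl
          exact hex ⟨Q', hQ', hQ'a⟩
        have hor : b' < Q₁.d ∨ b' < Q₂.d := by
          rcases lt_or_gt_of_ne hne with hlt | hlt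
          · have := hC.col Q₂ hQ₂ Q' hQ' a (by unfold Blk.Col; omega) hQ'a
            subst this
            omega
          · have := hC.col Q₁ hQ₁ Q' hQ' a (by unfold Blk.Col; omega) hQ'a
            subst this
            omega
        exact ⟨Q, Or.inl (hgapLow Q₁ hQ₁ Q₂ hQ₂ a' b' e1 e2 hor Q hQ hm), hm⟩
  -- A gap in a stack is a row piece as wide as the block, so it has an uncovered neighbour beside
  -- it. Below the chain the old neighbour stays uncovered. In a gap column at or above the bottoms
  -- of both adjacent chain blocks all cells are uncovered, and a neighbour is found above or, at
  -- the upper boundary, below.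
  · intro c hc r hr hunc
    by_cases hex : ∃ Q' ∈ C, Q'.Col c
    · obtain ⟨Q', hQ', hQ'c⟩ := hex
      have hs := h2 Q' hQ'
      by_cases hup : Q'.d + Q'.s ≤ r
      · have hnb : ∀ a, Q'.Col a → ¬ Covered (keep P C ∪ stacked C st) a r := by
          intro a ha hcov
          exact hunc ((hcolUp Q' hQ' c r hQ'c hup).2 ((hcolUp Q' hQ' a r ha hup).1 hcov))
        have haU : ∀ a, Q'.Col a → a ∈ U := fun a ha =>
          (hP.sub Q' (hC.sub hQ') a Q'.d ⟨ha, by unfold Blk.Row; omega⟩).1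
        unfold Blk.Col at hQ'c
        by_cases hl : Q'.l ≤ c - 1
        · have ha : Q'.Col (c - 1) := by unfold Blk.Col; omega
          exact ⟨c - 1, haU _ ha, r, hr, hnb _ ha, by omega, by omega, by omega, by omega, by omega⟩
        · have ha : Q'.Col (c + 1) := by unfold Blk.Col; omega
          exact ⟨c + 1, haU _ ha, r, hr, hnb _ ha, by omega, by omega, by omega, by omega, by omega⟩
      · have hunc' : ¬ Covered P c r := fun h => hunc ((hcolLow Q' hQ' c r hQ'c (by omega)).2 h)
        have hrlt : r < Q'.d := by
          by_contra hge
          exact hunc' ⟨Q', hC.sub hQ', hQ'c, by unfold Blk.Row; omega⟩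
        obtain ⟨c', hc', r', hr', hn, hne, g1, g2, g3, g4⟩ := hP.iso c hc r (hV' hr) hunc'
        have hr'V : r' ∈ V' := by
          refine hlow r' hr' Q'.d (hCV Q' hQ' _ (by unfold Blk.Row; omega)) (by omega)
        refine ⟨c', hc', r', hr'V, ?_, hne, g1, g2, g3, g4⟩
        by_cases hex' : ∃ R ∈ C, R.Col c'
        · obtain ⟨R, hR, hRc⟩ := hex'
          rw [hcolLow R hR c' r' hRc]
          · exact hn
          by_cases hRQ : R = Q'
          · subst hRQ
            omega
          · have hne1 : ¬ R.Col c := fun h => hRQ (hC.col R hR Q' hQ' c h hQ'c)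
            have hne2 : ¬ Q'.Col c' := fun h => hRQ (hC.col R hR Q' hQ' c' hRc h)
            unfold Blk.Col at hne1 hne2 hRc hQ'c
            rcases lt_or_ge c c' with hlt | hge
            · have := hC.overlap Q' hQ' R hR (by omega)
              omega
            · have := hC.overlap R hR Q' hQ' (by omega)
              omega
        · rcases hC.cover c' hc' with h' | ⟨⟨Q₁, hQ₁, e1⟩, Q₂, hQ₂, e2⟩
          · exact absurd h' hex'
          by_cases hlow' : r' < Q₁.d ∨ r' < Q₂.d
          · rintro ⟨Q, hQ | ⟨R, hR, h1, h3, h4⟩, hm⟩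
            · exact hn ⟨Q, hQ.1, hm⟩
            · refine hex' ⟨R, hR, ?_⟩
              have := hm.1
              unfold Blk.Col at this ⊢
              omega
          · exact hgapUp Q₁ hQ₁ Q₂ hQ₂ c' r' e1 e2 (by omega) (by omega)
    · rcases hC.cover c hc with h' | ⟨⟨Q₁, hQ₁, e1⟩, Q₂, hQ₂, e2⟩
      · exact absurd h' hex
      have hs1 := h2 Q₁ hQ₁
      have hs2 := h2 Q₂ hQ₂
      have ho := hC.overlap Q₁ hQ₁ Q₂ hQ₂ (by omega)
      by_cases hlow' : r < Q₁.d ∨ r < Q₂.d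
      · have hunc' : ¬ Covered P c r := fun ⟨Q, hQ, hm⟩ =>
          hunc ⟨Q, Or.inl (hgapLow Q₁ hQ₁ Q₂ hQ₂ c r e1 e2 hlow' Q hQ hm), hm⟩
        obtain ⟨c', hc', r', hr', hn, hne, g1, g2, g3, g4⟩ := hP.iso c hc r (hV' hr) hunc'
        have hr'V : r' ∈ V' := by
          rcases hlow' with h | h
          · exact hlow r' hr' Q₁.d (hCV Q₁ hQ₁ _ (by unfold Blk.Row; omega)) (by omega)
          · exact hlow r' hr' Q₂.d (hCV Q₂ hQ₂ _ (by unfold Blk.Row; omega)) (by omega)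
        refine ⟨c', hc', r', hr'V, ?_, hne, g1, g2, g3, g4⟩
        by_cases hcc : c' = c
        · subst hcc
          by_cases hlow2 : r' < Q₁.d ∨ r' < Q₂.d
          · rintro ⟨Q, hQ | ⟨R, hR, h1, h3, h4⟩, hm⟩
            · exact hn ⟨Q, hQ.1, hm⟩
            · refine hex ⟨R, hR, ?_⟩
              have := hm.1
              unfold Blk.Col at this ⊢
              omega
          · exact hgapUp Q₁ hQ₁ Q₂ hQ₂ c' r' e1 e2 (by omega) (by omega)
        · rcases lt_or_gt_of_ne hcc with hlt | hlt
          · rw [hcolLow Q₁ hQ₁ c' r' (by unfold Blk.Col; omega) (by omega)]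
            exact hn
          · rw [hcolLow Q₂ hQ₂ c' r' (by unfold Blk.Col; omega) (by omega)]
            exact hn
      · by_cases hr1 : r + 1 ∈ V'
        · exact ⟨c, hc, r + 1, hr1, hgapUp Q₁ hQ₁ Q₂ hQ₂ c (r + 1) e1 e2 (by omega) (by omega),
            by omega, by omega, by omega, by omega, by omega⟩
        -- If `r` is the top row of the region, the chain blocks beside the gap start strictly below
        -- it, because they have at least two rows inside the region.
        · have key : ∀ Q ∈ C, Q.d ≤ r → 2 ≤ Q.s → Q.d ≤ r - 1 := by
            intro Q hQ hd hs
            by_contra hcon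
            exact hr1 (hCV Q hQ (r + 1) (by unfold Blk.Row; omega))
          have k1 := key Q₁ hQ₁ (by omega) hs1
          have k2 := key Q₂ hQ₂ (by omega) hs2
          refine ⟨c, hc, r - 1, ?_, hgapUp Q₁ hQ₁ Q₂ hQ₂ c (r - 1) e1 e2 k1 k2,
            by omega, by omega, by omega, by omega, by omega⟩
          exact hord.out (hCV Q₁ hQ₁ Q₁.d (by unfold Blk.Row; omega)) hr ⟨k1, by omega⟩

end Surgery

end TCPE

namespace TCPE

open Set Filter Topology

/-! ### Symmetries of packings -/

namespace Blk

/-- Reflection in the diagonal. -/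
def swap (Q : Blk) : Blk := ⟨Q.d, Q.l, Q.s⟩

/-- Reflection in a horizontal axis; the row `r` becomes the row `-1 - r`. -/
def vflip (Q : Blk) : Blk := ⟨Q.l, -Q.d - Q.s, Q.s⟩

/-- Reflection in a vertical axis; the column `c` becomes the column `-1 - c`. -/
def hflip (Q : Blk) : Blk := ⟨-Q.l - Q.s, Q.d, Q.s⟩

@[simp] theorem swap_swap (Q : Blk) : Q.swap.swap = Q := rfl

@[simp] theorem vflip_vflip (Q : Blk) : Q.vflip.vflip = Q := by
  ext <;> simp only [vflip]; omega

@[simp] theorem hflip_hflip (Q : Blk) : Q.hflip.hflip = Q := by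
  ext <;> simp only [hflip]; omega

theorem mem_swap {Q : Blk} {c r : ℤ} : Q.swap.Mem c r ↔ Q.Mem r c := by
  simp only [Mem, Col, Row, swap]
  tauto

theorem mem_vflip {Q : Blk} {c r : ℤ} : Q.vflip.Mem c r ↔ Q.Mem c (-1 - r) := by
  simp only [Mem, Col, Row, vflip]
  omega

end Blk

theorem covered_swap {P : Set Blk} {c r : ℤ} :
    Covered {Q | Q.swap ∈ P} c r ↔ Covered P r c :=
  ⟨fun ⟨Q, hQ, h⟩ => ⟨Q.swap, hQ, Blk.mem_swap.2 h⟩,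
    fun ⟨Q, hQ, h⟩ => ⟨Q.swap, hQ, Blk.mem_swap.2 h⟩⟩

theorem covered_vflip {P : Set Blk} {c r : ℤ} :
    Covered {Q | Q.vflip ∈ P} c r ↔ Covered P c (-1 - r) := by
  constructor
  · rintro ⟨Q, hQ, h⟩
    exact ⟨Q.vflip, hQ, Blk.mem_vflip.2 (by rwa [sub_sub_cancel])⟩
  · rintro ⟨Q, hQ, h⟩
    exact ⟨Q.vflip, by simpa using hQ, Blk.mem_vflip.2 h⟩

section Packing

variable {A U V : Set ℤ} {P C : Set Blk}

theorem RegionPacking.swap (h : RegionPacking A U V P) :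
    RegionPacking A V U {Q | Q.swap ∈ P} where
  size Q hQ := h.size Q.swap hQ
  sub Q hQ c r hm := (h.sub _ hQ r c (Blk.mem_swap.2 hm)).symm
  disj Q hQ Q' hQ' c r hm hm' := by
    have := h.disj _ hQ _ hQ' r c (Blk.mem_swap.2 hm) (Blk.mem_swap.2 hm')
    simpa using congrArg Blk.swap this
  blk c r c' r' hc hr h1 h2 h3 h4 := by
    obtain ⟨a, b, g1, g2, g3, g4, g⟩ := h.blk r c r' c' hr hc h3 h4 h1 h2
    exact ⟨b, a, g3, g4, g1, g2, covered_swap.2 g⟩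
  iso c hc r hr hn := by
    obtain ⟨c', hc', r', hr', h1, h2, h3, h4, h5, h6⟩ :=
      h.iso r hr c hc (fun hh => hn (covered_swap.2 hh))
    exact ⟨r', hr', c', hc', fun hh => h1 (covered_swap.1 hh), by tauto, h5, h6, h3, h4⟩

theorem RegionPacking.vflip (h : RegionPacking A U V P) :
    RegionPacking A U {r | -1 - r ∈ V} {Q | Q.vflip ∈ P} where
  size Q hQ := h.size Q.vflip hQ
  sub Q hQ c r hm := h.sub _ hQ c (-1 - r) (Blk.mem_vflip.2 (by rwa [sub_sub_cancel]))
  disj Q hQ Q' hQ' c r hm hm' := by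
    have := h.disj _ hQ _ hQ' c (-1 - r) (Blk.mem_vflip.2 (by rwa [sub_sub_cancel]))
      (Blk.mem_vflip.2 (by rwa [sub_sub_cancel]))
    simpa using congrArg Blk.vflip this
  blk c r c' r' hc hr h1 h2 h3 h4 := by
    obtain ⟨a, b, g1, g2, g3, g4, g⟩ :=
      h.blk c (-1 - (r + 1)) c' (-1 - r') hc hr h1 h2 (by omega) (by omega)
    exact ⟨a, -1 - b, g1, g2, by omega, by omega, covered_vflip.2 (by rwa [sub_sub_cancel])⟩
  iso c hc r hr hn := by
    obtain ⟨c', hc', r', hr', h1, h2, h3, h4, h5, h6⟩ :=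
      h.iso c hc (-1 - r) hr (fun hh => hn (covered_vflip.2 hh))
    refine ⟨c', hc', -1 - r', ?_, fun hh => h1 ?_, ?_, h3, h4, by omega, by omega⟩
    · change -1 - (-1 - r') ∈ V
      rwa [sub_sub_cancel]
    · have := covered_vflip.1 hh
      rwa [sub_sub_cancel] at this
    · omega

theorem RegionPacking.hflip (h : RegionPacking A U V P) :
    RegionPacking A {c | -1 - c ∈ U} V {Q | Q.hflip ∈ P} :=
  h.swap.vflip.swap

theorem RegionPacking.congr {U' V' : Set ℤ} {P' : Set Blk} (h : RegionPacking A U V P)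
    (hU : U = U') (hV : V = V') (hP : P = P') : RegionPacking A U' V' P' := by
  subst hU hV hP
  exact h

/-! ### Chains -/

/-- The right neighbour of a block, at the height of the row `b` if possible. -/
theorem RegionPacking.exists_right (hP : RegionPacking A U V P) (hA : ∀ s ∈ A, 2 ≤ s) (b : ℤ)
    {Q : Blk} (hQ : Q ∈ P) (hU : Q.l + Q.s ∈ U) :
    ∃ Q' ∈ P, (Q'.l = Q.l + Q.s ∨ Q'.l = Q.l + Q.s + 1) ∧
      (Q.d < Q'.d + Q'.s ∧ Q'.d < Q.d + Q.s) ∧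
      Q'.d ≤ max Q.d b + 1 ∧ min (Q.d + Q.s) (b + 2) ≤ Q'.d + Q'.s + 1 := by
  have hs := hA _ (hP.size Q hQ)
  -- The row nearest to `b` for which both `r` and `r + 1` meet `Q`. The 2 × 2 block to the right of
  -- `Q` in these rows has a covered cell, whose block is the neighbour.
  obtain ⟨r, hr⟩ : ∃ r, r = max Q.d (min b (Q.d + Q.s - 2)) := ⟨_, rfl⟩
  obtain ⟨a, b', h1, h2, h3, h4, Q', hQ', hm⟩ := hP.blk (Q.l + Q.s) r (Q.l + Q.s) r hU
    (hP.sub Q hQ Q.l r ⟨by unfold Blk.Col; omega, by unfold Blk.Row; omega⟩).2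
    le_rfl (by omega) le_rfl (by omega)
  have hs' := hA _ (hP.size Q' hQ')
  obtain ⟨hmc, hmr⟩ := hm
  unfold Blk.Col at hmc
  unfold Blk.Row at hmr
  have hl : Q.l + Q.s ≤ Q'.l := by
    by_contra hcon
    have := hP.disj Q hQ Q' hQ' (Q.l + Q.s - 1) b' ⟨by unfold Blk.Col; omega, by unfold Blk.Row; omega⟩
      ⟨by unfold Blk.Col; omega, by unfold Blk.Row; omega⟩
    subst this
    omega
  exact ⟨Q', hQ', by omega, by omega, by omega, by omega⟩

theorem RegionPacking.exists_left (hP : RegionPacking A U V P) (hA : ∀ s ∈ A, 2 ≤ s) (b : ℤ)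
    {Q : Blk} (hQ : Q ∈ P) (hU : Q.l - 1 ∈ U) :
    ∃ Q' ∈ P, (Q'.l + Q'.s = Q.l ∨ Q'.l + Q'.s = Q.l - 1) ∧
      (Q.d < Q'.d + Q'.s ∧ Q'.d < Q.d + Q.s) ∧
      Q'.d ≤ max Q.d b + 1 ∧ min (Q.d + Q.s) (b + 2) ≤ Q'.d + Q'.s + 1 := by
  obtain ⟨Q', hQ', h1, h2, h3, h4⟩ := hP.hflip.exists_right hA b (Q := Q.hflip) (by simpa using hQ)
    (by change -1 - (-Q.l - Q.s + Q.s) ∈ U; convert hU using 1; ring)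
  refine ⟨Q'.hflip, hQ', ?_, h2, h3, h4⟩
  simp only [Blk.hflip] at h1 ⊢
  omega

/-- Following right neighbours gives the right half of a chain. -/
theorem exists_halfChain (hP : RegionPacking A U V P) (hA : ∀ s ∈ A, 2 ≤ s)
    (hU : U.OrdConnected) {I : Blk → Prop} {Q₀ : Blk} (hQ₀ : Q₀ ∈ P) (hI : I Q₀)
    (hstep : ∀ Q ∈ P, I Q → Q.l + Q.s ∈ U → ∃ Q' ∈ P, I Q' ∧
      (Q'.l = Q.l + Q.s ∨ Q'.l = Q.l + Q.s + 1) ∧ Q.d < Q'.d + Q'.s ∧ Q'.d < Q.d + Q.s) :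
    ∃ C ⊆ P, Q₀ ∈ C ∧ (∀ Q ∈ C, I Q ∧ (Q = Q₀ ∨ Q₀.l + Q₀.s ≤ Q.l)) ∧
      (∀ c ∈ U, Q₀.l ≤ c →
        (∃ Q ∈ C, Q.Col c) ∨ (∃ Q ∈ C, Q.l + Q.s = c) ∧ ∃ Q ∈ C, Q.l = c + 1) ∧
      (∀ Q ∈ C, ∀ Q' ∈ C, ∀ c, Q.Col c → Q'.Col c → Q = Q') ∧
      (∀ Q ∈ C, ∀ Q' ∈ C, (Q'.l = Q.l + Q.s ∨ Q'.l = Q.l + Q.s + 1) →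
        Q.d < Q'.d + Q'.s ∧ Q'.d < Q.d + Q.s) := by
  -- At the end of `U` the successor is the block itself, so the sequence of neighbours becomes
  -- stationary there.
  have hnext : ∀ Q : {Q // Q ∈ P ∧ I Q}, ∃ Q' : {Q // Q ∈ P ∧ I Q},
      ((Q.1.l + Q.1.s ∉ U ∧ Q' = Q) ∨ ((Q'.1.l = Q.1.l + Q.1.s ∨ Q'.1.l = Q.1.l + Q.1.s + 1) ∧
        Q.1.d < Q'.1.d + Q'.1.s ∧ Q'.1.d < Q.1.d + Q.1.s)) := by
    rintro ⟨Q, hQ, hIQ⟩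
    by_cases h : Q.l + Q.s ∈ U
    · obtain ⟨Q', hQ', hI', h'⟩ := hstep Q hQ hIQ h
      exact ⟨⟨Q', hQ', hI'⟩, Or.inr h'⟩
    · exact ⟨⟨Q, hQ, hIQ⟩, Or.inl ⟨h, rfl⟩⟩
  choose nx hnx using hnext
  let f : ℕ → {Q // Q ∈ P ∧ I Q} := fun n => nx^[n] ⟨Q₀, hQ₀, hI⟩
  have hf0 : (f 0).1 = Q₀ := rfl
  have hfs : ∀ n, f (n + 1) = nx (f n) := fun n => Function.iterate_succ_apply' _ _ _
  have h2 : ∀ n, 2 ≤ (f n).1.s := fun n => hA _ (hP.size _ (f n).2.1)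
  have hf : ∀ n, ((f n).1.l + (f n).1.s ∉ U ∧ f (n + 1) = f n) ∨
      (((f (n + 1)).1.l = (f n).1.l + (f n).1.s ∨ (f (n + 1)).1.l = (f n).1.l + (f n).1.s + 1) ∧
        (f n).1.d < (f (n + 1)).1.d + (f (n + 1)).1.s ∧
        (f (n + 1)).1.d < (f n).1.d + (f n).1.s) := by
    intro n
    rw [hfs]
    exact hnx (f n)
  -- later blocks are equal or to the right
  have hmono : ∀ m k, f (m + k) = f m ∨ (f m).1.l + (f m).1.s ≤ (f (m + k)).1.l := by
    intro m k
    induction k with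
    | zero => exact Or.inl rfl
    | succ k ih =>
      rw [← add_assoc]
      have h2' := h2 (m + k)
      rcases hf (m + k) with ⟨-, h⟩ | ⟨h, -⟩
      · rwa [h]
      · right
        rcases ih with ih | ih
        · rw [ih] at h
          omega
        · omega
  have hmono' : ∀ m n, m ≤ n → f n = f m ∨ (f m).1.l + (f m).1.s ≤ (f n).1.l := by
    intro m n hmn
    obtain ⟨k, rfl⟩ := Nat.exists_eq_add_of_le hmn
    exact hmono m k
  refine ⟨range fun n => (f n).1, ?_, ⟨0, rfl⟩, ?_, ?_, ?_, ?_⟩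
  · rintro _ ⟨n, rfl⟩
    exact (f n).2.1
  · rintro _ ⟨n, rfl⟩
    refine ⟨(f n).2.2, ?_⟩
    rcases hmono' 0 n (Nat.zero_le n) with h | h
    · exact Or.inl (congrArg Subtype.val h)
    · exact Or.inr h
  · intro c hc hle
    -- Unless column `c` has been accounted for, the n-th block still lies to its left; left ends
    -- advance by at least one each time, so this fails for `n = c - Q₀.l + 1`.
    have key : ∀ n : ℕ, (∃ Q ∈ range fun n => (f n).1, Q.Col c) ∨
        ((∃ Q ∈ range fun n => (f n).1, Q.l + Q.s = c) ∧
          ∃ Q ∈ range fun n => (f n).1, Q.l = c + 1) ∨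
        ((f n).1.l + (f n).1.s ≤ c ∧ Q₀.l + n ≤ (f n).1.l) := by
      intro n
      induction n with
      | zero =>
        by_cases h : Q₀.Col c
        · exact Or.inl ⟨Q₀, ⟨0, rfl⟩, h⟩
        · right; right
          unfold Blk.Col at h
          rw [hf0]
          constructor
          · omega
          · simp
      | succ n ih =>
        rcases ih with ih | ih | ⟨ih, ih'⟩
        · exact Or.inl ih
        · exact Or.inr (Or.inl ih)
        rcases hf n with ⟨h, -⟩ | ⟨h, -⟩
        · exfalso
          refine h (hU.out (hP.sub _ (f n).2.1 (f n).1.l (f n).1.d ?_).1 hc ⟨?_, ih⟩)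
          · have := h2 n
            exact ⟨by unfold Blk.Col; omega, by unfold Blk.Row; omega⟩
          · have := h2 n
            omega
        · have hs := h2 n
          have hs' := h2 (n + 1)
          by_cases hin : (f (n + 1)).1.Col c
          · exact Or.inl ⟨_, ⟨n + 1, rfl⟩, hin⟩
          unfold Blk.Col at hin
          by_cases hlt : c < (f (n + 1)).1.l
          · exact Or.inr (Or.inl ⟨⟨_, ⟨n, rfl⟩, by dsimp only; omega⟩,
              ⟨_, ⟨n + 1, rfl⟩, by dsimp only; omega⟩⟩)
          · right; right
            push_cast
            constructor <;> omega
    rcases key (c - Q₀.l + 1).toNat with h | h | ⟨h, h'⟩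
    · exact Or.inl h
    · exact Or.inr h
    · have := h2 (c - Q₀.l + 1).toNat
      omega
  · have key : ∀ m n, m ≤ n → ∀ c, (f m).1.Col c → (f n).1.Col c → (f m).1 = (f n).1 := by
      intro m n hmn c hm hn
      rcases hmono' m n hmn with h | h
      · rw [h]
      · unfold Blk.Col at hm hn
        omega
    rintro _ ⟨m, rfl⟩ _ ⟨n, rfl⟩ c hm hn
    rcases le_total m n with h | h
    · exact key m n h c hm hn
    · exact (key n m h c hn hm).symm
  · rintro _ ⟨m, rfl⟩ _ ⟨n, rfl⟩ h
    simp only at h ⊢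
    have hs := h2 m
    have hs' := h2 n
    have hmn : m < n := by
      by_contra hcon
      rcases hmono' n m (by omega) with h' | h'
      · rw [h'] at h
        omega
      · omega
    have hs1 := h2 (m + 1)
    rcases hf m with ⟨hno, he⟩ | ⟨h1, h3⟩
    · exfalso
      have hstay : ∀ k, f (m + k) = f m := by
        intro k
        induction k with
        | zero => rfl
        | succ k ih =>
          rcases hf (m + k) with ⟨-, h'⟩ | ⟨h', -⟩
          · rw [← add_assoc, h', ih]
          · rw [ih] at h'
            have hin : (f (m + k + 1)).1.l ∈ U := (hP.sub _ (f (m + k + 1)).2.1 _ (f (m + k + 1)).1.d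
              ⟨⟨le_rfl, by have := h2 (m + k + 1); omega⟩, ⟨le_rfl, by have := h2 (m + k + 1); omega⟩⟩).1
            exact absurd (hU.out (hP.sub _ (f m).2.1 (f m).1.l (f m).1.d
              ⟨⟨le_rfl, by omega⟩, ⟨le_rfl, by omega⟩⟩).1 hin ⟨by omega, by omega⟩) hno
      obtain ⟨k, rfl⟩ := Nat.exists_eq_add_of_lt hmn
      have := hstay (k + 1)
      rw [← add_assoc] at this
      rw [this] at h
      omega
    · rcases hmono' (m + 1) n hmn with h' | h'
      · rw [h']
        exact h3
      · omega

/-- A half chain to the right, with invariant `I`, is joined at `Q₀` to the mirror image of a half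
chain to the left, with invariant `J`. -/
theorem exists_chain (hP : RegionPacking A U V P) (hA : ∀ s ∈ A, 2 ≤ s)
    (hU : U.OrdConnected) {I J : Blk → Prop} {Q₀ : Blk} (hQ₀ : Q₀ ∈ P) (hI : I Q₀) (hJ : J Q₀)
    (hstep : ∀ Q ∈ P, I Q → Q.l + Q.s ∈ U → ∃ Q' ∈ P, I Q' ∧
      (Q'.l = Q.l + Q.s ∨ Q'.l = Q.l + Q.s + 1) ∧ Q.d < Q'.d + Q'.s ∧ Q'.d < Q.d + Q.s)
    (hstep' : ∀ Q ∈ P, J Q → Q.l - 1 ∈ U → ∃ Q' ∈ P, J Q' ∧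
      (Q'.l + Q'.s = Q.l ∨ Q'.l + Q'.s = Q.l - 1) ∧ Q.d < Q'.d + Q'.s ∧ Q'.d < Q.d + Q.s) :
    ∃ C, Chain U P C ∧ ∀ Q ∈ C, I Q ∨ J Q := by
  obtain ⟨C, hCP, h0, hC1, hC2, hC3, hC4⟩ := exists_halfChain hP hA hU hQ₀ hI hstep
  have hU' : OrdConnected {c | -1 - c ∈ U} :=
    ⟨fun x hx y hy z hz => hU.out hy hx ⟨by have := hz.2; omega, by have := hz.1; omega⟩⟩
  obtain ⟨D, hDP, h0', hD1, hD2, hD3, hD4⟩ := exists_halfChain hP.hflip hA hU'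
    (I := fun Q => J Q.hflip) (Q₀ := Q₀.hflip) (by simpa using hQ₀) (by simpa using hJ) (by
      rintro Q hQ hJQ hl
      obtain ⟨Q', hQ', hJ', h1, h2⟩ := hstep' Q.hflip hQ hJQ (by
        have : -1 - (Q.l + Q.s) ∈ U := hl
        simp only [Blk.hflip]
        convert this using 1
        ring)
      refine ⟨Q'.hflip, by simpa using hQ', by simpa using hJ', ?_, h2⟩
      simp only [Blk.hflip] at h1 ⊢
      omega)
  have hs0 := hA _ (hP.size _ hQ₀)
  have hCs : ∀ Q ∈ C, 2 ≤ Q.s := fun Q hQ => hA _ (hP.size _ (hCP hQ))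
  have hDs : ∀ Q ∈ D, 2 ≤ Q.s := fun Q hQ => hA _ (hP.hflip.size _ (hDP hQ))
  have hDe : ∀ Q ∈ D, Q = Q₀.hflip ∨ -Q₀.l ≤ Q.l := by
    intro Q hQ
    rcases (hD1 Q hQ).2 with h | h
    · exact Or.inl h
    · simp only [Blk.hflip] at h
      exact Or.inr (by omega)
  have hcol : ∀ {Q : Blk} {c : ℤ}, Q.hflip.Col c ↔ Q.Col (-1 - c) := by
    intro Q c
    simp only [Blk.hflip, Blk.Col]
    omega
  have hcross : ∀ Q ∈ C, ∀ Q' ∈ D, ∀ c, Q.Col c → Q'.hflip.Col c → Q = Q'.hflip := by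
    intro Q hQ Q' hQ' c h1 h2
    have := hDs Q' hQ'
    have := hCs Q hQ
    rw [hcol] at h2
    unfold Blk.Col at h1 h2
    rcases hDe Q' hQ' with h | h
    · subst h
      rw [Blk.hflip_hflip]
      simp only [Blk.hflip] at h2
      refine hC3 Q hQ Q₀ h0 c ?_ ?_ <;> unfold Blk.Col <;> omega
    · rcases (hC1 Q hQ).2 with h' | h'
      · subst h'
        omega
      · omega
  refine ⟨C ∪ {Q | Q.hflip ∈ D}, ⟨?_, ?_, ?_, ?_⟩, ?_⟩
  · rintro Q (hQ | hQ)
    · exact hCP hQ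
    · have : Q.hflip.hflip ∈ P := hDP hQ
      simpa using this
  · intro c hc
    by_cases hle : Q₀.l ≤ c
    · rcases hC2 c hc hle with ⟨Q, hQ, h⟩ | ⟨⟨Q, hQ, h⟩, Q', hQ', h'⟩
      · exact Or.inl ⟨Q, Or.inl hQ, h⟩
      · exact Or.inr ⟨⟨Q, Or.inl hQ, h⟩, Q', Or.inl hQ', h'⟩
    · rcases hD2 (-1 - c) (by change -1 - (-1 - c) ∈ U; rwa [sub_sub_cancel])
        (by simp only [Blk.hflip]; omega) with ⟨Q, hQ, h⟩ | ⟨⟨Q, hQ, h⟩, Q', hQ', h'⟩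
      · exact Or.inl ⟨Q.hflip, Or.inr (by simpa using hQ), hcol.2 h⟩
      · refine Or.inr ⟨⟨Q'.hflip, Or.inr (by simpa using hQ'), ?_⟩, Q.hflip,
          Or.inr (by simpa using hQ), ?_⟩ <;> simp only [Blk.hflip] <;> omega
  · rintro Q (hQ | hQ) Q' (hQ' | hQ') c h1 h2
    · exact hC3 Q hQ Q' hQ' c h1 h2
    · have := hcross Q hQ Q'.hflip hQ' c h1 (by simpa using h2)
      simpa using this
    · have := hcross Q' hQ' Q.hflip hQ c h2 (by simpa using h1)
      simpa using this.symm
    · have := hD3 _ hQ _ hQ' (-1 - c) (by rw [hcol, sub_sub_cancel]; exact h1)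
        (by rw [hcol, sub_sub_cancel]; exact h2)
      simpa using congrArg Blk.hflip this
  · rintro Q (hQ | hQ) Q' (hQ' | hQ') h
    · exact hC4 Q hQ Q' hQ' h
    · exfalso
      have h1 := hCs Q hQ
      have h2 := hDs _ hQ'
      have h3 : Q₀.l ≤ Q.l := by
        rcases (hC1 Q hQ).2 with h' | h'
        · rw [h']
        · omega
      rcases hDe _ hQ' with h' | h'
      · have : Q' = Q₀ := by simpa using congrArg Blk.hflip h'
        subst this
        omega
      · simp only [Blk.hflip] at h' h2
        omega
    · have h1 := hDs _ hQ
      have h2 := hCs Q' hQ'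
      by_cases hQe : Q = Q₀
      · subst hQe
        exact hC4 Q h0 Q' hQ' h
      by_cases hQe' : Q' = Q₀
      · subst hQe'
        have := hD4 Q'.hflip h0' Q.hflip hQ (by simp only [Blk.hflip]; omega)
        simp only [Blk.hflip] at this
        omega
      exfalso
      rcases hDe _ hQ with h' | h'
      · exact hQe (by simpa using congrArg Blk.hflip h')
      · rcases (hC1 Q' hQ').2 with h3 | h3
        · exact hQe' h3
        · simp only [Blk.hflip] at h' h1
          omega
    · have := hD4 Q'.hflip hQ' Q.hflip hQ (by simp only [Blk.hflip]; omega)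
      simp only [Blk.hflip] at this
      omega
  · rintro Q (hQ | hQ)
    · exact Or.inl (hC1 Q hQ).1
    · have := (hD1 _ hQ).1
      right
      simpa using this

end Packing

/-! ### Stacks -/

theorem isStack_straight {t s : ℤ} (hs : 2 ≤ s) : IsStack univ t s {b | ∃ k : ℕ, b = t + k * s} where
  le := by
    rintro b ⟨k, rfl⟩
    nlinarith
  sub := fun _ _ _ _ _ => mem_univ _
  disj := by
    have key : ∀ k k' : ℕ, ∀ r, t + k * s ≤ r → r < t + k * s + s → t + k' * s ≤ r →
        r < t + k' * s + s → k ≤ k' := by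
      intro k k' r h1 h2 h3 h4
      by_contra hcon
      have : (k' : ℤ) + 1 ≤ k := by omega
      nlinarith
    rintro b ⟨k, rfl⟩ b' ⟨k', rfl⟩ r h1 h2 h3 h4
    rw [le_antisymm (key k k' r h1 h2 h3 h4) (key k' k r h3 h4 h1 h2)]
  cover := by
    intro r hr _
    refine ⟨t + ((r - t) / s).toNat * s, ⟨_, rfl⟩, Or.inl ?_⟩
    have h0 : 0 ≤ (r - t) / s := Int.ediv_nonneg (by omega) (by omega)
    rw [Int.toNat_of_nonneg h0]
    have h1 := Int.emod_add_mul_ediv (r - t) s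
    have h2 := Int.emod_nonneg (r - t) (by omega : s ≠ 0)
    have h3 := Int.emod_lt_of_pos (r - t) (by omega : 0 < s)
    constructor <;> nlinarith

/-- One more block at the bottom, preceded by a gap of `e` rows. -/
theorem IsStack.cons {V B : Set ℤ} {t s : ℤ} (hs : 2 ≤ s) {e : ℤ} (he : 0 ≤ e) (he' : e ≤ 1)
    (h : IsStack V (t + s + e) s B) (hV : ∀ r, t ≤ r → r < t + s + e → r ∈ V) :
    IsStack V t s (insert (t + e) B) where
  le := by
    rintro b (rfl | hb)
    · omega
    · have := h.le b hb
      omega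
  sub := by
    rintro b (rfl | hb) r h1 h2
    · exact hV r (by omega) (by omega)
    · exact h.sub b hb r h1 h2
  disj := by
    rintro b (rfl | hb) b' (rfl | hb') r h1 h2 h3 h4
    · rfl
    · have := h.le b' hb'
      omega
    · have := h.le b hb
      omega
    · exact h.disj b hb b' hb' r h1 h2 h3 h4
  cover := by
    intro r hr hrV
    by_cases hlt : r < t + s + e
    · refine ⟨t + e, mem_insert _ _, ?_⟩
      omega
    · obtain ⟨b, hb, hb'⟩ := h.cover r (by omega) hrV
      exact ⟨b, mem_insert_of_mem _ hb, hb'⟩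

/-- A height of at least `s * s` is `q * s + e` with `0 ≤ e < s` and `e ≤ q`, hence the sum of `q -
e` terms `s` and `e` terms `s + 1`. The latter are blocks with a gap of one row below. -/
theorem exists_isStack_aligned {V : Set ℤ} {t s H : ℤ} (hs : 2 ≤ s) (hH : t + s * s ≤ H)
    (hV : ∀ r, t ≤ r → (r ∈ V ↔ r < H)) : ∃ B, IsStack V t s B := by
  have base : IsStack V H s ∅ := by
    have hsq : 0 ≤ s * s := mul_self_nonneg s
    refine ⟨by simp, by simp, by simp, ?_⟩
    rintro r hr (h | h)
    · have := (hV r (by omega)).1 h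
      omega
    · have := (hV (r + 1) (by omega)).1 h
      omega
  have flush : ∀ k : ℕ, t ≤ H - k * s → ∃ B, IsStack V (H - k * s) s B := by
    intro k
    induction k with
    | zero => exact fun _ => ⟨∅, by simpa using base⟩
    | succ k ih =>
      intro hk
      push_cast at hk ⊢
      obtain ⟨B, hB⟩ := ih (by nlinarith)
      refine ⟨_, IsStack.cons hs le_rfl zero_le_one (B := B) (by convert hB using 1; ring) ?_⟩
      intro r h1 h2
      refine (hV r (by omega)).2 ?_
      nlinarith
  have gaps : ∀ k e : ℕ, t ≤ H - k * s - e * (s + 1) →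
      ∃ B, IsStack V (H - k * s - e * (s + 1)) s B := by
    intro k e
    induction e with
    | zero => simpa using flush k
    | succ e ih =>
      intro hk
      push_cast at hk ⊢
      obtain ⟨B, hB⟩ := ih (by nlinarith)
      refine ⟨_, IsStack.cons hs zero_le_one le_rfl (B := B) (by convert hB using 1; ring) ?_⟩
      intro r h1 h2
      refine (hV r (by omega)).2 ?_
      nlinarith
  obtain ⟨q, e, h0, h1, h2⟩ : ∃ q e : ℤ, 0 ≤ e ∧ e < s ∧ H - t = q * s + e := by
    refine ⟨(H - t) / s, (H - t) % s, Int.emod_nonneg _ (by omega), Int.emod_lt_of_pos _ (by omega), ?_⟩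
    have := Int.emod_add_mul_ediv (H - t) s
    linarith
  have hq : e ≤ q := by nlinarith
  have := gaps (q - e).toNat e.toNat
  rw [Int.toNat_of_nonneg (by omega), Int.toNat_of_nonneg h0] at this
  have e1 : H - (q - e) * s - e * (s + 1) = t := by linarith
  rw [e1] at this
  exact this le_rfl

end TCPE

namespace TCPE

open Set Filter Topology

/-! ### Cutting a packing of the plane down to a packing of a box -/

section Cut

variable {A U V : Set ℤ} {P C : Set Blk} {M : ℤ}

/-- Over a gap column of the chain the block, being at least two wide, also occupies an adjacent
column, which belongs to a chain block; hence the hypothesis on the columns from `c - 1` to `c + 1`.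
-/
theorem mem_keep_of_low (hP : RegionPacking A U V P) (hA : ∀ s ∈ A, 2 ≤ s) (hC : Chain U P C)
    {Q : Blk} (hQ : Q ∈ P) {c r : ℤ} (hm : Q.Mem c r)
    (hlow : ∀ Q' ∈ C, ∀ a, Q'.Col a → c - 1 ≤ a → a ≤ c + 1 → r < Q'.d + Q'.s) : Q ∈ keep P C := by
  have hs := hA _ (hP.size Q hQ)
  rcases hC.cover c (hP.sub Q hQ c r hm).1 with ⟨Q', hQ', h⟩ | ⟨⟨Q₁, hQ₁, e1⟩, Q₂, hQ₂, e2⟩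
  · exact ⟨hQ, Q', hQ', c, r, hm, h, hlow Q' hQ' c h (by omega) (by omega)⟩
  · have h1 := hA _ (hP.size Q₁ (hC.sub hQ₁))
    have h2 := hA _ (hP.size Q₂ (hC.sub hQ₂))
    have hc1 : Q₁.Col (c - 1) := by unfold Blk.Col; omega
    have hc2 : Q₂.Col (c + 1) := by unfold Blk.Col; omega
    have hmc := hm.1
    unfold Blk.Col at hmc
    by_cases hl : Q.l ≤ c - 1
    · exact ⟨hQ, Q₁, hQ₁, c - 1, r, ⟨by unfold Blk.Col; omega, hm.2⟩, hc1,
        hlow Q₁ hQ₁ _ hc1 (by omega) (by omega)⟩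
    · exact ⟨hQ, Q₂, hQ₂, c + 1, r, ⟨by unfold Blk.Col; omega, hm.2⟩, hc2,
        hlow Q₂ hQ₂ _ hc2 (by omega) (by omega)⟩

/-- A chain through a given block whose height changes by at most one for every two columns. -/
theorem exists_drift_chain (hP : RegionPacking A U V P) (hA : ∀ s ∈ A, 2 ≤ s)
    (hU : U.OrdConnected) {Q₀ : Blk} (hQ₀ : Q₀ ∈ P) {b : ℤ} (hb : Q₀.Row b) :
    ∃ C, Chain U P C ∧ ∀ Q ∈ C,
      (2 * (Q.d - b) ≤ Q.l - Q₀.l ∧ 2 * (b + 1 - (Q.d + Q.s)) ≤ Q.l - Q₀.l) ∨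
      (2 * (Q.d - b) ≤ Q₀.l - Q.l ∧ 2 * (b + 1 - (Q.d + Q.s)) ≤ Q₀.l - Q.l) := by
  unfold Blk.Row at hb
  -- The bottom rises above `b` and the top sinks below `b + 1` by at most half the horizontal
  -- distance: each step costs at most one row, and consecutive left ends differ by at least two.
  obtain ⟨C, hC, h⟩ := exists_chain hP hA hU (Q₀ := Q₀)
    (I := fun Q => Q₀.l ≤ Q.l ∧ 2 * (Q.d - b) ≤ Q.l - Q₀.l ∧
      2 * (b + 1 - (Q.d + Q.s)) ≤ Q.l - Q₀.l)
    (J := fun Q => Q.l ≤ Q₀.l ∧ 2 * (Q.d - b) ≤ Q₀.l - Q.l ∧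
      2 * (b + 1 - (Q.d + Q.s)) ≤ Q₀.l - Q.l) hQ₀ (by omega) (by omega)
    (by
      rintro Q hQ ⟨h1, h2, h3⟩ hl
      obtain ⟨Q', hQ', g1, g2, g3, g4⟩ := hP.exists_right hA b hQ hl
      have := hA _ (hP.size Q hQ)
      exact ⟨Q', hQ', by omega, g1, g2⟩)
    (by
      rintro Q hQ ⟨h1, h2, h3⟩ hl
      obtain ⟨Q', hQ', g1, g2, g3, g4⟩ := hP.exists_left hA b hQ hl
      have := hA _ (hP.size Q' hQ')
      exact ⟨Q', hQ', by omega, g1, g2⟩)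
  refine ⟨C, hC, fun Q hQ => ?_⟩
  rcases h Q hQ with ⟨-, h⟩ | ⟨-, h⟩
  · exact Or.inl h
  · exact Or.inr h

/-- The block meets the window `[-N, N)²`. -/
def Blk.Meets (N : ℤ) (Q : Blk) : Prop :=
  ∃ c r, Q.Mem c r ∧ -N ≤ c ∧ c < N ∧ -N ≤ r ∧ r < N

theorem Blk.Meets.swap {N : ℤ} {Q : Blk} (h : Q.Meets N) : Q.swap.Meets N := by
  obtain ⟨c, r, hm, h⟩ := h
  exact ⟨r, c, Blk.mem_swap.2 hm, by tauto⟩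

theorem Blk.Meets.vflip {N : ℤ} {Q : Blk} (h : Q.Meets N) : Q.vflip.Meets N := by
  obtain ⟨c, r, hm, h⟩ := h
  exact ⟨c, -1 - r, Blk.mem_vflip.2 (by rwa [sub_sub_cancel]), by omega⟩

theorem Blk.Meets.lt {N : ℤ} {Q : Blk} (h : Q.Meets N) : Q.d < N := by
  obtain ⟨c, r, ⟨-, hr⟩, h⟩ := h
  unfold Blk.Row at hr
  omega

/-- Far above, in a sector, the blocks of `P` form straight columns. -/
def StraightUp (κ : ℤ) (P : Set Blk) : Prop :=
  ∀ Q ∈ P, Q.l + κ ≤ 2 * Q.d → -Q.l + κ ≤ 2 * Q.d → ⟨Q.l, Q.d + Q.s, Q.s⟩ ∈ P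

/-- Far below, in a sector, the blocks of `P` form straight columns. -/
def StraightDown (κ : ℤ) (P : Set Blk) : Prop :=
  ∀ Q ∈ P, Q.l + κ ≤ -(2 * Q.d) → -Q.l + κ ≤ -(2 * Q.d) → ⟨Q.l, Q.d - Q.s, Q.s⟩ ∈ P

/-- Surgery along a drifting chain: its slope is at most one half, so it stays above the window and
below a sector of that slope, in which only straight stacks remain. -/
theorem exists_straightUp (hP : RegionPacking A univ univ P) (hA : ∀ s ∈ A, 2 ≤ s ∧ s ≤ M)
    (N : ℤ) (hN : 0 ≤ N) : ∃ P', RegionPacking A univ univ P' ∧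
      (∀ Q, Q.Meets N → (Q ∈ P' ↔ Q ∈ P)) ∧ (∃ κ, StraightUp κ P') ∧
      ∀ κ, StraightDown κ P → ∃ κ', StraightDown κ' P' := by
  have hA2 : ∀ s ∈ A, 2 ≤ s := fun s hs => (hA s hs).1
  -- High enough for the chain to remain above the window after drifting over its columns.
  obtain ⟨Y, hY⟩ : ∃ Y, Y = 2 * N + 2 * M + 4 := ⟨_, rfl⟩
  obtain ⟨a, b, h1, h2, h3, h4, Q₀, hQ₀, hm⟩ := hP.blk 0 Y 0 Y trivial trivial le_rfl (by omega)
    le_rfl (by omega)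
  obtain ⟨hmc, hmr⟩ := hm
  obtain ⟨C, hC, hd⟩ := exists_drift_chain hP hA2 ordConnected_univ hQ₀ hmr
  have hs0 := hA _ (hP.size Q₀ hQ₀)
  unfold Blk.Col at hmc
  have hsC : ∀ Q ∈ C, 2 ≤ Q.s ∧ Q.s ≤ M := fun Q hQ => hA _ (hP.size Q (hC.sub hQ))
  let st : Blk → Set ℤ := fun Q => {b | ∃ k : ℕ, b = Q.d + Q.s + k * Q.s}
  have hst : ∀ Q ∈ C, IsStack univ (Q.d + Q.s) Q.s (st Q) := fun Q hQ =>
    isStack_straight (hsC Q hQ).1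
  refine ⟨keep P C ∪ stacked C st, hP.surgery hA2 hC subset_rfl (fun _ _ _ _ _ => trivial)
    ordConnected_univ (fun _ _ _ _ => trivial) hst, ?_, ?_, ?_⟩
  · rintro Q ⟨c, r, hm, hw⟩
    have hlow : ∀ Q' ∈ C, ∀ a, Q'.Col a → c - 1 ≤ a → a ≤ c + 1 → r < Q'.d + Q'.s := by
      intro Q' hQ' a ha h5 h6
      have := hsC Q' hQ'
      unfold Blk.Col at ha
      rcases hd Q' hQ' with h | h <;> omega
    constructor
    · rintro (hQ | ⟨Q', hQ', e1, e2, hQ⟩)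
      · exact hQ.1
      · exfalso
        have h5 := (hst Q' hQ').le _ hQ
        have hr := hm.2
        have hc := hm.1
        unfold Blk.Row at hr
        unfold Blk.Col at hc
        have := hlow Q' hQ' c (by unfold Blk.Col; omega) (by omega) (by omega)
        omega
    · exact fun hQ => Or.inl (mem_keep_of_low hP hA2 hC hQ hm hlow)
  -- The boundary of the sector is as steep as the steepest chain, so a constant exceeding the
  -- offset of the chain keeps the kept blocks out of the sector.
  · refine ⟨2 * b + 8 * M + 10, ?_⟩
    rintro Q (hQ | ⟨Q', hQ', e1, e2, k, hk⟩) g1 g2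
    · exfalso
      have hs := hA _ (hP.size Q hQ.1)
      obtain ⟨-, Q', hQ', c, r, ⟨hc, -⟩, hc', -⟩ := id hQ
      have hs' := hsC Q' hQ'
      have hlt := keep_lt hP hA2 hC hQ hc hQ' hc'
      unfold Blk.Col at hc hc'
      rcases hd Q' hQ' with h | h <;> omega
    · refine Or.inr ⟨Q', hQ', e1, e2, k + 1, ?_⟩
      simp only [hk, e2]
      push_cast
      ring
  · intro κ hκ
    -- The second value excludes stacked blocks from the lower sector. A kept block moved down by
    -- its side is still below the chain, so straightness below survives.
    refine ⟨max κ (2 * M + 10), ?_⟩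
    rintro Q (hQ | ⟨Q', hQ', e1, e2, hk⟩) g1 g2
    · have hs := hA _ (hP.size Q hQ.1)
      have := hκ Q hQ.1 (by omega) (by omega)
      obtain ⟨-, Q', hQ', c, r, ⟨hc, hr⟩, hc', hlt⟩ := id hQ
      refine Or.inl ⟨this, Q', hQ', c, r - Q.s, ⟨hc, ?_⟩, hc', by omega⟩
      unfold Blk.Row at hr ⊢
      simp only
      omega
    · exfalso
      have := (hst Q' hQ').le _ hk
      have := hsC Q' hQ'
      rcases hd Q' hQ' with h | h <;> omega

theorem StraightUp.vflip {κ : ℤ} (hA : ∀ Q ∈ P, Q.s ≤ M) (h : StraightUp κ P) :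
    StraightDown (κ + 2 * M) {Q | Q.vflip ∈ P} := by
  intro Q hQ h1 h2
  have hs : Q.s ≤ M := hA Q.vflip hQ
  have := h _ hQ (by simp only [Blk.vflip]; omega) (by simp only [Blk.vflip]; omega)
  change Blk.vflip _ ∈ P
  convert this using 1
  simp only [Blk.vflip, Blk.mk.injEq, and_true, true_and]
  omega

theorem StraightDown.vflip {κ : ℤ} (hA : ∀ Q ∈ P, 0 ≤ Q.s) (h : StraightDown κ P) :
    StraightUp κ {Q | Q.vflip ∈ P} := by
  intro Q hQ h1 h2
  have hs : 0 ≤ Q.s := hA Q.vflip hQ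
  have := h _ hQ (by simp only [Blk.vflip]; omega) (by simp only [Blk.vflip]; omega)
  change Blk.vflip _ ∈ P
  convert this using 1
  simp only [Blk.vflip, Blk.mk.injEq, and_true, true_and]
  omega

/-- The construction is applied, then applied again to the reflected packing; the second application
preserves the straightness obtained by the first. -/
theorem exists_straight (hP : RegionPacking A univ univ P) (hA : ∀ s ∈ A, 2 ≤ s ∧ s ≤ M)
    (N : ℤ) (hN : 0 ≤ N) : ∃ P', RegionPacking A univ univ P' ∧
      (∀ Q, Q.Meets N → (Q ∈ P' ↔ Q ∈ P)) ∧ ∃ κ, 0 ≤ κ ∧ StraightUp κ P' ∧ StraightDown κ P' := by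
  obtain ⟨P₁, hP₁, hm₁, ⟨κ₁, hκ₁⟩, -⟩ := exists_straightUp hP hA N hN
  obtain ⟨P₂, hP₂, hm₂, ⟨κ₂, hκ₂⟩, hd⟩ := exists_straightUp (hP₁.vflip.congr rfl
    (by ext; simp) rfl) hA N hN
  obtain ⟨κ₃, hκ₃⟩ := hd _ (hκ₁.vflip fun Q hQ => (hA _ (hP₁.size Q hQ)).2)
  refine ⟨{Q | Q.vflip ∈ P₂}, hP₂.vflip.congr rfl (by ext; simp) rfl, ?_,
    max 0 (max (κ₂ + 2 * M) κ₃), by omega, ?_, ?_⟩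
  · intro Q hQ
    rw [← hm₁ Q hQ]
    have := hm₂ _ hQ.vflip
    simpa using this
  · have := hκ₃.vflip fun Q hQ => (by have := hA _ (hP₂.size Q hQ); omega)
    exact fun Q hQ h1 h2 => this Q hQ (by omega) (by omega)
  · have := hκ₂.vflip fun Q hQ => (hA _ (hP₂.size Q hQ)).2
    exact fun Q hQ h1 h2 => this Q hQ (by omega) (by omega)

/-- If the blocks form straight rows far to the right and to the left, then there are chains of
bounded height. -/
theorem exists_bounded_chain (hP : RegionPacking A univ univ P) (hA : ∀ s ∈ A, 2 ≤ s ∧ s ≤ M)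
    {κ : ℤ} (hκ : 0 ≤ κ) (hu : StraightUp κ {Q | Q.swap ∈ P})
    (hd : StraightDown κ {Q | Q.swap ∈ P}) (k : ℤ) (hk : 0 ≤ k) :
    ∃ C, Chain univ P C ∧ ∃ B, ∀ Q ∈ C, k ≤ Q.d ∧ Q.d ≤ B := by
  have hA2 : ∀ s ∈ A, 2 ≤ s := fun s hs => (hA s hs).1
  obtain ⟨Y, hY⟩ : ∃ Y, Y = 10 * (k + M + κ + 10) := ⟨_, rfl⟩
  obtain ⟨a, b, h1, h2, h3, h4, Q₀, hQ₀, hm⟩ := hP.blk 0 Y 0 Y trivial trivial le_rfl (by omega)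
    le_rfl (by omega)
  obtain ⟨hmc, hmr⟩ := hm
  have hs0 := hA _ (hP.size Q₀ hQ₀)
  unfold Blk.Col at hmc
  unfold Blk.Row at hmr
  -- After `K` columns a chain that drifts from height `b` with slope one half is inside the sector
  -- where blocks continue in straight rows; from there it is continued at constant height. `B`
  -- bounds the drift up to that point, and `K` is about two thirds of `b`, so the chain stays above
  -- `k`.
  obtain ⟨K, hK⟩ : ∃ K, K = (2 * b + 6 * M + 2 * κ + 10) / 3 + 1 := ⟨_, rfl⟩
  obtain ⟨B, hB⟩ : ∃ B, B = (K + 3 * M + 4) / 2 + 1 := ⟨_, rfl⟩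
  have hright : ∀ Q ∈ P, Q.d + κ ≤ 2 * Q.l → -Q.d + κ ≤ 2 * Q.l → ⟨Q.l + Q.s, Q.d, Q.s⟩ ∈ P :=
    fun Q hQ => hu Q.swap hQ
  have hleft : ∀ Q ∈ P, Q.d + κ ≤ -(2 * Q.l) → -Q.d + κ ≤ -(2 * Q.l) →
      ⟨Q.l - Q.s, Q.d, Q.s⟩ ∈ P := fun Q hQ => hd Q.swap hQ
  obtain ⟨C, hC, h⟩ := exists_chain hP hA2 ordConnected_univ (Q₀ := Q₀)
    (I := fun Q => Q₀.l ≤ Q.l ∧ 2 * (Q.d - b) ≤ Q.l - Q₀.l ∧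
      2 * (b + 1 - (Q.d + Q.s)) ≤ Q.l - Q₀.l ∧ b - B ≤ Q.d ∧ Q.d ≤ b + B)
    (J := fun Q => Q.l ≤ Q₀.l ∧ 2 * (Q.d - b) ≤ Q₀.l - Q.l ∧
      2 * (b + 1 - (Q.d + Q.s)) ≤ Q₀.l - Q.l ∧ b - B ≤ Q.d ∧ Q.d ≤ b + B)
    hQ₀ (by omega) (by omega)
    (by
      rintro Q hQ ⟨h1, h2, h3, h4, h5⟩ hl
      have hs := hA _ (hP.size Q hQ)
      by_cases hst : K ≤ Q.l - Q₀.l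
      · exact ⟨_, hright Q hQ (by omega) (by omega), by simp only; omega, Or.inl rfl,
          by simp only; omega⟩
      · obtain ⟨Q', hQ', g1, g2, g3, g4⟩ := hP.exists_right hA2 b hQ hl
        have := hA _ (hP.size Q' hQ')
        exact ⟨Q', hQ', by omega, g1, g2⟩)
    (by
      rintro Q hQ ⟨h1, h2, h3, h4, h5⟩ hl
      have hs := hA _ (hP.size Q hQ)
      by_cases hst : K ≤ Q₀.l - Q.l
      · exact ⟨_, hleft Q hQ (by omega) (by omega), by simp only; omega, Or.inl (by simp),
          by simp only; omega⟩
      · obtain ⟨Q', hQ', g1, g2, g3, g4⟩ := hP.exists_left hA2 b hQ hl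
        have := hA _ (hP.size Q' hQ')
        exact ⟨Q', hQ', by omega, g1, g2⟩)
  refine ⟨C, hC, b + B, fun Q hQ => ?_⟩
  rcases h Q hQ with h | h <;> omega

/-- Across finitely many columns a drifting chain changes its height by no more than their number,
so it only has to start high enough. -/
theorem exists_bounded_chain_of_Ico {a b : ℤ} (hP : RegionPacking A (Ico a b) V P)
    (hA : ∀ s ∈ A, 2 ≤ s ∧ s ≤ M) (hne : V.Nonempty)
    (hV : ∀ r ∈ V, ∀ r', r ≤ r' → r' ∈ V) (k : ℤ) :
    ∃ C, Chain (Ico a b) P C ∧ ∃ B, ∀ Q ∈ C, k ≤ Q.d ∧ Q.d ≤ B := by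
  rcases le_or_gt b a with hab | hab
  · refine ⟨∅, ⟨empty_subset _, ?_, by simp, by simp⟩, 0, by simp⟩
    intro c hc
    have := hc.1
    have := hc.2
    omega
  have hA2 : ∀ s ∈ A, 2 ≤ s := fun s hs => (hA s hs).1
  obtain ⟨v, hv⟩ := hne
  obtain ⟨Y, hY⟩ : ∃ Y, Y = max v (k + (b - a) + 3 * M) := ⟨_, rfl⟩
  obtain ⟨c, r, h1, h2, h3, h4, Q₀, hQ₀, hm⟩ := hP.blk a Y a Y ⟨le_rfl, hab⟩
    (hV v hv Y (by omega)) le_rfl (by omega) le_rfl (by omega)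
  obtain ⟨C, hC, hd⟩ := exists_drift_chain hP hA2 ordConnected_Ico hQ₀ hm.2
  have hl : ∀ Q ∈ P, a ≤ Q.l ∧ Q.l < b := by
    intro Q hQ
    have hs := hA _ (hP.size Q hQ)
    exact (hP.sub Q hQ Q.l Q.d ⟨⟨le_rfl, by omega⟩, le_rfl, by omega⟩).1
  refine ⟨C, hC, r + (b - a), fun Q hQ => ?_⟩
  have := hl Q (hC.sub hQ)
  have := hl Q₀ hQ₀
  have := hA _ (hP.size Q (hC.sub hQ))
  rcases hd Q hQ with h | h <;> omega

/-- Above a chain of bounded height a packing can be cut off at any sufficiently large height. -/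
theorem eventually_cut (hP : RegionPacking A U V P) (hA : ∀ s ∈ A, 2 ≤ s ∧ s ≤ M)
    (hV : ∀ r ∈ V, ∀ r', r ≤ r' → r' ∈ V) (hC : Chain U P C) {k B : ℤ}
    (hB : ∀ Q ∈ C, k ≤ Q.d ∧ Q.d ≤ B) :
    ∀ᶠ H in atTop, ∃ P', RegionPacking A U {r | r ∈ V ∧ r < H} P' ∧
      ∀ Q, Q.d < k → (Q ∈ P' ↔ Q ∈ P) := by
  have hA2 : ∀ s ∈ A, 2 ≤ s := fun s hs => (hA s hs).1
  -- The stacks begin at height at most `B + M`, and a stack of blocks of side at most `M` can be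
  -- made flush once `M * M` rows are available.
  filter_upwards [eventually_ge_atTop (B + M + M * M)] with H hH
  have hsC : ∀ Q ∈ C, 2 ≤ Q.s ∧ Q.s ≤ M := fun Q hQ => hA _ (hP.size Q (hC.sub hQ))
  have hdV : ∀ Q ∈ C, ∀ r, Q.d ≤ r → r ∈ V := by
    intro Q hQ r hr
    have := hsC Q hQ
    exact hV Q.d (hP.sub Q (hC.sub hQ) Q.l Q.d ⟨⟨le_rfl, by omega⟩, le_rfl, by omega⟩).2 r hr
  have hex : ∀ Q : Blk, ∃ B, Q ∈ C → IsStack {r | r ∈ V ∧ r < H} (Q.d + Q.s) Q.s B := by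
    intro Q
    by_cases hQ : Q ∈ C
    · have h1 := hsC Q hQ
      have h2 := hB Q hQ
      have h3 : Q.s * Q.s ≤ M * M := by nlinarith
      obtain ⟨S, hS⟩ := exists_isStack_aligned (V := {r | r ∈ V ∧ r < H}) (t := Q.d + Q.s)
        (s := Q.s) (H := H) h1.1 (by omega)
        (fun r hr => ⟨fun h => h.2, fun h => ⟨hdV Q hQ r (by omega), h⟩⟩)
      exact ⟨S, fun _ => hS⟩
    · exact ⟨∅, fun h => absurd h hQ⟩
  choose st hst using hex
  refine ⟨keep P C ∪ stacked C st, hP.surgery hA2 hC (fun r hr => hr.1)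
    (fun r hr r' hr' hle => ⟨hr, lt_of_le_of_lt hle hr'.2⟩)
    ⟨fun x hx y hy z hz => ⟨hV x hx.1 z hz.1, lt_of_le_of_lt hz.2 hy.2⟩⟩ ?_ hst, ?_⟩
  · intro Q hQ r hr
    unfold Blk.Row at hr
    have h1 := hsC Q hQ
    have h2 := hB Q hQ
    have h3 : 0 ≤ M * M := mul_self_nonneg M
    exact ⟨hdV Q hQ r hr.1, by omega⟩
  · intro Q hQ
    constructor
    · rintro (h | ⟨Q', hQ', e1, e2, h⟩)
      · exact h.1
      · have := (hst Q' hQ').le _ h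
        have := hB Q' hQ'
        have := hsC Q' hQ'
        omega
    · intro h
      have hs := hA _ (hP.size Q h)
      refine Or.inl (mem_keep_of_low hP hA2 hC h (c := Q.l) (r := Q.d)
        ⟨⟨le_rfl, by omega⟩, le_rfl, by omega⟩ fun Q' hQ' a _ _ _ => ?_)
      have := hB Q' hQ'
      have := hsC Q' hQ'
      omega

/-- A packing of the plane can be changed outside a window into a packing of any sufficiently large
box. -/
theorem exists_box (hP : RegionPacking A univ univ P) (hA : ∀ s ∈ A, 2 ≤ s ∧ s ≤ M)
    (N : ℤ) (hN : 0 ≤ N) :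
    ∀ᶠ H in atTop, ∀ᶠ D in atTop, ∀ᶠ R in atTop, ∀ᶠ L in atTop, ∃ P',
      RegionPacking A (Ico (-L) R) (Ico (-D) H) P' ∧ ∀ Q, Q.Meets N → (Q ∈ P' ↔ Q ∈ P) := by
  -- Straight columns of the transposed packing are straight rows of the original one to the far
  -- right and left; they keep horizontal chains at bounded height.
  obtain ⟨P₁, hP₁, hm₁, κ, hκ, hu, hd⟩ := exists_straight hP.swap hA N hN
  have hm₁' : ∀ Q, Q.Meets N → (Q.swap ∈ P₁ ↔ Q ∈ P) := fun Q hQ => hm₁ _ hQ.swap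
  obtain ⟨C, hC, B, hB⟩ := exists_bounded_chain hP₁.swap hA hκ hu hd N hN
  have hs : ∀ Q ∈ P₁, 2 ≤ Q.s ∧ Q.s ≤ M := fun Q hQ => hA _ (hP₁.size Q hQ)
  obtain ⟨C', hC', B', hB'⟩ := exists_bounded_chain (κ := κ + 2 * M)
    (hP₁.swap.vflip.congr rfl (by ext; simp) rfl) hA
    (by
      by_contra hcon
      have hne : P₁.Nonempty := by
        obtain ⟨_, _, _, _, _, _, Q, hQ, _⟩ := hP₁.blk 0 0 0 0 trivial trivial le_rfl (by simp)
          le_rfl (by simp)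
        exact ⟨Q, hQ⟩
      obtain ⟨Q, hQ⟩ := hne
      have := hs Q hQ
      omega)
    (by
      intro Q hQ h1 h2
      have h3 : Q.swap.vflip.swap ∈ P₁ := hQ
      have h4 := hs _ h3
      simp only [Blk.swap, Blk.vflip] at h3 h4
      have := hu _ h3 (by simp only; omega) (by simp only; omega)
      change Blk.swap (Blk.vflip (Blk.swap _)) ∈ P₁
      simpa only [Blk.swap, Blk.vflip] using this)
    (by
      intro Q hQ h1 h2
      have h3 : Q.swap.vflip.swap ∈ P₁ := hQ
      have h4 := hs _ h3
      simp only [Blk.swap, Blk.vflip] at h3 h4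
      have := hd _ h3 (by simp only; omega) (by simp only; omega)
      change Blk.swap (Blk.vflip (Blk.swap _)) ∈ P₁
      simpa only [Blk.swap, Blk.vflip] using this) N hN
  have hP₂ : RegionPacking A univ univ {Q | Q.swap ∈ P₁} := hP₁.swap
  filter_upwards [eventually_cut hP₂ hA (fun _ _ _ _ => trivial) hC hB, eventually_ge_atTop 0]
    with H ⟨P₃, hP₃, hm₃⟩ hH
  -- The lower chain lies below the window, where cutting at the top has changed nothing.
  have hC₃ : Chain univ {Q | Q.vflip ∈ P₃} C' := by
    refine ⟨fun Q hQ => ?_, hC'.cover, hC'.col, hC'.overlap⟩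
    have h1 := hC'.sub hQ
    have h2 := hB' Q hQ
    have h3 := hs _ h1
    refine (hm₃ _ ?_).2 h1
    simp only [Blk.vflip, Blk.swap] at h3 ⊢
    omega
  filter_upwards [eventually_cut hP₃.vflip hA (fun r hr r' hrr => ⟨trivial, by
    have := hr.2; omega⟩) hC₃ hB', eventually_ge_atTop 1] with D ⟨P₄, hP₄, hm₄⟩ hD
  -- With top and bottom cut off, the transposed region has finitely many columns, so the chains for
  -- the two remaining cuts are bounded without further straightening.
  have hP₅ : RegionPacking A (Ico (-D) H) univ {Q | Q.swap.vflip ∈ P₄} :=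
    hP₄.vflip.swap.congr (by
      ext r
      simp only [mem_ofPred_eq, mem_Ico, mem_univ, true_and]
      omega) rfl rfl
  have hm₅ : ∀ Q : Blk, Q.Meets N → (Q.swap.vflip ∈ P₄ ↔ Q.swap ∈ P) := by
    intro Q hQ
    rw [hm₄ _ hQ.swap.vflip.lt, ← hm₁' _ hQ.swap]
    rw [Blk.vflip_vflip, hm₃ _ hQ.swap.lt]
  obtain ⟨C₅, hC₅, B₅, hB₅⟩ := exists_bounded_chain_of_Ico hP₅ hA ⟨0, trivial⟩
    (fun _ _ _ _ => trivial) N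
  filter_upwards [eventually_cut hP₅ hA (fun _ _ _ _ => trivial) hC₅ hB₅] with R ⟨P₆, hP₆, hm₆⟩
  obtain ⟨C₆, hC₆, B₆, hB₆⟩ := exists_bounded_chain_of_Ico hP₆.vflip hA
    ⟨-R, trivial, (by omega : -1 - -R < R)⟩
    (fun r hr r' hrr => ⟨trivial, by have := hr.2; omega⟩) N
  filter_upwards [eventually_cut hP₆.vflip hA (fun r hr r' hrr => ⟨trivial, by
    have := hr.2; omega⟩) hC₆ hB₆] with L ⟨P₇, hP₇, hm₇⟩
  refine ⟨{Q | Q.swap.vflip ∈ P₇}, hP₇.vflip.swap.congr ?_ rfl rfl, ?_⟩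
  · ext r
    simp only [mem_ofPred_eq, mem_Ico, mem_univ, true_and]
    omega
  · intro Q hQ
    change Q.swap.vflip ∈ P₇ ↔ _
    rw [hm₇ _ hQ.swap.vflip.lt]
    rw [Blk.vflip_vflip, hm₆ _ hQ.swap.lt]
    exact hm₅ _ hQ.swap

/-- The union of packings of the translates of a box with sides `W` and `H`. -/
def arrayPacking (W H : ℤ) (p : ℤ × ℤ → Set Blk) : Set Blk :=
  {Q | ∃ q : ℤ × ℤ, ⟨Q.l - W * q.1, Q.d - H * q.2, Q.s⟩ ∈ p q}

/-- In a packing of a region, a 2 × 2 block that merely touches the region already contains a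
covered cell of it, and an uncovered cell has an uncovered neighbour within the region. So packings
of adjacent boxes fit together without compatibility conditions. -/
theorem RegionPacking.array {a W b H : ℤ} (hW : 0 < W) (hH : 0 < H) {p : ℤ × ℤ → Set Blk}
    (hp : ∀ q, RegionPacking A (Ico a (a + W)) (Ico b (b + H)) (p q)) :
    RegionPacking A univ univ (arrayPacking W H p) := by
  have idx : ∀ (a W : ℤ), 0 < W → ∀ c, ∃ q, c - W * q ∈ Ico a (a + W) := by
    intro a W hW c
    refine ⟨(c - a) / W, ?_⟩
    have h1 := Int.emod_add_mul_ediv (c - a) W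
    have h2 := Int.emod_nonneg (c - a) hW.ne'
    have h3 := Int.emod_lt_of_pos (c - a) hW
    constructor <;> linarith
  have uniq : ∀ (a W : ℤ), 0 < W → ∀ c q q', c - W * q ∈ Ico a (a + W) →
      c - W * q' ∈ Ico a (a + W) → q = q' := by
    have key : ∀ (a W : ℤ), 0 < W → ∀ c q q', c - W * q ∈ Ico a (a + W) →
        c - W * q' ∈ Ico a (a + W) → q ≤ q' := by
      intro a W hW c q q' h1 h2
      by_contra hcon
      have := h1.1
      have := h2.2
      have : q' + 1 ≤ q := by omega
      nlinarith
    exact fun a W hW c q q' h1 h2 => le_antisymm (key a W hW c q q' h1 h2) (key a W hW c q' q h2 h1)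
  have hcov : ∀ q : ℤ × ℤ, ∀ c r, Covered (p q) c r →
      Covered (arrayPacking W H p) (c + W * q.1) (r + H * q.2) := by
    rintro q c r ⟨Q, hQ, hm⟩
    refine ⟨⟨Q.l + W * q.1, Q.d + H * q.2, Q.s⟩, ⟨q, ?_⟩, ?_⟩
    · simpa using hQ
    · simp only [Blk.Mem, Blk.Col, Blk.Row] at hm ⊢
      omega
  have hmem : ∀ Q : Blk, ∀ q : ℤ × ℤ, ∀ c r, Q.Mem c r ↔
      (⟨Q.l - W * q.1, Q.d - H * q.2, Q.s⟩ : Blk).Mem (c - W * q.1) (r - H * q.2) := by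
    intro Q q c r
    simp only [Blk.Mem, Blk.Col, Blk.Row]
    omega
  refine ⟨fun Q ⟨q, hQ⟩ => (hp q).size ⟨Q.l - W * q.1, Q.d - H * q.2, Q.s⟩ hQ, fun _ _ _ _ _ => ⟨trivial, trivial⟩, ?_, ?_, ?_⟩
  · rintro Q ⟨q, hQ⟩ Q' ⟨q', hQ'⟩ c r hm hm'
    have h1 := (hp q).sub _ hQ _ _ ((hmem Q q c r).1 hm)
    have h2 := (hp q').sub _ hQ' _ _ ((hmem Q' q' c r).1 hm')
    have e : q = q' := Prod.ext (uniq _ _ hW _ _ _ h1.1 h2.1) (uniq _ _ hH _ _ _ h1.2 h2.2)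
    subst e
    have := (hp q).disj _ hQ _ hQ' _ _ ((hmem Q q c r).1 hm) ((hmem Q' q c r).1 hm')
    simp only [Blk.mk.injEq] at this
    ext <;> omega
  · intro c r c' r' _ _ h1 h2 h3 h4
    obtain ⟨i, hi⟩ := idx a W hW c'
    obtain ⟨j, hj⟩ := idx b H hH r'
    obtain ⟨u, v, g1, g2, g3, g4, g⟩ := (hp (i, j)).blk (c - W * i) (r - H * j) _ _ hi hj
      (by omega) (by omega) (by omega) (by omega)
    exact ⟨u + W * i, v + H * j, by omega, by omega, by omega, by omega, hcov (i, j) u v g⟩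
  · intro c _ r _ hn
    obtain ⟨i, hi⟩ := idx a W hW c
    obtain ⟨j, hj⟩ := idx b H hH r
    obtain ⟨c', hc', r', hr', h1, h2, h3, h4, h5, h6⟩ := (hp (i, j)).iso _ hi _ hj (fun h => hn (by
      have := hcov (i, j) _ _ h
      simpa using this))
    refine ⟨c' + W * i, trivial, r' + H * j, trivial, ?_, by omega, by omega, by omega, by omega,
      by omega⟩
    rintro ⟨Q, ⟨q, hQ⟩, hm⟩
    have h7 := (hp q).sub _ hQ _ _ ((hmem Q q _ _).1 hm)
    have e1 : q.1 = i := uniq a W hW _ _ _ h7.1 (by simpa using hc')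
    have e2 : q.2 = j := uniq b H hH _ _ _ h7.2 (by simpa using hr')
    obtain rfl : q = (i, j) := Prod.ext e1 e2
    refine h1 ⟨_, hQ, ?_⟩
    have := (hmem Q (i, j) _ _).1 hm
    simpa using this

end Cut

end TCPE

namespace TCPE

open Set Filter Topology

/-! ### Parsings and packings -/

theorem encard_Ico_add (l : ℤ) (n : ℕ) : (Ico l (l + n + 2)).encard = (n : ℕ∞) + 2 := by
  rw [← Finset.coe_Ico, Set.encard_coe_eq_coe_finsetCard, Int.card_Ico]
  have : (l + n + 2 - l).toNat = n + 2 := by omega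
  rw [this]
  push_cast
  rfl

/-- The position of a finite square with lower left corner `(l, d)`. -/
def sq (l d : ℤ) (n : ℕ) : Square where
  cols := Ico l (l + n + 2)
  rows := Ico d (d + n + 2)
  size := n
  cols_ordConnected := ordConnected_Ico
  rows_ordConnected := ordConnected_Ico
  cols_encard := encard_Ico_add l n
  rows_encard := encard_Ico_add d n

theorem Square.ext {Q Q' : Square} (h1 : Q.cols = Q'.cols) (h2 : Q.rows = Q'.rows)
    (h3 : Q.size = Q'.size) : Q = Q' := by
  cases Q
  cases Q'
  subst h1 h2 h3
  rfl

theorem exists_eq_Ico {I : Set ℤ} (h : I.OrdConnected) {n : ℕ} (hn : I.encard = (n : ℕ∞) + 2) :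
    ∃ l : ℤ, I = Ico l (l + n + 2) := by
  have hfin : I.Finite := by
    rw [← Set.encard_ne_top_iff, hn]
    exact ENat.natCast_ne_top (n + 2)
  have hne : I.Nonempty := by
    rw [← Set.encard_ne_zero, hn]
    exact Nat.cast_ne_zero.2 (by omega : n + 2 ≠ 0)
  obtain ⟨l, hl, hlmin⟩ := Set.exists_min_image I id hfin hne
  obtain ⟨u, hu, humax⟩ := Set.exists_max_image I id hfin hne
  have e : I = Icc l u := by
    ext c
    exact ⟨fun hc => ⟨hlmin c hc, humax c hc⟩, fun hc => h.out hl hu hc⟩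
  have hcard : (Icc l u).encard = ((u + 1 - l).toNat : ℕ∞) := by
    rw [← Finset.coe_Icc, Set.encard_coe_eq_coe_finsetCard, Int.card_Icc]
  rw [← e, hn] at hcard
  have hcard' : n + 2 = (u + 1 - l).toNat := by exact_mod_cast hcard
  refine ⟨l, ?_⟩
  rw [e]
  ext c
  simp only [mem_Icc, mem_Ico]
  omega

theorem exists_eq_sq {Q : Square} {n : ℕ} (hn : Q.size = n) : ∃ l d, Q = sq l d n := by
  obtain ⟨l, hl⟩ := exists_eq_Ico Q.cols_ordConnected (hn ▸ Q.cols_encard)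
  obtain ⟨d, hd⟩ := exists_eq_Ico Q.rows_ordConnected (hn ▸ Q.rows_encard)
  exact ⟨l, d, Square.ext hl hd hn⟩

/-- The cell `(c, r)` is inside the block, off its border. -/
def Blk.Inner (Q : Blk) (c r : ℤ) : Prop :=
  Q.l < c ∧ c < Q.l + Q.s - 1 ∧ Q.d < r ∧ r < Q.d + Q.s - 1

/-- The square of a block has `0` on its border and `1` inside in `x`. -/
def Blk.Occ (Q : Blk) (x : Config) : Prop :=
  (∀ c r, Q.Mem c r → ¬ Q.Inner c r → x (c, r) = false) ∧ ∀ c r, Q.Inner c r → x (c, r) = true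

theorem mem_interior_sq {l d : ℤ} {n : ℕ} {p : ℤ × ℤ} :
    p ∈ (sq l d n).interior ↔ (⟨l, d, n + 2⟩ : Blk).Inner p.1 p.2 := by
  simp only [Square.interior, sq, Blk.Inner, mem_ofPred_eq, mem_Ico]
  omega

theorem mem_border_sq {l d : ℤ} {n : ℕ} {p : ℤ × ℤ} :
    p ∈ (sq l d n).border ↔ (⟨l, d, n + 2⟩ : Blk).Mem p.1 p.2 ∧
      ¬ (⟨l, d, n + 2⟩ : Blk).Inner p.1 p.2 := by
  rw [Square.border, Set.mem_sdiff, mem_interior_sq]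
  simp only [sq, Blk.Mem, Blk.Col, Blk.Row, mem_prod, mem_Ico, add_assoc]

theorem occurs_sq_iff {l d : ℤ} {n : ℕ} {x : Config} :
    (sq l d n).Occurs x ↔ (⟨l, d, n + 2⟩ : Blk).Occ x := by
  simp only [Square.Occurs, Blk.Occ, mem_interior_sq, mem_border_sq, Prod.forall, and_imp]

/-- If the edges differed, an edge of one square would pass through the interior of the other,
giving a cell that is both `0` and `1`. -/
theorem Blk.Occ.eq {x : Config} {Q Q' : Blk} (hQ : Q.Occ x) (hQ' : Q'.Occ x) {c r : ℤ}
    (h : Q.Inner c r) (h' : Q'.Inner c r) : Q = Q' := by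
  have key : ∀ Q Q' : Blk, Q.Occ x → Q'.Occ x → Q.Inner c r → Q'.Inner c r →
      Q.l ≤ Q'.l ∧ Q.d ≤ Q'.d ∧ Q'.l + Q'.s ≤ Q.l + Q.s := by
    intro Q Q' hQ hQ' h h'
    unfold Blk.Inner at h h'
    refine ⟨?_, ?_, ?_⟩
    · by_contra hcon
      have h1 := hQ.1 Q.l r (by simp only [Blk.Mem, Blk.Col, Blk.Row]; omega)
        (by unfold Blk.Inner; omega)
      have h2 := hQ'.2 Q.l r (by unfold Blk.Inner; omega)
      simp [h1] at h2
    · by_contra hcon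
      have h1 := hQ.1 c Q.d (by simp only [Blk.Mem, Blk.Col, Blk.Row]; omega)
        (by unfold Blk.Inner; omega)
      have h2 := hQ'.2 c Q.d (by unfold Blk.Inner; omega)
      simp [h1] at h2
    · by_contra hcon
      have h1 := hQ.1 (Q.l + Q.s - 1) r (by simp only [Blk.Mem, Blk.Col, Blk.Row]; omega)
        (by unfold Blk.Inner; omega)
      have h2 := hQ'.2 (Q.l + Q.s - 1) r (by unfold Blk.Inner; omega)
      simp [h1] at h2
  have h1 := key Q Q' hQ hQ' h h'
  have h2 := key Q' Q hQ' hQ h' h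
  ext <;> omega

open Classical in
/-- The configuration of a packing: `0` on the borders of the blocks, and `1` elsewhere. -/
noncomputable def packConfig (P : Set Blk) : Config :=
  fun p => !decide (∃ Q ∈ P, Q.Mem p.1 p.2 ∧ ¬ Q.Inner p.1 p.2)

theorem packConfig_eq_false_iff {P : Set Blk} {p : ℤ × ℤ} :
    packConfig P p = false ↔ ∃ Q ∈ P, Q.Mem p.1 p.2 ∧ ¬ Q.Inner p.1 p.2 := by
  simp [packConfig]

theorem packConfig_eq_true_iff {P : Set Blk} {p : ℤ × ℤ} :
    packConfig P p = true ↔ ∀ Q ∈ P, Q.Mem p.1 p.2 → Q.Inner p.1 p.2 := by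
  simp [packConfig]

theorem Blk.Inner.mem {Q : Blk} {c r : ℤ} (h : Q.Inner c r) : Q.Mem c r := by
  simp only [Blk.Mem, Blk.Col, Blk.Row, Blk.Inner] at *
  omega

/-- The squares of the blocks of a packing. -/
def squaresOf (P : Set Blk) : Set Square := {Q | ∃ l d, ∃ n : ℕ, ⟨l, d, n + 2⟩ ∈ P ∧ Q = sq l d n}

/-- The blocks of the finite squares of a parsing. -/
def blocksOf (S : Set Square) : Set Blk := {B | ∃ n : ℕ, B.s = n + 2 ∧ sq B.l B.d n ∈ S}

/-- A 2 × 2 block of `1`s contains a covered cell, which is inner, so the whole 2 × 2 block lies in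
that square of the packing. A visible square shares an inner cell with a square of the packing and
so equals it; isolated uncovered cells are forbidden because they could appear as extra 1-squares.
-/
theorem isParsing_packConfig {A : Set ℤ} {P : Set Blk} (hP : RegionPacking A univ univ P)
    {n : ℕ} (hA : ∀ s ∈ A, s = n + 2 ∨ s = n + 3) : IsParsing (packConfig P) (squaresOf P) := by
  have hA2 : ∀ Q ∈ P, 2 ≤ Q.s := by
    intro Q hQ
    have := hA _ (hP.size Q hQ)
    omega
  have hocc : ∀ Q ∈ P, Q.Occ (packConfig P) := by
    intro Q hQ
    refine ⟨fun c r hm hi => packConfig_eq_false_iff.2 ⟨Q, hQ, hm, hi⟩, fun c r hi => ?_⟩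
    refine packConfig_eq_true_iff.2 fun Q' hQ' hm => ?_
    rw [← hP.disj Q hQ Q' hQ' c r hi.mem hm]
    exact hi
  have hblk : ∀ c r, (∀ a b, c ≤ a → a ≤ c + 1 → r ≤ b → b ≤ r + 1 → packConfig P (a, b) = true) →
      ∃ Q ∈ P, ∀ a b, c ≤ a → a ≤ c + 1 → r ≤ b → b ≤ r + 1 → Q.Inner a b := by
    intro c r h
    obtain ⟨a, b, h1, h2, h3, h4, Q, hQ, hm⟩ := hP.blk c r c r trivial trivial le_rfl (by omega)
      le_rfl (by omega)
    refine ⟨Q, hQ, fun a' b' g1 g2 g3 g4 => ?_⟩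
    have hi := packConfig_eq_true_iff.1 (h a b h1 h2 h3 h4) Q hQ hm
    refine packConfig_eq_true_iff.1 (h a' b' g1 g2 g3 g4) Q hQ ?_
    simp only [Blk.Mem, Blk.Col, Blk.Row, Blk.Inner] at hi ⊢
    omega
  refine ⟨?_, ?_, ?_, ?_, ?_⟩
  · rintro _ ⟨l, d, m, hQ, rfl⟩
    exact occurs_sq_iff.2 (hocc _ hQ)
  · rintro ⟨c, r⟩ h
    obtain ⟨Q, hQ, hi⟩ := hblk c r (fun a b h1 h2 h3 h4 => h (a, b) ⟨⟨h1, h3⟩, ⟨h2, h4⟩⟩)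
    have hs := hA2 Q hQ
    obtain ⟨m, hm⟩ : ∃ m : ℕ, Q.s = m + 2 := ⟨(Q.s - 2).toNat, by omega⟩
    have e : (⟨Q.l, Q.d, m + 2⟩ : Blk) = Q := by ext <;> simp [hm]
    refine ⟨sq Q.l Q.d m, ⟨_, _, m, by rwa [e], rfl⟩, ?_⟩
    rintro ⟨a, b⟩ ⟨⟨h1, h3⟩, ⟨h2, h4⟩⟩
    rw [mem_interior_sq, e]
    exact hi a b h1 h2 h3 h4
  · rintro ⟨c, r⟩ h
    obtain ⟨Q, hQ, hm, hi⟩ := packConfig_eq_false_iff.1 h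
    have hs := hA2 Q hQ
    obtain ⟨m, hsm⟩ : ∃ m : ℕ, Q.s = m + 2 := ⟨(Q.s - 2).toNat, by omega⟩
    have e : (⟨Q.l, Q.d, m + 2⟩ : Blk) = Q := by ext <;> simp [hsm]
    refine ⟨sq Q.l Q.d m, ⟨⟨_, _, m, by rwa [e], rfl⟩, ?_⟩, ?_⟩
    · rw [mem_border_sq, e]
      exact ⟨hm, hi⟩
    · rintro _ ⟨⟨l, d, m', hQ', rfl⟩, hb⟩
      rw [mem_border_sq] at hb
      have := hP.disj _ hQ' Q hQ c r hb.1 hm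
      rw [← e] at this
      simp only [Blk.mk.injEq] at this
      obtain ⟨rfl, rfl, h3⟩ := this
      obtain rfl : m' = m := by omega
      rfl
  · intro Q h1 htop hQ
    obtain ⟨m, hm⟩ := ENat.ne_top_iff_exists.1 htop
    obtain ⟨l, d, rfl⟩ := exists_eq_sq hm.symm
    have hm1 : 1 ≤ m := by
      rw [← hm] at h1
      exact_mod_cast h1
    rw [occurs_sq_iff] at hQ
    suffices h : ∃ Q' ∈ P, ∃ c r, Q'.Inner c r ∧ (⟨l, d, m + 2⟩ : Blk).Inner c r by
      obtain ⟨Q', hQ', c, r, hi, hi'⟩ := h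
      have := (hocc Q' hQ').eq hQ hi hi'
      exact ⟨l, d, m, this ▸ hQ', rfl⟩
    -- A 1-square contains no 2 × 2 block of `1`s. If its centre were uncovered, an uncovered
    -- neighbour of it would be a `1` on the border.
    rcases (by omega : m = 1 ∨ 2 ≤ m) with rfl | h2
    · have ht : packConfig P (l + 1, d + 1) = true := hQ.2 _ _ (by simp only [Blk.Inner]; push_cast; omega)
      by_cases hc : Covered P (l + 1) (d + 1)
      · obtain ⟨Q', hQ', hmem⟩ := hc
        exact ⟨Q', hQ', l + 1, d + 1, packConfig_eq_true_iff.1 ht Q' hQ' hmem,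
          by simp only [Blk.Inner]; push_cast; omega⟩
      · exfalso
        obtain ⟨c', -, r', -, hn, hne, g1, g2, g3, g4⟩ := hP.iso _ trivial _ trivial hc
        have : packConfig P (c', r') = false := hQ.1 c' r'
          (by simp only [Blk.Mem, Blk.Col, Blk.Row]; push_cast; omega)
          (by simp only [Blk.Inner]; push_cast; omega)
        obtain ⟨Q', hQ', hmem, -⟩ := packConfig_eq_false_iff.1 this
        exact hn ⟨Q', hQ', hmem⟩
    · obtain ⟨Q', hQ', hi⟩ := hblk (l + 1) (d + 1) (fun a b g1 g2 g3 g4 =>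
        hQ.2 a b (by simp only [Blk.Inner]; omega))
      exact ⟨Q', hQ', l + 1, d + 1, hi _ _ le_rfl (by omega) le_rfl (by omega),
        by simp only [Blk.Inner]; omega⟩
  · rintro _ ⟨l, d, m, hQ, rfl⟩ _ ⟨l', d', m', hQ', rfl⟩
    have h1 := hA _ (hP.size _ hQ)
    have h2 := hA _ (hP.size _ hQ')
    simp only at h1 h2
    change (m : ℕ∞) ≤ (m' : ℕ∞) + 1
    exact_mod_cast (by omega : m ≤ m' + 1)

section Parsing

variable {x : Config} {S : Set Square}

theorem IsParsing.occ (hS : IsParsing x S) {Q : Blk} (hQ : Q ∈ blocksOf S) : Q.Occ x := by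
  obtain ⟨n, hn, hQ⟩ := hQ
  have := occurs_sq_iff.1 (hS.occurs _ hQ)
  rwa [← hn] at this

/-- A border cell of one block inside the other is a `0`, hence on the border of both, contrary to
uniqueness. The left edge lying further to the right supplies such a cell. -/
theorem IsParsing.disj (hS : IsParsing x S) {Q Q' : Blk} (hQ : Q ∈ blocksOf S)
    (hQ' : Q' ∈ blocksOf S) {c r : ℤ} (hm : Q.Mem c r) (hm' : Q'.Mem c r) : Q = Q' := by
  have hb : ∀ a b, Q.Mem a b → ¬ Q.Inner a b → Q'.Mem a b → Q = Q' := by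
    intro a b h1 h2 h3
    have hf := (hS.occ hQ).1 a b h1 h2
    have h4 : ¬ Q'.Inner a b := by
      intro h4
      have := (hS.occ hQ').2 a b h4
      simp [hf] at this
    obtain ⟨n, hn, hQS⟩ := hQ
    obtain ⟨n', hn', hQS'⟩ := hQ'
    have e := (hS.border (a, b) hf).unique ⟨hQS, by rw [mem_border_sq, ← hn]; exact ⟨h1, h2⟩⟩
      ⟨hQS', by rw [mem_border_sq, ← hn']; exact ⟨h3, h4⟩⟩
    have e1 : Ico Q.l (Q.l + n + 2) = Ico Q'.l (Q'.l + n' + 2) := congrArg Square.cols e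
    have e2 : Ico Q.d (Q.d + n + 2) = Ico Q'.d (Q'.d + n' + 2) := congrArg Square.rows e
    rw [Ico_eq_Ico_iff (Or.inl (by omega))] at e1 e2
    ext <;> omega
  have hb' : ∀ a b, Q'.Mem a b → ¬ Q'.Inner a b → Q.Mem a b → Q = Q' := by
    intro a b h1 h2 h3
    by_cases h4 : Q.Inner a b
    · have h5 := (hS.occ hQ).2 a b h4
      have h6 := (hS.occ hQ').1 a b h1 h2
      simp [h5] at h6
    · exact hb a b h3 h4 h1
  simp only [Blk.Mem, Blk.Col, Blk.Row, Blk.Inner] at *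
  rcases le_or_gt Q.l Q'.l with h | h
  · exact hb' Q'.l r (by omega) (by omega) (by omega)
  · exact hb Q.l r (by omega) (by omega) (by omega)

theorem mem_blocksOf {l d : ℤ} {n : ℕ} : (⟨l, d, n + 2⟩ : Blk) ∈ blocksOf S ↔ sq l d n ∈ S := by
  constructor
  · rintro ⟨m, hm, h⟩
    obtain rfl : n = m := by simpa using hm
    exact h
  · exact fun h => ⟨n, rfl, h⟩

/-- Uncovered cells carry `1`. An isolated one is surrounded by border cells, since an inner
neighbour would make it covered; so it is the centre of a visible 1-square, which the parsing must
contain. -/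
theorem IsParsing.regionPacking (hS : IsParsing x S) (hfin : ∀ Q ∈ S, Q.size ≠ ⊤) :
    RegionPacking {s | ∃ Q ∈ S, ∃ n : ℕ, Q.size = n ∧ s = n + 2} univ univ (blocksOf S) ∧
      x = packConfig (blocksOf S) := by
  have hsq : ∀ Q ∈ S, ∃ B ∈ blocksOf S, ∃ n : ℕ, B.s = n + 2 ∧ Q = sq B.l B.d n := by
    intro Q hQ
    obtain ⟨n, hn⟩ := ENat.ne_top_iff_exists.1 (hfin Q hQ)
    obtain ⟨l, d, rfl⟩ := exists_eq_sq hn.symm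
    exact ⟨⟨l, d, n + 2⟩, mem_blocksOf.2 hQ, n, rfl, rfl⟩
  have hfalse : ∀ c r, x (c, r) = false ↔ ∃ Q ∈ blocksOf S, Q.Mem c r ∧ ¬ Q.Inner c r := by
    intro c r
    constructor
    · intro h
      obtain ⟨Q, ⟨hQ, hb⟩, -⟩ := hS.border (c, r) h
      obtain ⟨B, hB, n, hn, rfl⟩ := hsq Q hQ
      rw [mem_border_sq, ← hn] at hb
      exact ⟨B, hB, hb⟩
    · rintro ⟨Q, hQ, h1, h2⟩
      exact (hS.occ hQ).1 c r h1 h2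
  refine ⟨⟨?_, fun _ _ _ _ _ => ⟨trivial, trivial⟩,
    fun Q hQ Q' hQ' c r => hS.disj hQ hQ', ?_, ?_⟩, ?_⟩
  · rintro Q ⟨n, hn, hQ⟩
    exact ⟨_, hQ, n, rfl, hn⟩
  · intro c r c' r' _ _ h1 h2 h3 h4
    by_contra hcon
    push Not at hcon
    have ht : ∀ q ∈ Icc (c, r) ((c, r) + (1, 1)), x q = true := by
      rintro ⟨a, b⟩ ⟨⟨g1, g3⟩, ⟨g2, g4⟩⟩
      rw [← Bool.not_eq_false]
      intro hf
      obtain ⟨Q, hQ, hm, -⟩ := (hfalse a b).1 hf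
      exact hcon a b g1 g2 g3 g4 ⟨Q, hQ, hm⟩
    obtain ⟨Q, hQ, hsub⟩ := hS.block (c, r) ht
    obtain ⟨B, hB, n, hn, rfl⟩ := hsq Q hQ
    have := hsub (show (c, r) ∈ Icc (c, r) ((c, r) + (1, 1)) from
      ⟨le_rfl, ⟨by simp, by simp⟩⟩)
    rw [mem_interior_sq, ← hn] at this
    exact hcon c r le_rfl (by omega) le_rfl (by omega) ⟨B, hB, this.mem⟩
  · intro c _ r _ hn
    by_contra hcon
    push Not at hcon
    have hnb : ∀ a b, c - 1 ≤ a → a ≤ c + 1 → r - 1 ≤ b → b ≤ r + 1 → ¬ (a = c ∧ b = r) →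
        x (a, b) = false := by
      intro a b h1 h2 h3 h4 h5
      have hcov : Covered (blocksOf S) a b := by
        by_contra hnc
        have := hcon a trivial b trivial hnc (by tauto) h1 h2 h3
        omega
      obtain ⟨Q, hQ, hm⟩ := hcov
      refine (hfalse a b).2 ⟨Q, hQ, hm, fun hi => hn ⟨Q, hQ, ?_⟩⟩
      simp only [Blk.Mem, Blk.Col, Blk.Row, Blk.Inner] at hi ⊢
      omega
    have htr : x (c, r) = true := by
      rw [← Bool.not_eq_false]
      intro hf
      obtain ⟨Q, hQ, hm, -⟩ := (hfalse c r).1 hf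
      exact hn ⟨Q, hQ, hm⟩
    have hocc : (sq (c - 1) (r - 1) 1).Occurs x := by
      rw [occurs_sq_iff]
      constructor
      · intro a b hm hi
        simp only [Blk.Mem, Blk.Col, Blk.Row, Blk.Inner] at hm hi
        push_cast at hm hi
        exact hnb a b (by omega) (by omega) (by omega) (by omega) (by omega)
      · intro a b hi
        simp only [Blk.Inner] at hi
        push_cast at hi
        obtain rfl : a = c := by omega
        obtain rfl : b = r := by omega
        exact htr
    have hin := hS.visible _ (by simp [sq]) (by simp [sq]) hocc
    refine hn ⟨_, mem_blocksOf.2 hin, ?_⟩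
    simp only [Blk.Mem, Blk.Col, Blk.Row]
    push_cast
    omega
  · funext p
    rw [Bool.eq_iff_iff, ← not_iff_not]
    simp only [Bool.not_eq_true]
    rw [packConfig_eq_false_iff]
    exact hfalse p.1 p.2

end Parsing

end TCPE

namespace TCPE

open Set Filter Topology

/-! ### Sizes of squares -/

theorem exists_window {I : Set ℤ} (hI : I.OrdConnected) {c : ℤ} (hc : c ∈ I) (k : ℕ)
    (hk : ((k + 1 : ℕ) : ℕ∞) ≤ I.encard) : ∃ a, a ≤ c ∧ c ≤ a + k ∧ Icc a (a + k) ⊆ I := by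
  induction k with
  | zero =>
    refine ⟨c, le_rfl, by simp, ?_⟩
    intro i hi
    obtain rfl : i = c := by
      have := hi.1
      have := hi.2
      push_cast at this
      omega
    exact hc
  | succ k ih =>
    obtain ⟨a, h1, h2, h3⟩ := ih (le_trans (by exact_mod_cast Nat.le_succ _) hk)
    push_cast at *
    by_cases hr : a + k + 1 ∈ I
    · refine ⟨a, h1, by omega, fun i hi => ?_⟩
      by_cases h : i = a + k + 1
      · exact h ▸ hr
      · exact h3 ⟨hi.1, by have := hi.2; omega⟩
    by_cases hl : a - 1 ∈ I
    · refine ⟨a - 1, by omega, by omega, fun i hi => ?_⟩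
      by_cases h : i = a - 1
      · exact h ▸ hl
      · exact h3 ⟨by have := hi.1; omega, by have := hi.2; omega⟩
    exfalso
    have hsub : I ⊆ Icc a (a + k) := by
      intro i hi
      constructor
      · by_contra hcon
        exact hl (hI.out hi hc ⟨by omega, by omega⟩)
      · by_contra hcon
        exact hr (hI.out hc hi ⟨by omega, by omega⟩)
    have h5 := hk.trans (Set.encard_le_encard hsub)
    rw [← Finset.coe_Icc, Set.encard_coe_eq_coe_finsetCard, Int.card_Icc] at h5
    have h6 : k + 1 + 1 ≤ (a + k + 1 - a).toNat := by exact_mod_cast h5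
    omega

theorem Square.exists_window (Q : Square) {p : ℤ × ℤ} (hp : p.1 ∈ Q.cols ∧ p.2 ∈ Q.rows) (k : ℕ)
    (hk : (k : ℕ∞) ≤ Q.size) : ∃ a b, (a ≤ p.1 ∧ p.1 ≤ a + (k + 1)) ∧ (b ≤ p.2 ∧ p.2 ≤ b + (k + 1)) ∧
      ∀ c r, a < c → c ≤ a + k → b < r → r ≤ b + k → (c, r) ∈ Q.interior := by
  have hle : ((k + 1 + 1 : ℕ) : ℕ∞) ≤ Q.size + 2 := by
    push_cast
    rw [add_assoc]
    exact add_le_add_left hk _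
  obtain ⟨a, h1, h2, h3⟩ := TCPE.exists_window Q.cols_ordConnected hp.1 (k + 1)
    (by rw [Q.cols_encard]; exact hle)
  obtain ⟨b, g1, g2, g3⟩ := TCPE.exists_window Q.rows_ordConnected hp.2 (k + 1)
    (by rw [Q.rows_encard]; exact hle)
  push_cast at *
  refine ⟨a, b, ⟨h1, h2⟩, ⟨g1, g2⟩, fun c r e1 e2 e3 e4 => ⟨h3 ⟨?_, ?_⟩, h3 ⟨?_, ?_⟩, g3 ⟨?_, ?_⟩,
    g3 ⟨?_, ?_⟩⟩⟩ <;> omega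

theorem Square.exists_mem (Q : Square) : ∃ p : ℤ × ℤ, p.1 ∈ Q.cols ∧ p.2 ∈ Q.rows := by
  have h : ∀ I : Set ℤ, I.encard = Q.size + 2 → I.Nonempty := by
    intro I hI
    rw [← Set.encard_ne_zero, hI]
    simp
  obtain ⟨c, hc⟩ := h _ Q.cols_encard
  obtain ⟨r, hr⟩ := h _ Q.rows_encard
  exact ⟨(c, r), hc, hr⟩

theorem Square.mem_of_mem_interior {Q : Square} {p : ℤ × ℤ} (h : p ∈ Q.interior) :
    p.1 ∈ Q.cols ∧ p.2 ∈ Q.rows :=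
  ⟨Q.cols_ordConnected.out h.1 h.2.1 ⟨by omega, by omega⟩,
    Q.rows_ordConnected.out h.2.2.1 h.2.2.2 ⟨by omega, by omega⟩⟩

section

variable {x : Config} {S S' : Set Square}

/-- A `k × k` block of `1`s is inside a square of size at least `k`. -/
theorem IsParsing.exists_size_ge (hS : IsParsing x S) {a b : ℤ} {k : ℕ} (hk : 2 ≤ k)
    (h : ∀ c r, a ≤ c → c < a + k → b ≤ r → r < b + k → x (c, r) = true) :
    ∃ Q ∈ S, (k : ℕ∞) ≤ Q.size := by
  obtain ⟨Q, hQ, hsub⟩ := hS.block (a, b) (by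
    rintro ⟨c, r⟩ ⟨⟨h1, h2⟩, ⟨h3, h4⟩⟩
    simp only [Prod.fst_add, Prod.snd_add] at h1 h2 h3 h4
    exact h c r h1 (by omega) h2 (by omega))
  refine ⟨Q, hQ, ?_⟩
  have h0 : (a, b) ∈ Q.interior := hsub ⟨le_rfl, ⟨by simp, by simp⟩⟩
  have hrow : b ∈ Q.rows := (Square.mem_of_mem_interior h0).2
  have key : ∀ i : ℕ, i < k → (a + i, b) ∈ Q.interior := by
    intro i
    induction i with
    | zero => intro _; simpa using h0
    | succ i ih =>
      intro hi
      have h1 := ih (by omega)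
      by_contra hcon
      have h2 := (hS.occurs Q hQ).1 (a + (i + 1 : ℕ), b) ⟨⟨by
        have := h1.2.1
        push_cast
        rwa [← add_assoc], hrow⟩, hcon⟩
      rw [h _ _ (by omega) (by omega) le_rfl (by omega)] at h2
      exact absurd h2 (by simp)
  have hcols : Icc (a - 1) (a + k) ⊆ Q.cols := by
    have h1 := (key 0 (by omega)).1
    have h2 := (key (k - 1) (by omega)).2.1
    simp only at h1 h2
    exact fun i hi => Q.cols_ordConnected.out h1 h2 ⟨by have := hi.1; push_cast; omega,
      by have := hi.2; omega⟩
  have h5 := Set.encard_le_encard hcols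
  rw [← Finset.coe_Icc, Set.encard_coe_eq_coe_finsetCard, Int.card_Icc, Q.cols_encard] at h5
  have e : (a + k + 1 - (a - 1)).toNat = k + 2 := by omega
  rw [e] at h5
  push_cast at h5
  exact (ENat.add_le_add_iff_right (by simp)).1 h5

theorem IsParsing.nonempty (hS : IsParsing x S) : S.Nonempty := by
  by_cases h : ∃ p, x p = false
  · obtain ⟨p, hp⟩ := h
    obtain ⟨Q, hQ, -⟩ := hS.border p hp
    exact ⟨Q, hQ.1⟩
  · push Not at h
    obtain ⟨Q, hQ, -⟩ := hS.block 0 (fun q _ => by simpa using h q)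
    exact ⟨Q, hQ⟩

theorem Square.exists_ones {Q : Square} (hQ : Q.Occurs x) (k : ℕ) (hk : (k : ℕ∞) ≤ Q.size) :
    ∃ a b : ℤ, ∀ c r : ℤ, a ≤ c → c < a + k → b ≤ r → r < b + k → x (c, r) = true := by
  obtain ⟨p, hp⟩ := Q.exists_mem
  obtain ⟨a, b, -, -, h⟩ := Q.exists_window hp k hk
  exact ⟨a + 1, b + 1, fun c r h1 h2 h3 h4 => hQ.2 _ (h c r (by omega) (by omega) (by omega)
    (by omega))⟩

/-- Sizes do not depend on the parsing. Finite positive sizes are visible, and size `⊤` is detected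
by a 2 × 2 block of `1`s. If only `S` had a 0-square, all squares of `S'` would be visible and in
`S`, and a border cell of the 0-square would be on two borders of `S`. -/
theorem IsParsing.exists_size_eq (hS : IsParsing x S) (hS' : IsParsing x S') {Q : Square}
    (hQ : Q ∈ S) : ∃ Q' ∈ S', Q'.size = Q.size := by
  by_cases htop : Q.size = ⊤
  · obtain ⟨a, b, h⟩ := Square.exists_ones (hS.occurs Q hQ) 2 (by rw [htop]; exact le_top)
    obtain ⟨Q', hQ', hs⟩ := hS'.exists_size_ge le_rfl h
    refine ⟨Q', hQ', ?_⟩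
    rw [htop]
    by_contra hne
    have := hS'.occurs Q' hQ'
    have hin := hS.visible Q' (le_trans (by norm_num) hs) hne this
    have := hS.size_le Q hQ Q' hin
    rw [htop, top_le_iff] at this
    exact hne (by simpa using this)
  by_cases h0 : Q.size = 0
  · by_contra hcon
    push Not at hcon
    rw [h0] at hcon
    have h1 : ∀ Q' ∈ S', 1 ≤ Q'.size := fun Q' hQ' => Order.one_le_iff_pos.2
      (pos_iff_ne_zero.2 (hcon Q' hQ'))
    by_cases ht : ∃ Q' ∈ S', Q'.size = ⊤
    · obtain ⟨Q', hQ', ht⟩ := ht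
      obtain ⟨a, b, h⟩ := Square.exists_ones (hS'.occurs Q' hQ') 2 (by rw [ht]; exact le_top)
      obtain ⟨Q₂, hQ₂, hs⟩ := hS.exists_size_ge le_rfl h
      have := hs.trans (hS.size_le Q₂ hQ₂ Q hQ)
      rw [h0] at this
      exact absurd this (by norm_num)
    · push Not at ht
      have hsub : S' ⊆ S := fun Q' hQ' => hS.visible Q' (h1 Q' hQ') (ht Q' hQ') (hS'.occurs Q' hQ')
      obtain ⟨l, d, rfl⟩ := exists_eq_sq (n := 0) (by simpa using h0)
      have hb : (l, d) ∈ (sq l d 0).border := by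
        rw [mem_border_sq]
        simp only [Blk.Mem, Blk.Col, Blk.Row, Blk.Inner]
        push_cast
        omega
      obtain ⟨Q', hQ', -⟩ := hS'.border (l, d) ((hS.occurs _ hQ).1 _ hb)
      have := (hS.border (l, d) ((hS.occurs _ hQ).1 _ hb)).unique ⟨hQ, hb⟩ ⟨hsub hQ'.1, hQ'.2⟩
      rw [← this] at hQ'
      exact hcon _ hQ'.1 h0
  · exact ⟨Q, hS'.visible Q (Order.one_le_iff_pos.2 (pos_iff_ne_zero.2 h0)) htop
      (hS.occurs Q hQ), rfl⟩

end

/-- The sizes of the squares contained in `x`. -/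
def sizes (x : Config) : Set ℕ∞ := {n | ∃ S, IsParsing x S ∧ ∃ Q ∈ S, Q.size = n}

section

variable {x z : Config} {S : Set Square}

theorem containsSquare_iff {n : ℕ} : ContainsSquare x n ↔ (n : ℕ∞) ∈ sizes x := Iff.rfl

theorem IsParsing.sizes_eq (hS : IsParsing x S) : Square.size '' S = sizes x := by
  ext n
  constructor
  · rintro ⟨Q, hQ, rfl⟩
    exact ⟨S, hS, Q, hQ, rfl⟩
  · rintro ⟨S', hS', Q, hQ, rfl⟩
    exact hS'.exists_size_eq hS hQ

theorem sizes_nonempty (hx : x ∈ baseShift) : (sizes x).Nonempty := by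
  obtain ⟨S, hS⟩ := hx
  rw [← hS.sizes_eq]
  exact hS.nonempty.image _

theorem mem_baseShift_of_mem_sizes {n : ℕ∞} (h : n ∈ sizes x) : x ∈ baseShift := by
  obtain ⟨S, hS, -⟩ := h
  exact ⟨S, hS⟩

theorem sizes_le {a b : ℕ∞} (ha : a ∈ sizes x) (hb : b ∈ sizes x) : a ≤ b + 1 := by
  obtain ⟨S, hS⟩ := mem_baseShift_of_mem_sizes ha
  rw [← hS.sizes_eq] at ha hb
  obtain ⟨Q, hQ, rfl⟩ := ha
  obtain ⟨Q', hQ', rfl⟩ := hb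
  exact hS.size_le Q hQ Q' hQ'

theorem mem_sizes_of_occ (hx : x ∈ baseShift) {l d : ℤ} {n : ℕ} (hn : 1 ≤ n)
    (h : (⟨l, d, n + 2⟩ : Blk).Occ x) : (n : ℕ∞) ∈ sizes x := by
  obtain ⟨S, hS⟩ := hx
  exact ⟨S, hS, _, hS.visible (sq l d n) (by simpa [sq] using hn) (by simp [sq])
    (occurs_sq_iff.2 h), rfl⟩

theorem exists_sq_of_mem_sizes (hS : IsParsing x S) {n : ℕ} (hn : (n : ℕ∞) ∈ sizes x) :
    ∃ l d, sq l d n ∈ S := by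
  rw [← hS.sizes_eq] at hn
  obtain ⟨Q, hQ, hQn⟩ := hn
  obtain ⟨l, d, rfl⟩ := exists_eq_sq hQn
  exact ⟨l, d, hQ⟩

theorem exists_mem_sizes_ge (hx : x ∈ baseShift) {a b : ℤ} {k : ℕ} (hk : 2 ≤ k)
    (h : ∀ c r, a ≤ c → c < a + k → b ≤ r → r < b + k → x (c, r) = true) :
    ∃ m ∈ sizes x, (k : ℕ∞) ≤ m := by
  obtain ⟨S, hS⟩ := hx
  obtain ⟨Q, hQ, hs⟩ := hS.exists_size_ge hk h
  exact ⟨_, ⟨S, hS, Q, hQ, rfl⟩, hs⟩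

theorem exists_ones_of_mem_sizes {n : ℕ∞} (hn : n ∈ sizes x) (k : ℕ) (hk : (k : ℕ∞) ≤ n) :
    ∃ a b : ℤ, ∀ c r : ℤ, a ≤ c → c < a + k → b ≤ r → r < b + k → x (c, r) = true := by
  obtain ⟨S, hS, Q, hQ, rfl⟩ := hn
  exact Square.exists_ones (hS.occurs Q hQ) k hk

theorem exists_agree_window (x : Config) (a b k : ℤ) : ∃ N : ℕ, ∀ z, Agree N x z →
    ∀ c r, a ≤ c → c < a + k → b ≤ r → r < b + k → z (c, r) = x (c, r) := by
  refine ⟨(|a| + |b| + |k|).toNat, fun z hz c r h1 h2 h3 h4 => hz (c, r) ?_⟩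
  have := abs_nonneg a
  have := abs_nonneg b
  have := abs_nonneg k
  have := neg_abs_le a
  have := neg_abs_le b
  have := le_abs_self a
  have := le_abs_self b
  have := le_abs_self k
  unfold InWindow
  simp only
  omega

/-- Finite sizes are visible on a window. -/
theorem exists_agree_mem_sizes {n : ℕ} (hn : (n : ℕ∞) ∈ sizes x) :
    ∃ N : ℕ, ∀ z ∈ baseShift, Agree N x z → (n : ℕ∞) ∈ sizes z := by
  obtain ⟨S, hS⟩ := mem_baseShift_of_mem_sizes hn
  obtain ⟨l, d, hQ⟩ := exists_sq_of_mem_sizes hS hn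
  obtain ⟨N, hN⟩ := exists_agree_window x (l - 10) (d - 10) (n + 30)
  refine ⟨N, fun z hz hag => ?_⟩
  have hag := hN z hag
  -- A 0-square is not visible as such. The square of `z` at the zero `(l, d)` has size less than
  -- two, as a larger one would show a 2 × 2 block of `1`s next to it; a 1-square would be visible
  -- in `x` too, and `(l, d)` would be on two borders.
  rcases Nat.eq_zero_or_pos n with rfl | hpos
  · obtain ⟨Sz, hSz⟩ := hz
    have hb : (l, d) ∈ (sq l d 0).border := by
      rw [mem_border_sq]
      simp only [Blk.Mem, Blk.Col, Blk.Row, Blk.Inner]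
      push_cast
      omega
    have hx0 : x (l, d) = false := (hS.occurs _ hQ).1 _ hb
    have hz0 : z (l, d) = false := by
      rw [hag l d (by omega) (by push_cast; omega) (by omega) (by push_cast; omega), hx0]
    obtain ⟨Q', ⟨hQ', hb'⟩, -⟩ := hSz.border _ hz0
    have hlt : Q'.size < 2 := by
      by_contra hge
      rw [not_lt] at hge
      obtain ⟨a, b, g1, g2, g3⟩ := Q'.exists_window (p := (l, d)) hb'.1 2 hge
      simp only at g1 g2
      push_cast at g1 g2
      obtain ⟨Q₂, hQ₂, hs⟩ := hS.exists_size_ge (a := a + 1) (b := b + 1) (k := 2) le_rfl (by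
        intro c r h1 h2 h3 h4
        push_cast at h2 h4
        rw [← hag c r (by omega) (by push_cast; omega) (by omega) (by push_cast; omega)]
        exact (hSz.occurs Q' hQ').2 _ (g3 c r (by omega) (by push_cast; omega) (by omega)
          (by push_cast; omega)))
      have := hs.trans (hS.size_le Q₂ hQ₂ _ hQ)
      simp only [sq] at this
      exact absurd this (by norm_num)
    refine ⟨Sz, hSz, Q', hQ', ?_⟩
    obtain ⟨m, hm⟩ := ENat.ne_top_iff_exists.1 (ne_top_of_lt hlt)
    have hm2 : m < 2 := by
      rw [← hm] at hlt
      exact_mod_cast hlt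
    rcases (by omega : m = 0 ∨ m = 1) with rfl | rfl
    · exact hm.symm
    · exfalso
      obtain ⟨l', d', rfl⟩ := exists_eq_sq hm.symm
      have hbm := mem_border_sq.1 hb'
      have hocc := occurs_sq_iff.1 (hSz.occurs _ hQ')
      simp only [Blk.Mem, Blk.Col, Blk.Row] at hbm
      push_cast at hbm
      have hin := hS.visible (sq l' d' 1) (by simp [sq]) (by simp [sq]) (by
        rw [occurs_sq_iff]
        constructor
        · intro c r hm hi
          rw [← hag c r _ _ _ _]
          · exact hocc.1 c r hm hi
          all_goals
            simp only [Blk.Mem, Blk.Col, Blk.Row] at hm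
            push_cast at hm ⊢
            omega
        · intro c r hi
          rw [← hag c r _ _ _ _]
          · exact hocc.2 c r hi
          all_goals
            simp only [Blk.Inner] at hi
            push_cast at hi ⊢
            omega)
      have := (hS.border _ hx0).unique ⟨hQ, hb⟩ ⟨hin, hb'⟩
      have := congrArg Square.size this
      simp [sq] at this
  · have hocc := occurs_sq_iff.1 (hS.occurs _ hQ)
    refine mem_sizes_of_occ hz hpos (l := l) (d := d) ⟨fun c r hm hi => ?_, fun c r hi => ?_⟩
    · rw [hag c r _ _ _ _]
      · exact hocc.1 c r hm hi
      all_goals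
        simp only [Blk.Mem, Blk.Col, Blk.Row] at hm
        omega
    · rw [hag c r _ _ _ _]
      · exact hocc.2 c r hi
      all_goals
        simp only [Blk.Inner] at hi
        omega

/-- A visible block of `(k + 2) ^ 2` ones forces a square of size at least `k + 2`, and sizes differ
by at most one. -/
theorem exists_agree_sizes_ge (hx : ⊤ ∈ sizes x) (k : ℕ) :
    ∃ N : ℕ, ∀ z ∈ baseShift, Agree N x z → ∀ m ∈ sizes z, (k : ℕ∞) ≤ m := by
  obtain ⟨a, b, h⟩ := exists_ones_of_mem_sizes hx (k + 2) le_top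
  obtain ⟨N, hN⟩ := exists_agree_window x a b (k + 2 : ℕ)
  refine ⟨N, fun z hz hag m hm => ?_⟩
  obtain ⟨m', hm', hk⟩ := exists_mem_sizes_ge hz (a := a) (b := b) (k := k + 2) (by omega)
    (fun c r h1 h2 h3 h4 => (hN z hag c r h1 h2 h3 h4).trans (h c r h1 h2 h3 h4))
  have h1 := hk.trans (sizes_le hm' hm)
  have h2 : (k : ℕ∞) + 1 ≤ m + 1 := le_trans (by exact_mod_cast (by omega : k + 1 ≤ k + 2)) h1
  exact (ENat.add_le_add_iff_right (by simp)).1 h2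

theorem sizes_cases (hx : x ∈ baseShift) : (∃ n : ℕ, sizes x = {(n : ℕ∞)}) ∨
    (∃ n : ℕ, sizes x = {(n : ℕ∞), (n : ℕ∞) + 1}) ∨ sizes x = {⊤} := by
  by_cases htop : ⊤ ∈ sizes x
  · right; right
    refine eq_singleton_iff_unique_mem.2 ⟨htop, fun m hm => ?_⟩
    have := sizes_le htop hm
    rw [top_le_iff] at this
    simpa using this
  · obtain ⟨m₀, hm₀⟩ := sizes_nonempty hx
    have hwf : ∃ m ∈ sizes x, ∀ k ∈ sizes x, m ≤ k := by
      obtain ⟨m, hm, hmin⟩ := WellFounded.has_min (wellFounded_lt (α := ℕ∞)) _ ⟨m₀, hm₀⟩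
      exact ⟨m, hm, fun k hk => not_lt.1 (hmin k hk)⟩
    obtain ⟨m, hm, hmin⟩ := hwf
    obtain ⟨n, rfl⟩ := ENat.ne_top_iff_exists.1 (fun h => htop (h ▸ hm))
    have hmem : ∀ k ∈ sizes x, k = n ∨ k = (n : ℕ∞) + 1 := by
      intro k hk
      have h1 := hmin k hk
      have h2 := sizes_le hk hm
      obtain ⟨j, rfl⟩ := ENat.ne_top_iff_exists.1 (fun h => htop (h ▸ hk))
      have h1' : n ≤ j := by exact_mod_cast h1
      have h2' : j ≤ n + 1 := by exact_mod_cast h2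
      rcases (by omega : j = n ∨ j = n + 1) with rfl | rfl
      · exact Or.inl rfl
      · exact Or.inr (by push_cast; rfl)
    by_cases hn1 : (n : ℕ∞) + 1 ∈ sizes x
    · right; left
      refine ⟨n, Set.Subset.antisymm (fun k hk => hmem k hk) ?_⟩
      rintro k (rfl | rfl)
      · exact hm
      · exact hn1
    · left
      refine ⟨n, eq_singleton_iff_unique_mem.2 ⟨hm, fun k hk => ?_⟩⟩
      rcases hmem k hk with h | h
      · exact h
      · exact absurd (h ▸ hk) hn1

end

/-! ### The base shift is a subshift -/

/-- The translate of a position. -/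
def Square.shift (g : ℤ × ℤ) (Q : Square) : Square where
  cols := (fun c => c - g.1) ⁻¹' Q.cols
  rows := (fun c => c - g.2) ⁻¹' Q.rows
  size := Q.size
  cols_ordConnected := Q.cols_ordConnected.preimage_mono (fun _ _ h => by simpa using h)
  rows_ordConnected := Q.rows_ordConnected.preimage_mono (fun _ _ h => by simpa using h)
  cols_encard := by
    exact (Set.encard_preimage_of_bijective (Equiv.subRight g.1).bijective _).trans Q.cols_encard
  rows_encard := by
    exact (Set.encard_preimage_of_bijective (Equiv.subRight g.2).bijective _).trans Q.rows_encard

theorem Square.shift_shift (g h : ℤ × ℤ) (Q : Square) : (Q.shift g).shift h = Q.shift (h + g) := by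
  refine Square.ext ?_ ?_ rfl <;> ext c <;> simp [Square.shift, sub_sub]

theorem Square.shift_zero (Q : Square) : Q.shift 0 = Q := by
  refine Square.ext ?_ ?_ rfl <;> ext c <;> simp [Square.shift]

theorem Square.mem_interior_shift {g p : ℤ × ℤ} {Q : Square} :
    p ∈ (Q.shift g).interior ↔ p - g ∈ Q.interior := by
  simp only [Square.interior, Square.shift, mem_ofPred_eq, mem_preimage, Prod.fst_sub, Prod.snd_sub,
    sub_right_comm, add_sub_right_comm]

theorem Square.mem_border_shift {g p : ℤ × ℤ} {Q : Square} :
    p ∈ (Q.shift g).border ↔ p - g ∈ Q.border := by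
  rw [Square.border, Set.mem_sdiff, Square.mem_interior_shift]
  exact Iff.rfl

theorem IsParsing.shift {x : Config} {S : Set Square} (hS : IsParsing x S) (g : ℤ × ℤ) :
    IsParsing (g +ᵥ x) {Q | Q.shift (-g) ∈ S} := by
  have hv : ∀ p, (g +ᵥ x : Config) p = x (p - g) := fun p => rfl
  have hocc : ∀ Q : Square, Q.Occurs (g +ᵥ x) ↔ (Q.shift (-g)).Occurs x := by
    intro Q
    simp only [Square.Occurs, Square.mem_interior_shift, Square.mem_border_shift, hv, sub_neg_eq_add]
    constructor
    · rintro ⟨h1, h2⟩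
      exact ⟨fun p hp => by simpa using h1 _ hp, fun p hp => by simpa using h2 _ hp⟩
    · rintro ⟨h1, h2⟩
      exact ⟨fun p hp => h1 (p - g) (by simpa using hp), fun p hp => h2 (p - g) (by simpa using hp)⟩
  have hback : ∀ Q ∈ S, Q.shift g ∈ {Q : Square | Q.shift (-g) ∈ S} := by
    intro Q hQ
    change (Q.shift g).shift (-g) ∈ S
    rwa [Square.shift_shift, neg_add_cancel, Square.shift_zero]
  refine ⟨fun Q hQ => (hocc Q).2 (hS.occurs _ hQ), ?_, ?_, ?_, ?_⟩
  · intro p h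
    obtain ⟨Q, hQ, hsub⟩ := hS.block (p - g) (by
      rintro q ⟨h1, h2⟩
      have := h (q + g) ⟨by rw [← sub_le_iff_le_add]; exact h1, by
        rw [← le_sub_iff_add_le, add_sub_right_comm]
        exact h2⟩
      rwa [hv, add_sub_cancel_right] at this)
    refine ⟨Q.shift g, hback Q hQ, fun q hq => Square.mem_interior_shift.2 (hsub ⟨?_, ?_⟩)⟩
    · exact sub_le_sub_right hq.1 g
    · rw [← add_sub_right_comm]
      exact sub_le_sub_right hq.2 g
  · intro p hp
    obtain ⟨Q, ⟨hQ, hb⟩, huniq⟩ := hS.border (p - g) hp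
    refine ⟨Q.shift g, ⟨hback Q hQ, Square.mem_border_shift.2 hb⟩, ?_⟩
    rintro Q' ⟨hQ', hb'⟩
    have := huniq (Q'.shift (-g)) ⟨hQ', by rw [Square.mem_border_shift]; simpa using hb'⟩
    rw [← this, Square.shift_shift, add_neg_cancel, Square.shift_zero]
  · exact fun Q h1 h2 h3 => hS.visible _ h1 h2 ((hocc Q).1 h3)
  · exact fun Q hQ Q' hQ' => hS.size_le _ hQ (Q'.shift (-g)) hQ'

theorem sizes_vadd (g : ℤ × ℤ) (x : Config) : sizes (g +ᵥ x) = sizes x := by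
  have key : ∀ (g : ℤ × ℤ) (x : Config), sizes (g +ᵥ x) ⊆ sizes x := by
    rintro g x n ⟨S, hS, Q, hQ, rfl⟩
    refine ⟨_, (neg_vadd_vadd g x) ▸ hS.shift (-g), Q.shift (-g), ?_, rfl⟩
    change (Q.shift (-g)).shift (- -g) ∈ S
    rwa [Square.shift_shift, neg_add_cancel, Square.shift_zero]
  refine Set.Subset.antisymm (key g x) ?_
  have := key (-g) (g +ᵥ x)
  rwa [neg_vadd_vadd] at this

theorem vadd_mem_baseShift {x : Config} (hx : x ∈ baseShift) (g : ℤ × ℤ) : g +ᵥ x ∈ baseShift := by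
  obtain ⟨S, hS⟩ := hx
  exact ⟨_, hS.shift g⟩

/-- `Q` is the limit of the squares `q y`. -/
structure IsLimitSquare (u : Ultrafilter Config) (q : Config → Square) (Q : Square) : Prop where
  cols : ∀ c, c ∈ Q.cols ↔ ∀ᶠ y in u, c ∈ (q y).cols
  rows : ∀ c, c ∈ Q.rows ↔ ∀ᶠ y in u, c ∈ (q y).rows
  size : (∀ᶠ y in u, (q y).size = Q.size) ∨ (Q.size = ⊤ ∧ ∀ n : ℕ, ∀ᶠ y in u, (n : ℕ∞) ≤ (q y).size)

/-- If the sizes are constant along the ultrafilter, only finitely many positions contain `p`, so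
the position is constant as well. Otherwise the sizes exceed every bound, and the limits of the two
intervals are infinite. -/
theorem exists_isLimitSquare (u : Ultrafilter Config) (q : Config → Square) {p : ℤ × ℤ}
    (hp : ∀ᶠ y in u, p.1 ∈ (q y).cols ∧ p.2 ∈ (q y).rows) : ∃ Q, IsLimitSquare u q Q := by
  by_cases hfin : ∃ n : ℕ, ∀ᶠ y in u, (q y).size = n
  · obtain ⟨n, hn⟩ := hfin
    have key : ∀ᶠ y in u, ∃ a ∈ Icc (p.1 - n - 2) p.1 ×ˢ Icc (p.2 - n - 2) p.2,
        q y = sq a.1 a.2 n := by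
      filter_upwards [hp, hn] with y h1 h2
      obtain ⟨l, d, h⟩ := exists_eq_sq h2
      refine ⟨(l, d), ?_, h⟩
      rw [h] at h1
      simp only [sq, mem_Ico, mem_prod, mem_Icc] at h1 ⊢
      omega
    rw [Ultrafilter.eventually_exists_mem_iff ((finite_Icc _ _).prod (finite_Icc _ _))] at key
    obtain ⟨a, -, ha⟩ := key
    refine ⟨sq a.1 a.2 n, fun c => ?_, fun c => ?_, Or.inl hn⟩
    · rw [eventually_congr (ha.mono fun y hy => by rw [hy] : ∀ᶠ y in u, c ∈ (q y).cols ↔ _)]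
      simp
    · rw [eventually_congr (ha.mono fun y hy => by rw [hy] : ∀ᶠ y in u, c ∈ (q y).rows ↔ _)]
      simp
  · push Not at hfin
    have hge : ∀ n : ℕ, ∀ᶠ y in u, (n : ℕ∞) ≤ (q y).size := by
      intro n
      induction n with
      | zero => simp
      | succ n ih =>
        filter_upwards [ih, hfin n] with y h1 h2
        push_cast
        exact Order.add_one_le_of_lt (lt_of_le_of_ne h1 (Ne.symm h2))
    have hord : ∀ I : Config → Set ℤ, (∀ y, (I y).OrdConnected) →
        OrdConnected {c | ∀ᶠ y in u, c ∈ I y} := by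
      intro I hI
      refine ⟨fun a ha b hb c hc => ?_⟩
      filter_upwards [ha, hb] with y h1 h2
      exact (hI y).out h1 h2 hc
    have hinf : ∀ (I : Config → Set ℤ) (a : ℤ), (∀ y, (I y).OrdConnected) →
        (∀ᶠ y in u, a ∈ I y) → (∀ y, (I y).encard = (q y).size + 2) →
        {c | ∀ᶠ y in u, c ∈ I y}.encard = ⊤ + 2 := by
      intro I a hI ha hcard
      rw [top_add, Set.encard_eq_top_iff]
      have hstep : ∀ n : ℕ, a + n ∈ {c | ∀ᶠ y in u, c ∈ I y} ∨ a - n ∈ {c | ∀ᶠ y in u, c ∈ I y} := by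
        intro n
        change (∀ᶠ y in u, a + n ∈ I y) ∨ ∀ᶠ y in u, a - n ∈ I y
        rw [← Ultrafilter.eventually_or]
        filter_upwards [ha, hge (2 * n + 1)] with y h1 h2
        obtain ⟨b, g1, g2, g3⟩ := exists_window (hI y) h1 (2 * n) (by
          rw [hcard]
          exact h2.trans le_self_add)
        push_cast at g2 g3
        by_cases hb : a + n ≤ b + 2 * n
        · exact Or.inl (g3 ⟨by omega, hb⟩)
        · exact Or.inr (g3 ⟨by omega, by omega⟩)
      intro hfin
      obtain ⟨m, hm⟩ := hfin.bddAbove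
      obtain ⟨m', hm'⟩ := hfin.bddBelow
      rcases hstep (max (m - a + 1) (a - m' + 1)).toNat with h | h
      · have := hm h
        omega
      · have := hm' h
        omega
    exact ⟨⟨{c | ∀ᶠ y in u, c ∈ (q y).cols}, {c | ∀ᶠ y in u, c ∈ (q y).rows}, ⊤,
      hord _ fun y => (q y).cols_ordConnected, hord _ fun y => (q y).rows_ordConnected,
      hinf _ p.1 (fun y => (q y).cols_ordConnected) (hp.mono fun _ h => h.1)
        fun y => (q y).cols_encard,
      hinf _ p.2 (fun y => (q y).rows_ordConnected) (hp.mono fun _ h => h.2)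
        fun y => (q y).rows_encard⟩, fun c => Iff.rfl, fun c => Iff.rfl, Or.inr ⟨rfl, hge⟩⟩

theorem IsLimitSquare.mem_interior {u : Ultrafilter Config} {q : Config → Square} {Q : Square}
    (h : IsLimitSquare u q Q) {p : ℤ × ℤ} :
    p ∈ Q.interior ↔ ∀ᶠ y in u, p ∈ (q y).interior := by
  simp only [Square.interior, mem_ofPred_eq, h.cols, h.rows, eventually_and]

theorem IsLimitSquare.mem_border {u : Ultrafilter Config} {q : Config → Square} {Q : Square}
    (h : IsLimitSquare u q Q) {p : ℤ × ℤ} :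
    p ∈ Q.border ↔ ∀ᶠ y in u, p ∈ (q y).border := by
  simp only [Square.border, Set.mem_sdiff, h.mem_interior, mem_prod, h.cols, h.rows, eventually_and,
    Ultrafilter.eventually_not]

/-- The limits of squares of parsings form a parsing of the limit. Uniqueness passes over because
two sequences of squares whose limits share a border cell agree along the ultrafilter. -/
theorem isClosed_baseShift : IsClosed baseShift := by
  classical
  rw [isClosed_iff_ultrafilter]
  intro x u hu hbase
  have hx : ∀ p, ∀ᶠ y in (u : Filter Config), y p = x p := by
    intro p
    refine hu ?_
    obtain ⟨N, hN⟩ := exists_inWindow {p} (finite_singleton p)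
    exact mem_of_superset (agree_mem_nhds N x) fun z hz => hz p (hN p rfl)
  let PS : Config → Set Square := fun y => if h : y ∈ baseShift then h.choose else ∅
  have hPS : ∀ᶠ y in (u : Filter Config), IsParsing y (PS y) := by
    filter_upwards [hbase] with y hy
    simp only [PS, dif_pos hy]
    exact hy.choose_spec
  have hsel : ∀ P : Config → Square → Prop, (∀ᶠ y in (u : Filter Config), ∃ Q, P y Q) →
      ∃ q : Config → Square, ∀ᶠ y in (u : Filter Config), P y (q y) := by
    intro P h
    refine ⟨fun y => if hy : ∃ Q, P y Q then hy.choose else sq 0 0 0, h.mono fun y hy => ?_⟩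
    simp only [dif_pos hy]
    exact hy.choose_spec
  refine ⟨{Q | ∃ q : Config → Square, (∀ᶠ y in (u : Filter Config), q y ∈ PS y) ∧
    IsLimitSquare u q Q}, ?_, ?_, ?_, ?_, ?_⟩
  · rintro Q ⟨q, hq, hlim⟩
    constructor
    · intro p hp
      obtain ⟨y, ⟨h1, h2⟩, h3, h4⟩ := (((hlim.mem_border.1 hp).and hq).and
        (hPS.and (hx p))).exists
      rw [← h4]
      exact (h3.occurs _ h2).1 p h1
    · intro p hp
      obtain ⟨y, ⟨h1, h2⟩, h3, h4⟩ := (((hlim.mem_interior.1 hp).and hq).and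
        (hPS.and (hx p))).exists
      rw [← h4]
      exact (h3.occurs _ h2).2 p h1
  · intro p hp
    have hev : ∀ᶠ y in (u : Filter Config), ∃ Q, Q ∈ PS y ∧ Icc p (p + (1, 1)) ⊆ Q.interior := by
      have hall : ∀ᶠ y in (u : Filter Config), ∀ q ∈ Icc p (p + (1, 1)), y q = x q :=
        (eventually_all_finite (finite_Icc p (p + (1, 1)))).2 fun q _ => hx q
      filter_upwards [hPS, hall] with y h1 h2
      exact h1.block p fun q hq => (h2 q hq).trans (hp q hq)
    obtain ⟨q, hq⟩ := hsel _ hev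
    have hpm : p ∈ Icc p (p + (1, 1)) := ⟨le_rfl, ⟨by simp, by simp⟩⟩
    obtain ⟨Q, hQ⟩ := exists_isLimitSquare u q (p := p)
      (hq.mono fun y h => Square.mem_of_mem_interior (h.2 hpm))
    exact ⟨Q, ⟨q, hq.mono fun y h => h.1, hQ⟩, fun a ha =>
      hQ.mem_interior.2 (hq.mono fun y h => h.2 ha)⟩
  · intro p hp
    have hev : ∀ᶠ y in (u : Filter Config), ∃ Q, Q ∈ PS y ∧ p ∈ Q.border := by
      filter_upwards [hPS, hx p] with y h1 h2
      exact (h1.border p (h2.trans hp)).exists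
    obtain ⟨q, hq⟩ := hsel _ hev
    obtain ⟨Q, hQ⟩ := exists_isLimitSquare u q (p := p) (hq.mono fun y h => h.2.1)
    refine ⟨Q, ⟨⟨q, hq.mono fun y h => h.1, hQ⟩, hQ.mem_border.2 (hq.mono fun y h => h.2)⟩, ?_⟩
    rintro Q' ⟨⟨q', hq', hQ'⟩, hb'⟩
    have heq : ∀ᶠ y in (u : Filter Config), q' y = q y := by
      filter_upwards [hPS, hq, hq', hQ'.mem_border.1 hb', hx p] with y h1 h2 h3 h4 h5
      exact (h1.border p (h5.trans hp)).unique ⟨h3, h4⟩ h2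
    refine Square.ext ?_ ?_ ?_
    · ext c
      rw [hQ.cols, hQ'.cols]
      exact eventually_congr (heq.mono fun y h => by rw [h])
    · ext c
      rw [hQ.rows, hQ'.rows]
      exact eventually_congr (heq.mono fun y h => by rw [h])
    · rcases hQ.size with h1 | ⟨h1, h1'⟩ <;> rcases hQ'.size with h2 | ⟨h2, h2'⟩
      · obtain ⟨y, ⟨g1, g2⟩, g3⟩ := ((h1.and h2).and heq).exists
        rw [← g1, ← g2, g3]
      · rw [h2]
        symm
        rw [ENat.eq_top_iff_forall_ge]
        intro m
        obtain ⟨y, ⟨g1, g2⟩, g3⟩ := ((h1.and (h2' m)).and heq).exists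
        rwa [← g1, ← g3]
      · rw [h1]
        rw [ENat.eq_top_iff_forall_ge]
        intro m
        obtain ⟨y, ⟨g1, g2⟩, g3⟩ := ((h2.and (h1' m)).and heq).exists
        rwa [← g1, g3]
      · rw [h1, h2]
  · intro Q h1 htop hQ
    obtain ⟨m, hm⟩ := ENat.ne_top_iff_exists.1 htop
    obtain ⟨l, d, rfl⟩ := exists_eq_sq hm.symm
    refine ⟨fun _ => sq l d m, ?_, fun c => by simp, fun c => by simp, Or.inl (by simp)⟩
    have hall : ∀ᶠ y in (u : Filter Config), ∀ p ∈ Ico l (l + m + 2) ×ˢ Ico d (d + m + 2),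
        y p = x p :=
      (eventually_all_finite ((finite_Ico _ _).prod (finite_Ico _ _))).2 fun q _ => hx q
    filter_upwards [hPS, hall] with y h2 h3
    refine h2.visible _ h1 htop ⟨fun p hp => ?_, fun p hp => ?_⟩
    · rw [h3 p hp.1]
      exact hQ.1 p hp
    · rw [h3 p (Square.mem_of_mem_interior hp)]
      exact hQ.2 p hp
  · rintro Q ⟨q, hq, hQ⟩ Q' ⟨q', hq', hQ'⟩
    have hle : ∀ᶠ y in (u : Filter Config), (q y).size ≤ (q' y).size + 1 := by
      filter_upwards [hPS, hq, hq'] with y h1 h2 h3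
      exact h1.size_le _ h2 _ h3
    rcases hQ'.size with h2 | ⟨h2, -⟩
    · rcases hQ.size with h1 | ⟨h1, h1'⟩
      · obtain ⟨y, ⟨g1, g2⟩, g3⟩ := ((h1.and h2).and hle).exists
        rwa [← g1, ← g2]
      · have : Q'.size + 1 = ⊤ := by
          rw [ENat.eq_top_iff_forall_ge]
          intro m
          obtain ⟨y, ⟨g1, g2⟩, g3⟩ := ((h2.and (h1' m)).and hle).exists
          rw [← g1]
          exact g2.trans g3
        rw [this]
        exact le_top
    · rw [h2, top_add]
      exact le_top

end TCPE

namespace TCPE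

open Set Filter Topology

/-! ### Grids -/

/-- Blocks in columns of width `W`, with period `H` in each column. -/
def gridPack (W H : ℤ) (φ : ℤ → ℤ) (s : ℤ × ℤ → ℤ) : Set Blk :=
  {Q | ∃ i j, Q = ⟨W * i, H * j + φ i, s (i, j)⟩}

section Grid

variable {W H : ℤ} {φ : ℤ → ℤ} {s : ℤ × ℤ → ℤ}

theorem mem_gridPack_iff (hW : 0 < W) (hH : 0 < H) (hsW : ∀ q, s q ≤ W) (hsH : ∀ q, s q ≤ H)
    {i j c r : ℤ} : (⟨W * i, H * j + φ i, s (i, j)⟩ : Blk).Mem c r ↔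
      (i = c / W ∧ j = (r - φ i) / H) ∧ c % W < s (i, j) ∧ (r - φ i) % H < s (i, j) := by
  have key : ∀ W i c t : ℤ, 0 < W → t ≤ W → ((W * i ≤ c ∧ c < W * i + t) ↔ (i = c / W ∧ c % W < t)) := by
    intro W i c t hW ht
    have h1 := Int.emod_add_mul_ediv c W
    have h2 := Int.emod_nonneg c hW.ne'
    constructor
    · rintro ⟨g1, g2⟩
      have hi : i = c / W := by
        refine le_antisymm ?_ ?_
        · rw [Int.le_ediv_iff_mul_le hW]
          linarith
        · have : c / W < i + 1 := by
            rw [Int.ediv_lt_iff_lt_mul hW]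
            linarith
          omega
      subst hi
      exact ⟨rfl, by linarith⟩
    · rintro ⟨rfl, h⟩
      constructor <;> linarith
  have h1 := key W i c (s (i, j)) hW (hsW _)
  have h2 := key H j (r - φ i) (s (i, j)) hH (hsH _)
  simp only [Blk.Mem, Blk.Col, Blk.Row]
  have h3 : (H * j + φ i ≤ r ∧ r < H * j + φ i + s (i, j)) ↔
      (H * j ≤ r - φ i ∧ r - φ i < H * j + s (i, j)) := by omega
  rw [h1, h3, h2]
  tauto

theorem covered_gridPack_iff (hW : 0 < W) (hH : 0 < H) (hsW : ∀ q, s q ≤ W) (hsH : ∀ q, s q ≤ H)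
    {c r : ℤ} : Covered (gridPack W H φ s) c r ↔
      c % W < s (c / W, (r - φ (c / W)) / H) ∧
        (r - φ (c / W)) % H < s (c / W, (r - φ (c / W)) / H) := by
  constructor
  · rintro ⟨_, ⟨i, j, rfl⟩, hm⟩
    rw [mem_gridPack_iff hW hH hsW hsH] at hm
    obtain ⟨⟨rfl, rfl⟩, h⟩ := hm
    exact h
  · intro h
    exact ⟨_, ⟨_, _, rfl⟩, (mem_gridPack_iff hW hH hsW hsH).2 ⟨⟨rfl, rfl⟩, h⟩⟩

/-- A cell of the grid exceeds its square by at most one column and one row, so gaps are thin. Along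
such a column or row, within the same cell of the grid, an uncovered position has an uncovered
neighbour. -/
theorem regionPacking_gridPack {A : Set ℤ} (hA : ∀ q, s q ∈ A) (h2 : ∀ q, 2 ≤ s q)
    (hsW : ∀ q, s q ≤ W ∧ W ≤ s q + 1) (hsH : ∀ q, s q ≤ H ∧ H ≤ s q + 1) :
    RegionPacking A univ univ (gridPack W H φ s) := by
  have hW : 2 ≤ W := (h2 0).trans (hsW 0).1
  have hH : 2 ≤ H := (h2 0).trans (hsH 0).1
  have hW0 : 0 < W := by omega
  have hH0 : 0 < H := by omega
  have hsW' : ∀ q, s q ≤ W := fun q => (hsW q).1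
  have hsH' : ∀ q, s q ≤ H := fun q => (hsH q).1
  have hpick : ∀ W : ℤ, 2 ≤ W → ∀ c, ∃ a, c ≤ a ∧ a ≤ c + 1 ∧ a % W < W - 1 := by
    intro W hW c
    have h3 := Int.emod_lt_of_pos c (by omega : 0 < W)
    by_cases h : c % W < W - 1
    · exact ⟨c, le_rfl, by omega, h⟩
    · refine ⟨c + 1, by omega, le_rfl, ?_⟩
      rw [Int.add_emod, (by omega : c % W = W - 1), Int.emod_eq_of_lt (by omega : (0 : ℤ) ≤ 1) (by omega)]
      simp only [sub_add_cancel, Int.emod_self]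
      omega
  have hnbr : ∀ W : ℤ, 2 ≤ W → ∀ c, ∃ a, c - 1 ≤ a ∧ a ≤ c + 1 ∧ a ≠ c ∧ a / W = c / W := by
    intro W hW c
    have h1 := Int.emod_add_mul_ediv c W
    have h2 := Int.emod_nonneg c (by omega : W ≠ 0)
    have h3 := Int.emod_lt_of_pos c (by omega : 0 < W)
    by_cases h : c % W = 0
    · refine ⟨c + 1, by omega, by omega, by omega, ?_⟩
      rw [Int.ediv_eq_iff_of_pos (by omega)]
      constructor <;> linarith
    · refine ⟨c - 1, by omega, by omega, by omega, ?_⟩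
      rw [Int.ediv_eq_iff_of_pos (by omega)]
      have : 1 ≤ c % W := by omega
      constructor <;> linarith
  refine ⟨?_, fun _ _ _ _ _ => ⟨trivial, trivial⟩, ?_, ?_, ?_⟩
  · rintro _ ⟨i, j, rfl⟩
    exact hA _
  · rintro _ ⟨i, j, rfl⟩ _ ⟨i', j', rfl⟩ c r hm hm'
    rw [mem_gridPack_iff hW0 hH0 hsW' hsH'] at hm hm'
    obtain ⟨⟨rfl, rfl⟩, -⟩ := hm
    obtain ⟨⟨rfl, rfl⟩, -⟩ := hm'
    rfl
  · intro c r _ _ _ _ _ _ _ _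
    obtain ⟨a, ha1, ha2, ha3⟩ := hpick W hW c
    obtain ⟨b, hb1, hb2, hb3⟩ := hpick H hH (r - φ (a / W))
    refine ⟨a, b + φ (a / W), ha1, ha2, by omega, by omega, ?_⟩
    rw [covered_gridPack_iff hW0 hH0 hsW' hsH', add_sub_cancel_right]
    have := hsW (a / W, b / H)
    have := hsH (a / W, b / H)
    constructor <;> omega
  · intro c _ r _ hn
    rw [covered_gridPack_iff hW0 hH0 hsW' hsH'] at hn
    by_cases hc : c % W < s (c / W, (r - φ (c / W)) / H)
    · obtain ⟨a, ha1, ha2, ha3, ha4⟩ := hnbr W hW c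
      refine ⟨a, trivial, r, trivial, ?_, by tauto, ha1, ha2, by omega, by omega⟩
      rw [covered_gridPack_iff hW0 hH0 hsW' hsH', ha4]
      tauto
    · obtain ⟨b, hb1, hb2, hb3, hb4⟩ := hnbr H hH (r - φ (c / W))
      refine ⟨c, trivial, b + φ (c / W), trivial, ?_, by omega, by omega, by omega, by omega, by omega⟩
      rw [covered_gridPack_iff hW0 hH0 hsW' hsH', add_sub_cancel_right, hb4]
      tauto

theorem packConfig_gridPack (hW : 0 < W) (hH : 0 < H) (hsW : ∀ q, s q ≤ W) (hsH : ∀ q, s q ≤ H)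
    {c r a b t : ℤ} (ha : c % W = a) (hb : (r - φ (c / W)) % H = b)
    (ht : s (c / W, (r - φ (c / W)) / H) = t) :
    packConfig (gridPack W H φ s) (c, r) = decide (t ≤ a ∨ t ≤ b ∨
      (1 ≤ a ∧ a ≤ t - 2) ∧ (1 ≤ b ∧ b ≤ t - 2)) := by
  subst ha hb ht
  rw [Bool.eq_iff_iff, packConfig_eq_true_iff, decide_eq_true_iff]
  have e1 := Int.emod_add_mul_ediv c W
  have e2 := Int.emod_add_mul_ediv (r - φ (c / W)) H
  constructor
  · intro h
    by_cases hc : Covered (gridPack W H φ s) c r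
    · obtain ⟨Q, hQ, hm⟩ := hc
      have hi := h Q hQ hm
      obtain ⟨i, j, rfl⟩ := hQ
      obtain ⟨⟨rfl, rfl⟩, h1, h2⟩ := (mem_gridPack_iff hW hH hsW hsH).1 hm
      simp only [Blk.Inner] at hi
      omega
    · rw [covered_gridPack_iff hW hH hsW hsH] at hc
      omega
  · rintro h _ ⟨i, j, rfl⟩ hm
    obtain ⟨⟨rfl, rfl⟩, h1, h2⟩ := (mem_gridPack_iff hW hH hsW hsH).1 hm
    simp only at h1 h2
    simp only [Blk.Inner]
    omega

end Grid

/-! ### Sizes of the squares in the configuration of a packing -/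

theorem sizes_packConfig {A : Set ℤ} {P : Set Blk} (hP : RegionPacking A univ univ P)
    {n : ℕ} (hA : ∀ s ∈ A, s = n + 2 ∨ s = n + 3) :
    sizes (packConfig P) = {m : ℕ∞ | ∃ k : ℕ, m = k ∧ ∃ Q ∈ P, Q.s = k + 2} := by
  rw [← (isParsing_packConfig hP hA).sizes_eq]
  ext m
  constructor
  · rintro ⟨_, ⟨l, d, k, hQ, rfl⟩, rfl⟩
    exact ⟨k, rfl, _, hQ, rfl⟩
  · rintro ⟨k, rfl, Q, hQ, hs⟩
    refine ⟨sq Q.l Q.d k, ⟨Q.l, Q.d, k, ?_, rfl⟩, rfl⟩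
    rwa [← hs]

theorem packConfig_mem_baseShift {A : Set ℤ} {P : Set Blk} (hP : RegionPacking A univ univ P)
    {n : ℕ} (hA : ∀ s ∈ A, s = n + 2 ∨ s = n + 3) : packConfig P ∈ baseShift :=
  ⟨_, isParsing_packConfig hP hA⟩

theorem sizes_packConfig_singleton {P : Set Blk} {n : ℕ}
    (hP : RegionPacking {(n : ℤ) + 2} univ univ P) : sizes (packConfig P) = {(n : ℕ∞)} := by
  rw [sizes_packConfig hP (n := n) (by simp)]
  ext m
  constructor
  · rintro ⟨k, rfl, Q, hQ, hs⟩
    have h1 : Q.s = n + 2 := hP.size Q hQ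
    have : k = n := by omega
    simp [this]
  · rintro rfl
    obtain ⟨_, _, _, _, _, _, Q, hQ, -⟩ := hP.blk 0 0 0 0 trivial trivial le_rfl (by simp) le_rfl
      (by simp)
    exact ⟨n, rfl, Q, hQ, hP.size Q hQ⟩

/-- The constant configurations. -/
def constConfig (b : Bool) : Config := fun _ => b

theorem sizes_constConfig_true : sizes (constConfig true) = {⊤} := by
  have h : IsParsing (constConfig true) {⟨univ, univ, ⊤, ordConnected_univ, ordConnected_univ,
      by simp [Set.infinite_univ], by simp [Set.infinite_univ]⟩} := by
    refine ⟨?_, ?_, ?_, ?_, ?_⟩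
    · rintro Q rfl
      refine ⟨fun p hp => ?_, fun p _ => rfl⟩
      exact absurd (by simp [Square.interior]) hp.2
    · intro p _
      exact ⟨_, rfl, fun q _ => by simp [Square.interior]⟩
    · intro p hp
      exact absurd hp (by simp [constConfig])
    · intro Q h1 htop hQ
      exfalso
      obtain ⟨m, hm⟩ := ENat.ne_top_iff_exists.1 htop
      obtain ⟨l, d, rfl⟩ := exists_eq_sq hm.symm
      have := hQ.1 (l, d) (by
        rw [mem_border_sq]
        simp only [Blk.Mem, Blk.Col, Blk.Row, Blk.Inner]
        omega)
      exact absurd this (by simp [constConfig])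
    · rintro Q rfl Q' rfl
      exact le_top
  rw [← h.sizes_eq]
  simp

theorem sizes_constConfig_false : sizes (constConfig false) = {((0 : ℕ) : ℕ∞)} := by
  have hP := regionPacking_gridPack (W := 2) (H := 2) (φ := fun _ => 0) (s := fun _ => 2)
    (A := {((0 : ℕ) : ℤ) + 2}) (by simp) (by simp) (by simp) (by simp)
  have e : constConfig false = packConfig (gridPack 2 2 (fun _ => 0) (fun _ => 2)) := by
    funext ⟨c, r⟩
    rw [packConfig_gridPack (by norm_num) (by norm_num) (by simp) (by simp) rfl rfl rfl]
    symm
    simp only [constConfig, decide_eq_false_iff_not]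
    omega
  rw [e]
  exact sizes_packConfig_singleton hP

theorem constConfig_mem_baseShift (b : Bool) : constConfig b ∈ baseShift := by
  cases b
  · exact mem_baseShift_of_mem_sizes (n := ((0 : ℕ) : ℕ∞)) (by simp [sizes_constConfig_false])
  · exact mem_baseShift_of_mem_sizes (n := ⊤) (by simp [sizes_constConfig_true])

/-- A configuration with squares of size `n` only, in which some column is constantly `0` and every
row has a `1`. -/
theorem exists_columns (n : ℕ) : ∃ y : Config, sizes y = {(n : ℕ∞)} ∧ (∀ r, y (0, r) = false) ∧
    ∀ r, ∃ c, y (c, r) = true := by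
  -- Width `n + 3` and height `n + 2`: the squares are stacked without gaps in columns separated by
  -- columns of `1`s.
  have hP := regionPacking_gridPack (W := n + 3) (H := n + 2) (φ := fun _ => 0)
    (s := fun _ => (n : ℤ) + 2) (A := {(n : ℤ) + 2}) (by simp) (by simp) (by simp; omega)
    (by simp)
  refine ⟨_, sizes_packConfig_singleton hP, fun r => ?_, fun r => ⟨n + 2, ?_⟩⟩
  · rw [packConfig_gridPack (by omega) (by omega) (by intro; omega) (by intro; omega) rfl rfl rfl]
    have := Int.emod_lt_of_pos r (by omega : (0 : ℤ) < n + 2)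
    simp only [Int.zero_emod, decide_eq_false_iff_not, sub_zero]
    omega
  · rw [packConfig_gridPack (by omega) (by omega) (by intro; omega) (by intro; omega) rfl rfl rfl]
    rw [Int.emod_eq_of_lt (by omega) (by omega)]
    simp

/-- Every `2 × 2` pattern occurs in a configuration with squares of size two only. -/
theorem exists_pattern (w : Bool → Bool → Bool) (p : ℤ × ℤ) : ∃ y : Config, sizes y = {((2 : ℕ) : ℕ∞)} ∧
    y p = w false false ∧ y (p.1 + 1, p.2) = w true false ∧ y (p.1, p.2 + 1) = w false true ∧
    y (p.1 + 1, p.2 + 1) = w true true := by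
  let val : ℤ → ℤ → ℤ → ℤ → ℤ → Bool := fun W H k c r =>
    decide (4 ≤ c % W ∨ 4 ≤ (r - k * (c / W)) % H ∨
      (1 ≤ c % W ∧ c % W ≤ 4 - 2) ∧ (1 ≤ (r - k * (c / W)) % H ∧ (r - k * (c / W)) % H ≤ 4 - 2))
  -- Blocks of side 4 in a grid with periods 4 or 5, columns shifted by `k` relative to each other;
  -- two of the sixteen patterns need a nonzero shift.
  have hval : ∀ w₀ w₁ w₂ w₃ : Bool, ∃ W H k c r : ℤ, (W = 4 ∨ W = 5) ∧ (H = 4 ∨ H = 5) ∧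
      val W H k c r = w₀ ∧ val W H k (c + 1) r = w₁ ∧ val W H k c (r + 1) = w₂ ∧
      val W H k (c + 1) (r + 1) = w₃ := by
    intro w₀ w₁ w₂ w₃
    cases w₀ <;> cases w₁ <;> cases w₂ <;> cases w₃
    · exact ⟨4, 5, 0, 3, 0, by decide⟩
    · exact ⟨5, 5, 0, 0, 0, by decide⟩
    · exact ⟨5, 5, 0, 2, 0, by decide⟩
    · exact ⟨5, 5, 0, 1, 0, by decide⟩
    · exact ⟨5, 5, 0, 0, 2, by decide⟩
    · exact ⟨5, 5, 0, 0, 1, by decide⟩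
    · exact ⟨4, 5, -1, 3, 3, by decide⟩
    · exact ⟨5, 5, 0, 3, 3, by decide⟩
    · exact ⟨5, 5, 0, 2, 2, by decide⟩
    · exact ⟨4, 5, 1, 3, 4, by decide⟩
    · exact ⟨5, 5, 0, 2, 1, by decide⟩
    · exact ⟨5, 5, 0, 4, 3, by decide⟩
    · exact ⟨5, 5, 0, 1, 2, by decide⟩
    · exact ⟨5, 5, 0, 3, 4, by decide⟩
    · exact ⟨5, 5, 0, 4, 4, by decide⟩
    · exact ⟨5, 5, 0, 1, 1, by decide⟩
  obtain ⟨W, H, k, c, r, hW, hH, h0, h1, h2, h3⟩ := hval (w false false) (w true false)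
    (w false true) (w true true)
  have hP := regionPacking_gridPack (W := W) (H := H) (φ := fun i => k * i)
    (s := fun _ => 4) (A := {((2 : ℕ) : ℤ) + 2}) (by simp) (by simp) (by intro; omega)
    (by intro; omega)
  have hv : ∀ c r, packConfig (gridPack W H (fun i => k * i) (fun _ => 4)) (c, r) = val W H k c r := by
    intro c r
    rw [packConfig_gridPack (by omega) (by omega) (by intro; omega) (by intro; omega) rfl rfl rfl]
  refine ⟨(p - (c, r)) +ᵥ packConfig (gridPack W H (fun i => k * i) (fun _ => 4)), ?_, ?_⟩
  · rw [sizes_vadd]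
    exact sizes_packConfig_singleton hP
  · simp only [vadd_config_apply]
    refine ⟨?_, ?_, ?_, ?_⟩
    · rw [← h0, ← hv]; congr 1; ext <;> simp
    · rw [← h1, ← hv]; congr 1; (ext <;> simp); ring
    · rw [← h2, ← hv]; congr 1; (ext <;> simp); ring
    · rw [← h3, ← hv]; congr 1; ext <;> simp <;> ring

/-! ### Independence in the base shift -/

theorem RegionPacking.mono {A A' U V : Set ℤ} {P : Set Blk} (h : RegionPacking A U V P)
    (hA : A ⊆ A') : RegionPacking A' U V P :=
  ⟨fun Q hQ => hA (h.size Q hQ), h.sub, h.disj, h.blk, h.iso⟩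

/-- Large patterns of two configurations whose squares have the sizes `n` and `n + 1` can be placed
independently on a lattice. -/
theorem exists_independent {n : ℕ} {F : Set ℕ∞} (hF : F ⊆ {(n : ℕ∞), (n : ℕ∞) + 1}) {x y : Config}
    (hx : x ∈ baseShift) (hy : y ∈ baseShift) (hxF : sizes x ⊆ F) (hyF : sizes y ⊆ F) (N : ℕ) :
    ∃ K : ℕ, 0 < K ∧ ∀ θ : ℤ × ℤ → Bool, ∃ z ∈ baseShift, sizes z ⊆ F ∧ ∀ q p : ℤ × ℤ,
      InWindow N p → z (K * q.1 + p.1, K * q.2 + p.2) = if θ q then x p else y p := by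
  classical
  obtain ⟨A, hA⟩ : ∃ A : Set ℤ, A = {s : ℤ | ∃ k : ℕ, (k : ℕ∞) ∈ F ∧ s = k + 2} := ⟨_, rfl⟩
  have hFn : ∀ k : ℕ, (k : ℕ∞) ∈ F → k = n ∨ k = n + 1 := by
    intro k hk
    rcases hF hk with h | h
    · exact Or.inl (by exact_mod_cast h)
    · exact Or.inr (by
        have : (k : ℕ∞) = ((n + 1 : ℕ) : ℕ∞) := by push_cast; exact h
        exact_mod_cast this)
  have hAn : ∀ s ∈ A, s = n + 2 ∨ s = n + 3 := by
    rw [hA]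
    rintro s ⟨k, hk, rfl⟩
    rcases hFn k hk with rfl | rfl
    · exact Or.inl rfl
    · exact Or.inr (by push_cast; ring)
  have hpack : ∀ w ∈ baseShift, sizes w ⊆ F → ∃ P, RegionPacking A univ univ P ∧ w = packConfig P := by
    rintro w ⟨S, hS⟩ hw
    have hfin : ∀ Q ∈ S, Q.size ≠ ⊤ := by
      intro Q hQ htop
      have := hF (hw ⟨S, hS, Q, hQ, rfl⟩)
      rw [htop] at this
      rcases this with h | h
      · exact absurd h.symm (by simp)
      · have h' : (⊤ : ℕ∞) = ((n + 1 : ℕ) : ℕ∞) := by push_cast; exact h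
        exact absurd h'.symm (ENat.natCast_ne_top _)
    obtain ⟨h1, h2⟩ := hS.regionPacking hfin
    refine ⟨_, h1.mono ?_, h2⟩
    rw [hA]
    rintro s ⟨Q, hQ, k, hk, rfl⟩
    exact ⟨k, hk ▸ hw ⟨S, hS, Q, hQ, rfl⟩, rfl⟩
  obtain ⟨P, hP, rfl⟩ := hpack x hx hxF
  obtain ⟨P', hP', rfl⟩ := hpack y hy hyF
  have hAM : ∀ s ∈ A, 2 ≤ s ∧ s ≤ n + 3 := by
    intro s hs
    have := hAn s hs
    omega
  -- The parameter `N + 1` makes the half-open window contain `[-N, N]²`.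
  have e1 := exists_box hP hAM (N + 1) (by omega)
  have e2 := exists_box hP' hAM (N + 1) (by omega)
  -- Each side may be any sufficiently large number, so both packings are cut down to the same box.
  obtain ⟨H, ⟨h1, h2⟩, hH⟩ := ((e1.and e2).and (eventually_ge_atTop (N + 1 : ℤ))).exists
  obtain ⟨D, ⟨h3, h4⟩, hD⟩ := ((h1.and h2).and (eventually_ge_atTop (N + 1 : ℤ))).exists
  obtain ⟨R, ⟨h5, h6⟩, hR⟩ := ((h3.and h4).and (eventually_ge_atTop (N + 1 : ℤ))).exists
  obtain ⟨L, ⟨⟨B, hB, hBm⟩, B', hB', hBm'⟩, hL⟩ :=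
    ((h5.and h6).and (eventually_ge_atTop (N + 1 : ℤ))).exists
  have hW : 0 < L + R := by omega
  have hHt : 0 < D + H := by omega
  refine ⟨((L + R) * (D + H)).toNat, by
    have := mul_pos hW hHt
    omega, fun θ => ?_⟩
  rw [Int.toNat_of_nonneg (mul_pos hW hHt).le]
  -- The boxes are not square, so the lattice has as its period the product of the two sides; box
  -- `((D + H) * q.1, (L + R) * q.2)` sits at the lattice point `q`, and the boxes between are
  -- filled arbitrarily.
  let p : ℤ × ℤ → Set Blk := fun q => if θ (q.1 / (D + H), q.2 / (L + R)) then B else B'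
  have hp : ∀ q, RegionPacking A (Ico (-L) (-L + (L + R))) (Ico (-D) (-D + (D + H))) (p q) := by
    intro q
    rw [neg_add_cancel_left, neg_add_cancel_left]
    simp only [p]
    split_ifs
    · exact hB
    · exact hB'
  have harr := RegionPacking.array hW hHt hp
  refine ⟨packConfig (arrayPacking (L + R) (D + H) p), packConfig_mem_baseShift harr hAn, ?_, ?_⟩
  · rw [sizes_packConfig harr hAn]
    rintro m ⟨k, rfl, Q, hQ, hs⟩
    have := harr.size Q hQ
    rw [hA] at this
    obtain ⟨k', hk', hs'⟩ := this
    obtain rfl : k = k' := by omega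
    exact hk'
  · rintro q ⟨c, r⟩ hw
    unfold InWindow at hw
    simp only at hw
    have idx : ∀ (a W u v c : ℤ), 0 < W → -a ≤ c - W * u → c - W * u < -a + W → -a ≤ c - W * v →
        c - W * v < -a + W → u = v := by
      have key : ∀ (a W u v c : ℤ), 0 < W → -a ≤ c - W * u → c - W * v < -a + W → u ≤ v := by
        intro a W u v c hW h1 h2
        by_contra hcon
        have : v + 1 ≤ u := by omega
        nlinarith
      exact fun a W u v c hW h1 h2 h3 h4 => le_antisymm (key a W u v c hW h1 h4)
        (key a W v u c hW h3 h2)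
    have hpq : p ((D + H) * q.1, (L + R) * q.2) = if θ q then B else B' := by
      simp only [p, Int.mul_ediv_cancel_left _ hHt.ne', Int.mul_ediv_cancel_left _ hW.ne', Prod.mk.eta]
    have hcell : ∀ (Z Z' : Set Blk), (∀ Q, Q.Meets (N + 1) → (Q ∈ Z ↔ Q ∈ Z')) →
        p ((D + H) * q.1, (L + R) * q.2) = Z →
        packConfig (arrayPacking (L + R) (D + H) p)
          ((L + R) * (D + H) * q.1 + c, (L + R) * (D + H) * q.2 + r) = packConfig Z' (c, r) := by
      intro Z Z' hZ hpZ
      rw [Bool.eq_iff_iff, ← not_iff_not, Bool.not_eq_true, Bool.not_eq_true,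
        packConfig_eq_false_iff, packConfig_eq_false_iff]
      constructor
      · rintro ⟨Q, ⟨i, hQ⟩, hm, hi⟩
        have hsub := (hp i).sub _ hQ ((L + R) * (D + H) * q.1 + c - (L + R) * i.1)
          ((L + R) * (D + H) * q.2 + r - (D + H) * i.2) (by
            simp only [Blk.Mem, Blk.Col, Blk.Row] at hm ⊢
            omega)
        have ei1 : i.1 = (D + H) * q.1 := idx L (L + R) _ _ ((L + R) * (D + H) * q.1 + c) hW
          hsub.1.1 hsub.1.2 (by rw [← mul_assoc]; omega) (by rw [← mul_assoc]; omega)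
        have ei2 : i.2 = (L + R) * q.2 := idx D (D + H) _ _ ((L + R) * (D + H) * q.2 + r) hHt
          hsub.2.1 hsub.2.2 (by rw [← mul_assoc, mul_comm (D + H)]; omega)
          (by rw [← mul_assoc, mul_comm (D + H)]; omega)
        obtain rfl : i = ((D + H) * q.1, (L + R) * q.2) := Prod.ext ei1 ei2
        rw [hpZ] at hQ
        have e3 : (L + R) * ((D + H) * q.1) = (L + R) * (D + H) * q.1 := by ring
        have e4 : (D + H) * ((L + R) * q.2) = (L + R) * (D + H) * q.2 := by ring
        simp only [e3, e4] at hQ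
        simp only [Blk.Mem, Blk.Col, Blk.Row, Blk.Inner] at hm hi
        refine ⟨_, (hZ _ ⟨c, r, ?_, ?_⟩).1 hQ, ?_, ?_⟩
        · simp only [Blk.Mem, Blk.Col, Blk.Row]
          omega
        · omega
        · simp only [Blk.Mem, Blk.Col, Blk.Row]
          omega
        · simp only [Blk.Inner]
          omega
      · rintro ⟨Q, hQ, hm, hi⟩
        have hQZ := (hZ Q ⟨c, r, hm, by omega⟩).2 hQ
        refine ⟨⟨Q.l + (L + R) * (D + H) * q.1, Q.d + (L + R) * (D + H) * q.2, Q.s⟩,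
          ⟨((D + H) * q.1, (L + R) * q.2), ?_⟩, ?_, ?_⟩
        · rw [hpZ]
          convert hQZ using 1
          ext <;> simp only
          · ring
          · ring
        · simp only [Blk.Mem, Blk.Col, Blk.Row] at hm ⊢
          omega
        · simp only [Blk.Inner] at hi ⊢
          omega
    cases hθ : θ q
    · rw [hθ] at hpq
      simpa using hcell B' P' hBm' (by simpa using hpq)
    · rw [hθ] at hpq
      simpa using hcell B P hBm (by simpa using hpq)

end TCPE

namespace TCPE

open Set Filter Topology

/-! ### Degenerate squares -/

theorem exists_left_edge {I : Set ℤ} {c p : ℤ} (hc : c ∉ I) (hp : p ∈ I) (hcp : c ≤ p) :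
    ∃ l, c < l ∧ l ≤ p ∧ l ∈ I ∧ l - 1 ∉ I := by
  obtain ⟨k, hk⟩ : ∃ k : ℕ, p = c + k := ⟨(p - c).toNat, by omega⟩
  subst hk
  induction k with
  | zero => simp at hp; exact absurd hp hc
  | succ k ih =>
    push_cast at hp ⊢
    by_cases h : c + k ∈ I
    · obtain ⟨l, h1, h2, h3⟩ := ih h (by omega)
      exact ⟨l, h1, by omega, h3⟩
    · refine ⟨c + (k + 1), by omega, le_rfl, hp, ?_⟩
      rwa [(by ring : c + ((k : ℤ) + 1) - 1 = c + k)]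

theorem exists_right_edge {I : Set ℤ} {c p : ℤ} (hc : c ∉ I) (hp : p ∈ I) (hcp : p ≤ c) :
    ∃ l, p ≤ l ∧ l < c ∧ l ∈ I ∧ l + 1 ∉ I := by
  obtain ⟨l, h1, h2, h3, h4⟩ := exists_left_edge (I := {a | -a ∈ I}) (c := -c) (p := -p)
    (by simpa using hc) (by simpa using hp) (by omega)
  refine ⟨-l, by omega, by omega, h3, fun h => h4 ?_⟩
  change -(l - 1) ∈ I
  convert h using 1
  ring

/-- Disjointness including degenerate squares: if one interval is not contained in the other, an
edge between them gives a common border cell. -/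
theorem IsParsing.eq_of_mem {x : Config} {S : Set Square} (hS : IsParsing x S) {Q Q' : Square}
    (hQ : Q ∈ S) (hQ' : Q' ∈ S) {p : ℤ × ℤ} (hp : p.1 ∈ Q.cols ∧ p.2 ∈ Q.rows)
    (hp' : p.1 ∈ Q'.cols ∧ p.2 ∈ Q'.rows) : Q = Q' := by
  have hb : ∀ Q ∈ S, ∀ Q' ∈ S, ∀ a, a ∈ Q.border → a.1 ∈ Q'.cols → a.2 ∈ Q'.rows → Q = Q' := by
    intro Q hQ Q' hQ' a ha h1 h2
    have hf := (hS.occurs Q hQ).1 a ha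
    refine (hS.border a hf).unique ⟨hQ, ha⟩ ⟨hQ', ⟨h1, h2⟩, fun hi => ?_⟩
    have := (hS.occurs Q' hQ').2 a hi
    simp [hf] at this
  by_contra hne
  have hsub : ∀ Q ∈ S, ∀ Q' ∈ S, Q ≠ Q' → p.1 ∈ Q.cols ∧ p.2 ∈ Q.rows →
      p.1 ∈ Q'.cols ∧ p.2 ∈ Q'.rows → Q.cols ⊆ Q'.cols ∧ Q.rows ⊆ Q'.rows := by
    intro Q hQ Q' hQ' hne hp hp'
    constructor
    · intro c hc
      by_contra hcon
      rcases le_total c p.1 with h | h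
      · obtain ⟨l, h1, h2, h3, h4⟩ := exists_left_edge hcon hp'.1 h
        exact hne (hb Q' hQ' Q hQ (l, p.2) ⟨⟨h3, hp'.2⟩, fun hi => h4 hi.1⟩
          (Q.cols_ordConnected.out hc hp.1 ⟨h1.le, h2⟩) hp.2).symm
      · obtain ⟨l, h1, h2, h3, h4⟩ := exists_right_edge hcon hp'.1 h
        exact hne (hb Q' hQ' Q hQ (l, p.2) ⟨⟨h3, hp'.2⟩, fun hi => h4 hi.2.1⟩
          (Q.cols_ordConnected.out hp.1 hc ⟨h1, h2.le⟩) hp.2).symm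
    · intro c hc
      by_contra hcon
      rcases le_total c p.2 with h | h
      · obtain ⟨l, h1, h2, h3, h4⟩ := exists_left_edge hcon hp'.2 h
        exact hne (hb Q' hQ' Q hQ (p.1, l) ⟨⟨hp'.1, h3⟩, fun hi => h4 hi.2.2.1⟩
          hp.1 (Q.rows_ordConnected.out hc hp.2 ⟨h1.le, h2⟩)).symm
      · obtain ⟨l, h1, h2, h3, h4⟩ := exists_right_edge hcon hp'.2 h
        exact hne (hb Q' hQ' Q hQ (p.1, l) ⟨⟨hp'.1, h3⟩, fun hi => h4 hi.2.2.2⟩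
          hp.1 (Q.rows_ordConnected.out hp.2 hc ⟨h1, h2.le⟩)).symm
  have h1 := hsub Q hQ Q' hQ' hne hp hp'
  have h2 := hsub Q' hQ' Q hQ (Ne.symm hne) hp' hp
  have hcols := h1.1.antisymm h2.1
  refine hne (Square.ext hcols (h1.2.antisymm h2.2) ?_)
  have h3 := Q.cols_encard
  rw [hcols, Q'.cols_encard] at h3
  exact (ENat.add_left_injective_of_ne_top (by simp) h3).symm

theorem infinite_ordConnected_cases {I : Set ℤ} (hI : I.OrdConnected) (hinf : I.Infinite) :
    I = univ ∨ (∃ l, I = Ici l) ∨ ∃ u, I = Iic u := by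
  obtain ⟨p, hp⟩ := hinf.nonempty
  have hup : ∀ u, u ∈ I → u + 1 ∉ I → ∀ e ∈ I, e ≤ u := by
    intro u hu hu' e he
    by_contra hcon
    exact hu' (hI.out hu he ⟨by omega, by omega⟩)
  have hlow : ∀ l, l ∈ I → l - 1 ∉ I → ∀ e ∈ I, l ≤ e := by
    intro u hu hu' e he
    by_contra hcon
    exact hu' (hI.out he hu ⟨by omega, by omega⟩)
  by_cases h1 : ∃ c, c ∉ I ∧ c ≤ p
  · obtain ⟨c, hc, hcp⟩ := h1
    obtain ⟨l, -, -, hl, hl'⟩ := exists_left_edge hc hp hcp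
    refine Or.inr (Or.inl ⟨l, Set.Subset.antisymm (fun e he => hlow l hl hl' e he) ?_⟩)
    intro e he
    by_contra hcon
    obtain ⟨u, -, -, hu, hu'⟩ := exists_right_edge hcon hl he
    exact hinf ((finite_Icc l u).subset fun e he => ⟨hlow l hl hl' e he, hup u hu hu' e he⟩)
  · push Not at h1
    by_cases h2 : ∃ c, c ∉ I ∧ p ≤ c
    · obtain ⟨c, hc, hcp⟩ := h2
      obtain ⟨u, -, -, hu, hu'⟩ := exists_right_edge hc hp hcp
      refine Or.inr (Or.inr ⟨u, Set.Subset.antisymm (fun e he => hup u hu hu' e he) ?_⟩)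
      intro e he
      by_contra hcon
      have := h1 e hcon
      exact hcon (hI.out hp hu ⟨this.le, he⟩)
    · push Not at h2
      left
      ext e
      simp only [mem_univ, iff_true]
      by_contra hcon
      have := h1 e hcon
      have := h2 e hcon
      omega

theorem emod_le_self_of_nonneg {a : ℤ} (s : ℤ) (ha : 0 ≤ a) (hs : 0 ≤ s) : a % s ≤ a := by
  have h1 := Int.emod_add_mul_ediv a s
  have h2 := mul_nonneg hs (Int.ediv_nonneg ha hs)
  omega

/-- `a` is the origin of a subdivision of `I` into intervals of length `s`. -/
structure IsAnchor (I : Set ℤ) (s a : ℤ) : Prop where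
  sub : ∀ c ∈ I, ∀ e, c - (c - a) % s ≤ e → e < c - (c - a) % s + s → e ∈ I
  left : ∀ c ∈ I, c - 1 ∉ I → (c - a) % s = 0
  right : ∀ c ∈ I, c + 1 ∉ I → (c - a) % s = s - 1

/-- A half-line is subdivided from its end. The full line is subdivided from `-(s / 2)`, so that the
seams leave every bounded set as `s` grows. -/
theorem exists_isAnchor {I : Set ℤ} (hI : I.OrdConnected) (hinf : I.Infinite) :
    ∃ a : ℤ → ℤ, (∀ s, 2 ≤ s → IsAnchor I s (a s)) ∧ ∀ c, c - 1 ∈ I → c + 1 ∈ I →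
      ∀ᶠ s in atTop, 1 ≤ (c - a s) % s ∧ (c - a s) % s ≤ s - 2 := by
  rcases infinite_ordConnected_cases hI hinf with rfl | ⟨l, rfl⟩ | ⟨u, rfl⟩
  · refine ⟨fun s => -(s / 2), fun s hs => ⟨fun _ _ _ _ _ => trivial, fun c _ h => absurd trivial h,
      fun c _ h => absurd trivial h⟩, fun c _ _ => ?_⟩
    filter_upwards [eventually_ge_atTop (3 * |c| + 10)] with s hs
    have h1 := neg_abs_le c
    have h2 := le_abs_self c
    rw [Int.emod_eq_of_lt (by omega) (by omega)]
    omega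
  · refine ⟨fun _ => l, fun s hs => ⟨?_, ?_, ?_⟩, fun c hc _ => ?_⟩
    · intro c hc e h1 h2
      have hc' : l ≤ c := hc
      beta_reduce at h1 h2
      have := emod_le_self_of_nonneg (a := c - l) s (by omega) (by omega)
      change l ≤ e
      omega
    · intro c hc hc'
      have h1 : l ≤ c := hc
      have h2 : ¬ l ≤ c - 1 := hc'
      obtain rfl : c = l := by omega
      simp
    · intro c hc hc'
      have h1 : l ≤ c := hc
      have h2 : ¬ l ≤ c + 1 := hc'
      omega
    · have h1 : l ≤ c - 1 := hc
      filter_upwards [eventually_ge_atTop (c - l + 2)] with s hs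
      rw [Int.emod_eq_of_lt (by omega) (by omega)]
      omega
  · have key : ∀ s, 2 ≤ s → ∀ c, c ≤ u → (c - (u + 1)) % s = s - 1 - (u - c) % s := by
      intro s hs c _
      have e1 := Int.emod_add_mul_ediv (u - c) s
      have e2 := Int.emod_nonneg (u - c) (by omega : s ≠ 0)
      have e3 := Int.emod_lt_of_pos (u - c) (by omega : 0 < s)
      have e4 : c - (u + 1) = (s - 1 - (u - c) % s) + s * (-((u - c) / s) - 1) := by linarith
      rw [e4, Int.add_mul_emod_self_left, Int.emod_eq_of_lt (by omega) (by omega)]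
    refine ⟨fun _ => u + 1, fun s hs => ⟨?_, ?_, ?_⟩, fun c _ hc => ?_⟩
    · intro c hc e h1 h2
      have hc' : c ≤ u := hc
      have := emod_le_self_of_nonneg (a := u - c) s (by omega) (by omega)
      rw [key s hs c hc'] at h2
      change e ≤ u
      omega
    · intro c hc hc'
      have h1 : c ≤ u := hc
      have h2 : ¬ c - 1 ≤ u := hc'
      omega
    · intro c hc hc'
      have h1 : c ≤ u := hc
      have h2 : ¬ c + 1 ≤ u := hc'
      obtain rfl : c = u := by omega
      rw [key s hs c le_rfl]
      simp
    · have h1 : c + 1 ≤ u := hc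
      filter_upwards [eventually_ge_atTop (u - c + 2)] with s hs
      rw [key s (by omega) c (by omega), Int.emod_eq_of_lt (by omega) (by omega)]
      omega

/-- A configuration with degenerate squares is a limit of configurations with squares of one large
size. -/
theorem eventually_exists_agree {x : Config} (hx : ⊤ ∈ sizes x) (N : ℕ) :
    ∀ᶠ m : ℕ in atTop, ∃ y, sizes y = {(m : ℕ∞)} ∧ Agree N x y := by
  classical
  obtain ⟨S, hS⟩ := mem_baseShift_of_mem_sizes hx
  have htop : ∀ Q ∈ S, Q.size = ⊤ := by
    intro Q hQ
    have := sizes_le hx ⟨S, hS, Q, hQ, rfl⟩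
    rw [top_le_iff] at this
    simpa using this
  have hinf : ∀ Q ∈ S, Q.cols.Infinite ∧ Q.rows.Infinite := by
    intro Q hQ
    rw [← Set.encard_eq_top_iff, ← Set.encard_eq_top_iff, Q.cols_encard, Q.rows_encard, htop Q hQ]
    simp
  have hanch : ∀ I : Set ℤ, ∃ a : ℤ → ℤ, I.OrdConnected → I.Infinite →
      (∀ s, 2 ≤ s → IsAnchor I s (a s)) ∧ ∀ c, c - 1 ∈ I → c + 1 ∈ I →
        ∀ᶠ s in atTop, 1 ≤ (c - a s) % s ∧ (c - a s) % s ≤ s - 2 := by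
    intro I
    by_cases h : I.OrdConnected ∧ I.Infinite
    · obtain ⟨a, ha⟩ := exists_isAnchor h.1 h.2
      exact ⟨a, fun _ _ => ha⟩
    · exact ⟨fun _ => 0, fun h1 h2 => absurd ⟨h1, h2⟩ h⟩
  choose a ha using hanch
  have hac : ∀ Q ∈ S, ∀ s, 2 ≤ s → IsAnchor Q.cols s (a Q.cols s) := fun Q hQ =>
    (ha _ Q.cols_ordConnected (hinf Q hQ).1).1
  have har : ∀ Q ∈ S, ∀ s, 2 ≤ s → IsAnchor Q.rows s (a Q.rows s) := fun Q hQ =>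
    (ha _ Q.rows_ordConnected (hinf Q hQ).2).1
  -- The block through the cell `(c, r)` in the subdivision of the degenerate square `Q` into blocks
  -- of side `s`.
  let B : Square → ℤ → ℤ → ℤ → Blk := fun Q s c r =>
    ⟨c - (c - a Q.cols s) % s, r - (r - a Q.rows s) % s, s⟩
  let P : ℤ → Set Blk := fun s => {b | ∃ Q ∈ S, ∃ c ∈ Q.cols, ∃ r ∈ Q.rows, b = B Q s c r}
  have hmod : ∀ s t c e : ℤ, 2 ≤ s → c - (c - t) % s ≤ e → e < c - (c - t) % s + s →
      e - (e - t) % s = c - (c - t) % s := by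
    intro s t c e hs h1 h2
    have e1 := Int.emod_add_mul_ediv (c - t) s
    have e4 : e - t = (e - c + (c - t) % s) + s * ((c - t) / s) := by linarith
    rw [e4, Int.add_mul_emod_self_left, Int.emod_eq_of_lt (by omega) (by omega)]
    ring
  have hself : ∀ s t c : ℤ, 2 ≤ s → c - (c - t) % s ≤ c ∧ c < c - (c - t) % s + s := by
    intro s t c hs
    have e2 := Int.emod_nonneg (c - t) (by omega : s ≠ 0)
    have e3 := Int.emod_lt_of_pos (c - t) (by omega : 0 < s)
    omega
  -- a block of the subdivision is determined by a square and a cell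
  have hPmem : ∀ s, 2 ≤ s → ∀ b ∈ P s, ∀ c r, b.Mem c r →
      ∃ Q ∈ S, c ∈ Q.cols ∧ r ∈ Q.rows ∧ b = B Q s c r := by
    rintro s hs _ ⟨Q, hQ, c, hc, r, hr, rfl⟩ c' r' ⟨hm1, hm2⟩
    refine ⟨Q, hQ, (hac Q hQ s hs).sub c hc c' hm1.1 hm1.2, (har Q hQ s hs).sub r hr r' hm2.1 hm2.2,
      ?_⟩
    simp only [B, hmod s _ c c' hs hm1.1 hm1.2, hmod s _ r r' hs hm2.1 hm2.2]
  have hPB : ∀ s, 2 ≤ s → ∀ Q ∈ S, ∀ c ∈ Q.cols, ∀ r ∈ Q.rows, B Q s c r ∈ P s ∧ (B Q s c r).Mem c r :=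
    fun s hs Q hQ c hc r hr => ⟨⟨Q, hQ, c, hc, r, hr, rfl⟩, hself s _ c hs, hself s _ r hs⟩
  have hcov : ∀ s, 2 ≤ s → ∀ c r, Covered (P s) c r ↔ ∃ Q ∈ S, c ∈ Q.cols ∧ r ∈ Q.rows := by
    intro s hs c r
    constructor
    · rintro ⟨b, hb, hm⟩
      obtain ⟨Q, hQ, h1, h2, -⟩ := hPmem s hs b hb c r hm
      exact ⟨Q, hQ, h1, h2⟩
    · rintro ⟨Q, hQ, h1, h2⟩
      exact ⟨_, hPB s hs Q hQ c h1 r h2⟩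
  have hzero : ∀ c r, x (c, r) = false → ∃ Q ∈ S, c ∈ Q.cols ∧ r ∈ Q.rows := by
    intro c r h
    obtain ⟨Q, ⟨hQ, hb⟩, -⟩ := hS.border (c, r) h
    exact ⟨Q, hQ, hb.1.1, hb.1.2⟩
  have hpack : ∀ s, 2 ≤ s → RegionPacking {s} univ univ (P s) := by
    intro s hs
    refine ⟨?_, fun _ _ _ _ _ => ⟨trivial, trivial⟩, ?_, ?_, ?_⟩
    · rintro _ ⟨Q, hQ, c, hc, r, hr, rfl⟩
      rfl
    · intro b hb b' hb' c r hm hm'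
      obtain ⟨Q, hQ, h1, h2, rfl⟩ := hPmem s hs b hb c r hm
      obtain ⟨Q', hQ', h1', h2', rfl⟩ := hPmem s hs b' hb' c r hm'
      rw [hS.eq_of_mem hQ hQ' (p := (c, r)) ⟨h1, h2⟩ ⟨h1', h2'⟩]
    · intro c r _ _ _ _ _ _ _ _
      by_contra hcon
      push Not at hcon
      obtain ⟨Q, hQ, hsub⟩ := hS.block (c, r) (by
        rintro ⟨a, b⟩ ⟨⟨g1, g3⟩, ⟨g2, g4⟩⟩
        rw [← Bool.not_eq_false]
        exact fun hf => hcon a b g1 g2 g3 g4 ((hcov s hs a b).2 (hzero a b hf)))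
      have := Square.mem_of_mem_interior (hsub (show (c, r) ∈ Icc (c, r) ((c, r) + (1, 1)) from
        ⟨le_rfl, ⟨by simp, by simp⟩⟩))
      exact hcon c r le_rfl (by omega) le_rfl (by omega) ((hcov s hs c r).2 ⟨Q, hQ, this⟩)
    · intro c _ r _ hn
      by_contra hcon
      push Not at hcon
      have hnb : ∀ a b, c - 1 ≤ a → a ≤ c + 1 → r - 1 ≤ b → b ≤ r + 1 → ¬ (a = c ∧ b = r) →
          x (a, b) = false := by
        intro a b h1 h2 h3 h4 h5
        have hc : Covered (P s) a b := by
          by_contra hnc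
          have := hcon a trivial b trivial hnc (by tauto) h1 h2 h3
          omega
        obtain ⟨Q, hQ, hm⟩ := (hcov s hs a b).1 hc
        refine (hS.occurs Q hQ).1 (a, b) ⟨hm, fun hi => hn ((hcov s hs c r).2 ⟨Q, hQ, ?_, ?_⟩)⟩
        · exact Q.cols_ordConnected.out hi.1 hi.2.1 ⟨by simp only; omega, by simp only; omega⟩
        · exact Q.rows_ordConnected.out hi.2.2.1 hi.2.2.2 ⟨by simp only; omega, by simp only; omega⟩
      -- An isolated uncovered cell would again be the centre of a visible 1-square, but all squares
      -- of this parsing are degenerate.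
      have hin := hS.visible (sq (c - 1) (r - 1) 1) (by simp [sq]) (by simp [sq]) (by
        rw [occurs_sq_iff]
        constructor
        · intro a b hm hi
          simp only [Blk.Mem, Blk.Col, Blk.Row, Blk.Inner] at hm hi
          push_cast at hm hi
          exact hnb a b (by omega) (by omega) (by omega) (by omega) (by omega)
        · intro a b hi
          simp only [Blk.Inner] at hi
          push_cast at hi
          obtain rfl : a = c := by omega
          obtain rfl : b = r := by omega
          rw [← Bool.not_eq_false]
          exact fun hf => hn ((hcov s hs a b).2 (hzero a b hf)))
      have := htop _ hin
      simp [sq] at this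
  -- Border cells of a degenerate square are border cells in every subdivision; inner cells are
  -- eventually away from all seams.
  have hval : ∀ c r, ∀ᶠ s in atTop, packConfig (P s) (c, r) = x (c, r) := by
    intro c r
    cases h : x (c, r)
    · filter_upwards [eventually_ge_atTop 2] with s hs
      obtain ⟨Q, ⟨hQ, hb⟩, -⟩ := hS.border (c, r) h
      obtain ⟨h1, h2⟩ := hPB s hs Q hQ c hb.1.1 r hb.1.2
      refine packConfig_eq_false_iff.2 ⟨_, h1, h2, fun hi => hb.2 ⟨?_, ?_, ?_, ?_⟩⟩ <;>
        by_contra hcon <;> simp only [Blk.Inner, B] at hi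
      · have := (hac Q hQ s hs).left c hb.1.1 hcon
        omega
      · have := (hac Q hQ s hs).right c hb.1.1 hcon
        omega
      · have := (har Q hQ s hs).left r hb.1.2 hcon
        omega
      · have := (har Q hQ s hs).right r hb.1.2 hcon
        omega
    · by_cases hc : ∃ Q ∈ S, c ∈ Q.cols ∧ r ∈ Q.rows
      · obtain ⟨Q, hQ, h1, h2⟩ := hc
        have hi : (c, r) ∈ Q.interior := by
          by_contra hi
          have := (hS.occurs Q hQ).1 (c, r) ⟨⟨h1, h2⟩, hi⟩
          simp [h] at this
        filter_upwards [eventually_ge_atTop 2,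
          (ha _ Q.cols_ordConnected (hinf Q hQ).1).2 c hi.1 hi.2.1,
          (ha _ Q.rows_ordConnected (hinf Q hQ).2).2 r hi.2.2.1 hi.2.2.2] with s hs g1 g2
        refine packConfig_eq_true_iff.2 fun b hb hm => ?_
        obtain ⟨Q', hQ', h1', h2', rfl⟩ := hPmem s hs b hb c r hm
        rw [hS.eq_of_mem hQ' hQ (p := (c, r)) ⟨h1', h2'⟩ ⟨h1, h2⟩]
        simp only [Blk.Inner, B]
        omega
      · filter_upwards [eventually_ge_atTop 2] with s hs
        refine packConfig_eq_true_iff.2 fun b hb hm => ?_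
        exact absurd ((hcov s hs c r).1 ⟨b, hb, hm⟩) hc
  have hall : ∀ᶠ s in atTop, ∀ p ∈ {p : ℤ × ℤ | InWindow N p}, packConfig (P s) p = x p := by
    refine (eventually_all_finite ?_).2 fun p _ => hval p.1 p.2
    refine ((finite_Icc (-(N : ℤ)) N).prod (finite_Icc (-(N : ℤ)) N)).subset ?_
    rintro p ⟨h1, h2⟩
    exact ⟨h1, h2⟩
  have htend : Tendsto (fun m : ℕ => (m : ℤ) + 2) atTop atTop :=
    tendsto_atTop_add_const_right _ _ tendsto_natCast_atTop_atTop
  filter_upwards [htend.eventually hall] with m hm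
  exact ⟨packConfig (P (m + 2)), sizes_packConfig_singleton (hpack _ (by omega)),
    fun p hp => hm p hp⟩

end TCPE

namespace TCPE

open Set Filter Topology

/-! ### Configurations composed of tiles -/

/-- The configuration composed of the patterns `A_ρ` and `B_ρ`, as prescribed by `y`, with a corner
of a pattern at `g`. -/
def place (ρ : List ℕ) (g : ℤ × ℤ) (y : Config) : Config := fun p =>
  tile ρ (y ((p.1 - g.1) / tileSize ρ, (p.2 - g.2) / tileSize ρ))
    ((p.1 - g.1) % tileSize ρ, (p.2 - g.2) % tileSize ρ)

theorem tileSize_pos (ρ : List ℕ) : 0 < tileSize ρ := by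
  unfold tileSize
  induction ρ with
  | nil => simp
  | cons n ρ ih => simp [ih]

theorem tileSize_append (ρ : List ℕ) (n : ℕ) : tileSize (ρ ++ [n]) = tileSize ρ * (n + 3) := by
  simp [tileSize]

theorem le_tileSize (ρ : List ℕ) : ρ.length < tileSize ρ := by
  induction ρ using List.reverseRecOn with
  | nil => simp [tileSize]
  | append_singleton ρ n ih =>
    rw [tileSize_append, List.length_append, List.length_singleton]
    nlinarith

theorem place_nil (g : ℤ × ℤ) (y : Config) : place [] g y = g +ᵥ y := by
  funext p
  change tile [] _ _ = y (p - g)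
  rw [tile_nil]
  simp [tileSize, Prod.sub_def]

theorem vadd_place (h : ℤ × ℤ) (ρ : List ℕ) (g : ℤ × ℤ) (y : Config) :
    h +ᵥ place ρ g y = place ρ (g + h) y := by
  funext p
  simp only [vadd_config_apply, place, Prod.fst_sub, Prod.snd_sub, Prod.fst_add, Prod.snd_add,
    sub_sub, add_comm h.1, add_comm h.2]

theorem place_add_smul (ρ : List ℕ) (g h : ℤ × ℤ) (y : Config) :
    place ρ (g + tileSize ρ • h) y = place ρ g (h +ᵥ y) := by
  have hj : (tileSize ρ : ℤ) ≠ 0 := by exact_mod_cast (tileSize_pos ρ).ne'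
  have key : ∀ a b c : ℤ, (a - (b + tileSize ρ * c)) / tileSize ρ = (a - b) / tileSize ρ - c ∧
      (a - (b + tileSize ρ * c)) % tileSize ρ = (a - b) % tileSize ρ := by
    intro a b c
    have e : a - (b + tileSize ρ * c) = (a - b) + tileSize ρ * (-c) := by ring
    rw [e, Int.add_mul_ediv_left _ _ hj, Int.add_mul_emod_self_left]
    exact ⟨by ring, rfl⟩
  funext p
  simp only [place, vadd_config_apply, Prod.fst_add, Prod.snd_add, Prod.smul_fst, Prod.smul_snd]
  simp only [nsmul_eq_mul, (key _ _ _).1, (key _ _ _).2]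
  rfl

theorem tile_singleton (n : ℕ) (b : Bool) (q : ℤ × ℤ) : tile [n] b q = unitTile n b q := by
  have := tile_append [] n b q
  simp only [List.nil_append, tile_nil, tileSize, List.map_nil, List.prod_nil, Nat.cast_one,
    Int.ediv_one, Prod.mk.eta] at this
  exact this

theorem place_append (ρ : List ℕ) (n : ℕ) (g : ℤ × ℤ) (z : Config) :
    place (ρ ++ [n]) g z = place ρ g (place [n] 0 z) := by
  have hj : (0 : ℤ) < tileSize ρ := by exact_mod_cast tileSize_pos ρ
  have hn : (0 : ℤ) < (n : ℤ) + 3 := by omega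
  have hJ : ((tileSize (ρ ++ [n]) : ℕ) : ℤ) = tileSize ρ * ((n : ℤ) + 3) := by
    rw [tileSize_append]
    push_cast
    rfl
  have h1 : ((tileSize [n] : ℕ) : ℤ) = (n : ℤ) + 3 := by simp [tileSize]
  funext p
  simp only [place, tile_append, tile_singleton, hJ, h1, Prod.fst_zero, Prod.snd_zero, sub_zero]
  have k1 : ∀ a : ℤ, a / (tileSize ρ * ((n : ℤ) + 3)) = a / tileSize ρ / (n + 3) := fun a =>
    (Int.ediv_ediv_of_nonneg hj.le).symm
  have k2 : ∀ a : ℤ, a % (tileSize ρ * ((n : ℤ) + 3)) / tileSize ρ = a / tileSize ρ % (n + 3) := by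
    intro a
    have e1 := Int.emod_add_mul_ediv a (tileSize ρ * ((n : ℤ) + 3))
    have e2 : a % (tileSize ρ * ((n : ℤ) + 3)) =
        a + tileSize ρ * (-(((n : ℤ) + 3) * (a / (tileSize ρ * ((n : ℤ) + 3))))) := by linarith
    rw [e2, Int.add_mul_ediv_left _ _ hj.ne', k1]
    have e3 := Int.emod_add_mul_ediv (a / tileSize ρ) ((n : ℤ) + 3)
    linarith
  have k3 : ∀ a : ℤ, a % (tileSize ρ * ((n : ℤ) + 3)) % tileSize ρ = a % tileSize ρ := fun a =>
    Int.emod_emod_of_dvd a (Dvd.intro _ rfl)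
  simp only [k1, k2, k3]

/-- The tiles are blocks of side `n + 2` or `n + 3` in the corners of a grid of period `n + 3`, so
everything known about packings applies to them. -/
theorem place_singleton (n : ℕ) (z : Config) : place [n] 0 z =
    packConfig (gridPack (n + 3) (n + 3) (fun _ => 0) (fun q => if z q then n + 3 else n + 2)) := by
  have h1 : ((tileSize [n] : ℕ) : ℤ) = (n : ℤ) + 3 := by simp [tileSize]
  funext ⟨c, r⟩
  have hs : ∀ q : ℤ × ℤ, (if z q then (n : ℤ) + 3 else n + 2) ≤ n + 3 := by
    intro q
    split_ifs <;> omega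
  rw [packConfig_gridPack (by omega) (by omega) hs hs rfl rfl rfl]
  simp only [place, tile_singleton, h1, Prod.fst_zero, Prod.snd_zero, sub_zero, unitTile]
  have e1 := Int.emod_lt_of_pos c (by omega : (0 : ℤ) < n + 3)
  have e2 := Int.emod_lt_of_pos r (by omega : (0 : ℤ) < n + 3)
  cases z (c / (n + 3), r / (n + 3))
  · simp only [Bool.false_eq_true, if_false]
    congr 1
    rw [eq_iff_iff]
    omega
  · simp only [if_true]
    congr 1
    rw [eq_iff_iff]
    omega

theorem regionPacking_tiles (n : ℕ) (z : Config) : RegionPacking {(n : ℤ) + 2, (n : ℤ) + 3} univ univ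
    (gridPack (n + 3) (n + 3) (fun _ => 0) (fun q => if z q then n + 3 else n + 2)) := by
  apply regionPacking_gridPack
  · intro q
    split_ifs <;> simp
  all_goals
    intro q
    split_ifs <;> omega

theorem place_singleton_eq (n : ℕ) (h : ℤ × ℤ) (z : Config) : place [n] h z = h +ᵥ place [n] 0 z := by
  rw [vadd_place, zero_add]

theorem sizes_place_singleton (n : ℕ) (h : ℤ × ℤ) (z : Config) : sizes (place [n] h z) =
    {m : ℕ∞ | (m = n ∧ ∃ q, z q = false) ∨ (m = (n : ℕ∞) + 1 ∧ ∃ q, z q = true)} := by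
  rw [place_singleton_eq, sizes_vadd, place_singleton,
    sizes_packConfig (regionPacking_tiles n z) (n := n) (by rintro s (h | h) <;> simp_all)]
  ext m
  constructor
  · rintro ⟨k, rfl, _, ⟨i, j, rfl⟩, hs⟩
    cases hz : z (i, j)
    · left
      simp only [hz] at hs
      have : k = n := by simp at hs; omega
      exact ⟨by rw [this], _, hz⟩
    · right
      simp only [hz] at hs
      have : k = n + 1 := by simp at hs; omega
      exact ⟨by rw [this]; push_cast; rfl, _, hz⟩
  · rintro (⟨rfl, q, hq⟩ | ⟨rfl, q, hq⟩)
    · exact ⟨n, rfl, _, ⟨q.1, q.2, rfl⟩, by simp [hq]⟩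
    · refine ⟨n + 1, by push_cast; rfl, _, ⟨q.1, q.2, rfl⟩, ?_⟩
      simp only [Prod.mk.eta, hq, if_true]
      push_cast
      ring

theorem place_singleton_mem_baseShift (n : ℕ) (h : ℤ × ℤ) (z : Config) :
    place [n] h z ∈ baseShift := by
  rw [place_singleton_eq, place_singleton]
  exact vadd_mem_baseShift (packConfig_mem_baseShift (regionPacking_tiles n z) (n := n)
    (by rintro s (h | h) <;> simp_all)) h

theorem place_singleton_ne (n : ℕ) (h : ℤ × ℤ) (z : Config) (b : Bool) :
    ∃ q, place [n] h z q ≠ b := by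
  by_contra hcon
  push Not at hcon
  have e : place [n] h z = constConfig b := funext hcon
  have hs := sizes_place_singleton n h z
  rw [e] at hs
  cases b
  · have h0 : ((0 : ℕ) : ℕ∞) ∈ sizes (constConfig false) := by simp [sizes_constConfig_false]
    rw [hs] at h0
    rcases h0 with ⟨h1, -⟩ | ⟨h1, -⟩
    · obtain rfl : 0 = n := by exact_mod_cast h1
      have hv := congrFun (place_singleton 0 z) (2, 0)
      have hv' : (h +ᵥ place [0] 0 z) (h + (2, 0)) = false := by
        rw [← place_singleton_eq]
        exact hcon _
      rw [vadd_config_apply, add_sub_cancel_left, hv] at hv'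
      have hall : ∀ q, z q = false := by
        intro q
        rw [← Bool.not_eq_true]
        intro hq
        have h2 : (((0 : ℕ) : ℕ∞) + 1) ∈ sizes (constConfig false) := by
          rw [hs]
          exact Or.inr ⟨rfl, q, hq⟩
        rw [sizes_constConfig_false] at h2
        simp at h2
      rw [packConfig_gridPack (by norm_num) (by norm_num) (by intro; split_ifs <;> simp)
        (by intro; split_ifs <;> simp) rfl rfl rfl] at hv'
      simp [hall] at hv'
    · have : (0 : ℕ) = n + 1 := by exact_mod_cast h1
      omega
  · have h0 : (⊤ : ℕ∞) ∈ sizes (constConfig true) := by simp [sizes_constConfig_true]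
    rw [hs] at h0
    rcases h0 with ⟨h1, -⟩ | ⟨h1, -⟩
    · exact absurd h1.symm (ENat.natCast_ne_top _)
    · exact absurd h1.symm (ENat.natCast_ne_top (n + 1))

theorem place_singleton_injective {n : ℕ} {z z' : Config} (h : place [n] 0 z = place [n] 0 z') :
    z = z' := by
  rw [place_singleton, place_singleton] at h
  funext q
  -- The upper left cell of a tile tells the two apart: it is `1` in the tile for `false` and `0` in
  -- the tile for `true`.
  have hv := congrFun h ((n + 3) * q.1, (n + 3) * q.2 + (n + 2))
  have hs : ∀ (z : Config) (q : ℤ × ℤ), (if z q then (n : ℤ) + 3 else n + 2) ≤ n + 3 := by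
    intro z q
    split_ifs <;> omega
  have hn : (n : ℤ) + 3 ≠ 0 := by omega
  have e1 : ((n : ℤ) + 3) * q.1 / (n + 3) = q.1 := Int.mul_ediv_cancel_left _ hn
  have e2 : (((n : ℤ) + 3) * q.2 + (n + 2)) / (n + 3) = q.2 := by
    rw [add_comm, Int.add_mul_ediv_left _ _ hn, Int.ediv_eq_zero_of_lt (by omega) (by omega), zero_add]
  have e3 : (((n : ℤ) + 3) * q.2 + (n + 2)) % (n + 3) = n + 2 := by
    rw [add_comm, Int.add_mul_emod_self_left, Int.emod_eq_of_lt (by omega) (by omega)]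
  have e4 : ((n : ℤ) + 3) * q.1 % (n + 3) = 0 := Int.mul_emod_right _ _
  rw [packConfig_gridPack (by omega) (by omega) (hs z) (hs z) rfl rfl rfl,
    packConfig_gridPack (by omega) (by omega) (hs z') (hs z') rfl rfl rfl] at hv
  simp only [sub_zero, e1, e2, e3, e4, Prod.mk.eta] at hv
  cases h1 : z q <;> cases h2 : z' q <;> simp [h1, h2] at hv ⊢
  all_goals omega

theorem place_injective {ρ : List ℕ} {g : ℤ × ℤ} {y y' : Config} (h : place ρ g y = place ρ g y') :
    y = y' := by
  induction ρ using List.reverseRecOn generalizing y y' with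
  | nil =>
    rw [place_nil, place_nil] at h
    exact vadd_left_cancel g h
  | append_singleton ρ n ih =>
    rw [place_append, place_append] at h
    exact place_singleton_injective (ih h)

/-- Corners of visible squares of positive size lie on the lattice of tiles. If there are none, then
`n = 0` and only one tile is used, and its pattern has no period smaller than three. -/
theorem alignment_singleton {n : ℕ} {h h' : ℤ × ℤ} {z z' : Config}
    (e : place [n] h z = place [n] h' z') : ∃ k : ℤ × ℤ, h' = h + (n + 3) • k := by
  have hocc : ∀ (h : ℤ × ℤ) (z : Config) (l d : ℤ) (m : ℕ), 1 ≤ m →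
      (⟨l, d, m + 2⟩ : Blk).Occ (place [n] h z) → ∃ k : ℤ × ℤ, (l, d) = h + (n + 3) • k := by
    intro h z l d m hm hO
    have hO' : (⟨l - h.1, d - h.2, m + 2⟩ : Blk).Occ (place [n] 0 z) := by
      have hv : ∀ c r, place [n] 0 z (c, r) = place [n] h z (c + h.1, r + h.2) := by
        intro c r
        rw [place_singleton_eq n h, vadd_config_apply]
        congr 1
        ext <;> simp
      refine ⟨fun c r h1 h2 => ?_, fun c r h1 => ?_⟩
      · rw [hv]
        refine hO.1 _ _ ?_ ?_
        · simp only [Blk.Mem, Blk.Col, Blk.Row] at h1 ⊢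
          omega
        · simp only [Blk.Inner] at h2 ⊢
          omega
      · rw [hv]
        refine hO.2 _ _ ?_
        simp only [Blk.Inner] at h1 ⊢
        omega
    rw [place_singleton] at hO'
    have hin := (isParsing_packConfig (regionPacking_tiles n z) (n := n)
      (by rintro s (h | h) <;> simp_all)).visible (sq (l - h.1) (d - h.2) m)
      (by simpa [sq] using hm) (by simp [sq]) (occurs_sq_iff.2 hO')
    obtain ⟨l', d', m', ⟨i, j, hB⟩, hsq⟩ := hin
    have e1 : Ico (l - h.1) (l - h.1 + m + 2) = Ico l' (l' + m' + 2) := congrArg Square.cols hsq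
    have e2 : Ico (d - h.2) (d - h.2 + m + 2) = Ico d' (d' + m' + 2) := congrArg Square.rows hsq
    rw [Ico_eq_Ico_iff (Or.inl (by omega))] at e1 e2
    simp only [Blk.mk.injEq] at hB
    refine ⟨(i, j), ?_⟩
    ext
    · simp
      linarith [hB.1, e1.1]
    · simp
      linarith [hB.2.1, e2.1]
  have hex : ∀ (h : ℤ × ℤ) (z : Config), (1 ≤ n ∨ ∃ q, z q = true) →
      ∃ l d, ∃ m : ℕ, 1 ≤ m ∧ (⟨l, d, m + 2⟩ : Blk).Occ (place [n] h z) := by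
    intro h z hz
    obtain ⟨m, hm1, hm⟩ : ∃ m : ℕ, 1 ≤ m ∧ (m : ℕ∞) ∈ sizes (place [n] h z) := by
      rw [sizes_place_singleton]
      by_cases ht : ∃ q, z q = true
      · exact ⟨n + 1, by omega, Or.inr ⟨by push_cast; rfl, ht⟩⟩
      · refine ⟨n, by tauto, Or.inl ⟨rfl, 0, ?_⟩⟩
        push Not at ht
        simpa using ht 0
    obtain ⟨S, hS⟩ := mem_baseShift_of_mem_sizes hm
    obtain ⟨l, d, hQ⟩ := exists_sq_of_mem_sizes hS hm
    exact ⟨l, d, m, hm1, occurs_sq_iff.1 (hS.occurs _ hQ)⟩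
  by_cases hc : 1 ≤ n ∨ (∃ q, z q = true) ∨ ∃ q, z' q = true
  · obtain ⟨l, d, m, hm, hO⟩ : ∃ l d, ∃ m : ℕ, 1 ≤ m ∧ (⟨l, d, m + 2⟩ : Blk).Occ (place [n] h z) := by
      rcases hc with hc | hc | hc
      · exact hex h z (Or.inl hc)
      · exact hex h z (Or.inr hc)
      · rw [e]
        exact hex h' z' (Or.inr hc)
    obtain ⟨k, hk⟩ := hocc h z l d m hm hO
    rw [e] at hO
    obtain ⟨k', hk'⟩ := hocc h' z' l d m hm hO
    refine ⟨k - k', ?_⟩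
    rw [hk] at hk'
    rw [smul_sub, ← add_sub_assoc, hk', add_sub_cancel_right]
  · push Not at hc
    obtain ⟨hn, hz, hz'⟩ := hc
    obtain rfl : n = 0 := by omega
    have hv : ∀ (h : ℤ × ℤ) (z : Config), (∀ q, z q ≠ true) → ∀ p : ℤ × ℤ, place [0] h z p =
        decide (2 ≤ (p.1 - h.1) % 3 ∨ 2 ≤ (p.2 - h.2) % 3) := by
      intro h z hz p
      have hz0 : ∀ q, z q = false := fun q => by simpa using hz q
      simp only [place, tile_singleton, hz0, tileSize, unitTile, Bool.false_eq_true, if_false]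
      congr 1
      rw [eq_iff_iff]
      simp
      omega
    have h1 := congrFun e h'
    have h2 := congrFun e (h' + (1, 1))
    rw [hv _ _ hz, hv _ _ hz'] at h1 h2
    rw [decide_eq_decide] at h1 h2
    simp only [sub_self, Prod.fst_add, Prod.snd_add, add_sub_cancel_left] at h1 h2
    refine ⟨((h'.1 - h.1) / 3, (h'.2 - h.2) / 3), ?_⟩
    ext
    · simp
      omega
    · simp
      omega

/-- The alignment is determined up to a period. -/
theorem alignment_unique {ρ : List ℕ} {g g' : ℤ × ℤ} {y y' : Config}
    (e : place ρ g y = place ρ g' y') : ∃ h : ℤ × ℤ, g' = g + tileSize ρ • h := by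
  induction ρ using List.reverseRecOn generalizing y y' with
  | nil => exact ⟨g' - g, by simp [tileSize]⟩
  | append_singleton ρ n ih =>
    rw [place_append, place_append] at e
    obtain ⟨h, rfl⟩ := ih e
    rw [place_add_smul] at e
    have e' := place_injective e
    rw [← place_singleton_eq] at e'
    obtain ⟨k, hk⟩ := alignment_singleton e'
    refine ⟨k, ?_⟩
    rw [hk, zero_add, tileSize_append, smul_smul]

theorem reading_unique {ρ : List ℕ} {g g' : ℤ × ℤ} {y y' : Config}
    (e : place ρ g y = place ρ g' y') : ∃ h : ℤ × ℤ, y = h +ᵥ y' := by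
  obtain ⟨h, rfl⟩ := alignment_unique e
  rw [place_add_smul] at e
  exact ⟨h, place_injective e⟩

theorem isReading_iff {ρ : List ℕ} {x y : Config} :
    IsReading ρ x y ↔ ∃ g ∈ box (tileSize ρ), x = place ρ g y := by
  have hj : (0 : ℤ) < tileSize ρ := by exact_mod_cast tileSize_pos ρ
  constructor
  · rintro ⟨g, hg, h⟩
    refine ⟨g, hg, funext fun p => ?_⟩
    have := h ((p.1 - g.1) / tileSize ρ, (p.2 - g.2) / tileSize ρ)
      ((p.1 - g.1) % tileSize ρ, (p.2 - g.2) % tileSize ρ)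
      ⟨⟨Int.emod_nonneg _ hj.ne', Int.emod_lt_of_pos _ hj⟩,
        ⟨Int.emod_nonneg _ hj.ne', Int.emod_lt_of_pos _ hj⟩⟩
    change x p = tile ρ _ _
    rw [← this]
    have e1 := Int.emod_add_mul_ediv (p.1 - g.1) (tileSize ρ)
    have e2 := Int.emod_add_mul_ediv (p.2 - g.2) (tileSize ρ)
    congr 1
    ext <;> simp <;> linarith
  · rintro ⟨g, hg, rfl⟩
    refine ⟨g, hg, fun q p hp => ?_⟩
    have key : ∀ a b c : ℤ, c ∈ Ico 0 (tileSize ρ : ℤ) →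
        (a + tileSize ρ * b + c - a) / tileSize ρ = b ∧ (a + tileSize ρ * b + c - a) % tileSize ρ = c := by
      intro a b c hc
      have e : a + tileSize ρ * b + c - a = c + tileSize ρ * b := by ring
      rw [e, Int.add_mul_ediv_left _ _ hj.ne', Int.add_mul_emod_self_left,
        Int.ediv_eq_zero_of_lt hc.1 hc.2, Int.emod_eq_of_lt hc.1 hc.2, zero_add]
      exact ⟨rfl, rfl⟩
    simp only [place, Prod.fst_add, Prod.snd_add, Prod.smul_fst, Prod.smul_snd]
    simp only [nsmul_eq_mul, (key _ _ _ hp.1).1, (key _ _ _ hp.1).2, (key _ _ _ hp.2).1, (key _ _ _ hp.2).2, Prod.mk.eta]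

theorem exists_mem_box (j : ℕ) (hj : 0 < j) (g : ℤ × ℤ) : ∃ g₀ ∈ box j, ∃ h : ℤ × ℤ, g = g₀ + j • h := by
  have hj' : (0 : ℤ) < j := by exact_mod_cast hj
  refine ⟨(g.1 % j, g.2 % j), ⟨⟨Int.emod_nonneg _ hj'.ne', Int.emod_lt_of_pos _ hj'⟩,
    ⟨Int.emod_nonneg _ hj'.ne', Int.emod_lt_of_pos _ hj'⟩⟩, (g.1 / j, g.2 / j), ?_⟩
  have e1 := Int.emod_add_mul_ediv g.1 j
  have e2 := Int.emod_add_mul_ediv g.2 j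
  ext <;> simp <;> linarith

/-- `x` is `ρ`-regular with the alignment `g`. -/
def Aligned (ρ : List ℕ) (g : ℤ × ℤ) (x : Config) : Prop := ∃ y, x = place ρ g y

section Aligned

variable {ρ : List ℕ} {g g' : ℤ × ℤ} {x : Config}

theorem Aligned.add_smul (h : Aligned ρ g x) (k : ℤ × ℤ) : Aligned ρ (g + tileSize ρ • k) x := by
  obtain ⟨y, rfl⟩ := h
  refine ⟨-k +ᵥ y, ?_⟩
  rw [place_add_smul, vadd_neg_vadd]

theorem Aligned.isRegular (h : Aligned ρ g x) : IsRegular ρ x := by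
  obtain ⟨g₀, hg₀, k, rfl⟩ := exists_mem_box _ (tileSize_pos ρ) g
  obtain ⟨y, rfl⟩ := h
  exact ⟨k +ᵥ y, isReading_iff.2 ⟨g₀, hg₀, place_add_smul _ _ _ _⟩⟩

theorem IsRegular.exists_aligned (h : IsRegular ρ x) : ∃ g, Aligned ρ g x := by
  obtain ⟨y, hy⟩ := h
  obtain ⟨g, -, e⟩ := isReading_iff.1 hy
  exact ⟨g, y, e⟩

/-- Alignments of one configuration differ by a multiple of the tile size, so they can be exchanged
for any other configuration. -/
theorem Aligned.congr (h : Aligned ρ g x) (h' : Aligned ρ g' x) {z : Config} (hz : Aligned ρ g z) :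
    Aligned ρ g' z := by
  obtain ⟨y, rfl⟩ := h
  obtain ⟨y', e⟩ := h'
  obtain ⟨k, rfl⟩ := alignment_unique e
  exact hz.add_smul k

theorem Aligned.of_append {n : ℕ} (h : Aligned (ρ ++ [n]) g x) : Aligned ρ g x := by
  obtain ⟨y, rfl⟩ := h
  exact ⟨_, place_append _ _ _ _⟩

theorem Aligned.of_prefix {σ : List ℕ} (hσ : σ <+: ρ) (h : Aligned ρ g x) : Aligned σ g x := by
  obtain ⟨τ, rfl⟩ := hσ
  induction τ using List.reverseRecOn with
  | nil => simpa using h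
  | append_singleton τ n ih =>
    rw [← List.append_assoc] at h
    exact ih h.of_append

theorem IsRegular.of_prefix {σ : List ℕ} (hσ : σ <+: ρ) (h : IsRegular ρ x) : IsRegular σ x := by
  obtain ⟨g, hg⟩ := h.exists_aligned
  exact (hg.of_prefix hσ).isRegular

theorem aligned_vadd (h : Aligned ρ g x) (k : ℤ × ℤ) : Aligned ρ (g + k) (k +ᵥ x) := by
  obtain ⟨y, rfl⟩ := h
  exact ⟨y, vadd_place _ _ _ _⟩

end Aligned

theorem isReading_of_eq_place {ρ : List ℕ} {g : ℤ × ℤ} {y : Config} :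
    ∃ h : ℤ × ℤ, IsReading ρ (place ρ g y) (h +ᵥ y) := by
  obtain ⟨g₀, hg₀, k, rfl⟩ := exists_mem_box _ (tileSize_pos ρ) g
  exact ⟨k, isReading_iff.2 ⟨g₀, hg₀, place_add_smul _ _ _ _⟩⟩

theorem IsReading.exists_vadd_eq {ρ : List ℕ} {g : ℤ × ℤ} {y y' : Config}
    (h : IsReading ρ (place ρ g y) y') : ∃ k : ℤ × ℤ, y' = k +ᵥ y := by
  obtain ⟨g', -, e⟩ := isReading_iff.1 h
  exact reading_unique e.symm

end TCPE

namespace TCPE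

open Set Filter Topology

/-! ### The subshift of a tree -/

theorem continuous_place (ρ : List ℕ) (g : ℤ × ℤ) : Continuous (place ρ g) := by
  refine continuous_pi fun p => ?_
  have h1 : Continuous fun y : Config =>
      y ((p.1 - g.1) / tileSize ρ, (p.2 - g.2) / tileSize ρ) := continuous_apply _
  exact (continuous_of_discreteTopology (f := fun b : Bool =>
    tile ρ b ((p.1 - g.1) % tileSize ρ, (p.2 - g.2) % tileSize ρ))).comp h1

theorem isClosedEmbedding_place (ρ : List ℕ) (g : ℤ × ℤ) : IsClosedEmbedding (place ρ g) :=
  (continuous_place ρ g).isClosedEmbedding fun _ _ h => place_injective h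

theorem isClosed_aligned (ρ : List ℕ) (g : ℤ × ℤ) : IsClosed {z | Aligned ρ g z} := by
  convert (isClosedEmbedding_place ρ g).isClosed_range using 1
  ext z
  exact ⟨fun ⟨y, h⟩ => ⟨y, h.symm⟩, fun ⟨y, h⟩ => ⟨y, h.symm⟩⟩

theorem IsRegular.exists_aligned_box {ρ : List ℕ} {x : Config} (h : IsRegular ρ x) :
    ∃ g ∈ box (tileSize ρ), Aligned ρ g x := by
  obtain ⟨y, hy⟩ := h
  obtain ⟨g, hg, e⟩ := isReading_iff.1 hy
  exact ⟨g, hg, y, e⟩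

theorem finite_box (n : ℕ) : (box n).Finite := (finite_Ico _ _).prod (finite_Ico _ _)

theorem isClosed_isRegular (ρ : List ℕ) : IsClosed {z | IsRegular ρ z} := by
  have h : {z | IsRegular ρ z} = ⋃ g ∈ box (tileSize ρ), {z | Aligned ρ g z} := by
    ext z
    simp only [mem_iUnion, mem_ofPred_eq]
    exact ⟨fun h => by obtain ⟨g, hg, h⟩ := h.exists_aligned_box; exact ⟨g, hg, h⟩,
      fun ⟨_, _, h⟩ => h.isRegular⟩
  rw [h]
  exact (finite_box _).isClosed_biUnion fun g _ => isClosed_aligned ρ g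

/-- Regular configurations close to a regular one have the same alignment and a close reading. -/
theorem eventually_reading {ρ : List ℕ} {g : ℤ × ℤ} {y : Config} {P : Config → Prop}
    (hP : ∀ᶠ y' in 𝓝 y, P y') :
    ∀ᶠ z in 𝓝 (place ρ g y), IsRegular ρ z → ∃ y', z = place ρ g y' ∧ P y' := by
  have h1 : ∀ᶠ z in 𝓝 (place ρ g y), ∀ y', place ρ g y' = z → P y' := by
    rw [(isClosedEmbedding_place ρ g).isInducing.nhds_eq_comap, eventually_comap] at hP
    exact hP
  -- Up to periods there are only finitely many alignments, and each one that does not fit is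
  -- excluded on a neighbourhood.
  have h2 : ∀ᶠ z in 𝓝 (place ρ g y), ∀ g' ∈ box (tileSize ρ),
      ¬ Aligned ρ g' (place ρ g y) → ¬ Aligned ρ g' z := by
    rw [eventually_all_finite (finite_box _)]
    intro g' _
    by_cases h : Aligned ρ g' (place ρ g y)
    · simp [h]
    · filter_upwards [(isClosed_aligned ρ g').isOpen_compl.mem_nhds h] with z hz _ using hz
  filter_upwards [h1, h2] with z hz1 hz2 hz
  obtain ⟨g', hg', hz'⟩ := hz.exists_aligned_box
  have h3 : Aligned ρ g' (place ρ g y) := by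
    by_contra h
    exact hz2 g' hg' h hz'
  obtain ⟨y', rfl⟩ := h3.congr ⟨y, rfl⟩ hz'
  exact ⟨y', rfl, hz1 y' rfl⟩

theorem eventually_mem_sizes {y : Config} {n : ℕ} (hn : (n : ℕ∞) ∈ sizes y) :
    ∀ᶠ z in 𝓝 y, z ∈ baseShift → (n : ℕ∞) ∈ sizes z := by
  obtain ⟨N, hN⟩ := exists_agree_mem_sizes hn
  filter_upwards [agree_mem_nhds N y] with z hz hb using hN z hb hz

theorem eventually_sizes_ge {y : Config} (hy : ⊤ ∈ sizes y) (k : ℕ) :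
    ∀ᶠ z in 𝓝 y, z ∈ baseShift → ∀ m ∈ sizes z, (k : ℕ∞) ≤ m := by
  obtain ⟨N, hN⟩ := exists_agree_sizes_ge hy k
  filter_upwards [agree_mem_nhds N y] with z hz hb using hN z hb hz

theorem vadd_mem_baseShift_iff {x : Config} {g : ℤ × ℤ} : g +ᵥ x ∈ baseShift ↔ x ∈ baseShift :=
  ⟨fun h => by simpa using vadd_mem_baseShift h (-g), fun h => vadd_mem_baseShift h g⟩

theorem isRegular_vadd_iff {ρ : List ℕ} {x : Config} {k : ℤ × ℤ} :
    IsRegular ρ (k +ᵥ x) ↔ IsRegular ρ x := by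
  constructor
  · intro h
    obtain ⟨g, hg⟩ := h.exists_aligned
    simpa using (aligned_vadd hg (-k)).isRegular
  · intro h
    obtain ⟨g, hg⟩ := h.exists_aligned
    exact (aligned_vadd hg k).isRegular

theorem isRegular_place {ρ : List ℕ} {g : ℤ × ℤ} {y : Config} : IsRegular ρ (place ρ g y) :=
  Aligned.isRegular ⟨y, rfl⟩

/-- Regularity for a longer string is regularity of the reading. -/
theorem isRegular_append_iff {ρ : List ℕ} {n : ℕ} {g : ℤ × ℤ} {y : Config} :
    IsRegular (ρ ++ [n]) (place ρ g y) ↔ IsRegular [n] y := by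
  constructor
  · intro h
    obtain ⟨g', w, e⟩ := h.exists_aligned
    rw [place_append] at e
    obtain ⟨k, rfl⟩ := reading_unique e
    exact isRegular_vadd_iff.2 isRegular_place
  · intro h
    obtain ⟨k, w, rfl⟩ := h.exists_aligned
    rw [place_singleton_eq, ← place_add_smul, ← place_append]
    exact isRegular_place

theorem IsRegular.exists_eq_place {ρ : List ℕ} {x : Config} (h : IsRegular ρ x) :
    ∃ g y, x = place ρ g y := h.exists_aligned

theorem sizes_subset_of_isRegular {n : ℕ} {y : Config} (h : IsRegular [n] y) :
    sizes y ⊆ {(n : ℕ∞), (n : ℕ∞) + 1} := by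
  obtain ⟨k, w, rfl⟩ := h.exists_eq_place
  rw [sizes_place_singleton]
  rintro m (h | h)
  · exact Or.inl h.1
  · exact Or.inr h.1

theorem IsRegular.mem_baseShift {n : ℕ} {y : Config} (h : IsRegular [n] y) : y ∈ baseShift := by
  obtain ⟨k, w, rfl⟩ := h.exists_eq_place
  exact place_singleton_mem_baseShift _ _ _

theorem IsRegular.ne_const {n : ℕ} {y : Config} (h : IsRegular [n] y) (b : Bool) :
    ∃ q, y q ≠ b := by
  obtain ⟨k, w, rfl⟩ := h.exists_eq_place
  exact place_singleton_ne n k w b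

theorem not_isRegular_const (n : ℕ) (b : Bool) : ¬ IsRegular [n] (constConfig b) := fun h =>
  let ⟨_, hq⟩ := h.ne_const b
  hq rfl

theorem const_of_not_ne {y : Config} {b : Bool} (h : ¬ ∃ q, y q ≠ b) : y = constConfig b := by
  push Not at h
  exact funext h

theorem pair_eq_of_mem {n m : ℕ} {s : Set ℕ∞} (hs : s ⊆ {(m : ℕ∞), (m : ℕ∞) + 1})
    (h : (n : ℕ∞) ∈ s) (h' : (n : ℕ∞) + 1 ∈ s) : n = m := by
  have h1 : n = m ∨ n = m + 1 := by
    rcases hs h with h | h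
    · exact Or.inl (by exact_mod_cast h)
    · exact Or.inr (by exact_mod_cast mem_singleton_iff.1 h)
  have h2 : n + 1 = m ∨ n + 1 = m + 1 := by
    rcases hs h' with h | h
    · exact Or.inl (by exact_mod_cast h)
    · exact Or.inr (by exact_mod_cast mem_singleton_iff.1 h)
  omega

theorem not_both_mem_sizes_const (n : ℕ) (b : Bool) :
    ¬ ((n : ℕ∞) ∈ sizes (constConfig b) ∧ (n : ℕ∞) + 1 ∈ sizes (constConfig b)) := by
  rintro ⟨h1, h2⟩
  cases b
  · rw [sizes_constConfig_false, mem_singleton_iff] at h1 h2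
    rw [h1] at h2
    have : (0 + 1 : ℕ) = 0 := by exact_mod_cast h2
    omega
  · rw [sizes_constConfig_true, mem_singleton_iff] at h1
    exact ENat.natCast_ne_top _ h1

section Tree

variable {T : Set (List ℕ)}

/-- The clause that both tiles appear is automatic: the n-square comes from one tile and the
(n+1)-square from the other. -/
theorem mem_shiftOf_iff {x : Config} : x ∈ shiftOf T ↔
    (∀ σ ∈ T, ∀ g y, x = place σ g y → y ∈ baseShift) ∧
    ∀ ρ n, ρ ++ [n] ∈ T → ∀ g y, x = place ρ g y → (n : ℕ∞) ∈ sizes y → (n : ℕ∞) + 1 ∈ sizes y →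
      IsRegular [n] y := by
  constructor
  · rintro ⟨hF, hR⟩
    refine ⟨?_, ?_⟩
    · rintro σ hσ g y rfl
      obtain ⟨h, hr⟩ := isReading_of_eq_place (ρ := σ) (g := g) (y := y)
      exact vadd_mem_baseShift_iff.1 (hF σ hσ _ hr)
    · rintro ρ n hρ g y rfl h1 h2
      obtain ⟨h, hr⟩ := isReading_of_eq_place (ρ := ρ) (g := g) (y := y)
      obtain ⟨z, hz, -⟩ := hR ρ n hρ _ hr (by rwa [containsSquare_iff, sizes_vadd])
        (by rw [containsSquare_iff, sizes_vadd]; exact_mod_cast h2)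
      exact isRegular_append_iff.1 ⟨z, hz⟩
  · rintro ⟨hF, hR⟩
    refine ⟨?_, ?_⟩
    · intro σ hσ y hy
      obtain ⟨g, -, e⟩ := isReading_iff.1 hy
      exact hF σ hσ g y e
    · intro ρ n hρ y hy h1 h2
      obtain ⟨g, -, rfl⟩ := isReading_iff.1 hy
      have h2' : (n : ℕ∞) + 1 ∈ sizes y := by exact_mod_cast (containsSquare_iff.1 h2)
      obtain ⟨z, hz⟩ := isRegular_append_iff.2 (hR ρ n hρ g y rfl h1 h2')
      refine ⟨z, hz, ?_⟩
      obtain ⟨g', -, e⟩ := isReading_iff.1 hz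
      rw [place_append] at e
      obtain ⟨k, rfl⟩ := reading_unique e
      have h1' := containsSquare_iff.1 h1
      rw [sizes_vadd, sizes_place_singleton] at h1' h2'
      constructor
      · rcases h1' with h | h
        · exact h.2
        · have : n = n + 1 := by exact_mod_cast h.1
          omega
      · rcases h2' with h | h
        · have : n + 1 = n := by exact_mod_cast h.1
          omega
        · exact h.2

theorem vadd_mem_shiftOf {x : Config} (hx : x ∈ shiftOf T) (h : ℤ × ℤ) : h +ᵥ x ∈ shiftOf T := by
  rw [mem_shiftOf_iff] at hx ⊢
  have key : ∀ σ g y, h +ᵥ x = place σ g y → x = place σ (g + -h) y := by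
    intro σ g y e
    rw [← vadd_place, ← e, neg_vadd_vadd]
  exact ⟨fun σ hσ g y e => hx.1 σ hσ _ y (key σ g y e),
    fun ρ n hρ g y e => hx.2 ρ n hρ _ y (key ρ g y e)⟩

/-- A tree of strings of even numbers. -/
structure IsEvenTree (T : Set (List ℕ)) : Prop extends IsTree T where
  even : ∀ σ ∈ T, ∀ n ∈ σ, Even n

/-- This is where evenness enters: for even `n` and `m`, the sets `{n, n + 1}` and `{m, m + 1}` of
possible sizes meet only if `n = m`. -/
theorem eq_of_isRegular (hT : IsEvenTree T) {ρ σ : List ℕ} {n m : ℕ} (hn : ρ ++ [n] ∈ T) (hm : σ ++ [m] ∈ T) {y : Config}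
    (h : IsRegular [n] y) (h' : IsRegular [m] y) : n = m := by
  obtain ⟨k, hk⟩ := sizes_nonempty h.mem_baseShift
  have hne := hT.even _ hn n (by simp)
  have hme := hT.even _ hm m (by simp)
  rw [Nat.even_iff] at hne hme
  rcases sizes_subset_of_isRegular h hk with h1 | h1 <;>
  rcases sizes_subset_of_isRegular h' hk with h2 | h2 <;> rw [h1] at h2
  · exact_mod_cast h2
  · have : n = m + 1 := by exact_mod_cast mem_singleton_iff.1 h2
    omega
  · have : n + 1 = m := by exact_mod_cast h2
    omega
  · have : n + 1 = m + 1 := by exact_mod_cast mem_singleton_iff.1 h2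
    omega

theorem prefix_or_prefix (hT : IsEvenTree T) {ρ σ : List ℕ} (hρ : ρ ∈ T) (hσ : σ ∈ T) {x : Config} (h : IsRegular ρ x)
    (h' : IsRegular σ x) : ρ <+: σ ∨ σ <+: ρ := by
  induction ρ using List.reverseRecOn with
  | nil => exact Or.inl List.nil_prefix
  | append_singleton ρ n ih =>
    have hpre : ρ <+: ρ ++ [n] := List.prefix_append _ _
    rcases ih (hT.prefix_mem _ _ hpre hρ) (h.of_prefix hpre) with ⟨τ, rfl⟩ | h1
    · cases τ with
      | nil => exact Or.inr (by simp)
      | cons m τ =>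
        have hpre' : ρ ++ [m] <+: ρ ++ m :: τ := ⟨τ, by simp⟩
        have hm := h'.of_prefix hpre'
        obtain ⟨g, y, rfl⟩ := (h.of_prefix hpre).exists_eq_place
        obtain rfl := eq_of_isRegular hT hρ (hT.prefix_mem _ _ hpre' hσ)
          (isRegular_append_iff.1 h) (isRegular_append_iff.1 hm)
        exact Or.inl hpre'
    · exact Or.inr (h1.trans hpre)

/-- A configuration with the reading `y` belongs to the subshift if `y` is not affected by the
restrictions for the extensions of `ρ`. -/
theorem place_mem_shiftOf (hT : IsEvenTree T) {ρ : List ℕ} (hρ : ρ ∈ T) {y : Config} (hy : y ∈ baseShift)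
    (h : ∀ n : ℕ, ρ ++ [n] ∈ T → ¬ ((n : ℕ∞) ∈ sizes y ∧ (n : ℕ∞) + 1 ∈ sizes y)) (g : ℤ × ℤ) :
    place ρ g y ∈ shiftOf T := by
  -- Other levels impose nothing new: a reading for a shorter string is composed of tiles, and a
  -- reading for a longer one is constant.
  have key : ∀ σ ∈ T, ∀ g' y', place ρ g y = place σ g' y' →
      (σ = ρ ∧ ∃ k : ℤ × ℤ, y' = k +ᵥ y) ∨ (∃ n, IsRegular [n] y') ∨ ∃ b, y' = constConfig b := by
    intro σ hσ g' y' e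
    have hr : IsRegular σ (place ρ g y) := by
      rw [e]
      exact isRegular_place
    rcases prefix_or_prefix hT hρ hσ isRegular_place hr with ⟨τ, rfl⟩ | ⟨τ, rfl⟩
    · cases τ with
      | nil =>
        rw [List.append_nil] at e ⊢
        exact Or.inl ⟨rfl, reading_unique e.symm⟩
      | cons n τ =>
        right; right
        have hpre : ρ ++ [n] <+: ρ ++ n :: τ := ⟨τ, by simp⟩
        have hn := hT.prefix_mem _ _ hpre hσ
        have hreg := hr.of_prefix hpre
        obtain ⟨k, w, rfl⟩ := (isRegular_append_iff.1 hreg).exists_eq_place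
        -- If both symbols occurred, the reading `y` would contain both an n-square and an
        -- (n+1)-square.
        obtain ⟨b, rfl⟩ : ∃ b, w = constConfig b := by
          have h1 := h n hn
          by_contra hcon
          push Not at hcon
          refine h1 ?_
          rw [sizes_place_singleton]
          have hf : ∃ q, w q ≠ true := by
            by_contra hh
            exact hcon true (const_of_not_ne hh)
          have ht : ∃ q, w q ≠ false := by
            by_contra hh
            exact hcon false (const_of_not_ne hh)
          exact ⟨Or.inl ⟨rfl, by simpa using hf⟩, Or.inr ⟨rfl, by simpa using ht⟩⟩
        rw [place_singleton_eq, ← place_add_smul, ← place_append] at e hr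
        cases τ with
        | nil =>
          obtain ⟨l, hl⟩ := reading_unique e.symm
          exact ⟨b, hl⟩
        | cons m τ =>
          have hm := hr.of_prefix (σ := ρ ++ [n] ++ [m]) ⟨τ, by simp⟩
          exact absurd (isRegular_append_iff.1 hm) (not_isRegular_const m b)
    · cases τ with
      | nil =>
        rw [List.append_nil] at e ⊢
        exact Or.inl ⟨rfl, reading_unique e.symm⟩
      | cons n τ =>
        right; left
        have hpre : σ ++ [n] <+: σ ++ n :: τ := ⟨τ, by simp⟩
        have h1 := isRegular_place (ρ := σ ++ n :: τ) (g := g) (y := y)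
        rw [e] at h1
        exact ⟨n, isRegular_append_iff.1 (h1.of_prefix hpre)⟩
  rw [mem_shiftOf_iff]
  constructor
  · intro σ hσ g' y' e
    rcases key σ hσ g' y' e with ⟨-, k, rfl⟩ | ⟨n, hn⟩ | ⟨b, rfl⟩
    · exact vadd_mem_baseShift hy k
    · exact hn.mem_baseShift
    · exact constConfig_mem_baseShift b
  · intro σ n hσ g' y' e h1 h2
    rcases key σ (hT.prefix_mem _ _ (List.prefix_append _ _) hσ) g' y' e with
      ⟨rfl, k, rfl⟩ | ⟨m, hm⟩ | ⟨b, rfl⟩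
    · rw [sizes_vadd] at h1 h2
      exact absurd ⟨h1, h2⟩ (h n hσ)
    · rwa [pair_eq_of_mem (sizes_subset_of_isRegular hm) h1 h2]
    · exact absurd ⟨h1, h2⟩ (not_both_mem_sizes_const n b)

/-- Elements of the subshift that are close to a regular configuration with a nonconstant reading
are regular, with the same alignment and a close reading. -/
theorem eventually_shiftOf_reading (hT : IsEvenTree T) {ρ : List ℕ} (hρ : ρ ∈ T) {g : ℤ × ℤ} {y : Config}
    (hy : ρ = [] ∨ ∀ b, ∃ q, y q ≠ b) {P : Config → Prop} (hP : ∀ᶠ y' in 𝓝 y, P y') :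
    ∀ᶠ z in 𝓝 (place ρ g y), z ∈ shiftOf T → ∃ y', z = place ρ g y' ∧ P y' := by
  suffices h : ∀ᶠ z in 𝓝 (place ρ g y), z ∈ shiftOf T → IsRegular ρ z by
    filter_upwards [h, eventually_reading hP] with z h1 h2 hz using h2 (h1 hz)
  clear hP P
  induction ρ using List.reverseRecOn generalizing y with
  | nil =>
    refine Eventually.of_forall fun z _ => ?_
    have : z = place [] 0 z := by rw [place_nil, zero_vadd]
    rw [this]
    exact isRegular_place
  | append_singleton ρ n ih =>
    have hρ' := hT.prefix_mem _ _ (List.prefix_append ρ [n]) hρ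
    rcases hy with hy | hy
    · simp at hy
    -- Since the reading is nonconstant, both tiles occur, so squares of both sizes are visible one
    -- level lower; there the reading is never constant. The restriction R then forces nearby points
    -- to be regular.
    have hw : ∀ b, ∃ q, place [n] 0 y q ≠ b := place_singleton_ne n 0 y
    rw [place_append]
    have hs := sizes_place_singleton n 0 y
    have h1 : (n : ℕ∞) ∈ sizes (place [n] 0 y) := by
      rw [hs]
      exact Or.inl ⟨rfl, by simpa using hy true⟩
    have h2 : ((n + 1 : ℕ) : ℕ∞) ∈ sizes (place [n] 0 y) := by
      rw [hs]
      exact Or.inr ⟨by push_cast; rfl, by simpa using hy false⟩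
    filter_upwards [ih hρ' (Or.inr hw), eventually_reading (ρ := ρ) (g := g)
      ((eventually_mem_sizes h1).and (eventually_mem_sizes h2))] with z hz1 hz2 hz
    obtain ⟨y', rfl, hy1, hy2⟩ := hz2 (hz1 hz)
    rw [mem_shiftOf_iff] at hz
    have hb := hz.1 ρ hρ' g y' rfl
    rw [isRegular_append_iff]
    exact hz.2 ρ n hρ g y' rfl (hy1 hb) (by exact_mod_cast hy2 hb)

/-- For a nonconstant reading, nearby points have close readings with the same alignment, so a
violated restriction is violated nearby. Constant readings satisfy the restrictions anyway. -/
theorem isClosed_shiftOf (hT : IsEvenTree T) : IsClosed (shiftOf T) := by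
  rw [isClosed_iff_frequently]
  intro x hx
  rw [mem_shiftOf_iff]
  constructor
  · rintro σ hσ g y rfl
    by_cases hy : ∀ b, ∃ q, y q ≠ b
    · by_contra hb
      refine hx ?_
      filter_upwards [eventually_shiftOf_reading hT hσ (g := g) (Or.inr hy)
        (isClosed_baseShift.isOpen_compl.mem_nhds hb)] with z h1 hz
      obtain ⟨y', rfl, hy'⟩ := h1 hz
      exact hy' ((mem_shiftOf_iff.1 hz).1 σ hσ g y' rfl)
    · push Not at hy
      obtain ⟨b, hb⟩ := hy
      have : y = constConfig b := funext hb
      rw [this]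
      exact constConfig_mem_baseShift b
  · rintro ρ n hρ g y rfl h1 h2
    have hρ' := hT.prefix_mem _ _ (List.prefix_append ρ [n]) hρ
    have hy : ∀ b, ∃ q, y q ≠ b := by
      intro b
      by_contra hb
      rw [const_of_not_ne hb] at h1 h2
      exact not_both_mem_sizes_const n b ⟨h1, h2⟩
    by_contra hcon
    refine hx ?_
    have h2' : ((n + 1 : ℕ) : ℕ∞) ∈ sizes y := by exact_mod_cast h2
    have hreg : ∀ᶠ y' in 𝓝 y, ¬ IsRegular [n] y' :=
      (isClosed_isRegular [n]).isOpen_compl.mem_nhds hcon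
    filter_upwards [eventually_shiftOf_reading hT hρ' (g := g) (Or.inr hy)
      (hreg.and ((eventually_mem_sizes h1).and (eventually_mem_sizes h2')))] with z h hz
    obtain ⟨y', rfl, hy', hy1, hy2⟩ := h hz
    rw [mem_shiftOf_iff] at hz
    have hb := hz.1 ρ hρ' g y' rfl
    exact hy' (hz.2 ρ n hρ g y' rfl (hy1 hb) (by exact_mod_cast hy2 hb))

end Tree

end TCPE

namespace TCPE

open Set Filter Topology

/-! ### Types -/

/-- The string `ρ⌢t`. -/
def word (ρ : List ℕ) (t : Sym) : TypeString := finString (ρ.map Sym.pair ++ [t])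

/-- `ρ` is an initial segment of `s`. -/
def Extends (ρ : List ℕ) (s : TypeString) : Prop :=
  ∀ (i : ℕ) (h : i < ρ.length), ofLex s i = (Sym.pair ρ[i] : Sym)

theorem pair_injective {n m : ℕ} (h : Sym.pair n = Sym.pair m) : n = m := by
  have : 2 * n + 1 = 2 * m + 1 := Nat.cast_injective (R := ℕ∞) h
  omega

theorem num_injective {n m : ℕ} (h : Sym.num n = Sym.num m) : n = m := by
  have : 2 * n = 2 * m := Nat.cast_injective (R := ℕ∞) h
  omega

theorem num_ne_pair (n m : ℕ) : Sym.num n ≠ Sym.pair m := by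
  intro h
  have : 2 * n = 2 * m + 1 := Nat.cast_injective (R := ℕ∞) h
  omega

theorem num_ne_top (n : ℕ) : Sym.num n ≠ ⊤ := ENat.natCast_ne_top _

theorem pair_ne_top (n : ℕ) : Sym.pair n ≠ ⊤ := ENat.natCast_ne_top _

theorem extends_nil (s : TypeString) : Extends [] s := fun i h => absurd h (by simp)

theorem extends_word (ρ : List ℕ) (t : Sym) : Extends ρ (word ρ t) := by
  intro i h
  simp [word, finString, List.getElem?_append, h]

theorem ofLex_word (ρ : List ℕ) (t : Sym) : ofLex (word ρ t) ρ.length = (t : Sym) := by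
  simp [word, finString, List.getElem?_append]

theorem extends_append_iff {ρ : List ℕ} {n : ℕ} {s : TypeString} :
    Extends (ρ ++ [n]) s ↔ Extends ρ s ∧ ofLex s ρ.length = (Sym.pair n : Sym) := by
  constructor
  · intro h
    refine ⟨fun i hi => ?_, ?_⟩
    · have := h i (by simp; omega)
      rwa [List.getElem_append_left hi] at this
    · have := h ρ.length (by simp)
      simpa using this
  · rintro ⟨h1, h2⟩ i hi
    rcases lt_or_ge i ρ.length with h | h
    · rw [h1 i h, List.getElem_append_left h]
    · have : i = ρ.length := by simp at hi; omega
      subst this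
      simpa using h2

theorem Extends.of_prefix {ρ σ : List ℕ} {s : TypeString} (h : Extends ρ s) (hσ : σ <+: ρ) :
    Extends σ s := by
  obtain ⟨τ, rfl⟩ := hσ
  intro i hi
  rw [h i (by simp; omega), List.getElem_append_left hi]

theorem Extends.prefix {ρ σ : List ℕ} {s : TypeString} (h : Extends ρ s) (h' : Extends σ s)
    (hl : σ.length ≤ ρ.length) : σ <+: ρ := by
  rw [List.prefix_iff_eq_take]
  refine List.ext_getElem (by simp [hl]) fun i h1 h2 => ?_
  have e := (h' i h1).symm.trans (h i (by omega))
  rw [List.getElem_take]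
  exact pair_injective (WithBot.coe_injective e)

section Order

variable {ρ : List ℕ} {a b e : TypeString}

theorem lt_of_ofLex_lt (ha : Extends ρ a) (hb : Extends ρ b)
    (h : ofLex a ρ.length < ofLex b ρ.length) : a < b :=
  ⟨ρ.length, fun i hi => (ha i hi).trans (hb i hi).symm, h⟩

theorem ofLex_le_of_le (ha : Extends ρ a) (hb : Extends ρ b) (h : a ≤ b) :
    ofLex a ρ.length ≤ ofLex b ρ.length := by
  by_contra hcon
  exact (lt_of_ofLex_lt hb ha (not_le.1 hcon)).not_ge h

theorem Extends.of_le_of_le (ha : Extends ρ a) (hb : Extends ρ b) (h1 : a ≤ e) (h2 : e ≤ b) :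
    Extends ρ e := by
  induction ρ using List.reverseRecOn with
  | nil => exact extends_nil e
  | append_singleton ρ n ih =>
    rw [extends_append_iff] at ha hb ⊢
    have he := ih ha.1 hb.1
    refine ⟨he, le_antisymm ?_ ?_⟩
    · rw [← hb.2]
      exact ofLex_le_of_le he hb.1 h2
    · rw [← ha.2]
      exact ofLex_le_of_le ha.1 he h1

end Order

theorem hasBaseType_iff {y : Config} {t : Sym} : HasBaseType y t ↔
    (∃ n : ℕ, t = Sym.num n ∧ sizes y = {(n : ℕ∞)}) ∨
    (∃ n : ℕ, t = Sym.pair n ∧ sizes y = {(n : ℕ∞), (n : ℕ∞) + 1}) ∨ (t = ⊤ ∧ sizes y = {⊤}) := by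
  have hS : ∀ {s : Set ℕ∞} {k : ℕ∞}, sizes y = s → k ∈ s → ∃ S, IsParsing y S ∧
      Square.size '' S = s := by
    intro s k e hk
    rw [← e] at hk
    obtain ⟨S, hS⟩ := mem_baseShift_of_mem_sizes hk
    exact ⟨S, hS, by rw [hS.sizes_eq, e]⟩
  constructor
  · rintro (⟨S, n, h, e⟩ | ⟨S, n, h, e⟩ | ⟨S, h, e⟩) <;> rw [h.sizes_eq] at e
    · exact Or.inl ⟨n, rfl, e⟩
    · exact Or.inr (Or.inl ⟨n, rfl, e⟩)
    · exact Or.inr (Or.inr ⟨rfl, e⟩)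
  · rintro (⟨n, rfl, e⟩ | ⟨n, rfl, e⟩ | ⟨rfl, e⟩)
    · obtain ⟨S, hS, e'⟩ := hS e (mem_singleton _)
      exact .num S n hS e'
    · obtain ⟨S, hS, e'⟩ := hS e (mem_insert _ _)
      exact .pair S n hS e'
    · obtain ⟨S, hS, e'⟩ := hS e (mem_singleton _)
      exact .infty S hS e'

theorem exists_hasBaseType {y : Config} (hy : y ∈ baseShift) : ∃ t, HasBaseType y t := by
  rcases sizes_cases hy with ⟨n, h⟩ | ⟨n, h⟩ | h
  · exact ⟨_, hasBaseType_iff.2 (Or.inl ⟨n, rfl, h⟩)⟩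
  · exact ⟨_, hasBaseType_iff.2 (Or.inr (Or.inl ⟨n, rfl, h⟩))⟩
  · exact ⟨_, hasBaseType_iff.2 (Or.inr (Or.inr ⟨rfl, h⟩))⟩

theorem HasBaseType.vadd {y : Config} {t : Sym} (h : HasBaseType y t) (g : ℤ × ℤ) :
    HasBaseType (g +ᵥ y) t := by
  rw [hasBaseType_iff] at h ⊢
  rwa [sizes_vadd]

theorem HasBaseType.num_sizes {y : Config} {n : ℕ} (h : HasBaseType y (Sym.num n)) :
    sizes y = {(n : ℕ∞)} := by
  rcases hasBaseType_iff.1 h with ⟨m, e, h⟩ | ⟨m, e, h⟩ | ⟨e, h⟩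
  · rwa [num_injective e]
  · exact absurd e (num_ne_pair _ _)
  · exact absurd e (num_ne_top _)

theorem HasBaseType.pair_sizes {y : Config} {n : ℕ} (h : HasBaseType y (Sym.pair n)) :
    sizes y = {(n : ℕ∞), (n : ℕ∞) + 1} := by
  rcases hasBaseType_iff.1 h with ⟨m, e, h⟩ | ⟨m, e, h⟩ | ⟨e, h⟩
  · exact absurd e.symm (num_ne_pair _ _)
  · rwa [pair_injective e]
  · exact absurd e (pair_ne_top _)

theorem HasBaseType.top_sizes {y : Config} (h : HasBaseType y ⊤) : sizes y = {⊤} := by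
  rcases hasBaseType_iff.1 h with ⟨m, e, h⟩ | ⟨m, e, h⟩ | ⟨e, h⟩
  · exact absurd e.symm (num_ne_top _)
  · exact absurd e.symm (pair_ne_top _)
  · exact h

theorem HasBaseType.unique {y : Config} {t t' : Sym} (h : HasBaseType y t) (h' : HasBaseType y t') :
    t = t' := by
  have hp : ∀ n m : ℕ, sizes y = {(n : ℕ∞)} → sizes y ≠ {(m : ℕ∞), (m : ℕ∞) + 1} := by
    intro n m h1 h2
    have e1 : (m : ℕ∞) ∈ sizes y := by simp [h2]
    have e2 : (m : ℕ∞) + 1 ∈ sizes y := by simp [h2]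
    rw [h1, mem_singleton_iff] at e1 e2
    have : m = m + 1 := by exact_mod_cast e1.trans e2.symm
    omega
  have ht : ∀ m : ℕ, sizes y = {⊤} → (m : ℕ∞) ∉ sizes y := by
    intro m h1 h2
    rw [h1] at h2
    exact ENat.natCast_ne_top _ h2
  rcases hasBaseType_iff.1 h with ⟨m, rfl, e⟩ | ⟨m, rfl, e⟩ | ⟨rfl, e⟩ <;>
  rcases hasBaseType_iff.1 h' with ⟨k, rfl, e'⟩ | ⟨k, rfl, e'⟩ | ⟨rfl, e'⟩
  · have : m = k := by
      rw [e] at e'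
      exact_mod_cast singleton_injective e'
    rw [this]
  · exact absurd e' (hp _ _ e)
  · exact absurd (by simp [e]) (ht m e')
  · exact absurd e (hp _ _ e')
  · rw [pair_eq_of_mem (n := m) (m := k) e'.subset (by simp [e]) (by simp [e])]
  · exact absurd (by simp [e]) (ht m e')
  · exact absurd (by simp [e']) (ht k e)
  · exact absurd (by simp [e']) (ht k e)
  · rfl

section Tree

variable {T : Set (List ℕ)}

theorem mem_baseShift_of_place_mem {ρ : List ℕ} (hρ : ρ ∈ T) {g : ℤ × ℤ} {y : Config}
    (h : place ρ g y ∈ shiftOf T) : y ∈ baseShift :=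
  (mem_shiftOf_iff.1 h).1 ρ hρ g y rfl

theorem isRegular_of_sizes {ρ : List ℕ} {n : ℕ} (hρ : ρ ++ [n] ∈ T) {g : ℤ × ℤ} {y : Config}
    (h : place ρ g y ∈ shiftOf T) (h1 : (n : ℕ∞) ∈ sizes y) (h2 : (n : ℕ∞) + 1 ∈ sizes y) :
    IsRegular [n] y :=
  (mem_shiftOf_iff.1 h).2 ρ n hρ g y rfl h1 h2

theorem IsEvenTree.mem_of_append (hT : IsEvenTree T) {ρ : List ℕ} {n : ℕ} (h : ρ ++ [n] ∈ T) :
    ρ ∈ T := hT.prefix_mem _ _ (List.prefix_append _ _) h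

/-- A type has the initial segment `ρ` if and only if the configuration is `ρ`-regular. -/
theorem HasType.extends_iff (hT : IsEvenTree T) {x : Config} (hx : x ∈ shiftOf T) {s : TypeString}
    (hs : HasType T x s) {ρ : List ℕ} (hρ : ρ ∈ T) : Extends ρ s ↔ IsRegular ρ x := by
  cases hs with
  | fin σ y t hσ hy hmax ht =>
    have hσr : IsRegular σ x := ⟨y, hy⟩
    constructor
    · intro h
      have hl : ρ.length ≤ σ.length := by
        by_contra hcon
        push Not at hcon
        obtain ⟨τ, rfl⟩ := h.prefix (extends_word σ t) hcon.le
        cases τ with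
        | nil => simp at hcon
        | cons n τ =>
          have hpre : σ ++ [n] <+: σ ++ n :: τ := ⟨τ, by simp⟩
          have hn := hT.prefix_mem _ _ hpre hρ
          have h1 := (extends_append_iff.1 (h.of_prefix hpre)).2
          -- With the pair `(n, n+1)` as next symbol both sizes occur, so R makes the point regular
          -- one level further, contrary to maximality.
          have h2 : t = Sym.pair n :=
            WithBot.coe_injective ((ofLex_word σ t).symm.trans h1)
          subst h2
          obtain ⟨g, -, rfl⟩ := isReading_iff.1 hy
          have h3 := isRegular_of_sizes hn hx (by rw [ht.pair_sizes]; simp)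
            (by rw [ht.pair_sizes]; simp)
          have := hmax _ hn (isRegular_append_iff.2 h3)
          simp at this
      exact hσr.of_prefix ((extends_word σ t).prefix h hl)
    · intro h
      have hl := hmax ρ hρ h
      have hpre : ρ <+: σ := by
        rcases prefix_or_prefix hT hρ hσ h hσr with h | h
        · exact h
        · rw [h.eq_of_length_le hl]
      exact (extends_word σ t).of_prefix hpre
  | path f hf =>
    have he : ∀ k, Extends ((List.range k).map f) (infString fun i => Sym.pair (f i)) := by
      intro k i hi
      simp [infString]
    obtain ⟨hk, hkr⟩ := hf ρ.length
    constructor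
    · intro h
      have := (he ρ.length).prefix h (by simp)
      exact hkr.of_prefix this
    · intro h
      have : ρ = (List.range ρ.length).map f := by
        rcases prefix_or_prefix hT hρ hk h hkr with h | h
        · exact h.eq_of_length (by simp)
        · exact (h.eq_of_length (by simp)).symm
      rw [this]
      exact he _

/-- If the reading is not composed of tiles of the next level, then the type is read off the
squares. -/
theorem HasType.eq_word (hT : IsEvenTree T) {ρ : List ℕ} {g : ℤ × ℤ} {y : Config} {s : TypeString}
    (hs : HasType T (place ρ g y) s) (hρ : ρ ∈ T)
    (h : ∀ n, ρ ++ [n] ∈ T → ¬ IsRegular [n] y) : ∃ t, s = word ρ t ∧ HasBaseType y t := by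
  cases hs with
  | fin σ y' t hσ hy hmax ht =>
    have hσr : IsRegular σ (place ρ g y) := ⟨y', hy⟩
    have hpre : ρ <+: σ := by
      rcases prefix_or_prefix hT hρ hσ isRegular_place hσr with h | h
      · exact h
      · rw [h.eq_of_length_le (hmax ρ hρ isRegular_place)]
    obtain ⟨τ, rfl⟩ := hpre
    cases τ with
    | nil =>
      rw [List.append_nil] at hy ⊢
      obtain ⟨k, rfl⟩ := hy.exists_vadd_eq
      exact ⟨t, rfl, by simpa using ht.vadd (-k)⟩
    | cons n τ =>
      have hpre : ρ ++ [n] <+: ρ ++ n :: τ := ⟨τ, by simp⟩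
      exact absurd (isRegular_append_iff.1 (hσr.of_prefix hpre)) (h n (hT.prefix_mem _ _ hpre hσ))
  | path f hf =>
    have hk : ρ = (List.range ρ.length).map f := by
      obtain ⟨hk, hkr⟩ := hf ρ.length
      rcases prefix_or_prefix hT hρ hk isRegular_place hkr with h | h
      · exact h.eq_of_length (by simp)
      · exact (h.eq_of_length (by simp)).symm
    obtain ⟨h1, h2⟩ := hf (ρ.length + 1)
    rw [List.range_succ, List.map_append, ← hk] at h1 h2
    exact absurd (isRegular_append_iff.1 h2) (h _ h1)

theorem HasType.unique (hT : IsEvenTree T) {x : Config} (hx : x ∈ shiftOf T) {s s' : TypeString}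
    (h : HasType T x s) (h' : HasType T x s') : s = s' := by
  have key : ∀ {s' : TypeString} (ρ : List ℕ) (y : Config) (t : Sym), ρ ∈ T → IsReading ρ x y →
      (∀ ρ' ∈ T, IsRegular ρ' x → ρ'.length ≤ ρ.length) → HasBaseType y t → HasType T x s' →
      word ρ t = s' := by
    intro s' ρ y t hρ hy hmax ht h'
    obtain ⟨g, -, rfl⟩ := isReading_iff.1 hy
    obtain ⟨t', e, ht'⟩ := h'.eq_word hT hρ fun n hn hr => by
      have := hmax _ hn (isRegular_append_iff.2 hr)
      simp at this
    rw [e, ht.unique ht']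
  cases h with
  | fin ρ y t hρ hy hmax ht => exact key ρ y t hρ hy hmax ht h'
  | path f hf =>
    cases h' with
    | fin ρ y t hρ hy hmax ht => exact (key ρ y t hρ hy hmax ht (.path f hf)).symm
    | path f' hf' =>
      refine congrArg toLex (funext fun i => ?_)
      have h1 := (HasType.path f' hf').extends_iff hT hx (hf (i + 1)).1
      have h2 := h1.2 (hf (i + 1)).2 i (by simp)
      simpa [infString] using h2.symm

theorem exists_hasType (hT : IsEvenTree T) {x : Config} (hx : x ∈ shiftOf T) :
    ∃ s, HasType T x s := by
  by_cases hmax : ∃ ρ ∈ T, IsRegular ρ x ∧ ∀ ρ' ∈ T, IsRegular ρ' x → ρ'.length ≤ ρ.length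
  · obtain ⟨ρ, hρ, ⟨y, hy⟩, hm⟩ := hmax
    obtain ⟨t, ht⟩ := exists_hasBaseType (hx.1 ρ hρ y hy)
    exact ⟨_, .fin ρ y t hρ hy hm ht⟩
  · push Not at hmax
    have hlen : ∀ k, ∃ ρ ∈ T, IsRegular ρ x ∧ ρ.length = k := by
      intro k
      induction k with
      | zero =>
        refine ⟨[], hT.root, ?_, rfl⟩
        have := isRegular_place (ρ := []) (g := 0) (y := x)
        rwa [place_nil, zero_vadd] at this
      | succ k ih =>
        obtain ⟨ρ, hρ, hr, hl⟩ := ih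
        obtain ⟨σ, hσ, hσr, hlt⟩ := hmax ρ hρ hr
        have hpre := List.take_prefix (k + 1) σ
        exact ⟨σ.take (k + 1), hT.prefix_mem _ _ hpre hσ, hσr.of_prefix hpre, by simp; omega⟩
    -- Without a longest string, the strings for which the point is regular form an infinite chain,
    -- hence a path.
    choose σ hσ hr hl using hlen
    have hmap : ∀ k, (List.range k).map (fun i => (σ (i + 1)).getD i 0) = σ k := by
      intro k
      refine List.ext_getElem (by simp [hl]) fun i h1 h2 => ?_
      rw [hl] at h2
      have hpre : σ (i + 1) <+: σ k := by
        rcases prefix_or_prefix hT (hσ (i + 1)) (hσ k) (hr _) (hr _) with h | h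
        · exact h
        · rw [h.eq_of_length_le (by simp [hl]; omega)]
      have h3 : i < (σ (i + 1)).length := by simp [hl]
      simp only [List.getElem_map, List.getElem_range, List.getD_eq_getElem _ _ h3]
      exact hpre.getElem h3
    exact ⟨_, .path _ fun k => by rw [hmap]; exact ⟨hσ k, hr k⟩⟩

theorem HasType.vadd {x : Config} {s : TypeString} (h : HasType T x s) (k : ℤ × ℤ) :
    HasType T (k +ᵥ x) s := by
  cases h with
  | fin ρ y t hρ hy hmax ht =>
    obtain ⟨g, -, rfl⟩ := isReading_iff.1 hy
    rw [vadd_place] at *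
    obtain ⟨l, hl⟩ := isReading_of_eq_place (ρ := ρ) (g := g + k) (y := y)
    refine .fin ρ _ t hρ hl (fun ρ' hρ' hr => hmax ρ' hρ' ?_) (ht.vadd l)
    rw [← vadd_place] at hr
    exact isRegular_vadd_iff.1 hr
  | path f hf => exact .path f fun j => ⟨(hf j).1, isRegular_vadd_iff.2 (hf j).2⟩

/-- The type of a configuration with a given reading. -/
theorem hasType_word (hT : IsEvenTree T) {ρ : List ℕ} (hρ : ρ ∈ T) {g : ℤ × ℤ} {y : Config}
    {t : Sym} (ht : HasBaseType y t) (h : ∀ n, ρ ++ [n] ∈ T → ¬ IsRegular [n] y) :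
    HasType T (place ρ g y) (word ρ t) := by
  obtain ⟨l, hl⟩ := isReading_of_eq_place (ρ := ρ) (g := g) (y := y)
  refine .fin ρ _ t hρ hl (fun σ hσ hr => ?_) (ht.vadd l)
  rcases prefix_or_prefix hT hρ hσ isRegular_place hr with ⟨τ, rfl⟩ | h'
  · cases τ with
    | nil => simp
    | cons n τ =>
      have hpre : ρ ++ [n] <+: ρ ++ n :: τ := ⟨τ, by simp⟩
      exact absurd (isRegular_append_iff.1 (hr.of_prefix hpre)) (h n (hT.prefix_mem _ _ hpre hσ))
  · exact h'.length_le

theorem mem_shiftOf_of_sizes_eq (hT : IsEvenTree T) {ρ : List ℕ} (hρ : ρ ∈ T) (g : ℤ × ℤ)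
    {y : Config} {k : ℕ∞} (h : sizes y = {k}) : place ρ g y ∈ shiftOf T := by
  have hk : k ∈ sizes y := by simp [h]
  refine place_mem_shiftOf hT hρ (mem_baseShift_of_mem_sizes hk) (fun n _ => ?_) g
  rintro ⟨h1, h2⟩
  rw [h, mem_singleton_iff] at h1 h2
  have : n = n + 1 := by exact_mod_cast h1.trans h2.symm
  omega

theorem mem_shiftOf_of_sizes_subset (hT : IsEvenTree T) {ρ : List ℕ} (hρ : ρ ∈ T) (g : ℤ × ℤ)
    {y : Config} (hy : y ∈ baseShift) {k : ℕ} (hk : ρ ++ [k] ∉ T)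
    (h : sizes y ⊆ {(k : ℕ∞), (k : ℕ∞) + 1}) : place ρ g y ∈ shiftOf T := by
  refine place_mem_shiftOf hT hρ hy (fun n hn => ?_) g
  rintro ⟨h1, h2⟩
  exact hk (pair_eq_of_mem h h1 h2 ▸ hn)

/-- A configuration that consists of tiles with the same symbol. -/
theorem place_singleton_of_sizes {n : ℕ} {k : ℕ∞} {y : Config} (hr : IsRegular [n] y)
    (h : sizes y = {k}) : (k = n ∧ ∃ g, y = place [n] g (constConfig false)) ∨
      (k = (n : ℕ∞) + 1 ∧ ∃ g, y = place [n] g (constConfig true)) := by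
  obtain ⟨g, w, rfl⟩ := hr.exists_eq_place
  rw [sizes_place_singleton] at h
  have hsub : ∀ m : ℕ∞, ((m = n ∧ ∃ q, w q = false) ∨ (m = (n : ℕ∞) + 1 ∧ ∃ q, w q = true)) →
      m = k := by
    intro m hm
    have : m ∈ ({k} : Set ℕ∞) := by
      rw [← h]
      exact hm
    exact this
  by_cases hf : ∃ q, w q = false
  · left
    have h1 := hsub n (Or.inl ⟨rfl, hf⟩)
    refine ⟨h1.symm, g, ?_⟩
    rw [const_of_not_ne (y := w) (b := false)]
    rintro ⟨q, hq⟩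
    have h2 := hsub (n + 1) (Or.inr ⟨rfl, q, by simpa using hq⟩)
    have : n + 1 = n := by exact_mod_cast h2.trans h1.symm
    omega
  · right
    have ht : w = constConfig true := const_of_not_ne (by simpa using hf)
    exact ⟨(hsub (n + 1) (Or.inr ⟨rfl, 0, by rw [ht]; rfl⟩)).symm, g, by rw [ht]⟩

theorem exists_true_place_const (n : ℕ) (g : ℤ × ℤ) (c : ℤ) :
    ∃ r, place [n] g (constConfig false) (c, r) = true := by
  refine ⟨g.2 + (n + 2), ?_⟩
  have h1 : ((tileSize [n] : ℕ) : ℤ) = (n : ℤ) + 3 := by simp [tileSize]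
  simp only [place, tile_singleton, constConfig, unitTile, h1, add_sub_cancel_left, Bool.false_eq_true,
    if_false, decide_eq_true_eq]
  right; left
  exact Int.emod_eq_of_lt (by omega) (by omega)

theorem place_const_eq_false (n : ℕ) (g : ℤ × ℤ) (c : ℤ) :
    place [n] g (constConfig true) (c, g.2) = false := by
  simp [place, tile_singleton, constConfig, unitTile]

/-- A constant column of `0`s excludes the configuration of first tiles, whose columns all contain a
`1`; a `1` in each row excludes that of second tiles, whose bottom rows are `0`. So single sizes are
realised as types without passing to a longer string. -/
theorem exists_sizes_not_isRegular (n : ℕ) : ∃ y, sizes y = {(n : ℕ∞)} ∧ ∀ m, ¬ IsRegular [m] y := by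
  obtain ⟨y, hs, h0, h1⟩ := exists_columns n
  refine ⟨y, hs, fun m hm => ?_⟩
  rcases place_singleton_of_sizes hm hs with ⟨-, g, rfl⟩ | ⟨-, g, rfl⟩
  · obtain ⟨r, hr⟩ := exists_true_place_const m g 0
    rw [h0] at hr
    exact absurd hr (by simp)
  · obtain ⟨c, hc⟩ := h1 g.2
    rw [place_const_eq_false] at hc
    exact absurd hc (by simp)

/-- `s` is the type of an element of the subshift. -/
def IsType (T : Set (List ℕ)) (s : TypeString) : Prop := ∃ x ∈ shiftOf T, HasType T x s

theorem isType_num (hT : IsEvenTree T) {ρ : List ℕ} (hρ : ρ ∈ T) (n : ℕ) :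
    IsType T (word ρ (Sym.num n)) := by
  obtain ⟨y, hs, hr⟩ := exists_sizes_not_isRegular n
  exact ⟨place ρ 0 y, mem_shiftOf_of_sizes_eq hT hρ 0 hs,
    hasType_word hT hρ (hasBaseType_iff.2 (Or.inl ⟨n, rfl, hs⟩)) fun m _ => hr m⟩

theorem isType_top (hT : IsEvenTree T) {ρ : List ℕ} (hρ : ρ ∈ T) : IsType T (word ρ ⊤) :=
  ⟨place ρ 0 (constConfig true), mem_shiftOf_of_sizes_eq hT hρ 0 sizes_constConfig_true,
    hasType_word hT hρ (hasBaseType_iff.2 (Or.inr (Or.inr ⟨rfl, sizes_constConfig_true⟩)))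
      fun m _ => not_isRegular_const m true⟩

theorem not_isRegular_of_sizes {ρ : List ℕ} {n : ℕ} (hn : ρ ++ [n] ∉ T) {y : Config}
    (hs : sizes y = {(n : ℕ∞), (n : ℕ∞) + 1}) (m : ℕ) (hm : ρ ++ [m] ∈ T) : ¬ IsRegular [m] y := by
  intro hr
  refine hn ?_
  rwa [pair_eq_of_mem (n := n) (sizes_subset_of_isRegular hr) (by simp [hs]) (by simp [hs])]

theorem isType_pair (hT : IsEvenTree T) {ρ : List ℕ} (hρ : ρ ∈ T) {n : ℕ} (hn : ρ ++ [n] ∉ T) :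
    IsType T (word ρ (Sym.pair n)) := by
  let w : Config := fun q => decide (q = 0)
  have hs : sizes (place [n] 0 w) = {(n : ℕ∞), (n : ℕ∞) + 1} := by
    rw [sizes_place_singleton]
    have h1 : ∃ q, w q = false := ⟨(1, 0), by simp [w]⟩
    have h2 : ∃ q, w q = true := ⟨0, by simp [w]⟩
    ext m
    simp [h1, h2]
  exact ⟨place ρ 0 (place [n] 0 w), mem_shiftOf_of_sizes_subset hT hρ 0
    (place_singleton_mem_baseShift _ _ _) hn hs.subset,
    hasType_word hT hρ (hasBaseType_iff.2 (Or.inr (Or.inl ⟨n, rfl, hs⟩)))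
      (not_isRegular_of_sizes hn hs)⟩

/-- The types with the initial segment `ρ`. -/
theorem IsType.cases (hT : IsEvenTree T) {s : TypeString} (hs : IsType T s) {ρ : List ℕ} (hρ : ρ ∈ T)
    (h : Extends ρ s) : (∃ n, s = word ρ (Sym.num n)) ∨
      (∃ n, ρ ++ [n] ∉ T ∧ s = word ρ (Sym.pair n)) ∨ (∃ n, ρ ++ [n] ∈ T ∧ Extends (ρ ++ [n]) s) ∨
      s = word ρ ⊤ := by
  obtain ⟨x, hx, hs⟩ := hs
  obtain ⟨g, y, rfl⟩ := ((hs.extends_iff hT hx hρ).1 h).exists_eq_place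
  by_cases hn : ∃ n, ρ ++ [n] ∈ T ∧ IsRegular [n] y
  · obtain ⟨n, hn, hr⟩ := hn
    exact Or.inr (Or.inr (Or.inl ⟨n, hn, (hs.extends_iff hT hx hn).2 (isRegular_append_iff.2 hr)⟩))
  · push Not at hn
    obtain ⟨t, rfl, ht⟩ := hs.eq_word hT hρ hn
    rcases hasBaseType_iff.1 ht with ⟨n, rfl, e⟩ | ⟨n, rfl, e⟩ | ⟨rfl, e⟩
    · exact Or.inl ⟨n, rfl⟩
    · refine Or.inr (Or.inl ⟨n, fun hn' => ?_, rfl⟩)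
      exact hn n hn' (isRegular_of_sizes hn' hx (by simp [e]) (by simp [e]))
    · exact Or.inr (Or.inr (Or.inr rfl))

end Tree

end TCPE

namespace TCPE

open Set Filter Topology

/-! ### Types of close configurations -/

section Tree

variable {T : Set (List ℕ)}

/-- At most three types lie between `s` and `s'`. -/
def NearType (T : Set (List ℕ)) (s s' : TypeString) : Prop :=
  ∃ S : Set TypeString, S.encard ≤ 3 ∧ ∀ e, IsType T e → e ∈ uIcc s s' → e ∈ S

theorem encard_triple_le {α : Type*} (a b c : α) : ({a, b, c} : Set α).encard ≤ 3 := by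
  refine (encard_insert_le _ _).trans ?_
  refine (add_le_add_left ((encard_insert_le _ _).trans
    (add_le_add_left (encard_singleton c).le 1)) 1).trans ?_
  norm_num

theorem nearType_of_le {a b s s' : TypeString} (h1 : a ≤ s) (h2 : s ≤ b) (h3 : a ≤ s') (h4 : s' ≤ b)
    (s₁ s₂ s₃ : TypeString)
    (h : ∀ e, IsType T e → a ≤ e → e ≤ b → e = s₁ ∨ e = s₂ ∨ e = s₃) : NearType T s s' :=
  ⟨{s₁, s₂, s₃}, encard_triple_le _ _ _, fun e he hm =>
    h e he ((le_inf h1 h3).trans hm.1) (hm.2.trans (sup_le h2 h4))⟩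

theorem nearType_self (s : TypeString) : NearType T s s :=
  nearType_of_le le_rfl le_rfl le_rfl le_rfl s s s fun _ _ h1 h2 => Or.inl (le_antisymm h2 h1)

theorem NearType.near {a b : typeOrder T} (h : NearType T a.1 b.1) : Near a b := by
  obtain ⟨S, hS, h⟩ := h
  unfold Near
  rw [← Subtype.val_injective.encard_image]
  refine (encard_le_encard ?_).trans hS
  rintro _ ⟨e, he, rfl⟩
  refine h e.1 e.2 ?_
  rcases le_total a b with hab | hab
  · rw [uIcc_of_le hab] at he
    rw [uIcc_of_le (show a.1 ≤ b.1 from hab)]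
    exact he
  · rw [uIcc_of_ge hab] at he
    rw [uIcc_of_ge (show b.1 ≤ a.1 from hab)]
    exact he

theorem word_le_word {ρ : List ℕ} {t t' : Sym} (h : t ≤ t') : word ρ t ≤ word ρ t' := by
  rcases h.eq_or_lt with rfl | h
  · rfl
  · exact (lt_of_ofLex_lt (extends_word ρ t) (extends_word ρ t')
      (by rw [ofLex_word, ofLex_word]; exact WithBot.coe_lt_coe.2 h)).le

theorem coe_le_ofLex {i j : ℕ} {a : WithBot Sym} (ha : a = ((j : ℕ∞) : Sym))
    (h : (((i : ℕ∞) : Sym) : WithBot Sym) ≤ a) : i ≤ j := by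
  rw [ha, WithBot.coe_le_coe] at h
  exact Nat.cast_le.1 h

theorem ofLex_le_coe {i j : ℕ} {a : WithBot Sym} (ha : a = ((j : ℕ∞) : Sym))
    (h : a ≤ (((i : ℕ∞) : Sym) : WithBot Sym)) : j ≤ i := by
  rw [ha, WithBot.coe_le_coe] at h
  exact Nat.cast_le.1 h

/-- The types with the initial segment `ρ` and with bounds for the next symbol. -/
theorem IsType.cases_of_le (hT : IsEvenTree T) {e : TypeString} (he : IsType T e) {ρ : List ℕ}
    (hρ : ρ ∈ T) (h : Extends ρ e) {i j : ℕ}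
    (h1 : (((i : ℕ∞) : Sym) : WithBot Sym) ≤ ofLex e ρ.length)
    (h2 : ofLex e ρ.length ≤ (((j : ℕ∞) : Sym) : WithBot Sym)) :
    (∃ n, (i ≤ 2 * n ∧ 2 * n ≤ j) ∧ e = word ρ (Sym.num n)) ∨
    (∃ n, (i ≤ 2 * n + 1 ∧ 2 * n + 1 ≤ j) ∧ ρ ++ [n] ∉ T ∧ e = word ρ (Sym.pair n)) ∨
    (∃ n, (i ≤ 2 * n + 1 ∧ 2 * n + 1 ≤ j) ∧ ρ ++ [n] ∈ T ∧ Extends (ρ ++ [n]) e) := by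
  rcases he.cases hT hρ h with ⟨n, rfl⟩ | ⟨n, hn, rfl⟩ | ⟨n, hn, hx⟩ | rfl
  · exact Or.inl ⟨n, ⟨coe_le_ofLex (ofLex_word _ _) h1, ofLex_le_coe (ofLex_word _ _) h2⟩, rfl⟩
  · exact Or.inr (Or.inl ⟨n, ⟨coe_le_ofLex (ofLex_word _ _) h1,
      ofLex_le_coe (ofLex_word _ _) h2⟩, hn, rfl⟩)
  · have := (extends_append_iff.1 hx).2
    exact Or.inr (Or.inr ⟨n, ⟨coe_le_ofLex this h1, ofLex_le_coe this h2⟩, hn, hx⟩)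
  · rw [ofLex_word, WithBot.coe_le_coe, top_le_iff] at h2
    exact absurd h2 (ENat.natCast_ne_top j)

theorem ofLex_bounds {ρ : List ℕ} {t t' : Sym} {a b e : TypeString} (ha : Extends ρ a)
    (hb : Extends ρ b) (ea : ofLex a ρ.length = (t : Sym)) (eb : ofLex b ρ.length = (t' : Sym))
    (h1 : a ≤ e) (h2 : e ≤ b) :
    Extends ρ e ∧ (t : WithBot Sym) ≤ ofLex e ρ.length ∧ ofLex e ρ.length ≤ (t' : Sym) := by
  have he := ha.of_le_of_le hb h1 h2
  refine ⟨he, ?_, ?_⟩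
  · rw [← ea]
    exact ofLex_le_of_le ha he h1
  · rw [← eb]
    exact ofLex_le_of_le he hb h2

theorem num_le_pair (n : ℕ) : Sym.num n ≤ Sym.pair n := Nat.cast_le.2 (by omega)

theorem pair_le_num (n : ℕ) : Sym.pair n ≤ Sym.num (n + 1) := Nat.cast_le.2 (by omega)

theorem nearType_num_pair (hT : IsEvenTree T) {ρ : List ℕ} (hρ : ρ ∈ T) {n : ℕ}
    (hn : ρ ++ [n] ∉ T) : NearType T (word ρ (Sym.pair n)) (word ρ (Sym.num n)) := by
  refine nearType_of_le (word_le_word (num_le_pair n)) le_rfl le_rfl (word_le_word (num_le_pair n))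
    (word ρ (Sym.num n)) (word ρ (Sym.pair n)) (word ρ (Sym.pair n)) fun e he h1 h2 => ?_
  obtain ⟨hx, h1, h2⟩ := ofLex_bounds (extends_word _ _) (extends_word _ _) (ofLex_word _ _)
    (ofLex_word _ _) h1 h2
  rcases he.cases_of_le hT hρ hx h1 h2 with ⟨m, h, rfl⟩ | ⟨m, h, -, rfl⟩ | ⟨m, h, hm, -⟩
  · obtain rfl : m = n := by omega
    exact Or.inl rfl
  · obtain rfl : m = n := by omega
    exact Or.inr (Or.inl rfl)
  · obtain rfl : m = n := by omega
    exact absurd hm hn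

theorem nearType_pair_num (hT : IsEvenTree T) {ρ : List ℕ} (hρ : ρ ∈ T) {n : ℕ}
    (hn : ρ ++ [n] ∉ T) : NearType T (word ρ (Sym.pair n)) (word ρ (Sym.num (n + 1))) := by
  refine nearType_of_le le_rfl (word_le_word (pair_le_num n)) (word_le_word (pair_le_num n)) le_rfl
    (word ρ (Sym.num (n + 1))) (word ρ (Sym.pair n)) (word ρ (Sym.pair n)) fun e he h1 h2 => ?_
  obtain ⟨hx, h1, h2⟩ := ofLex_bounds (extends_word _ _) (extends_word _ _) (ofLex_word _ _)
    (ofLex_word _ _) h1 h2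
  rcases he.cases_of_le hT hρ hx h1 h2 with ⟨m, h, rfl⟩ | ⟨m, h, -, rfl⟩ | ⟨m, h, hm, -⟩
  · obtain rfl : m = n + 1 := by omega
    exact Or.inl rfl
  · obtain rfl : m = n := by omega
    exact Or.inr (Or.inl rfl)
  · obtain rfl : m = n := by omega
    exact absurd hm hn

theorem extends_word_append (ρ : List ℕ) (n : ℕ) (t : Sym) :
    Extends ρ (word (ρ ++ [n]) t) ∧ ofLex (word (ρ ++ [n]) t) ρ.length = (Sym.pair n : Sym) :=
  extends_append_iff.1 (extends_word _ _)

theorem word_lt_word_append {ρ : List ℕ} {n : ℕ} {t t' : Sym} (h : t < Sym.pair n) :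
    word ρ t < word (ρ ++ [n]) t' := by
  obtain ⟨h1, h2⟩ := extends_word_append ρ n t'
  refine lt_of_ofLex_lt (extends_word _ _) h1 ?_
  rw [ofLex_word, h2]
  exact WithBot.coe_lt_coe.2 h

theorem word_append_lt_word {ρ : List ℕ} {n : ℕ} {t t' : Sym} (h : Sym.pair n < t) :
    word (ρ ++ [n]) t' < word ρ t := by
  obtain ⟨h1, h2⟩ := extends_word_append ρ n t'
  refine lt_of_ofLex_lt h1 (extends_word _ _) ?_
  rw [ofLex_word, h2]
  exact WithBot.coe_lt_coe.2 h

theorem eq_word_zero (hT : IsEvenTree T) {e : TypeString} (he : IsType T e) {ρ : List ℕ}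
    (hρ : ρ ∈ T) (h : Extends ρ e) (hle : e ≤ word ρ (Sym.num 0)) : e = word ρ (Sym.num 0) := by
  have h1 := ofLex_le_of_le h (extends_word _ _) hle
  rw [ofLex_word] at h1
  have h0 : (((((0 : ℕ) : ℕ∞)) : Sym) : WithBot Sym) ≤ ofLex e ρ.length := by
    rcases he.cases hT hρ h with ⟨n, rfl⟩ | ⟨n, -, rfl⟩ | ⟨n, -, hx⟩ | rfl
    · rw [ofLex_word]
      simp
    · rw [ofLex_word]
      simp
    · rw [(extends_append_iff.1 hx).2]
      simp
    · rw [ofLex_word]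
      simp
  rcases he.cases_of_le hT hρ h h0 (j := 0) h1 with ⟨m, h, rfl⟩ | ⟨m, h, -, rfl⟩ | ⟨m, h, -, -⟩
  · obtain rfl : m = 0 := by omega
    rfl
  · omega
  · omega

theorem eq_word_top (hT : IsEvenTree T) {e : TypeString} (he : IsType T e) {ρ : List ℕ}
    (hρ : ρ ∈ T) (h : Extends ρ e) (hle : word ρ ⊤ ≤ e) : e = word ρ ⊤ := by
  have h1 := ofLex_le_of_le (extends_word _ _) h hle
  rw [ofLex_word] at h1
  rcases he.cases hT hρ h with ⟨n, rfl⟩ | ⟨n, -, rfl⟩ | ⟨n, -, hx⟩ | rfl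
  · rw [ofLex_word, WithBot.coe_le_coe, top_le_iff] at h1
    exact absurd h1 (num_ne_top n)
  · rw [ofLex_word, WithBot.coe_le_coe, top_le_iff] at h1
    exact absurd h1 (pair_ne_top n)
  · rw [(extends_append_iff.1 hx).2, WithBot.coe_le_coe, top_le_iff] at h1
    exact absurd h1 (pair_ne_top n)
  · rfl

theorem IsEvenTree.succ_not_mem (hT : IsEvenTree T) {ρ : List ℕ} {k : ℕ} (h : ρ ++ [k] ∈ T) :
    ρ ++ [k + 1] ∉ T := by
  intro h'
  have h1 := hT.even _ h k (by simp)
  have h2 := hT.even _ h' (k + 1) (by simp)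
  rw [Nat.even_iff] at h1 h2
  omega

theorem IsEvenTree.not_mem_of_succ (hT : IsEvenTree T) {ρ : List ℕ} {k : ℕ}
    (h : ρ ++ [k + 1] ∈ T) : ρ ++ [k] ∉ T := fun h' => hT.succ_not_mem h' h

/-- Regularity for `ρ⌢(k,k+1)` can fail in a limit of points only through a constant reading; the
types on the two sides of that failure are consecutive. -/
theorem nearType_num_append (hT : IsEvenTree T) {ρ : List ℕ} {k : ℕ} (hk : ρ ++ [k] ∈ T) :
    NearType T (word ρ (Sym.num k)) (word (ρ ++ [k]) (Sym.num 0)) := by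
  have hlt : word ρ (Sym.num k) < word (ρ ++ [k]) (Sym.num 0) :=
    word_lt_word_append (Nat.cast_lt.2 (by omega))
  refine nearType_of_le le_rfl hlt.le hlt.le le_rfl (word ρ (Sym.num k))
    (word (ρ ++ [k]) (Sym.num 0)) (word ρ (Sym.num k)) fun e he h1 h2 => ?_
  obtain ⟨hb, eb⟩ := extends_word_append ρ k (Sym.num 0)
  obtain ⟨hx, h1', h2'⟩ := ofLex_bounds (extends_word _ _) hb (ofLex_word _ _) eb h1 h2
  rcases he.cases_of_le hT (hT.mem_of_append hk) hx h1' h2' with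
    ⟨m, h, rfl⟩ | ⟨m, h, hm, rfl⟩ | ⟨m, h, hm, hx'⟩
  · obtain rfl : m = k := by omega
    exact Or.inl rfl
  · obtain rfl : m = k := by omega
    exact absurd hk hm
  · obtain rfl : m = k := by omega
    exact Or.inr (Or.inl (eq_word_zero hT he hk hx' h2))

theorem nearType_pair_append (hT : IsEvenTree T) {ρ : List ℕ} {k : ℕ} (hk : ρ ++ [k + 1] ∈ T) :
    NearType T (word ρ (Sym.pair k)) (word (ρ ++ [k + 1]) (Sym.num 0)) := by
  have hlt : word ρ (Sym.pair k) < word (ρ ++ [k + 1]) (Sym.num 0) :=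
    word_lt_word_append (Nat.cast_lt.2 (by omega))
  refine nearType_of_le le_rfl hlt.le hlt.le le_rfl (word ρ (Sym.pair k))
    (word ρ (Sym.num (k + 1))) (word (ρ ++ [k + 1]) (Sym.num 0)) fun e he h1 h2 => ?_
  obtain ⟨hb, eb⟩ := extends_word_append ρ (k + 1) (Sym.num 0)
  obtain ⟨hx, h1', h2'⟩ := ofLex_bounds (extends_word _ _) hb (ofLex_word _ _) eb h1 h2
  rcases he.cases_of_le hT (hT.mem_of_append hk) hx h1' h2' with
    ⟨m, h, rfl⟩ | ⟨m, h, hm, rfl⟩ | ⟨m, h, hm, hx'⟩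
  · obtain rfl : m = k + 1 := by omega
    exact Or.inr (Or.inl rfl)
  · obtain rfl | rfl : m = k ∨ m = k + 1 := by omega
    · exact Or.inl rfl
    · exact absurd hk hm
  · obtain rfl | rfl : m = k ∨ m = k + 1 := by omega
    · exact absurd hm (hT.not_mem_of_succ hk)
    · exact Or.inr (Or.inr (eq_word_zero hT he hk hx' h2))

/-- The extreme case with three types, `ρ⌢(k,k+1)⌢∞`, `ρ⌢(k+1)` and `ρ⌢(k+1,k+2)`. No longer string
intervenes because by evenness `ρ ++ [k + 1]` is not in `T`. -/
theorem nearType_append_top (hT : IsEvenTree T) {ρ : List ℕ} {k : ℕ} (hk : ρ ++ [k] ∈ T)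
    {t : Sym} (ht : Sym.num (k + 1) ≤ t) (ht' : t ≤ Sym.pair (k + 1)) :
    NearType T (word ρ t) (word (ρ ++ [k]) ⊤) := by
  have hlt : ∀ {t : Sym}, Sym.num (k + 1) ≤ t → word (ρ ++ [k]) ⊤ < word ρ t := fun h =>
    word_append_lt_word (lt_of_lt_of_le (Nat.cast_lt.2 (by omega)) h)
  refine nearType_of_le (hlt ht).le (word_le_word ht') le_rfl (hlt (num_le_pair _)).le
    (word (ρ ++ [k]) ⊤) (word ρ (Sym.num (k + 1))) (word ρ (Sym.pair (k + 1))) fun e he h1 h2 => ?_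
  obtain ⟨hb, eb⟩ := extends_word_append ρ k ⊤
  obtain ⟨hx, h1', h2'⟩ := ofLex_bounds hb (extends_word _ _) eb (ofLex_word _ _) h1 h2
  rcases he.cases_of_le hT (hT.mem_of_append hk) hx h1' h2' with
    ⟨m, h, rfl⟩ | ⟨m, h, hm, rfl⟩ | ⟨m, h, hm, hx'⟩
  · obtain rfl : m = k + 1 := by omega
    exact Or.inr (Or.inl rfl)
  · obtain rfl | rfl : m = k ∨ m = k + 1 := by omega
    · exact absurd hk hm
    · exact Or.inr (Or.inr rfl)
  · obtain rfl | rfl : m = k ∨ m = k + 1 := by omega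
    · exact Or.inl (eq_word_top hT he hm hx' h1)
    · exact absurd hm (hT.succ_not_mem hk)

/-- The base types of configurations that contain an `n`-square. -/
theorem HasBaseType.cases_of_mem {y : Config} {t : Sym} (h : HasBaseType y t) {n : ℕ}
    (hn : (n : ℕ∞) ∈ sizes y) : t = Sym.num n ∨ (t = Sym.pair n ∧ (n : ℕ∞) + 1 ∈ sizes y) ∨
      ∃ m, n = m + 1 ∧ t = Sym.pair m ∧ (m : ℕ∞) ∈ sizes y := by
  rcases hasBaseType_iff.1 h with ⟨m, rfl, e⟩ | ⟨m, rfl, e⟩ | ⟨rfl, e⟩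
  · rw [e, mem_singleton_iff] at hn
    have : n = m := by exact_mod_cast hn
    exact Or.inl (by rw [this])
  · rw [e] at hn
    rcases hn with hn | hn
    · have : n = m := by exact_mod_cast hn
      subst this
      exact Or.inr (Or.inl ⟨rfl, by simp [e]⟩)
    · have : n = m + 1 := by exact_mod_cast mem_singleton_iff.1 hn
      exact Or.inr (Or.inr ⟨m, this, rfl, by simp [e]⟩)
  · rw [e] at hn
    exact absurd hn (ENat.natCast_ne_top n)

/-- Elements of the subshift with a reading that contains an `n`-square and is not composed of
tiles. -/
theorem nearType_of_mem_sizes (hT : IsEvenTree T) {ρ : List ℕ} (hρ : ρ ∈ T) {g : ℤ × ℤ} {y : Config}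
    (hx : place ρ g y ∈ shiftOf T) {s : TypeString} (hs : HasType T (place ρ g y) s) {n : ℕ}
    (hn : (n : ℕ∞) ∈ sizes y) (h : ∀ m ≤ n, ρ ++ [m] ∈ T → ¬ IsRegular [m] y) :
    NearType T s (word ρ (Sym.num n)) := by
  have hreg : ∀ m, ρ ++ [m] ∈ T → ¬ IsRegular [m] y := by
    intro m hm hr
    refine h m ?_ hm hr
    rcases sizes_subset_of_isRegular hr hn with h | h
    · have : n = m := by exact_mod_cast h
      omega
    · have : n = m + 1 := by exact_mod_cast mem_singleton_iff.1 h
      omega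
  obtain ⟨t, rfl, ht⟩ := hs.eq_word hT hρ hreg
  rcases ht.cases_of_mem hn with rfl | ⟨rfl, h'⟩ | ⟨m, rfl, rfl, h'⟩
  · exact nearType_self _
  · exact nearType_num_pair hT hρ fun hn' => hreg n hn' (isRegular_of_sizes hn' hx hn h')
  · exact nearType_pair_num hT hρ fun hn' => hreg m hn'
      (isRegular_of_sizes hn' hx h' (by exact_mod_cast hn))

theorem eventually_not_isRegular {y : Config} (n : ℕ) {P : ℕ → Prop}
    (h : ∀ m, P m → ¬ IsRegular [m] y) : ∀ᶠ y' in 𝓝 y, ∀ m ≤ n, P m → ¬ IsRegular [m] y' := by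
  change ∀ᶠ y' in 𝓝 y, ∀ m ∈ Iic n, P m → ¬ IsRegular [m] y'
  rw [eventually_all_finite (finite_Iic n)]
  intro m _
  by_cases hm : P m
  · have : ∀ᶠ y' in 𝓝 y, ¬ IsRegular [m] y' :=
      (isClosed_isRegular [m]).isOpen_compl.mem_nhds (h m hm)
    filter_upwards [this] with y' h' _ using h'
  · simp [hm]

/-- The reading of a tile on its own is not constant. -/
theorem exists_append_of_const {ρ : List ℕ} {y : Config} (h : ¬ (ρ = [] ∨ ∀ b, ∃ q, y q ≠ b)) :
    ∃ τ k b, ρ = τ ++ [k] ∧ y = constConfig b := by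
  push Not at h
  obtain ⟨h1, b, hb⟩ := h
  rcases List.eq_nil_or_concat ρ with h | ⟨τ, k, h⟩
  · exact absurd h h1
  · exact ⟨τ, k, b, by simpa using h, funext hb⟩

theorem mem_sizes_place_const_false (k : ℕ) (g : ℤ × ℤ) :
    (k : ℕ∞) ∈ sizes (place [k] g (constConfig false)) := by
  rw [sizes_place_singleton]
  exact Or.inl ⟨rfl, 0, rfl⟩

theorem mem_sizes_place_const_true (k : ℕ) (g : ℤ × ℤ) :
    ((k + 1 : ℕ) : ℕ∞) ∈ sizes (place [k] g (constConfig true)) := by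
  rw [sizes_place_singleton]
  exact Or.inr ⟨by push_cast; rfl, 0, rfl⟩

/-- An n-square stays visible nearby. If the reading consists of one tile only, nearby points may
lose regularity; then their lower readings contain k-squares and have type `k` or `(k-1,k)`, still
close to the present type. -/
theorem eventually_near_of_num (hT : IsEvenTree T) {ρ : List ℕ} (hρ : ρ ∈ T) {g : ℤ × ℤ}
    {y : Config} {n : ℕ} (hs : sizes y = {(n : ℕ∞)}) (h : ∀ m, ρ ++ [m] ∈ T → ¬ IsRegular [m] y) :
    ∀ᶠ z in 𝓝 (place ρ g y), z ∈ shiftOf T → ∀ s, HasType T z s →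
      NearType T s (word ρ (Sym.num n)) := by
  have hn : (n : ℕ∞) ∈ sizes y := by simp [hs]
  have hev := (eventually_mem_sizes hn).and (eventually_not_isRegular n h)
  by_cases hc : ρ = [] ∨ ∀ b, ∃ q, y q ≠ b
  · filter_upwards [eventually_shiftOf_reading hT hρ (g := g) hc hev] with z hz hzX s hzs
    obtain ⟨y', rfl, h1, h2⟩ := hz hzX
    exact nearType_of_mem_sizes hT hρ hzX hzs (h1 (mem_baseShift_of_place_mem hρ hzX)) h2
  · obtain ⟨τ, k, b, rfl, rfl⟩ := exists_append_of_const hc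
    have hτ := hT.mem_of_append hρ
    obtain rfl : b = false := by
      rw [← Bool.not_eq_true]
      rintro rfl
      rw [sizes_constConfig_true] at hs
      exact absurd (singleton_injective hs).symm (ENat.natCast_ne_top n)
    obtain rfl : n = 0 := by
      rw [sizes_constConfig_false] at hs
      exact_mod_cast (singleton_injective hs).symm
    have hk := mem_sizes_place_const_false k 0
    rw [place_append]
    filter_upwards [eventually_shiftOf_reading hT hτ (g := g) (Or.inr (place_singleton_ne k 0 _))
      ((eventually_mem_sizes hk).and (eventually_reading hev))] with z hz hzX s hzs
    obtain ⟨y', rfl, h1, h2⟩ := hz hzX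
    have hb := mem_baseShift_of_place_mem hτ hzX
    by_cases hr : IsRegular [k] y'
    · obtain ⟨w, rfl, h3, h4⟩ := h2 hr
      rw [← place_append] at hzX hzs
      exact nearType_of_mem_sizes hT hρ hzX hzs (h3 (mem_baseShift_of_place_mem hρ hzX)) h4
    · have hk' := h1 hb
      have hreg : ∀ m, τ ++ [m] ∈ T → ¬ IsRegular [m] y' := by
        intro m hm hr'
        rcases sizes_subset_of_isRegular hr' hk' with h | h
        · have : k = m := by exact_mod_cast h
          exact hr (this ▸ hr')
        · have : k = m + 1 := by exact_mod_cast mem_singleton_iff.1 h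
          subst this
          exact hT.succ_not_mem hm hρ
      obtain ⟨t, rfl, ht⟩ := hzs.eq_word hT hτ hreg
      rcases ht.cases_of_mem hk' with rfl | ⟨rfl, h'⟩ | ⟨m, rfl, rfl, h'⟩
      · exact nearType_num_append hT hρ
      · exact absurd (isRegular_of_sizes hρ hzX hk' h') hr
      · exact nearType_pair_append hT hρ

/-- Both sizes stay visible nearby, and they determine the pair. -/
theorem eventually_eq_of_pair (hT : IsEvenTree T) {ρ : List ℕ} (hρ : ρ ∈ T) {g : ℤ × ℤ}
    {y : Config} {n : ℕ} (hs : sizes y = {(n : ℕ∞), (n : ℕ∞) + 1}) (hn : ρ ++ [n] ∉ T) :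
    ∀ᶠ z in 𝓝 (place ρ g y), z ∈ shiftOf T → ∀ s, HasType T z s → s = word ρ (Sym.pair n) := by
  have h1 : (n : ℕ∞) ∈ sizes y := by simp [hs]
  have h2 : ((n + 1 : ℕ) : ℕ∞) ∈ sizes y := by simp [hs]
  have hc : ∀ b, ∃ q, y q ≠ b := by
    intro b
    by_contra hb
    rw [const_of_not_ne hb] at h1 h2
    exact not_both_mem_sizes_const n b ⟨h1, by exact_mod_cast h2⟩
  filter_upwards [eventually_shiftOf_reading hT hρ (g := g) (Or.inr hc)
    ((eventually_mem_sizes h1).and (eventually_mem_sizes h2))] with z hz hzX s hzs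
  obtain ⟨y', rfl, h3, h4⟩ := hz hzX
  have hb := mem_baseShift_of_place_mem hρ hzX
  have h5 := h3 hb
  have h6 : (n : ℕ∞) + 1 ∈ sizes y' := by exact_mod_cast h4 hb
  obtain ⟨t, rfl, ht⟩ := hzs.eq_word hT hρ fun m hm hr =>
    hn (pair_eq_of_mem (sizes_subset_of_isRegular hr) h5 h6 ▸ hm)
  rcases hasBaseType_iff.1 ht with ⟨m, rfl, e⟩ | ⟨m, rfl, e⟩ | ⟨rfl, e⟩
  · rw [e, mem_singleton_iff] at h5 h6
    have : n = n + 1 := by exact_mod_cast h5.trans h6.symm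
    omega
  · rw [pair_eq_of_mem e.subset h5 h6]
  · rw [e] at h5
    exact absurd h5 (ENat.natCast_ne_top n)

/-- Elements of the subshift with a reading that contains only big squares. -/
theorem le_ofLex_of_sizes (hT : IsEvenTree T) {ρ : List ℕ} (hρ : ρ ∈ T) {g : ℤ × ℤ} {y : Config}
    (hx : place ρ g y ∈ shiftOf T) {s : TypeString} (hs : HasType T (place ρ g y) s) {k : ℕ}
    (h : ∀ m ∈ sizes y, ((k + 1 : ℕ) : ℕ∞) ≤ m) :
    Extends ρ s ∧ (((k : ℕ∞) : Sym) : WithBot Sym) ≤ ofLex s ρ.length := by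
  refine ⟨(hs.extends_iff hT hx hρ).2 isRegular_place, ?_⟩
  by_cases hreg : ∃ m, ρ ++ [m] ∈ T ∧ IsRegular [m] y
  · obtain ⟨m, hm, hr⟩ := hreg
    have he := (hs.extends_iff hT hx hm).2 (isRegular_append_iff.2 hr)
    rw [(extends_append_iff.1 he).2, WithBot.coe_le_coe]
    obtain ⟨j, hj⟩ := sizes_nonempty hr.mem_baseShift
    have hkj := h j hj
    refine Nat.cast_le.2 ?_
    rcases sizes_subset_of_isRegular hr hj with rfl | rfl
    · have : k + 1 ≤ m := by exact_mod_cast hkj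
      omega
    · have : k + 1 ≤ m + 1 := by exact_mod_cast hkj
      omega
  · push Not at hreg
    obtain ⟨t, rfl, ht⟩ := hs.eq_word hT hρ hreg
    rw [ofLex_word, WithBot.coe_le_coe]
    rcases hasBaseType_iff.1 ht with ⟨m, rfl, e⟩ | ⟨m, rfl, e⟩ | ⟨rfl, e⟩
    · have : k + 1 ≤ m := by exact_mod_cast h m (by simp [e])
      exact Nat.cast_le.2 (by omega)
    · have : k + 1 ≤ m := by exact_mod_cast h m (by simp [e])
      exact Nat.cast_le.2 (by omega)
    · exact le_top

/-- Nearby points that keep the alignment have only large squares, hence a large next symbol. Those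
that lose it, possible only if the reading is constantly `1`, have a close type. -/
theorem eventually_near_of_top (hT : IsEvenTree T) {ρ : List ℕ} (hρ : ρ ∈ T) {g : ℤ × ℤ}
    {y : Config} (hs : sizes y = {⊤}) (k : ℕ) :
    ∀ᶠ z in 𝓝 (place ρ g y), z ∈ shiftOf T → ∀ s, HasType T z s →
      NearType T s (word ρ ⊤) ∨ (Aligned ρ g z ∧ Extends ρ s ∧
        (((k : ℕ∞) : Sym) : WithBot Sym) ≤ ofLex s ρ.length) := by
  have hev := eventually_sizes_ge (y := y) (by simp [hs]) (k + 1)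
  by_cases hc : ρ = [] ∨ ∀ b, ∃ q, y q ≠ b
  · filter_upwards [eventually_shiftOf_reading hT hρ (g := g) hc hev] with z hz hzX s hzs
    obtain ⟨y', rfl, h1⟩ := hz hzX
    exact Or.inr ⟨⟨_, rfl⟩,
      le_ofLex_of_sizes hT hρ hzX hzs (h1 (mem_baseShift_of_place_mem hρ hzX))⟩
  · obtain ⟨τ, j, b, rfl, rfl⟩ := exists_append_of_const hc
    have hτ := hT.mem_of_append hρ
    obtain rfl : b = true := by
      rw [← Bool.not_eq_false]
      rintro rfl
      rw [sizes_constConfig_false] at hs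
      exact absurd (singleton_injective hs) (ENat.natCast_ne_top 0)
    have hj := mem_sizes_place_const_true j 0
    rw [place_append]
    filter_upwards [eventually_shiftOf_reading hT hτ (g := g) (Or.inr (place_singleton_ne j 0 _))
      ((eventually_mem_sizes hj).and (eventually_reading hev))] with z hz hzX s hzs
    obtain ⟨y', rfl, h1, h2⟩ := hz hzX
    have hb := mem_baseShift_of_place_mem hτ hzX
    by_cases hr : IsRegular [j] y'
    · obtain ⟨w, rfl, h3⟩ := h2 hr
      rw [← place_append] at hzX hzs ⊢
      exact Or.inr ⟨⟨_, rfl⟩,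
        le_ofLex_of_sizes hT hρ hzX hzs (h3 (mem_baseShift_of_place_mem hρ hzX))⟩
    · left
      have hj' := h1 hb
      have hreg : ∀ m, τ ++ [m] ∈ T → ¬ IsRegular [m] y' := by
        intro m hm hr'
        rcases sizes_subset_of_isRegular hr' hj' with h | h
        · have : j + 1 = m := by exact_mod_cast h
          subst this
          exact hT.succ_not_mem hρ hm
        · have : j + 1 = m + 1 := by exact_mod_cast mem_singleton_iff.1 h
          obtain rfl : j = m := by omega
          exact hr hr'
      obtain ⟨t, rfl, ht⟩ := hzs.eq_word hT hτ hreg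
      rcases ht.cases_of_mem hj' with rfl | ⟨rfl, h'⟩ | ⟨m, hm, rfl, h'⟩
      · exact nearType_append_top hT hρ le_rfl (num_le_pair _)
      · exact nearType_append_top hT hρ (num_le_pair _) le_rfl
      · obtain rfl : j = m := by omega
        exact absurd (isRegular_of_sizes hρ hzX h' (by exact_mod_cast hj')) hr

end Tree

end TCPE

/-! ### Semicontinuity of types and common alignments -/

namespace TCPE

open Set Filter Topology

section Tree

variable {T : Set (List ℕ)}

/-- The types with a given initial segment form an interval, so they all lie on the same side of any
other type. -/
theorem lt_of_not_extends {ρ : List ℕ} {a s s' : TypeString} (ha : ¬ Extends ρ a) (hs : Extends ρ s)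
    (hs' : Extends ρ s') (h : a < s) : a < s' := by
  by_contra hcon
  exact ha (hs'.of_le_of_le hs (not_lt.1 hcon) h.le)

theorem gt_of_not_extends {ρ : List ℕ} {a s s' : TypeString} (ha : ¬ Extends ρ a) (hs : Extends ρ s)
    (hs' : Extends ρ s') (h : s < a) : s' < a := by
  by_contra hcon
  exact ha (hs.of_le_of_le hs' h.le (not_lt.1 hcon))

theorem prefix_of_extends_word_top {ρ σ : List ℕ} (h : Extends σ (word ρ ⊤)) : σ <+: ρ := by
  have hl : σ.length ≤ ρ.length := by
    by_contra hcon
    push Not at hcon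
    obtain ⟨τ, rfl⟩ := h.prefix (extends_word ρ ⊤) hcon.le
    cases τ with
    | nil => simp at hcon
    | cons n τ =>
      have h1 := (extends_append_iff.1 (h.of_prefix (σ := ρ ++ [n]) ⟨τ, by simp⟩)).2
      rw [ofLex_word] at h1
      exact pair_ne_top n (WithBot.coe_injective h1).symm
  exact (extends_word ρ ⊤).prefix h hl

theorem exists_nat_of_lt_top (hT : IsEvenTree T) {ρ : List ℕ} (hρ : ρ ∈ T) {a : TypeString}
    (ha : IsType T a) (h : a < word ρ ⊤) : ∃ k : ℕ, ∀ s, Extends ρ s →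
      (((k : ℕ∞) : Sym) : WithBot Sym) ≤ ofLex s ρ.length → a < s := by
  by_cases hx : Extends ρ a
  · obtain ⟨k, hk⟩ : ∃ k : ℕ, ofLex a ρ.length = (((k : ℕ∞) : Sym) : WithBot Sym) := by
      rcases ha.cases hT hρ hx with ⟨n, rfl⟩ | ⟨n, -, rfl⟩ | ⟨n, -, hx'⟩ | rfl
      · exact ⟨_, ofLex_word _ _⟩
      · exact ⟨_, ofLex_word _ _⟩
      · exact ⟨_, (extends_append_iff.1 hx').2⟩
      · exact absurd h (lt_irrefl _)
    refine ⟨k + 1, fun s hs hk' => lt_of_ofLex_lt hx hs (lt_of_lt_of_le ?_ hk')⟩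
    rw [hk]
    exact WithBot.coe_lt_coe.2 (Nat.cast_lt.2 (by omega))
  · exact ⟨0, fun s hs _ => lt_of_not_extends hx (extends_word ρ ⊤) hs h⟩

/-- Types are semicontinuous up to close types, and alignments are locally constant. -/
theorem HasType.eventually_near (hT : IsEvenTree T) {x : Config} (hx : x ∈ shiftOf T)
    {s : TypeString} (hs : HasType T x s) :
    (∀ᶠ z in 𝓝 x, z ∈ shiftOf T → ∀ s', HasType T z s' → NearType T s' s) ∨
    ((∀ ρ ∈ T, IsRegular ρ x → ∃ g, Aligned ρ g x ∧ ∀ᶠ z in 𝓝 x, z ∈ shiftOf T → ∀ s',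
        HasType T z s' → NearType T s' s ∨ Aligned ρ g z) ∧
      (∀ a, IsType T a → a < s → ∀ᶠ z in 𝓝 x, z ∈ shiftOf T → ∀ s', HasType T z s' →
        NearType T s' s ∨ a < s') ∧
      (∀ a, IsType T a → s < a → ∀ᶠ z in 𝓝 x, z ∈ shiftOf T → ∀ s', HasType T z s' →
        NearType T s' s ∨ s' < a)) := by
  have hs' := hs
  cases hs with
  | fin ρ y t hρ hy hmax ht =>
    obtain ⟨g, -, rfl⟩ := isReading_iff.1 hy
    have hreg : ∀ m, ρ ++ [m] ∈ T → ¬ IsRegular [m] y := by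
      intro m hm hr
      have := hmax _ hm (isRegular_append_iff.2 hr)
      simp at this
    rcases hasBaseType_iff.1 ht with ⟨n, rfl, e⟩ | ⟨n, rfl, e⟩ | ⟨rfl, e⟩
    · exact Or.inl (eventually_near_of_num hT hρ e hreg)
    · left
      have hn : ρ ++ [n] ∉ T := fun hn =>
        hreg n hn (isRegular_of_sizes hn hx (by simp [e]) (by simp [e]))
      filter_upwards [eventually_eq_of_pair hT hρ (g := g) e hn] with z hz hzX s' hzs
      rw [hz hzX s' hzs]
      exact nearType_self _
    · right
      have hev := fun k => eventually_near_of_top hT hρ (g := g) e k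
      refine ⟨fun σ hσ hr => ?_, fun a ha hlt => ?_, fun a ha hlt => ?_⟩
      · have hpre := prefix_of_extends_word_top ((hs'.extends_iff hT hx hσ).2 hr)
        refine ⟨g, Aligned.of_prefix hpre ⟨y, rfl⟩, ?_⟩
        filter_upwards [hev 0] with z hz hzX s' hzs
        exact (hz hzX s' hzs).imp id fun h => h.1.of_prefix hpre
      · obtain ⟨k, hk⟩ := exists_nat_of_lt_top hT hρ ha hlt
        filter_upwards [hev k] with z hz hzX s' hzs
        exact (hz hzX s' hzs).imp id fun h => hk s' h.2.1 h.2.2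
      -- Among the types that extend `ρ`, the one ending in `∞` is the largest.
      · have hnx : ¬ Extends ρ a := fun h => hlt.ne (eq_word_top hT ha hρ h hlt.le).symm
        filter_upwards [hev 0] with z hz hzX s' hzs
        exact (hz hzX s' hzs).imp id fun h => gt_of_not_extends hnx (extends_word ρ ⊤) h.2.1 hlt
  | path f hf =>
    right
    -- On a path the reading at each level is composed of tiles of the next one, hence nonconstant,
    -- so regularity and alignment are locally constant.
    have hev : ∀ k, ∃ g, Aligned ((List.range k).map f) g x ∧
        ∀ᶠ z in 𝓝 x, z ∈ shiftOf T → Aligned ((List.range k).map f) g z := by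
      intro k
      obtain ⟨g, y, rfl⟩ := (hf k).2.exists_eq_place
      have h1 := hf (k + 1)
      rw [List.range_succ, List.map_append, List.map_singleton] at h1
      refine ⟨g, ⟨y, rfl⟩, ?_⟩
      filter_upwards [eventually_shiftOf_reading hT (hf k).1 (g := g)
        (Or.inr (isRegular_append_iff.1 h1.2).ne_const) (Eventually.of_forall fun _ => trivial)]
        with z hz hzX
      obtain ⟨y', rfl, -⟩ := hz hzX
      exact ⟨y', rfl⟩
    have hne : ∀ a : TypeString, a ≠ (infString fun i => Sym.pair (f i)) →
        ∃ k, ¬ Extends ((List.range k).map f) a := by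
      intro a ha
      by_contra hcon
      push Not at hcon
      refine ha (congrArg toLex (funext fun i => ?_) : toLex (ofLex a) = _)
      rw [hcon (i + 1) i (by simp)]
      simp
    have hext := fun k => (hs'.extends_iff hT hx (hf k).1).2 (hf k).2
    refine ⟨fun σ hσ hr => ?_, fun a ha hlt => ?_, fun a ha hlt => ?_⟩
    · obtain ⟨g, hg, hgz⟩ := hev σ.length
      have hpre : σ <+: (List.range σ.length).map f :=
        (hext σ.length).prefix ((hs'.extends_iff hT hx hσ).2 hr) (by simp)
      refine ⟨g, hg.of_prefix hpre, ?_⟩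
      filter_upwards [hgz] with z hz hzX s' _ using Or.inr ((hz hzX).of_prefix hpre)
    · obtain ⟨k, hk⟩ := hne a hlt.ne
      obtain ⟨g, hg, hgz⟩ := hev k
      filter_upwards [hgz] with z hz hzX s' hzs
      exact Or.inr (lt_of_not_extends hk (hext k)
        ((hzs.extends_iff hT hzX (hf k).1).2 (hz hzX).isRegular) hlt)
    · obtain ⟨k, hk⟩ := hne a hlt.ne'
      obtain ⟨g, hg, hgz⟩ := hev k
      filter_upwards [hgz] with z hz hzX s' hzs
      exact Or.inr (gt_of_not_extends hk (hext k)
        ((hzs.extends_iff hT hzX (hf k).1).2 (hz hzX).isRegular) hlt)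

/-- The configurations have a common alignment wherever both of them are regular. -/
def Allied (T : Set (List ℕ)) (x y : Config) : Prop :=
  ∀ ρ ∈ T, IsRegular ρ x → IsRegular ρ y → ∃ g, Aligned ρ g x ∧ Aligned ρ g y

theorem Allied.symm {x y : Config} (h : Allied T x y) : Allied T y x := fun ρ hρ h1 h2 =>
  let ⟨g, h1, h2⟩ := h ρ hρ h2 h1
  ⟨g, h2, h1⟩

theorem allied_self (x : Config) : Allied T x x := fun _ _ h _ =>
  let ⟨g, hg⟩ := h.exists_aligned
  ⟨g, hg, hg⟩

open Classical in
/-- The type of an element of the subshift. -/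
noncomputable def typeOf (hT : IsEvenTree T) (x : shiftOf T) : typeOrder T :=
  ⟨choose (exists_hasType hT x.2), x, x.2, choose_spec (exists_hasType hT x.2)⟩

theorem hasType_typeOf (hT : IsEvenTree T) (x : shiftOf T) : HasType T x (typeOf hT x).1 :=
  Classical.choose_spec (exists_hasType hT x.2)

theorem typeOf_eq (hT : IsEvenTree T) {x : shiftOf T} {s : typeOrder T} (h : HasType T x s.1) :
    typeOf hT x = s := Subtype.ext ((hasType_typeOf hT x).unique hT x.2 h)

theorem typeOf_surjective (hT : IsEvenTree T) : Function.Surjective (typeOf hT) := by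
  rintro ⟨s, x, hx, hs⟩
  exact ⟨⟨x, hx⟩, typeOf_eq hT hs⟩

theorem typeOf_vadd (hT : IsEvenTree T) (g : ℤ × ℤ) (x x' : shiftOf T)
    (h : (x' : Config) = g +ᵥ (x : Config)) : typeOf hT x' = typeOf hT x := by
  refine typeOf_eq hT ?_
  rw [h]
  exact (hasType_typeOf hT x).vadd g

theorem isRegular_nil (x : Config) : IsRegular [] x := by
  have := isRegular_place (ρ := []) (g := 0) (y := x)
  rwa [place_nil, zero_vadd] at this

/-- A configuration with a given type and with the alignments of `x`. -/
theorem exists_allied (hT : IsEvenTree T) (x z : shiftOf T) : ∃ z' : shiftOf T,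
    typeOf hT z' = typeOf hT z ∧ (∀ ρ ∈ T, IsRegular ρ (z' : Config) ↔ IsRegular ρ (z : Config)) ∧
      Allied T x z' := by
  by_cases hmax : ∃ ρ ∈ T, (IsRegular ρ (x : Config) ∧ IsRegular ρ (z : Config)) ∧
      ∀ σ ∈ T, IsRegular σ (x : Config) → IsRegular σ (z : Config) → σ.length ≤ ρ.length
  · obtain ⟨ρ, hρ, ⟨hx, hz⟩, hm⟩ := hmax
    obtain ⟨g, hg⟩ := hx.exists_aligned
    obtain ⟨g', hg'⟩ := hz.exists_aligned
    refine ⟨⟨(g - g') +ᵥ (z : Config), vadd_mem_shiftOf z.2 _⟩, typeOf_vadd hT (g - g') _ _ rfl,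
      fun σ _ => isRegular_vadd_iff, ?_⟩
    intro σ hσ h1 h2
    have h3 : IsRegular σ (z : Config) := isRegular_vadd_iff.1 h2
    have hpre : σ <+: ρ := by
      rcases prefix_or_prefix hT hσ hρ h1 hx with h | h
      · exact h
      · rw [h.eq_of_length_le (hm σ hσ h1 h3)]
    refine ⟨g, hg.of_prefix hpre, ?_⟩
    have := aligned_vadd (hg'.of_prefix hpre) (g - g')
    rwa [add_sub_cancel] at this
  · push Not at hmax
    have key : ∀ k, ∃ ρ ∈ T, (IsRegular ρ (x : Config) ∧ IsRegular ρ (z : Config)) ∧ k ≤ ρ.length := by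
      intro k
      induction k with
      | zero => exact ⟨[], hT.root, ⟨isRegular_nil _, isRegular_nil _⟩, le_rfl⟩
      | succ k ih =>
        obtain ⟨ρ, hρ, h, hk⟩ := ih
        obtain ⟨σ, hσ, h1, h2, hlt⟩ := hmax ρ hρ h
        exact ⟨σ, hσ, ⟨h1, h2⟩, by omega⟩
    have hreg : ∀ ρ ∈ T, IsRegular ρ (x : Config) ↔ IsRegular ρ (z : Config) := by
      intro ρ hρ
      obtain ⟨σ, hσ, ⟨h1, h2⟩, hl⟩ := key ρ.length
      constructor
      · intro h
        rcases prefix_or_prefix hT hρ hσ h h1 with h' | h'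
        · exact h2.of_prefix h'
        · rwa [← h'.eq_of_length_le hl]
      · intro h
        rcases prefix_or_prefix hT hρ hσ h h2 with h' | h'
        · exact h1.of_prefix h'
        · rwa [← h'.eq_of_length_le hl]
    -- Without a longest common string, both points follow the same infinite path, so `x` itself has
    -- the type of `z`.
    refine ⟨x, ?_, hreg, allied_self _⟩
    refine typeOf_eq hT ?_
    have hz := hasType_typeOf hT z
    generalize (typeOf hT z).1 = s at hz
    cases hz with
    | fin ρ y t hρ hy hm ht =>
      obtain ⟨σ, hσ, ⟨-, h2⟩, hl⟩ := key (ρ.length + 1)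
      have := hm σ hσ h2
      omega
    | path f hf => exact .path f fun k => ⟨(hf k).1, (hreg _ (hf k).1).2 (hf k).2⟩

/-- It suffices to align a point of type `c` with one of `x` and `y`: with `x`, if every string
common to it and `y` is also a string of `x`. If this fails for `σ`, every string it shares with `x`
is an initial segment of `σ`, hence a string of `y`, and the roles are exchanged. -/
theorem exists_interpolation (hT : IsEvenTree T) {x y : shiftOf T} (h : Allied T x y)
    (c : typeOrder T) : ∃ z : shiftOf T, typeOf hT z = c ∧ Allied T x z ∧ Allied T z y := by
  obtain ⟨z, rfl⟩ := typeOf_surjective hT c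
  have key : ∀ {x y : shiftOf T}, Allied T x y →
      (∀ ρ ∈ T, IsRegular ρ (z : Config) → IsRegular ρ (y : Config) → IsRegular ρ (x : Config)) →
      ∃ z' : shiftOf T, typeOf hT z' = typeOf hT z ∧ Allied T x z' ∧ Allied T z' y := by
    intro x y h hsub
    obtain ⟨z', h1, h2, h3⟩ := exists_allied hT x z
    refine ⟨z', h1, h3, fun ρ hρ hz hy => ?_⟩
    have hx := hsub ρ hρ ((h2 ρ hρ).1 hz) hy
    obtain ⟨g, hg, hg'⟩ := h ρ hρ hx hy
    obtain ⟨k, hk, hk'⟩ := h3 ρ hρ hx hz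
    exact ⟨g, hk.congr hg hk', hg'⟩
  by_cases hsub : ∀ ρ ∈ T, IsRegular ρ (z : Config) → IsRegular ρ (y : Config) →
      IsRegular ρ (x : Config)
  · exact key h hsub
  · push Not at hsub
    obtain ⟨σ, hσ, h1, h2, h3⟩ := hsub
    obtain ⟨z', e, h4, h5⟩ := key h.symm fun ρ hρ hz hx => by
      rcases prefix_or_prefix hT hσ hρ h1 hz with h' | h'
      · exact absurd (hx.of_prefix h') h3
      · exact h2.of_prefix h'
    exact ⟨z', e, h5.symm, h4.symm⟩

theorem eventually_subtype {X : Set Config} {x : X} {P : Config → Prop}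
    (h : ∀ᶠ z in 𝓝 (x : Config), z ∈ X → P z) : ∀ᶠ z : X in 𝓝 x, P z := by
  filter_upwards [continuous_subtype_val.continuousAt.eventually h] with z hz using hz z.2

theorem typeMap (hT : IsEvenTree T) :
    TypeMap (typeOf hT) (fun x y : shiftOf T => Allied T x y) where
  symm h := h.symm
  interpolate h c := exists_interpolation hT h c
  eventually_gt x a ha := by
    rcases (hasType_typeOf hT x).eventually_near hT x.2 with h | ⟨-, h, -⟩
    · filter_upwards [eventually_subtype h] with z hz using Or.inr (hz _ (hasType_typeOf hT z)).near
    · filter_upwards [eventually_subtype (h a.1 a.2 ha)] with z hz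
      exact (hz _ (hasType_typeOf hT z)).symm.imp id NearType.near
  eventually_lt x a ha := by
    rcases (hasType_typeOf hT x).eventually_near hT x.2 with h | ⟨-, -, h⟩
    · filter_upwards [eventually_subtype h] with z hz using Or.inr (hz _ (hasType_typeOf hT z)).near
    · filter_upwards [eventually_subtype (h a.1 a.2 ha)] with z hz
      exact (hz _ (hasType_typeOf hT z)).symm.imp id NearType.near
  -- Nearby points that are not close in type inherit the alignment of `x`, and they share one with
  -- `y`.
  of_frequently {x y} hf := by
    rcases (hasType_typeOf hT x).eventually_near hT x.2 with h | ⟨h, -, -⟩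
    · obtain ⟨z, hz1, hz2⟩ := (hf.and_eventually (eventually_subtype h)).exists
      exact absurd (hz2 _ (hasType_typeOf hT z)).near hz1.2
    · intro ρ hρ h1 h2
      obtain ⟨g, hg, hev⟩ := h ρ hρ h1
      obtain ⟨z, ⟨hz1, hz2⟩, hz3⟩ := (hf.and_eventually (eventually_subtype hev)).exists
      have hzg := (hz3 _ (hasType_typeOf hT z)).resolve_left fun h => hz2 h.near
      obtain ⟨g', hz', hy'⟩ := hz1 ρ hρ hzg.isRegular h2
      exact ⟨g', hzg.congr hz' hg, hy'⟩

end Tree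

end TCPE

namespace TCPE

open Set Filter Topology

/-! ### Entropy pairs in the subshift of a tree -/

theorem finite_inWindow (N : ℕ) : {p : ℤ × ℤ | InWindow N p}.Finite :=
  ((finite_Icc (-(N : ℤ)) N).prod (finite_Icc (-(N : ℤ)) N)).subset fun _ hp => ⟨hp.1, hp.2⟩

theorem exists_inWindow_div (j : ℕ) (g : ℤ × ℤ) (N : ℕ) : ∃ M : ℕ, ∀ p, InWindow N p →
    InWindow M ((p.1 - g.1) / j, (p.2 - g.2) / j) := by
  obtain ⟨M, hM⟩ := exists_inWindow _
    ((finite_inWindow N).image fun p => ((p.1 - g.1) / (j : ℤ), (p.2 - g.2) / (j : ℤ)))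
  exact ⟨M, fun p hp => hM _ ⟨p, hp, rfl⟩⟩

theorem mem_entropyOrEqual_of_agree {X : Set Config} {x y : X}
    (h : ∀ N, ∃ u v : X, Agree N x u ∧ Agree N y v ∧ (u, v) ∈ entropyOrEqual X) :
    (x, y) ∈ entropyOrEqual X := by
  rw [← (isClosed_entropyOrEqual X).closure_eq, mem_closure_iff_nhds]
  intro U hU
  rw [nhds_prod_eq, mem_prod_iff] at hU
  obtain ⟨U₁, hU₁, U₂, hU₂, hsub⟩ := hU
  rw [nhds_subtype_eq_comap] at hU₁ hU₂
  obtain ⟨V₁, hV₁, hVU₁⟩ := hU₁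
  obtain ⟨V₂, hV₂, hVU₂⟩ := hU₂
  obtain ⟨N₁, hN₁⟩ := mem_nhds_config_iff.1 hV₁
  obtain ⟨N₂, hN₂⟩ := mem_nhds_config_iff.1 hV₂
  obtain ⟨u, v, hu, hv, huv⟩ := h (max N₁ N₂)
  exact ⟨(u, v), hsub ⟨hVU₁ (hN₁ _ (hu.mono (le_max_left _ _))),
    hVU₂ (hN₂ _ (hv.mono (le_max_right _ _)))⟩, huv⟩

theorem mem_equivClosure_trans {X : Type} {E : Set (X × X)} {a b c : X} (h : (a, b) ∈ E)
    (h' : (b, c) ∈ E) : (a, c) ∈ equivClosure E :=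
  .trans _ _ _ (.rel _ _ h) (.rel _ _ h')

section Tree

variable {T : Set (List ℕ)}

/-- Configurations with a common alignment and with readings made of the same squares. -/
theorem mem_entropyOrEqual_of_sizes (hT : IsEvenTree T) {ρ : List ℕ} (hρ : ρ ∈ T) {g : ℤ × ℤ}
    {y y' : Config} {n : ℕ} {F : Set ℕ∞} (hF : F ⊆ {(n : ℕ∞), (n : ℕ∞) + 1})
    (hFT : ∀ m : ℕ, ρ ++ [m] ∈ T → ¬ ((m : ℕ∞) ∈ F ∧ (m : ℕ∞) + 1 ∈ F)) (hs : sizes y ⊆ F)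
    (hs' : sizes y' ⊆ F) {x x' : shiftOf T} (hx : (x : Config) = place ρ g y)
    (hx' : (x' : Config) = place ρ g y') : (x, x') ∈ entropyOrEqual (shiftOf T) := by
  by_cases hxx : x = x'
  · exact Or.inl hxx
  refine Or.inr (isEntropyPair_of_independent hxx (fun g z hz => vadd_mem_shiftOf hz g) fun N => ?_)
  obtain ⟨M, hM⟩ := exists_inWindow_div (tileSize ρ) g N
  have hy := mem_baseShift_of_place_mem hρ (hx ▸ x.2)
  have hy' := mem_baseShift_of_place_mem hρ (hx' ▸ x'.2)
  obtain ⟨K, hK, hind⟩ := exists_independent hF hy hy' hs hs' M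
  have hj := tileSize_pos ρ
  have hj' : (tileSize ρ : ℤ) ≠ 0 := by exact_mod_cast hj.ne'
  -- Independence of the readings on a lattice of period `K` becomes independence of the points
  -- after scaling by the tile size.
  refine ⟨tileSize ρ * K, by positivity, fun θ => ?_⟩
  obtain ⟨w, hw, hwF, hwv⟩ := hind θ
  refine ⟨place ρ g w, place_mem_shiftOf hT hρ hw (fun m hm h => hFT m hm ⟨hwF h.1, hwF h.2⟩) g,
    fun q p hp => ?_⟩
  have key : ∀ a b c : ℤ, (((tileSize ρ * K : ℕ) : ℤ) * a + b - c) / tileSize ρ =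
      K * a + (b - c) / tileSize ρ ∧
      (((tileSize ρ * K : ℕ) : ℤ) * a + b - c) % tileSize ρ = (b - c) % tileSize ρ := by
    intro a b c
    have e : ((tileSize ρ * K : ℕ) : ℤ) * a + b - c = (b - c) + tileSize ρ * (K * a) := by
      push_cast
      ring
    rw [e, Int.add_mul_ediv_left _ _ hj', Int.add_mul_emod_self_left]
    exact ⟨by ring, rfl⟩
  have h1 := hwv q _ (hM p hp)
  rw [hx, hx']
  simp only [place, (key _ _ _).1, (key _ _ _).2, h1]
  split_ifs <;> rfl

theorem agree_place {ρ : List ℕ} {g : ℤ × ℤ} {N M : ℕ} (hM : ∀ p, InWindow N p →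
    InWindow M ((p.1 - g.1) / tileSize ρ, (p.2 - g.2) / tileSize ρ)) {y y' : Config}
    (h : Agree M y y') : Agree N (place ρ g y) (place ρ g y') := by
  intro p hp
  simp only [place, h _ (hM p hp)]

theorem not_both_mem_singleton (k : ℕ∞) (m : ℕ) :
    ¬ ((m : ℕ∞) ∈ ({k} : Set ℕ∞) ∧ (m : ℕ∞) + 1 ∈ ({k} : Set ℕ∞)) := by
  rintro ⟨h1, h2⟩
  have : m = m + 1 := by exact_mod_cast (mem_singleton_iff.1 h1).trans (mem_singleton_iff.1 h2).symm
  omega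

theorem mem_entropyOrEqual_of_eq (hT : IsEvenTree T) {ρ : List ℕ} (hρ : ρ ∈ T) {g : ℤ × ℤ}
    {y y' : Config} {n : ℕ} (hs : sizes y = {(n : ℕ∞)}) (hs' : sizes y' = {(n : ℕ∞)})
    {x x' : shiftOf T} (hx : (x : Config) = place ρ g y) (hx' : (x' : Config) = place ρ g y') :
    (x, x') ∈ entropyOrEqual (shiftOf T) :=
  mem_entropyOrEqual_of_sizes hT hρ (n := n) (F := {(n : ℕ∞)}) (by simp)
    (fun m _ => not_both_mem_singleton _ m) hs.subset hs'.subset hx hx'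

theorem mem_entropyOrEqual_of_pair (hT : IsEvenTree T) {ρ : List ℕ} (hρ : ρ ∈ T) {g : ℤ × ℤ}
    {y y' : Config} {n : ℕ} (hn : ρ ++ [n] ∉ T) (hs : sizes y ⊆ {(n : ℕ∞), (n : ℕ∞) + 1})
    (hs' : sizes y' ⊆ {(n : ℕ∞), (n : ℕ∞) + 1})
    {x x' : shiftOf T} (hx : (x : Config) = place ρ g y) (hx' : (x' : Config) = place ρ g y') :
    (x, x') ∈ entropyOrEqual (shiftOf T) :=
  mem_entropyOrEqual_of_sizes hT hρ le_rfl
    (fun _ hm h => hn ((pair_eq_of_mem (m := n) le_rfl h.1 h.2) ▸ hm)) hs hs' hx hx'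

/-- Both points are limits of points whose readings consist of m-squares, with the same `m`, and the
relation is closed. -/
theorem mem_entropyOrEqual_of_top (hT : IsEvenTree T) {ρ : List ℕ} (hρ : ρ ∈ T) {g : ℤ × ℤ}
    {y y' : Config} (hs : sizes y = {⊤}) (hs' : sizes y' = {⊤}) {x x' : shiftOf T}
    (hx : (x : Config) = place ρ g y) (hx' : (x' : Config) = place ρ g y') :
    (x, x') ∈ entropyOrEqual (shiftOf T) := by
  refine mem_entropyOrEqual_of_agree fun N => ?_
  obtain ⟨M, hM⟩ := exists_inWindow_div (tileSize ρ) g N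
  obtain ⟨m, ⟨w, hw, ha⟩, ⟨w', hw', ha'⟩⟩ := ((eventually_exists_agree (x := y) (by simp [hs]) M).and
    (eventually_exists_agree (x := y') (by simp [hs']) M)).exists
  refine ⟨⟨_, mem_shiftOf_of_sizes_eq hT hρ g hw⟩, ⟨_, mem_shiftOf_of_sizes_eq hT hρ g hw'⟩, ?_, ?_,
    mem_entropyOrEqual_of_eq hT hρ hw hw' rfl rfl⟩
  · rw [hx]
    exact agree_place hM ha
  · rw [hx']
    exact agree_place hM ha'

/-- A window that meets at most two rows and two columns of tiles. -/
theorem exists_agree_place {ρ : List ℕ} (g : ℤ × ℤ) (y : Config) {N : ℕ}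
    (hN : 2 * N < tileSize ρ) :
    ∃ w, sizes w = {((2 : ℕ) : ℕ∞)} ∧ Agree N (place ρ g y) (place ρ g w) := by
  have hj : (0 : ℤ) < tileSize ρ := by exact_mod_cast tileSize_pos ρ
  let c : ℤ → ℤ := fun a => (-(N : ℤ) - a) / tileSize ρ
  obtain ⟨w, hw, h00, h10, h01, h11⟩ := exists_pattern
    (fun a b => y (c g.1 + (if a then 1 else 0), c g.2 + (if b then 1 else 0))) (c g.1, c g.2)
  refine ⟨w, hw, fun p hp => ?_⟩
  have hc : ∀ a b : ℤ, -(N : ℤ) ≤ a → a ≤ N →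
      (a - b) / tileSize ρ = c b ∨ (a - b) / tileSize ρ = c b + 1 := by
    intro a b h1 h2
    have h3 : c b ≤ (a - b) / tileSize ρ := Int.ediv_le_ediv hj (by omega)
    have h4 : (a - b) / tileSize ρ ≤ c b + 1 := by
      have : c b + 1 = (-(N : ℤ) - b + tileSize ρ * 1) / tileSize ρ := by
        rw [Int.add_mul_ediv_left _ _ hj.ne']
      rw [this]
      exact Int.ediv_le_ediv hj (by omega)
    omega
  simp only [Bool.false_eq_true, if_false, if_true, add_zero] at h00 h10 h01 h11
  have : w ((p.1 - g.1) / tileSize ρ, (p.2 - g.2) / tileSize ρ) =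
      y ((p.1 - g.1) / tileSize ρ, (p.2 - g.2) / tileSize ρ) := by
    rcases hc p.1 g.1 hp.1.1 hp.1.2 with e1 | e1 <;> rcases hc p.2 g.2 hp.2.1 hp.2.2 with e2 | e2 <;>
      rw [e1, e2]
    · exact h00
    · exact h01
    · exact h10
    · exact h11
  simp only [place, this]

theorem HasType.hasBaseType (hT : IsEvenTree T) {ρ : List ℕ} {g : ℤ × ℤ} {y : Config} {t : Sym}
    (hx : place ρ g y ∈ shiftOf T) (h : HasType T (place ρ g y) (word ρ t)) (hρ : ρ ∈ T)
    (ht : ∀ n, ρ ++ [n] ∈ T → t ≠ Sym.pair n) : HasBaseType y t := by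
  obtain ⟨t', e, h'⟩ := h.eq_word hT hρ fun n hn hr => by
    have h1 := (h.extends_iff hT hx hn).2 (isRegular_append_iff.2 hr)
    have h2 := (extends_append_iff.1 h1).2
    rw [ofLex_word] at h2
    exact ht n hn (WithBot.coe_injective h2)
  have h1 := ofLex_word ρ t
  rw [e, ofLex_word] at h1
  rwa [← WithBot.coe_injective h1]

theorem exists_common_reading {ρ : List ℕ} (hρ : ρ ∈ T) {x y : Config} (h : Allied T x y)
    (hx : IsRegular ρ x) (hy : IsRegular ρ y) : ∃ g u v, x = place ρ g u ∧ y = place ρ g v := by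
  obtain ⟨g, ⟨u, hu⟩, ⟨v, hv⟩⟩ := h ρ hρ hx hy
  exact ⟨g, u, v, hu, hv⟩

/-- If the type is a finite word, both readings use squares of the same sizes, and independence
applies, after approximation in the case of `∞`. -/
theorem mem_entropyOrEqual_of_typeOf_eq (hT : IsEvenTree T) {x y : shiftOf T}
    (h : typeOf hT x = typeOf hT y) (hA : Allied T x y) : (x, y) ∈ entropyOrEqual (shiftOf T) := by
  have hx := hasType_typeOf hT x
  have hy := hasType_typeOf hT y
  rw [← h] at hy
  generalize (typeOf hT x).1 = s at hx hy
  have hx' := hx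
  cases hx with
  | fin ρ u t hρ hu hmax ht =>
    have hyr := (hy.extends_iff hT y.2 hρ).1 (extends_word ρ t)
    obtain ⟨g, u, v, e, e'⟩ := exists_common_reading hρ hA ⟨u, hu⟩ hyr
    have hne : ∀ n, ρ ++ [n] ∈ T → t ≠ Sym.pair n := by
      rintro n hn rfl
      have h1 := (hx'.extends_iff hT x.2 hn).1 (extends_append_iff.2 ⟨extends_word _ _, ofLex_word _ _⟩)
      have := hmax _ hn h1
      simp at this
    have hxX := x.2
    have hyX := y.2
    rw [e] at hx' hxX
    rw [e'] at hy hyX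
    have hbu := hx'.hasBaseType hT hxX hρ hne
    have hbv := hy.hasBaseType hT hyX hρ hne
    rcases hasBaseType_iff.1 ht with ⟨n, rfl, -⟩ | ⟨n, rfl, -⟩ | ⟨rfl, -⟩
    · exact mem_entropyOrEqual_of_eq hT hρ hbu.num_sizes hbv.num_sizes e e'
    · exact mem_entropyOrEqual_of_pair hT hρ (fun hn => hne n hn rfl) hbu.pair_sizes.subset
        hbv.pair_sizes.subset e e'
    · exact mem_entropyOrEqual_of_top hT hρ hbu.top_sizes hbv.top_sizes e e'
  | path f hf =>
    -- For a path, tiles at depth `2 * N` are larger than the window. Hence both patterns also occur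
    -- in points whose readings consist of 2-squares only, with the common alignment.
    refine mem_entropyOrEqual_of_agree fun N => ?_
    obtain ⟨hρ, hr⟩ := hf (2 * N)
    have hyr := (hy.extends_iff hT y.2 hρ).1 ((hx'.extends_iff hT x.2 hρ).2 hr)
    obtain ⟨g, u, v, e, e'⟩ := exists_common_reading hρ hA hr hyr
    have hN := le_tileSize ((List.range (2 * N)).map f)
    rw [List.length_map, List.length_range] at hN
    obtain ⟨w, hw, ha⟩ := exists_agree_place g u hN
    obtain ⟨w', hw', ha'⟩ := exists_agree_place g v hN
    refine ⟨⟨_, mem_shiftOf_of_sizes_eq hT hρ g hw⟩, ⟨_, mem_shiftOf_of_sizes_eq hT hρ g hw'⟩, ?_, ?_,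
      mem_entropyOrEqual_of_eq hT hρ hw hw' rfl rfl⟩
    · rwa [e]
    · rwa [e']

theorem IsType.extends_or_word (hT : IsEvenTree T) {s : TypeString} (hs : IsType T s) {ρ : List ℕ}
    (hρ : ρ ∈ T) (h : Extends ρ s) : (∃ n, ρ ++ [n] ∈ T ∧ Extends (ρ ++ [n]) s) ∨
      ∃ t, s = word ρ t ∧ ∀ n, ρ ++ [n] ∈ T → t ≠ Sym.pair n := by
  rcases hs.cases hT hρ h with ⟨n, rfl⟩ | ⟨n, hn, rfl⟩ | ⟨n, hn, hx⟩ | rfl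
  · exact Or.inr ⟨_, rfl, fun m _ => num_ne_pair n m⟩
  · exact Or.inr ⟨_, rfl, fun m hm e => hn (pair_injective e ▸ hm)⟩
  · exact Or.inl ⟨n, hn, hx⟩
  · exact Or.inr ⟨_, rfl, fun m _ => (pair_ne_top m).symm⟩

/-- A type with an initial segment in `T` either continues along `T` or ends with the next symbol;
so two types first differ right after a common string of `T`. -/
theorem exists_extends_of_lt (hT : IsEvenTree T) {a b : TypeString} (ha : IsType T a)
    (hb : IsType T b) (h : a < b) : ∃ ρ ∈ T, Extends ρ a ∧ Extends ρ b ∧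
      ofLex a ρ.length < ofLex b ρ.length := by
  have hne := h.ne
  obtain ⟨i, hj, hi⟩ := h
  have key : ∀ k ≤ i, ∃ ρ ∈ T, ρ.length = k ∧ Extends ρ a ∧ Extends ρ b := by
    intro k hk
    induction k with
    | zero => exact ⟨[], hT.root, rfl, extends_nil _, extends_nil _⟩
    | succ k ih =>
      obtain ⟨ρ, hρ, rfl, h1, h2⟩ := ih (by omega)
      have e : ofLex a ρ.length = ofLex b ρ.length := hj _ (by omega)
      rcases ha.extends_or_word hT hρ h1 with ⟨n, hn, hx⟩ | ⟨t, rfl, ht⟩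
      · exact ⟨ρ ++ [n], hn, by simp, hx,
          extends_append_iff.2 ⟨h2, e.symm.trans (extends_append_iff.1 hx).2⟩⟩
      · rw [ofLex_word] at e
        rcases hb.extends_or_word hT hρ h2 with ⟨n, hn, hx⟩ | ⟨t', rfl, ht'⟩
        · exact absurd (WithBot.coe_injective (e.trans (extends_append_iff.1 hx).2)) (ht n hn)
        · rw [ofLex_word] at e
          exact absurd (by rw [WithBot.coe_injective e]) hne
  obtain ⟨ρ, hρ, rfl, h1, h2⟩ := key i le_rfl
  exact ⟨ρ, hρ, h1, h2, hi⟩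

theorem coe_succ_le {i : ℕ} {a : WithBot Sym} (h : (((i : ℕ∞) : Sym) : WithBot Sym) < a) :
    ((((i + 1 : ℕ) : ℕ∞) : Sym) : WithBot Sym) ≤ a := by
  induction a with
  | bot => exact absurd h not_lt_bot
  | coe a =>
    rw [WithBot.coe_lt_coe] at h
    rw [WithBot.coe_le_coe, Nat.cast_add, Nat.cast_one]
    exact Order.add_one_le_of_lt h

/-- Consecutive types. -/
theorem covBy_cases (hT : IsEvenTree T) {a b : typeOrder T} (h : a ⋖ b) : ∃ ρ ∈ T, ∃ n,
    (ρ ++ [n] ∉ T ∧ ((a.1 = word ρ (Sym.num n) ∧ b.1 = word ρ (Sym.pair n)) ∨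
      (a.1 = word ρ (Sym.pair n) ∧ b.1 = word ρ (Sym.num (n + 1))))) ∨
    (ρ ++ [n] ∈ T ∧ ((a.1 = word ρ (Sym.num n) ∧ b.1 = word (ρ ++ [n]) (Sym.num 0)) ∨
      (a.1 = word (ρ ++ [n]) ⊤ ∧ b.1 = word ρ (Sym.num (n + 1))))) := by
  have hright : ∀ c, IsType T c → a.1 < c → c ≤ b.1 → b.1 = c := by
    intro c hc h1 h2
    have := h.eq_or_eq (c := ⟨c, hc⟩) h1.le h2
    rcases this with e | e
    · exact absurd (congrArg Subtype.val e) h1.ne'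
    · exact (congrArg Subtype.val e).symm
  have hleft : ∀ c, IsType T c → a.1 ≤ c → c < b.1 → a.1 = c := by
    intro c hc h1 h2
    have := h.eq_or_eq (c := ⟨c, hc⟩) h1 h2.le
    rcases this with e | e
    · exact (congrArg Subtype.val e).symm
    · exact absurd (congrArg Subtype.val e) h2.ne
  obtain ⟨a, ha⟩ := a
  obtain ⟨b, hb⟩ := b
  obtain ⟨ρ, hρ, hax, hbx, hlt⟩ := exists_extends_of_lt hT ha hb h.lt
  simp only at hright hleft ⊢
  refine ⟨ρ, hρ, ?_⟩
  have hle : ∀ {c : TypeString} {i : ℕ}, ofLex a ρ.length = (((i : ℕ∞) : Sym) : WithBot Sym) →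
      Extends ρ c → ofLex c ρ.length = ((((i + 1 : ℕ) : ℕ∞) : Sym) : WithBot Sym) → b < c →
      (∃ n, i + 1 = 2 * n ∧ b = word ρ (Sym.num n)) ∨
      (∃ n, i + 1 = 2 * n + 1 ∧ ρ ++ [n] ∉ T ∧ b = word ρ (Sym.pair n)) ∨
      (∃ n, i + 1 = 2 * n + 1 ∧ ρ ++ [n] ∈ T ∧ Extends (ρ ++ [n]) b) := by
    intro c i hi hc hci hbc
    rw [hi] at hlt
    have h2 := ofLex_le_of_le hbx hc hbc.le
    rw [hci] at h2
    rcases IsType.cases_of_le hT hb hρ hbx (coe_succ_le hlt) h2 with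
      ⟨m, h, e⟩ | ⟨m, h, e⟩ | ⟨m, h, e⟩
    · exact Or.inl ⟨m, by omega, e⟩
    · exact Or.inr (Or.inl ⟨m, by omega, e⟩)
    · exact Or.inr (Or.inr ⟨m, by omega, e⟩)
  have hnum : ∀ n, ofLex a ρ.length = (Sym.pair n : Sym) → b = word ρ (Sym.num (n + 1)) := by
    intro n hn
    refine hright _ (isType_num hT hρ (n + 1)) (lt_of_ofLex_lt hax (extends_word _ _) ?_) ?_
    · rw [hn, ofLex_word]
      exact WithBot.coe_lt_coe.2 (Nat.cast_lt.2 (by omega))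
    · by_contra hcon
      rcases hle hn (extends_word _ _) (ofLex_word ρ (Sym.num (n + 1))) (not_le.1 hcon) with
        ⟨m, h, rfl⟩ | ⟨m, h, -, -⟩ | ⟨m, h, -, -⟩
      · obtain rfl : m = n + 1 := by omega
        exact hcon le_rfl
      · omega
      · omega
  rcases IsType.cases hT ha hρ hax with ⟨n, rfl⟩ | ⟨n, hn, rfl⟩ | ⟨n, hn, hx⟩ | rfl
  · by_cases hn : ρ ++ [n] ∈ T
    · refine ⟨n, Or.inr ⟨hn, Or.inl ⟨rfl, ?_⟩⟩⟩
      refine hright _ (isType_num hT hn 0) (word_lt_word_append (Nat.cast_lt.2 (by omega))) ?_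
      by_contra hcon
      obtain ⟨hc, ec⟩ := extends_word_append ρ n (Sym.num 0)
      rcases hle (ofLex_word _ _) hc ec (not_le.1 hcon) with
        ⟨m, h, -⟩ | ⟨m, h, hm, -⟩ | ⟨m, h, -, hx⟩
      · omega
      · obtain rfl : m = n := by omega
        exact hm hn
      · obtain rfl : m = n := by omega
        exact hcon (eq_word_zero hT hb hn hx (not_le.1 hcon).le).ge
    · refine ⟨n, Or.inl ⟨hn, Or.inl ⟨rfl, ?_⟩⟩⟩
      refine hright _ (isType_pair hT hρ hn) (lt_of_ofLex_lt hax (extends_word _ _) ?_) ?_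
      · rw [ofLex_word, ofLex_word]
        exact WithBot.coe_lt_coe.2 (Nat.cast_lt.2 (by omega))
      · by_contra hcon
        rcases hle (ofLex_word _ _) (extends_word _ _) (ofLex_word ρ (Sym.pair n)) (not_le.1 hcon)
          with ⟨m, h, -⟩ | ⟨m, h, -, rfl⟩ | ⟨m, h, hm, -⟩
        · omega
        · obtain rfl : m = n := by omega
          exact hcon le_rfl
        · obtain rfl : m = n := by omega
          exact hn hm
  · exact ⟨n, Or.inl ⟨hn, Or.inr ⟨rfl, hnum n (ofLex_word _ _)⟩⟩⟩
  · have hb' := hnum n (extends_append_iff.1 hx).2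
    refine ⟨n, Or.inr ⟨hn, Or.inr ⟨hleft _ (isType_top hT hn) ?_ ?_, hb'⟩⟩⟩
    · by_contra hcon
      exact hcon (eq_word_top hT ha hn hx (not_le.1 hcon).le).le
    · rw [hb']
      exact word_append_lt_word (Nat.cast_lt.2 (by omega))
  · rw [ofLex_word] at hlt
    exact absurd hlt (not_lt_of_ge le_top)

/-- A size and an adjacent pair outside the tree are treated within one reading. On entering or
leaving `ρ⌢(n,n+1)`, the configuration of one tile serves as intermediate point: it can be read on
both levels, as squares of one size and as a constant. -/
theorem mem_equivClosure_of_covBy (hT : IsEvenTree T) {x y : shiftOf T}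
    (h : typeOf hT x ⋖ typeOf hT y) (hA : Allied T x y) :
    (x, y) ∈ equivClosure (entropyOrEqual (shiftOf T)) := by
  have hx := hasType_typeOf hT x
  have hy := hasType_typeOf hT y
  obtain ⟨ρ, hρ, n, ⟨hn, ⟨ex, ey⟩ | ⟨ex, ey⟩⟩ | ⟨hn, ⟨ex, ey⟩ | ⟨ex, ey⟩⟩⟩ := covBy_cases hT h
  all_goals
    rw [ex] at hx
    rw [ey] at hy
    have hxX := x.2
    have hyX := y.2
  · obtain ⟨g, u, v, e, e'⟩ := exists_common_reading hρ hA
      ((hx.extends_iff hT x.2 hρ).1 (extends_word _ _))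
      ((hy.extends_iff hT y.2 hρ).1 (extends_word _ _))
    rw [e] at hx hxX
    rw [e'] at hy hyX
    refine subset_equivClosure _ (mem_entropyOrEqual_of_pair hT hρ hn ?_ ?_ e e')
    · rw [(hx.hasBaseType hT hxX hρ fun m _ => num_ne_pair n m).num_sizes]
      simp
    · exact (hy.hasBaseType hT hyX hρ fun m hm e => hn (pair_injective e ▸ hm)).pair_sizes.subset
  · obtain ⟨g, u, v, e, e'⟩ := exists_common_reading hρ hA
      ((hx.extends_iff hT x.2 hρ).1 (extends_word _ _))
      ((hy.extends_iff hT y.2 hρ).1 (extends_word _ _))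
    rw [e] at hx hxX
    rw [e'] at hy hyX
    refine subset_equivClosure _ (mem_entropyOrEqual_of_pair hT hρ hn ?_ ?_ e e')
    · exact (hx.hasBaseType hT hxX hρ fun m hm e => hn (pair_injective e ▸ hm)).pair_sizes.subset
    · rw [(hy.hasBaseType hT hyX hρ fun m _ => num_ne_pair (n + 1) m).num_sizes]
      simp
  · obtain ⟨g, w, e'⟩ := ((hy.extends_iff hT y.2 hn).1 (extends_word _ _)).exists_eq_place
    obtain ⟨g', hg', hg''⟩ := hA ρ hρ ((hx.extends_iff hT x.2 hρ).1 (extends_word _ _))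
      ((hy.extends_iff hT y.2 hρ).1 (extends_word_append ρ n _).1)
    obtain ⟨u, e⟩ := hg''.congr (Aligned.of_append ⟨w, e'⟩) hg'
    rw [e] at hx hxX
    rw [e'] at hy hyX
    have hu := (hx.hasBaseType hT hxX hρ fun m _ => num_ne_pair n m).num_sizes
    have hw := (hy.hasBaseType hT hyX hn fun m _ => num_ne_pair 0 m).num_sizes
    have hz := mem_shiftOf_of_sizes_eq hT hn g sizes_constConfig_false
    refine mem_equivClosure_trans (b := ⟨_, hz⟩) (mem_entropyOrEqual_of_eq hT hρ hu ?_ e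
      (place_append _ _ _ _)) (mem_entropyOrEqual_of_eq hT hn sizes_constConfig_false hw rfl e')
    rw [sizes_place_singleton]
    ext m
    simp [constConfig]
  · obtain ⟨g, w, e⟩ := ((hx.extends_iff hT x.2 hn).1 (extends_word _ _)).exists_eq_place
    obtain ⟨g', hg', hg''⟩ := hA ρ hρ ((hx.extends_iff hT x.2 hρ).1 (extends_word_append ρ n _).1)
      ((hy.extends_iff hT y.2 hρ).1 (extends_word _ _))
    obtain ⟨u, e'⟩ := hg'.congr (Aligned.of_append ⟨w, e⟩) hg''
    rw [e] at hx hxX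
    rw [e'] at hy hyX
    have hu := (hy.hasBaseType hT hyX hρ fun m _ => num_ne_pair (n + 1) m).num_sizes
    have hw := (hx.hasBaseType hT hxX hn fun m _ => (pair_ne_top m).symm).top_sizes
    have hz := mem_shiftOf_of_sizes_eq hT hn g sizes_constConfig_true
    refine mem_equivClosure_trans (b := ⟨_, hz⟩) (mem_entropyOrEqual_of_top hT hn hw
      sizes_constConfig_true e rfl) (mem_entropyOrEqual_of_eq hT hρ ?_ hu
        (place_append _ _ _ _) e')
    rw [sizes_place_singleton]
    ext m
    simp [constConfig]

theorem mem_equivClosure_of_finite (hT : IsEvenTree T) {x y : shiftOf T}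
    (h : (uIcc (typeOf hT x) (typeOf hT y)).Finite) (hA : Allied T x y) :
    (x, y) ∈ equivClosure (entropyOrEqual (shiftOf T)) := by
  have key : ∀ (k : ℕ) (x y : shiftOf T), typeOf hT x ≤ typeOf hT y →
      (Icc (typeOf hT x) (typeOf hT y)).Finite → (Icc (typeOf hT x) (typeOf hT y)).ncard ≤ k →
      Allied T x y → (x, y) ∈ equivClosure (entropyOrEqual (shiftOf T)) := by
    intro k
    induction k with
    | zero =>
      intro x y hle hfin hk _
      rw [Nat.le_zero, ncard_eq_zero hfin] at hk
      exact absurd (left_mem_Icc.2 hle) (by simp [hk])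
    | succ k ih =>
      intro x y hle hfin hk hA
      rcases hle.eq_or_lt with e | hlt
      · exact subset_equivClosure _ (mem_entropyOrEqual_of_typeOf_eq hT e hA)
      · obtain ⟨c, ⟨hc1, hc2⟩, hmin⟩ := (hfin.subset Ioc_subset_Icc_self).exists_minimal
          (s := Ioc (typeOf hT x) (typeOf hT y)) ⟨_, hlt, le_rfl⟩
        have hcov : typeOf hT x ⋖ c := ⟨hc1, fun d hd1 hd2 =>
          hd2.not_ge (hmin ⟨hd1, hd2.le.trans hc2⟩ hd2.le)⟩
        obtain ⟨z, rfl, h1, h2⟩ := exists_interpolation hT hA c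
        refine .trans _ z _ (mem_equivClosure_of_covBy hT hcov h1) (ih z y hc2
          (hfin.subset (Icc_subset_Icc_left hc1.le)) ?_ h2)
        have : Icc (typeOf hT z) (typeOf hT y) ⊂ Icc (typeOf hT x) (typeOf hT y) :=
          (ssubset_iff_of_subset (Icc_subset_Icc_left hc1.le)).2
            ⟨typeOf hT x, left_mem_Icc.2 hle, fun h => hc1.not_ge h.1⟩
        have := ncard_lt_ncard this hfin
        omega
  rcases le_total (typeOf hT x) (typeOf hT y) with hle | hle
  · rw [uIcc_of_le hle] at h
    exact key _ x y hle h le_rfl hA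
  · rw [uIcc_of_ge hle] at h
    exact .symm _ _ (key _ y x hle h le_rfl hA.symm)

theorem constConfig_mem_shiftOf (hT : IsEvenTree T) (b : Bool) : constConfig b ∈ shiftOf T := by
  have h := place_mem_shiftOf hT hT.root (constConfig_mem_baseShift b)
    (fun n _ => not_both_mem_sizes_const n b) 0
  rwa [place_nil, zero_vadd] at h

/-- A constant configuration is fixed by all shifts, so any alignment of it can be moved to any
other. -/
theorem allied_constConfig (x : Config) (b : Bool) : Allied T x (constConfig b) := by
  intro ρ _ hx h
  obtain ⟨g, hg⟩ := hx.exists_aligned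
  obtain ⟨g', hg'⟩ := h.exists_aligned
  have := aligned_vadd hg' (g - g')
  rw [add_sub_cancel] at this
  exact ⟨g, hg, this⟩

end Tree

end TCPE

/-! ### Conclusion: scatteredness, TCPE and the two ranks -/

namespace TCPE

open Set Filter Topology

section Tree

variable {T : Set (List ℕ)}

theorem isEntropyPair_typeOf (hT : IsEvenTree T) (x y : shiftOf T)
    (h : IsEntropyPair (shiftOf T) x y) :
    (x, y) ∈ closure {p : shiftOf T × shiftOf T | typeOf hT p.1 = typeOf hT p.2} :=
  mem_closure_of_isEntropyPair (isClosed_shiftOf hT) (fun g _ hz => vadd_mem_shiftOf hz g)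
    (typeOf_vadd hT) h

theorem mem_equivClosure_of_hausdorffRel (hT : IsEvenTree T) (x y : shiftOf T)
    (h : hausdorffRel (typeOrder T) 1 (typeOf hT x) (typeOf hT y)) (hA : Allied T x y) :
    (x, y) ∈ equivClosure (entropyOrEqual (shiftOf T)) :=
  mem_equivClosure_of_finite hT (finite_of_hausdorffRel_one h) hA

theorem exists_forall_allied (hT : IsEvenTree T) : ∃ z : shiftOf T, ∀ x : shiftOf T, Allied T x z :=
  ⟨⟨_, constConfig_mem_shiftOf hT false⟩, fun x => allied_constConfig x false⟩

theorem exists_typeOrder_ne (hT : IsEvenTree T) : ∃ a b : typeOrder T, a ≠ b := by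
  refine ⟨⟨_, isType_num hT hT.root 0⟩, ⟨_, isType_top hT hT.root⟩, fun h => ?_⟩
  have h1 := congrArg (fun s : TypeString => ofLex s 0) (congrArg Subtype.val h)
  have h2 := (ofLex_word [] (Sym.num 0)).symm.trans (h1.trans (ofLex_word [] ⊤))
  exact num_ne_top 0 (WithBot.coe_injective h2)

theorem compactSpace_shiftOf (hT : IsEvenTree T) : CompactSpace (shiftOf T) :=
  isCompact_iff_compactSpace.1 (isClosed_shiftOf hT).isCompact

theorem rank_relation_shiftOf (hT : IsEvenTree T) {α β : Ordinal.{0}}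
    (hα : IsTCPERank (shiftOf T) α) (hβ : IsHausdorffRank (typeOrder T) β) :
    α + 1 = 2 * β ∨ α = 2 * β :=
  have := compactSpace_shiftOf hT
  rank_relation (typeMap hT) (typeOf_surjective hT) (isEntropyPair_typeOf hT)
    (mem_equivClosure_of_hausdorffRel hT) (exists_forall_allied hT) (exists_typeOrder_ne hT) hα hβ

theorem exists_tcpeRel_eq_univ (hT : IsEvenTree T) (h : IsScattered (typeOrder T)) :
    ∃ γ : Ordinal.{0}, 1 ≤ γ ∧ (∀ a b : typeOrder T, hausdorffRel _ γ a b) ∧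
      tcpeRel (shiftOf T) (2 * γ) = univ := by
  have := compactSpace_shiftOf hT
  obtain ⟨γ, hγ⟩ := exists_hausdorffRel_of_isScattered h
  have h1 : ∀ a b : typeOrder T, hausdorffRel _ (max γ 1) a b := fun a b =>
    hausdorffRel_mono (le_max_left _ _) (hγ a b)
  -- The comparison of the two hierarchies starts with the first derivative, hence the maximum with
  -- 1.
  exact ⟨max γ 1, le_max_right _ _, h1, (tcpeRel_even_eq_univ_iff (typeMap hT) (typeOf_surjective hT)
    (isEntropyPair_typeOf hT) (mem_equivClosure_of_hausdorffRel hT) (exists_forall_allied hT)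
    (le_max_right _ _)).2 h1⟩

theorem isScattered_of_hasTCPE (hT : IsEvenTree T) (h : HasTCPE (shiftOf T)) :
    IsScattered (typeOrder T) := by
  by_contra hL
  obtain ⟨φ, hφ, a, b, hab⟩ := (typeMap hT).exists_continuous_of_not_isScattered hL
  obtain ⟨x, rfl⟩ := typeOf_surjective hT a
  obtain ⟨y, rfl⟩ := typeOf_surjective hT b
  exact not_hasTCPE_of_invariant (isClosed_shiftOf hT) hφ
    (fun g x x' e => congrArg φ (typeOf_vadd hT g x x' e)) hab h

theorem exists_isLeast_ordinal {s : Set Ordinal.{0}} (h : s.Nonempty) : ∃ α, IsLeast s α :=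
  ⟨sInf s, csInf_mem h, fun _ hβ => csInf_le' hβ⟩

end Tree

end TCPE

theorem mainTheorem4 (T : Set (List ℕ)) (hT : TCPE.IsTree T)
    (heven : ∀ σ ∈ T, ∀ n ∈ σ, Even n) :
    (TCPE.HasTCPE (TCPE.shiftOf T) ↔ TCPE.IsScattered (TCPE.typeOrder T)) ∧
    (TCPE.HasTCPE (TCPE.shiftOf T) →
      ∃ α β : Ordinal.{0}, TCPE.IsTCPERank (TCPE.shiftOf T) α ∧
        TCPE.IsHausdorffRank (TCPE.typeOrder T) β) ∧
    (∀ α β : Ordinal.{0}, TCPE.IsTCPERank (TCPE.shiftOf T) α →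
      TCPE.IsHausdorffRank (TCPE.typeOrder T) β → α + 1 = 2 * β ∨ α = 2 * β) := by
  have hE : TCPE.IsEvenTree T := ⟨hT, heven⟩
  refine ⟨⟨TCPE.isScattered_of_hasTCPE hE, fun h => ?_⟩, fun h => ?_, fun α β hα hβ =>
    TCPE.rank_relation_shiftOf hE hα hβ⟩
  · obtain ⟨γ, -, -, h2⟩ := TCPE.exists_tcpeRel_eq_univ hE h
    exact TCPE.hasTCPE_of_tcpeRel (TCPE.isClosed_shiftOf hE) h2
  · obtain ⟨γ, h0, h1, h2⟩ := TCPE.exists_tcpeRel_eq_univ hE (TCPE.isScattered_of_hasTCPE hE h)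
    obtain ⟨α, hα⟩ := TCPE.exists_isLeast_ordinal (s := {δ | 1 ≤ δ ∧ TCPE.tcpeRel (TCPE.shiftOf T) δ =
      Set.univ}) ⟨2 * γ, h0.trans (Ordinal.le_mul_right γ two_pos), h2⟩
    obtain ⟨β, hβ⟩ := TCPE.exists_isLeast_ordinal (s := {δ | ∀ a b : TCPE.typeOrder T,
      TCPE.hausdorffRel _ δ a b}) ⟨γ, h1⟩
    exact ⟨α, β, hα, hβ⟩
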